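/- Let $d\in\{2,3\}$, let $\Omega_-\subset\mathbb R^d$ be a bounded open set with Lipschitz boundary $\Gamma$ (for instance a bounded Lipschitz domain), $\Omega_+:=\mathbb R^d\setminus\overline{\Omega_-}$, and let $\rho,\kappa>0$ be constants. All function spaces are complex. For an open set $O$, $H^1(O)$ is normed by $\|u\|_{1,O}^2=\|u\|_O^2+\|\nabla u\|_O^2$, where $\|\cdot\|_O$ is the $L^2(O)$ norm, and $H^1_\Delta(O)=\{u\in H^1(O):\Delta u\in L^2(O)\}$ (weak derivatives). $H^{1/2}_\Gamma$ is the trace space, i.e. the range of the trace operator $\gamma:H^1(\mathbb R^d)\to L^2(\Gamma)$ with the image norm; $H^{-1/2}_\Gamma$ is its dual, with duality product $\langle\lambda,\varphi\rangle_\Gamma$, taken linear in $\lambda$ and antilinear in $\varphi$. Let $\gamma^\mp:H^1(\mathbb R^d\setminus\Gamma)\to H^{1/2}_\Gamma$ be the traces from $\Omega_\mp$, and $\partial_\nu^\mp:H^1_\Delta(\mathbb R^d\setminus\Gamma)\to H^{-1/2}_\Gamma$ the weak normal derivatives from $\Omega_\mp$, with $\nu$ pointing from $\Omega_-$ to $\Omega_+$,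 i.e. $\langle\partial_\nu^\mp w,\gamma v\rangle_\Gamma=\pm\left((\nabla w,\nabla v)_{\Omega_\mp}+(\Delta w,v)_{\Omega_\mp}\right)$ for all $v\in H^1(\mathbb R^d)$. Let $X_h\subset H^{-1/2}_\Gamma$ and $Y_h\subset H^{1/2}_\Gamma$ be closed subspaces, with polar sets $X_h^\circ=\{\varphi\in H^{1/2}_\Gamma:\langle\mu,\varphi\rangle_\Gamma=0\ \forall\mu\in X_h\}$ and $Y_h^\circ=\{\lambda\in H^{-1/2}_\Gamma:\langle\lambda,\varphi\rangle_\Gamma=0\ \forall\varphi\in Y_h\}$. Put $\boldsymbol H=L^2(\mathbb R^d\setminus\Gamma)^2$ with inner product $(\boldsymbol w,\boldsymbol w')_{\boldsymbol H}=\rho(w_-,w_-')_{\mathbb R^d\setminus\Gamma}+(w_+,w_+')_{\mathbb R^d\setminus\Gamma}$, $\boldsymbol D=H^1_\Delta(\mathbb R^d\setminus\Gamma)^2$, $\boldsymbol H^{\pm1/2}_\Gamma=(H^{\pm1/2}_\Gamma)^4$, $\boldsymbol\kappa\boldsymbol w=(\kappa w_-,w_+)$, $A_\star\boldsymbol w=(\rho^{-1}\kappa\Delta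 w_-,\Delta w_+)$, and, for $\boldsymbol w=(w_-,w_+)\in\boldsymbol D$, $$\boldsymbol\gamma_D\boldsymbol w=\Theta_D(\gamma^-w_-,\gamma^+w_-,\gamma^-w_+,\gamma^+w_+),\qquad \boldsymbol\gamma_N\boldsymbol w=\Theta_N(\partial_\nu^-w_-,\partial_\nu^+w_-,\partial_\nu^-w_+,\partial_\nu^+w_+),$$ $$\Theta_D=\begin{bmatrix}1&-1&1&-1\\0&1&-1&0\\1&-1&0&0\\0&0&0&1\end{bmatrix},\qquad \Theta_N=\begin{bmatrix}1&-1&1&0\\1&-1&0&0\\0&1&-1&0\\1&-1&1&-1\end{bmatrix},$$ $$\boldsymbol M^{1/2}=\{0\}\times X_h^\circ\times Y_h\times H^{1/2}_\Gamma,\qquad \boldsymbol M^{-1/2}=H^{-1/2}_\Gamma\times X_h\times Y_h^\circ\times\{0\}.$$ Let $A$ be the unbounded operator in $\boldsymbol H$ with domain $D(A)=\{\boldsymbol w\in\boldsymbol D:\boldsymbol\gamma_D\boldsymbol w\in\boldsymbol M^{1/2},\ \boldsymbol\gamma_N\boldsymbol\kappa\boldsymbol w\in\boldsymbol M^{-1/2}\}$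 and $A\boldsymbol w=A_\star\boldsymbol w$. Then: (a) For every $(\boldsymbol g,\boldsymbol\xi_D,\boldsymbol\xi_N)\in\boldsymbol H\times\boldsymbol H^{1/2}_\Gamma\times\boldsymbol H^{-1/2}_\Gamma$ the problem of finding $\boldsymbol w\in\boldsymbol D$ with $$\boldsymbol w=A_\star\boldsymbol w+\boldsymbol g,\qquad \boldsymbol\gamma_D\boldsymbol w-\boldsymbol\xi_D\in\boldsymbol M^{1/2},\qquad \boldsymbol\gamma_N\boldsymbol\kappa\boldsymbol w-\boldsymbol\xi_N\in\boldsymbol M^{-1/2}$$ has a unique solution, and $$\|\boldsymbol w\|_{1,\mathbb R^d\setminus\Gamma}+\|\Delta\boldsymbol w\|_{\mathbb R^d\setminus\Gamma}\le C\left(\|\boldsymbol g\|_{\mathbb R^d\setminus\Gamma}+\|\boldsymbol\xi_D\|_{1/2,\Gamma}+\|\boldsymbol\xi_N\|_{-1/2,\Gamma}\right)$$ (with product norms), where $C$ depends only on $\Gamma$, $\rho$ and $\kappa$ (in particular not on $X_h$, $Y_h$). (b) $A$ is maximal dissipative ($\operatorname{Re}(A\boldsymbol w,\boldsymbol w)_{\boldsymbol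 H}\le0$ on $D(A)$ and $I-A:D(A)\to\boldsymbol H$ is onto), densely defined and self-adjoint. (c) $A$ is the infinitesimal generator of a contractive analytic semigroup in $\boldsymbol H$. -/

import Mathlib

open MeasureTheory Set Filter Topology
open scoped ContDiff ENNReal NNReal

noncomputable section

namespace HeatTransmission

/-- The Euclidean space `ℝᵈ`. -/
abbrev E (d : ℕ) := EuclideanSpace ℝ (Fin d)

/-! ### Lipschitz domains -/

/-- `Ω` is a bounded open set with Lipschitz boundary: near each boundary point there are a unit
vector `e` and a Lipschitz function `f` of the variables orthogonal to `e` (i.e. `f` is constant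
along `e`) such that `Ω` is locally the set of the points lying below the graph of `f` in the
direction `e`. -/
structure IsBoundedLipschitz {d : ℕ} (Ω : Set (E d)) : Prop where
  isOpen : IsOpen Ω
  isBounded : Bornology.IsBounded Ω
  lipschitz : ∀ x ∈ frontier Ω, ∃ (e : E d) (f : E d → ℝ) (L : ℝ≥0) (r : ℝ),
    ‖e‖ = 1 ∧ LipschitzWith L f ∧ (∀ (y : E d) (t : ℝ), f (y + t • e) = f y) ∧ 0 < r ∧
      ∀ y ∈ Metric.ball x r, (y ∈ Ω ↔ inner ℝ e y < f y)

/-- The exterior domain `Ω₊ = ℝᵈ ∖ closure Ω₋`. -/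
def exterior {d : ℕ} (Ω : Set (E d)) : Set (E d) := (closure Ω)ᶜ

/-- The surface measure on `Γ = ∂Ω`: the `(d-1)`-dimensional Hausdorff measure restricted to `Γ`. -/
def surf {d : ℕ} (Ω : Set (E d)) : Measure (E d) :=
  (Measure.hausdorffMeasure ((d : ℝ) - 1)).restrict (frontier Ω)

/-! ### Sobolev spaces on an open set `O` -/

/-- `L²(O)`, complex valued. -/
abbrev L2 {d : ℕ} (O : Set (E d)) := Lp ℂ 2 (volume.restrict O)

/-- `L²(O)ᵈ`. -/
abbrev L2v {d : ℕ} (O : Set (E d)) := Lp (EuclideanSpace ℂ (Fin d)) 2 (volume.restrict O)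

/-- Test functions on `O`. -/
structure IsTest {d : ℕ} (O : Set (E d)) (φ : E d → ℝ) : Prop where
  contDiff : ContDiff ℝ ∞ φ
  hasCompactSupport : HasCompactSupport φ
  subset : tsupport φ ⊆ O

/-- The partial derivative `∂φ/∂xᵢ`. -/
def pderiv {d : ℕ} (i : Fin d) (φ : E d → ℝ) (x : E d) : ℝ :=
  fderiv ℝ φ x (EuclideanSpace.single i 1)

theorem IsTest.memLp {d : ℕ} {O : Set (E d)} {φ : E d → ℝ} (h : IsTest O φ) :
    MemLp φ 2 (volume.restrict O) :=
  (h.contDiff.continuous.memLp_of_hasCompactSupport h.hasCompactSupport).mono_measure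
    Measure.restrict_le_self

theorem IsTest.memLp_pderiv {d : ℕ} {O : Set (E d)} {φ : E d → ℝ} (h : IsTest O φ) (i : Fin d) :
    MemLp (pderiv i φ) 2 (volume.restrict O) := by
  have hc : Continuous (pderiv i φ) :=
    (h.contDiff.continuous_fderiv (by simp)).clm_apply continuous_const
  have hs : HasCompactSupport (pderiv i φ) :=
    h.hasCompactSupport.fderiv_apply (𝕜 := ℝ) (EuclideanSpace.single i 1)
  exact (hc.memLp_of_hasCompactSupport hs).mono_measure Measure.restrict_le_self

theorem memLp_coord {d : ℕ} {μ : Measure (E d)} (p : Lp (EuclideanSpace ℂ (Fin d)) 2 μ)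
    (i : Fin d) : MemLp (fun x => p x i) 2 μ :=
  (EuclideanSpace.proj (𝕜 := ℂ) i : EuclideanSpace ℂ (Fin d) →L[ℂ] ℂ).comp_memLp' (Lp.memLp p)

theorem integrable_smul_of_memLp {d : ℕ} {μ : Measure (E d)} {φ : E d → ℝ} {f : E d → ℂ}
    (hφ : MemLp φ 2 μ) (hf : MemLp f 2 μ) : Integrable (fun x => φ x • f x) μ :=
  memLp_one_iff_integrable.1 (hf.smul hφ)

/-- `p = ∇u` in the sense of distributions on `O`. -/
def IsWeakGrad {d : ℕ} {O : Set (E d)} (u : L2 O) (p : L2v O) : Prop :=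
  ∀ φ : E d → ℝ, IsTest O φ → ∀ i : Fin d,
    ∫ x in O, pderiv i φ x • u x = -∫ x in O, φ x • p x i

/-- `f = div p` in the sense of distributions on `O`. -/
def IsWeakDiv {d : ℕ} {O : Set (E d)} (p : L2v O) (f : L2 O) : Prop :=
  ∀ φ : E d → ℝ, IsTest O φ →
    ∫ x in O, ∑ i, pderiv i φ x • p x i = -∫ x in O, φ x • f x

/-- The pairs `(u, ∇u)` in `L²(O) × L²(O)ᵈ`. -/
def H1sub {d : ℕ} (O : Set (E d)) : Submodule ℂ (WithLp 2 (L2 O × L2v O)) where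
  carrier := {w | IsWeakGrad w.fst w.snd}
  zero_mem' := by
    intro φ hφ i
    have h1 : ∀ᵐ x ∂(volume.restrict O), pderiv i φ x • (0 : L2 O) x = 0 := by
      filter_upwards [Lp.coeFn_zero ℂ 2 (volume.restrict O)] with x hx
      rw [hx, Pi.zero_apply, smul_zero]
    have h2 : ∀ᵐ x ∂(volume.restrict O), φ x • (0 : L2v O) x i = 0 := by
      filter_upwards [Lp.coeFn_zero (EuclideanSpace ℂ (Fin d)) 2 (volume.restrict O)] with x hx
      rw [hx, Pi.zero_apply, PiLp.zero_apply, smul_zero]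
    change ∫ x in O, pderiv i φ x • (0 : L2 O) x = -∫ x in O, φ x • (0 : L2v O) x i
    rw [integral_congr_ae h1, integral_congr_ae h2]
    simp
  add_mem' := by
    intro v w hv hw φ hφ i
    have h1 : ∀ᵐ x ∂(volume.restrict O), pderiv i φ x • (v.fst + w.fst : L2 O) x
        = pderiv i φ x • v.fst x + pderiv i φ x • w.fst x := by
      filter_upwards [Lp.coeFn_add v.fst w.fst] with x hx
      rw [hx, Pi.add_apply, smul_add]
    have h2 : ∀ᵐ x ∂(volume.restrict O), φ x • (v.snd + w.snd : L2v O) x i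
        = φ x • v.snd x i + φ x • w.snd x i := by
      filter_upwards [Lp.coeFn_add v.snd w.snd] with x hx
      rw [hx, Pi.add_apply, PiLp.add_apply, smul_add]
    change ∫ x in O, pderiv i φ x • (v.fst + w.fst : L2 O) x
      = -∫ x in O, φ x • (v.snd + w.snd : L2v O) x i
    rw [integral_congr_ae h1, integral_congr_ae h2,
      integral_add (integrable_smul_of_memLp (hφ.memLp_pderiv i) (Lp.memLp _))
        (integrable_smul_of_memLp (hφ.memLp_pderiv i) (Lp.memLp _)),
      integral_add (integrable_smul_of_memLp hφ.memLp (memLp_coord _ i))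
        (integrable_smul_of_memLp hφ.memLp (memLp_coord _ i)), hv φ hφ i, hw φ hφ i]
    ring
  smul_mem' := by
    intro c w hw φ hφ i
    have h1 : ∀ᵐ x ∂(volume.restrict O), pderiv i φ x • (c • w.fst : L2 O) x
        = c • (pderiv i φ x • w.fst x) := by
      filter_upwards [Lp.coeFn_smul c w.fst] with x hx
      simp only [hx, Pi.smul_apply]
      exact smul_comm _ _ _
    have h2 : ∀ᵐ x ∂(volume.restrict O), φ x • (c • w.snd : L2v O) x i
        = c • (φ x • w.snd x i) := by
      filter_upwards [Lp.coeFn_smul c w.snd] with x hx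
      simp only [hx, Pi.smul_apply, PiLp.smul_apply]
      exact smul_comm _ _ _
    change ∫ x in O, pderiv i φ x • (c • w.fst : L2 O) x
      = -∫ x in O, φ x • (c • w.snd : L2v O) x i
    rw [integral_congr_ae h1, integral_congr_ae h2, integral_smul, integral_smul, hw φ hφ i,
      smul_neg]

/-- The Sobolev space `H¹(O)` with the Hilbert norm `‖u‖₁² = ‖u‖² + ‖∇u‖²`. -/
def H1 {d : ℕ} (O : Set (E d)) : Type := H1sub O

instance {d : ℕ} (O : Set (E d)) : NormedAddCommGroup (H1 O) :=
  inferInstanceAs (NormedAddCommGroup (H1sub O))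

instance {d : ℕ} (O : Set (E d)) : InnerProductSpace ℂ (H1 O) :=
  inferInstanceAs (InnerProductSpace ℂ (H1sub O))

/-- The underlying `L²` function of an element of `H¹(O)`. -/
def fnOf {d : ℕ} {O : Set (E d)} : H1 O →ₗ[ℂ] L2 O where
  toFun u := u.1.fst
  map_add' _ _ := rfl
  map_smul' _ _ := rfl

/-- The gradient of an element of `H¹(O)`. -/
def gradOf {d : ℕ} {O : Set (E d)} : H1 O →ₗ[ℂ] L2v O where
  toFun u := u.1.snd
  map_add' _ _ := rfl
  map_smul' _ _ := rfl

/-- The pairs `(u, Δu)` in `H¹(O) × L²(O)`. -/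
def H1LapSub {d : ℕ} (O : Set (E d)) : Submodule ℂ (H1 O × L2 O) where
  carrier := {w | IsWeakDiv (gradOf w.1) w.2}
  zero_mem' := by
    intro φ hφ
    have h1 : ∀ᵐ x ∂(volume.restrict O), ∑ i, pderiv i φ x • (0 : L2v O) x i = 0 := by
      filter_upwards [Lp.coeFn_zero (EuclideanSpace ℂ (Fin d)) 2 (volume.restrict O)] with x hx
      simp only [hx, Pi.zero_apply, PiLp.zero_apply, smul_zero, Finset.sum_const_zero]
    have h2 : ∀ᵐ x ∂(volume.restrict O), φ x • (0 : L2 O) x = 0 := by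
      filter_upwards [Lp.coeFn_zero ℂ 2 (volume.restrict O)] with x hx
      rw [hx, Pi.zero_apply, smul_zero]
    change ∫ x in O, ∑ i, pderiv i φ x • (gradOf (0 : H1 O)) x i = -∫ x in O, φ x • (0 : L2 O) x
    rw [map_zero, integral_congr_ae h1, integral_congr_ae h2]
    simp
  add_mem' := by
    intro v w hv hw φ hφ
    have hI : ∀ p : L2v O, Integrable (fun x => ∑ i, pderiv i φ x • p x i) (volume.restrict O) :=
      fun p => integrable_finsetSum _ fun i _ =>
        integrable_smul_of_memLp (hφ.memLp_pderiv i) (memLp_coord p i)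
    have h1 : ∀ᵐ x ∂(volume.restrict O),
        ∑ i, pderiv i φ x • (gradOf v.1 + gradOf w.1 : L2v O) x i
        = ∑ i, pderiv i φ x • gradOf v.1 x i + ∑ i, pderiv i φ x • gradOf w.1 x i := by
      filter_upwards [Lp.coeFn_add (gradOf v.1) (gradOf w.1)] with x hx
      simp only [hx, Pi.add_apply, PiLp.add_apply, smul_add, Finset.sum_add_distrib]
    have h2 : ∀ᵐ x ∂(volume.restrict O), φ x • (v.2 + w.2 : L2 O) x
        = φ x • v.2 x + φ x • w.2 x := by
      filter_upwards [Lp.coeFn_add v.2 w.2] with x hx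
      rw [hx, Pi.add_apply, smul_add]
    change ∫ x in O, ∑ i, pderiv i φ x • gradOf (v.1 + w.1) x i
      = -∫ x in O, φ x • (v.2 + w.2 : L2 O) x
    rw [map_add, integral_congr_ae h1, integral_congr_ae h2, integral_add (hI _) (hI _),
      integral_add (integrable_smul_of_memLp hφ.memLp (Lp.memLp _))
        (integrable_smul_of_memLp hφ.memLp (Lp.memLp _)), hv φ hφ, hw φ hφ]
    ring
  smul_mem' := by
    intro c w hw φ hφ
    have h1 : ∀ᵐ x ∂(volume.restrict O), ∑ i, pderiv i φ x • (c • gradOf w.1 : L2v O) x i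
        = c • ∑ i, pderiv i φ x • gradOf w.1 x i := by
      filter_upwards [Lp.coeFn_smul c (gradOf w.1)] with x hx
      simp only [hx, Pi.smul_apply, PiLp.smul_apply, Finset.smul_sum]
      exact Finset.sum_congr rfl fun i _ => smul_comm _ _ _
    have h2 : ∀ᵐ x ∂(volume.restrict O), φ x • (c • w.2 : L2 O) x
        = c • (φ x • w.2 x) := by
      filter_upwards [Lp.coeFn_smul c w.2] with x hx
      simp only [hx, Pi.smul_apply]
      exact smul_comm _ _ _
    change ∫ x in O, ∑ i, pderiv i φ x • gradOf (c • w.1) x i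
      = -∫ x in O, φ x • (c • w.2 : L2 O) x
    rw [map_smul, integral_congr_ae h1, integral_congr_ae h2, integral_smul, integral_smul, hw φ hφ,
      smul_neg]

/-- The space `H¹_Δ(O)` of the `u ∈ H¹(O)` with `Δu ∈ L²(O)`. -/
def H1Lap {d : ℕ} (O : Set (E d)) : Type := H1LapSub O

instance {d : ℕ} (O : Set (E d)) : AddCommGroup (H1Lap O) :=
  inferInstanceAs (AddCommGroup (H1LapSub O))

instance {d : ℕ} (O : Set (E d)) : Module ℂ (H1Lap O) :=
  inferInstanceAs (Module ℂ (H1LapSub O))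

/-- The element of `H¹(O)` underlying an element of `H¹_Δ(O)`. -/
def toH1 {d : ℕ} {O : Set (E d)} : H1Lap O →ₗ[ℂ] H1 O where
  toFun u := u.1.1
  map_add' _ _ := rfl
  map_smul' _ _ := rfl

/-- The Laplacian of an element of `H¹_Δ(O)`. -/
def lapOf {d : ℕ} {O : Set (E d)} : H1Lap O →ₗ[ℂ] L2 O where
  toFun u := u.1.2
  map_add' _ _ := rfl
  map_smul' _ _ := rfl

/-! ### Traces and the trace space -/

/-- The `L²(Γ)`-trace, taken from the side `U ⊆ O` of `Γ = ∂Ω`, as the closure in `H¹(O) × L²(Γ)` of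
the restriction operator `φ ↦ φ|_Γ` on functions which coincide on `U` with a smooth compactly
supported function `φ` on `ℝᵈ`. (For a bounded Lipschitz domain this is the graph of the usual
everywhere defined bounded trace operator.) -/
def traceGraph {d : ℕ} (Ω O U : Set (E d)) : Submodule ℂ (H1 O × Lp ℂ 2 (surf Ω)) :=
  Submodule.topologicalClosure
    { carrier := {p | ∃ φ : E d → ℂ, ContDiff ℝ ∞ φ ∧ HasCompactSupport φ ∧
        (∀ᵐ x ∂(volume.restrict O), x ∈ U → fnOf p.1 x = φ x) ∧ ∀ᵐ x ∂(surf Ω), p.2 x = φ x}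
      zero_mem' := by
        refine ⟨0, contDiff_const, HasCompactSupport.zero, ?_, ?_⟩
        · filter_upwards [Lp.coeFn_zero ℂ 2 (volume.restrict O)] with x hx _
          rw [Prod.fst_zero, map_zero]
          exact hx
        · filter_upwards [Lp.coeFn_zero ℂ 2 (surf Ω)] with x hx
          exact hx
      add_mem' := by
        rintro p q ⟨φ, h1, h2, h3, h4⟩ ⟨ψ, k1, k2, k3, k4⟩
        refine ⟨φ + ψ, h1.add k1, h2.add k2, ?_, ?_⟩
        · filter_upwards [Lp.coeFn_add (fnOf p.1) (fnOf q.1), h3, k3] with x hx hp hq hU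
          rw [Prod.fst_add, map_add]
          exact hx.trans (congrArg₂ (· + ·) (hp hU) (hq hU))
        · filter_upwards [Lp.coeFn_add p.2 q.2, h4, k4] with x hx hp hq
          exact hx.trans (congrArg₂ (· + ·) hp hq)
      smul_mem' := by
        rintro c p ⟨φ, h1, h2, h3, h4⟩
        refine ⟨c • φ, contDiff_const.smul h1, h2.smul_left (f := fun _ => c), ?_, ?_⟩
        · filter_upwards [Lp.coeFn_smul c (fnOf p.1), h3] with x hx hp hU
          rw [Prod.smul_fst, map_smul]
          exact hx.trans (congrArg (c • ·) (hp hU))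
        · filter_upwards [Lp.coeFn_smul c p.2, h4] with x hx hp
          exact hx.trans (congrArg (c • ·) hp) }

/-- The kernel of the trace operator `γ : H¹(ℝᵈ) → L²(Γ)`. -/
def traceKer {d : ℕ} (Ω : Set (E d)) : Submodule ℂ (H1 (univ : Set (E d))) :=
  (traceGraph Ω univ univ).comap (LinearMap.inl ℂ _ _)

instance traceKer_isClosed {d : ℕ} (Ω : Set (E d)) :
    IsClosed (traceKer Ω : Set (H1 (univ : Set (E d)))) :=
  (Submodule.isClosed_topologicalClosure _).preimage
    (continuous_id.prodMk continuous_const : Continuous fun v => (v, (0 : Lp ℂ 2 (surf Ω))))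

/-- The trace space `H^{1/2}_Γ`, i.e. the range of `γ : H¹(ℝᵈ) → L²(Γ)` with the image norm
`‖g‖_{1/2,Γ} = inf {‖v‖₁ : γ v = g}`, realized as `H¹(ℝᵈ) / ker γ`. -/
def H12 {d : ℕ} (Ω : Set (E d)) : Type := H1 (univ : Set (E d)) ⧸ traceKer Ω

instance {d : ℕ} (Ω : Set (E d)) : NormedAddCommGroup (H12 Ω) :=
  inferInstanceAs (NormedAddCommGroup (H1 (univ : Set (E d)) ⧸ traceKer Ω))

instance {d : ℕ} (Ω : Set (E d)) : NormedSpace ℂ (H12 Ω) :=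
  inferInstanceAs (NormedSpace ℂ (H1 (univ : Set (E d)) ⧸ traceKer Ω))

/-- The trace operator `γ : H¹(ℝᵈ) → H^{1/2}_Γ`. -/
def traceOp {d : ℕ} (Ω : Set (E d)) : H1 (univ : Set (E d)) →ₗ[ℂ] H12 Ω := (traceKer Ω).mkQ

/-- `H^{-1/2}_Γ`: the (anti)dual of `H^{1/2}_Γ` with the dual norm. The duality product
`⟨λ, φ⟩_Γ = λ φ` is linear in `λ` and antilinear in `φ`, as the complex `L²` products. -/
abbrev Hm12 {d : ℕ} (Ω : Set (E d)) := H12 Ω →SL[starRingEnd ℂ] ℂ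

/-- `ℝᵈ ∖ Γ`. -/
abbrev offGamma {d : ℕ} (Ω : Set (E d)) : Set (E d) := (frontier Ω)ᶜ

/-- The graph of the trace `H¹(ℝᵈ∖Γ) → H^{1/2}_Γ` from the side `U` (`U = Ω` gives `γ⁻` and
`U = exterior Ω` gives `γ⁺`): the class of `v ∈ H¹(ℝᵈ)` is the trace of `u` iff `v` and `u` have the
same `L²(Γ)`-trace. -/
def sideTrace {d : ℕ} (Ω U : Set (E d)) : Submodule ℂ (H1 (offGamma Ω) × H12 Ω) where
  carrier := {p | ∃ (v : H1 (univ : Set (E d))) (g : Lp ℂ 2 (surf Ω)),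
    (p.1, g) ∈ traceGraph Ω (offGamma Ω) U ∧ (v, g) ∈ traceGraph Ω univ univ ∧ traceOp Ω v = p.2}
  zero_mem' := ⟨0, 0, zero_mem _, zero_mem _, map_zero _⟩
  add_mem' := by
    rintro ⟨a, b⟩ ⟨a', b'⟩ ⟨v, g, h1, h2, h3⟩ ⟨v', g', k1, k2, k3⟩
    have e1 : (a + a', g + g') ∈ traceGraph Ω (offGamma Ω) U := by
      rw [← Prod.mk_add_mk]
      exact Submodule.add_mem _ h1 k1
    have e2 : (v + v', g + g') ∈ traceGraph Ω univ univ := by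
      rw [← Prod.mk_add_mk]
      exact Submodule.add_mem _ h2 k2
    have e3 : traceOp Ω (v + v') = b + b' := (map_add _ _ _).trans (congrArg₂ (· + ·) h3 k3)
    exact ⟨v + v', g + g', e1, e2, e3⟩
  smul_mem' := by
    rintro c ⟨a, b⟩ ⟨v, g, h1, h2, h3⟩
    have e1 : (c • a, c • g) ∈ traceGraph Ω (offGamma Ω) U := by
      rw [← Prod.smul_mk]
      exact Submodule.smul_mem _ c h1
    have e2 : (c • v, c • g) ∈ traceGraph Ω univ univ := by
      rw [← Prod.smul_mk]
      exact Submodule.smul_mem _ c h2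
    have e3 : traceOp Ω (c • v) = c • b := (map_smul _ _ _).trans (congrArg (c • ·) h3)
    exact ⟨c • v, c • g, e1, e2, e3⟩

/-- `(∇w, ∇v)_U + (Δw, v)_U` for `w ∈ H¹_Δ(ℝᵈ∖Γ)`, `v ∈ H¹(ℝᵈ)` and a side `U ⊆ ℝᵈ∖Γ`. -/
def greenForm {d : ℕ} (Ω U : Set (E d)) (w : H1Lap (offGamma Ω)) (v : H1 (univ : Set (E d))) : ℂ :=
  ∫ x in U, (inner ℂ (gradOf v x) (gradOf (toH1 w) x) + inner ℂ (fnOf v x) (lapOf w x))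
    ∂(volume.restrict (offGamma Ω))

theorem greenForm_integrable {d : ℕ} (Ω U : Set (E d)) (w : H1Lap (offGamma Ω))
    (v : H1 (univ : Set (E d))) :
    Integrable (fun x => inner ℂ (gradOf v x) (gradOf (toH1 w) x) + inner ℂ (fnOf v x) (lapOf w x))
      ((volume.restrict (offGamma Ω)).restrict U) := by
  have hle : volume.restrict (offGamma Ω) ≤ volume.restrict (univ : Set (E d)) :=
    Measure.restrict_mono (subset_univ _) le_rfl
  have h1 : Integrable (fun x => inner ℂ (gradOf v x) (gradOf (toH1 w) x))
      (volume.restrict (offGamma Ω)) := by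
    have := L2.integrable_inner (𝕜 := ℂ) (((Lp.memLp (gradOf v)).mono_measure hle).toLp _) (gradOf (toH1 w))
    refine this.congr ?_
    filter_upwards [((Lp.memLp (gradOf v)).mono_measure hle).coeFn_toLp] with x hx
    rw [hx]
  have h2 : Integrable (fun x => inner ℂ (fnOf v x) (lapOf w x)) (volume.restrict (offGamma Ω)) := by
    have := L2.integrable_inner (𝕜 := ℂ) (((Lp.memLp (fnOf v)).mono_measure hle).toLp _) (lapOf w)
    refine this.congr ?_
    filter_upwards [((Lp.memLp (fnOf v)).mono_measure hle).coeFn_toLp] with x hx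
    rw [hx]
  exact (h1.add h2).mono_measure Measure.restrict_le_self

/-- The graph of the weak normal derivative `H¹_Δ(ℝᵈ∖Γ) → H^{-1/2}_Γ` taken from the side `U`,
`s = ±1` telling whether the normal vector points out of `U` or into `U`:
`⟨∂_ν w, γ v⟩_Γ = s ((∇w, ∇v)_U + (Δw, v)_U)` for all `v ∈ H¹(ℝᵈ)`. -/
def sideNormal {d : ℕ} (Ω U : Set (E d)) (s : ℂ) : Submodule ℂ (H1Lap (offGamma Ω) × Hm12 Ω) where
  carrier := {p | ∀ v : H1 (univ : Set (E d)), p.2 (traceOp Ω v) = s * greenForm Ω U p.1 v}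
  zero_mem' := by
    intro v
    have : ∀ᵐ x ∂((volume.restrict (offGamma Ω)).restrict U),
        inner ℂ (gradOf v x) ((0 : L2v (offGamma Ω)) x) + inner ℂ (fnOf v x) ((0 : L2 (offGamma Ω)) x)
          = (0 : ℂ) := by
      refine ae_mono Measure.restrict_le_self ?_
      filter_upwards [Lp.coeFn_zero ℂ 2 (volume.restrict (offGamma Ω)),
        Lp.coeFn_zero (EuclideanSpace ℂ (Fin d)) 2 (volume.restrict (offGamma Ω))] with x h1 h2
      rw [h1, h2, Pi.zero_apply, Pi.zero_apply, inner_zero_right, inner_zero_right, add_zero]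
    have h0 : greenForm Ω U 0 v = 0 := by
      unfold greenForm
      rw [map_zero, map_zero, map_zero]
      exact (integral_congr_ae this).trans (by simp)
    change (0 : ℂ) = s * greenForm Ω U 0 v
    rw [h0, mul_zero]
  add_mem' := by
    intro p q hp hq v
    have : ∀ᵐ x ∂((volume.restrict (offGamma Ω)).restrict U),
        inner ℂ (gradOf v x) ((gradOf (toH1 p.1) + gradOf (toH1 q.1) : L2v (offGamma Ω)) x)
          + inner ℂ (fnOf v x) ((lapOf p.1 + lapOf q.1 : L2 (offGamma Ω)) x)
          = (inner ℂ (gradOf v x) (gradOf (toH1 p.1) x) + inner ℂ (fnOf v x) (lapOf p.1 x))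
            + (inner ℂ (gradOf v x) (gradOf (toH1 q.1) x) + inner ℂ (fnOf v x) (lapOf q.1 x)) := by
      refine ae_mono Measure.restrict_le_self ?_
      filter_upwards [Lp.coeFn_add (gradOf (toH1 p.1)) (gradOf (toH1 q.1)),
        Lp.coeFn_add (lapOf p.1) (lapOf q.1)] with x h1 h2
      rw [h1, h2, Pi.add_apply, Pi.add_apply, inner_add_right, inner_add_right]
      ring
    have h0 : greenForm Ω U (p.1 + q.1) v = greenForm Ω U p.1 v + greenForm Ω U q.1 v := by
      unfold greenForm
      rw [map_add, map_add, map_add]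
      exact (integral_congr_ae this).trans
        (integral_add (greenForm_integrable Ω U p.1 v) (greenForm_integrable Ω U q.1 v))
    change p.2 _ + q.2 _ = s * greenForm Ω U (p.1 + q.1) v
    rw [h0, hp v, hq v, mul_add]
  smul_mem' := by
    intro c p hp v
    have : ∀ᵐ x ∂((volume.restrict (offGamma Ω)).restrict U),
        inner ℂ (gradOf v x) ((c • gradOf (toH1 p.1) : L2v (offGamma Ω)) x)
          + inner ℂ (fnOf v x) ((c • lapOf p.1 : L2 (offGamma Ω)) x)
          = c * (inner ℂ (gradOf v x) (gradOf (toH1 p.1) x) + inner ℂ (fnOf v x) (lapOf p.1 x)) := by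
      refine ae_mono Measure.restrict_le_self ?_
      filter_upwards [Lp.coeFn_smul c (gradOf (toH1 p.1)), Lp.coeFn_smul c (lapOf p.1)] with x h1 h2
      rw [h1, h2, Pi.smul_apply, Pi.smul_apply, inner_smul_right, inner_smul_right]
      ring
    have h0 : greenForm Ω U (c • p.1) v = c * greenForm Ω U p.1 v := by
      unfold greenForm
      rw [map_smul, map_smul, map_smul]
      exact (integral_congr_ae this).trans (integral_const_mul c _)
    change c * p.2 _ = s * greenForm Ω U (c • p.1) v
    rw [h0, hp v]
    ring

/-! ### The product spaces and the transmission operators -/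

/-- `V = H¹(ℝᵈ∖Γ)²`; elements are written `(w₋, w₊)`. -/
abbrev VSpace {d : ℕ} (Ω : Set (E d)) := H1 (offGamma Ω) × H1 (offGamma Ω)

/-- `D = H¹_Δ(ℝᵈ∖Γ)²`. -/
abbrev DSpace {d : ℕ} (Ω : Set (E d)) := H1Lap (offGamma Ω) × H1Lap (offGamma Ω)

/-- `L²(ℝᵈ∖Γ)²` with its standard norm. -/
abbrev L2Pair {d : ℕ} (Ω : Set (E d)) := WithLp 2 (L2 (offGamma Ω) × L2 (offGamma Ω))

/-- The inclusion `D ⊆ V`. -/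
def pairV {d : ℕ} {Ω : Set (E d)} : DSpace Ω →ₗ[ℂ] VSpace Ω := toH1.prodMap toH1

/-- `(w₋, w₊)` as an element of `L²(ℝᵈ∖Γ)²`. -/
def pairFn {d : ℕ} {Ω : Set (E d)} : DSpace Ω →ₗ[ℂ] L2Pair Ω where
  toFun w := WithLp.toLp 2 (fnOf (toH1 w.1), fnOf (toH1 w.2))
  map_add' v w := by
    rw [Prod.fst_add, Prod.snd_add, map_add, map_add, map_add, map_add]
    rfl
  map_smul' c w := by
    rw [Prod.smul_fst, Prod.smul_snd, map_smul, map_smul, map_smul, map_smul]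
    rfl

/-- `(Δw₋, Δw₊)`. -/
def pairLap {d : ℕ} {Ω : Set (E d)} (w : DSpace Ω) : L2Pair Ω :=
  WithLp.toLp 2 (lapOf w.1, lapOf w.2)

/-- Multiplication by `c` of the first component: `(c w₋, w₊)`. -/
def mulFst {d : ℕ} {Ω : Set (E d)} (c : ℝ) : DSpace Ω →ₗ[ℂ] DSpace Ω :=
  LinearMap.prodMap ((c : ℂ) • LinearMap.id) LinearMap.id

/-- `A⋆ w = (ρ⁻¹ κ Δw₋, Δw₊)`. -/
def Astar {d : ℕ} {Ω : Set (E d)} (ρ κ : ℝ) : DSpace Ω →ₗ[ℂ] L2Pair Ω where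
  toFun w := WithLp.toLp 2 (((ρ⁻¹ * κ : ℝ) : ℂ) • lapOf w.1, lapOf w.2)
  map_add' v w := by
    rw [Prod.fst_add, Prod.snd_add, map_add, map_add, smul_add]
    rfl
  map_smul' c w := by
    rw [Prod.smul_fst, Prod.smul_snd, map_smul, map_smul, smul_comm]
    rfl

def ThetaD : Matrix (Fin 4) (Fin 4) ℂ :=
  !![1, -1, 1, -1;
     0, 1, -1, 0;
     1, -1, 0, 0;
     0, 0, 0, 1]

def ThetaN : Matrix (Fin 4) (Fin 4) ℂ :=
  !![1, -1, 1, 0;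
     1, -1, 0, 0;
     0, 1, -1, 0;
     1, -1, 1, -1]

/-- The action of a `4 × 4` matrix on quadruples. -/
def mix {M : Type*} [AddCommGroup M] [Module ℂ M] (Θ : Matrix (Fin 4) (Fin 4) ℂ) :
    (Fin 4 → M) →ₗ[ℂ] (Fin 4 → M) :=
  LinearMap.pi fun i => ∑ j, Θ i j • LinearMap.proj j

/-- `t = (γ⁻v₋, γ⁺v₋, γ⁻v₊, γ⁺v₊)`. -/
def IsTrace {d : ℕ} {Ω : Set (E d)} (v : VSpace Ω) (t : Fin 4 → H12 Ω) : Prop :=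
  (v.1, t 0) ∈ sideTrace Ω Ω ∧ (v.1, t 1) ∈ sideTrace Ω (exterior Ω) ∧
    (v.2, t 2) ∈ sideTrace Ω Ω ∧ (v.2, t 3) ∈ sideTrace Ω (exterior Ω)

/-- `n = (∂_ν⁻w₋, ∂_ν⁺w₋, ∂_ν⁻w₊, ∂_ν⁺w₊)`, where `ν` points from `Ω` into the exterior. -/
def IsNormalDeriv {d : ℕ} {Ω : Set (E d)} (w : DSpace Ω) (n : Fin 4 → Hm12 Ω) : Prop :=
  (w.1, n 0) ∈ sideNormal Ω Ω 1 ∧ (w.1, n 1) ∈ sideNormal Ω (exterior Ω) (-1) ∧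
    (w.2, n 2) ∈ sideNormal Ω Ω 1 ∧ (w.2, n 3) ∈ sideNormal Ω (exterior Ω) (-1)

/-- `η = γ_D v`. -/
def IsGammaD {d : ℕ} {Ω : Set (E d)} (v : VSpace Ω) (η : Fin 4 → H12 Ω) : Prop :=
  ∃ t, IsTrace v t ∧ η = mix ThetaD t

/-- `η = γ_N w`. -/
def IsGammaN {d : ℕ} {Ω : Set (E d)} (w : DSpace Ω) (η : Fin 4 → Hm12 Ω) : Prop :=
  ∃ n, IsNormalDeriv w n ∧ η = mix ThetaN n

theorem pair_add_mem {M N : Type*} [AddCommGroup M] [Module ℂ M] [AddCommGroup N] [Module ℂ N]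
    (S : Submodule ℂ (M × N)) {a a' : M} {b b' : N} (h : (a, b) ∈ S) (k : (a', b') ∈ S) :
    (a + a', b + b') ∈ S :=
  S.add_mem h k

theorem pair_smul_mem {M N : Type*} [AddCommGroup M] [Module ℂ M] [AddCommGroup N] [Module ℂ N]
    (S : Submodule ℂ (M × N)) (c : ℂ) {a : M} {b : N} (h : (a, b) ∈ S) : (c • a, c • b) ∈ S :=
  S.smul_mem c h

theorem IsTrace.add {d : ℕ} {Ω : Set (E d)} {v w : VSpace Ω} {t r : Fin 4 → H12 Ω}
    (h : IsTrace v t) (k : IsTrace w r) : IsTrace (v + w) (t + r) := by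
  unfold IsTrace at *
  rw [Prod.fst_add, Prod.snd_add, Pi.add_apply, Pi.add_apply, Pi.add_apply, Pi.add_apply]
  exact ⟨pair_add_mem _ h.1 k.1, pair_add_mem _ h.2.1 k.2.1, pair_add_mem _ h.2.2.1 k.2.2.1,
    pair_add_mem _ h.2.2.2 k.2.2.2⟩

theorem IsTrace.smul {d : ℕ} {Ω : Set (E d)} (c : ℂ) {w : VSpace Ω} {t : Fin 4 → H12 Ω}
    (h : IsTrace w t) : IsTrace (c • w) (c • t) := by
  unfold IsTrace at *
  rw [Prod.smul_fst, Prod.smul_snd, Pi.smul_apply, Pi.smul_apply, Pi.smul_apply, Pi.smul_apply]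
  exact ⟨pair_smul_mem _ c h.1, pair_smul_mem _ c h.2.1, pair_smul_mem _ c h.2.2.1,
    pair_smul_mem _ c h.2.2.2⟩

theorem IsGammaD.zero {d : ℕ} {Ω : Set (E d)} : IsGammaD (0 : VSpace Ω) (0 : Fin 4 → H12 Ω) :=
  ⟨0, ⟨Submodule.zero_mem _, Submodule.zero_mem _, Submodule.zero_mem _, Submodule.zero_mem _⟩,
    (map_zero (mix ThetaD)).symm⟩

theorem IsGammaD.add {d : ℕ} {Ω : Set (E d)} {v w : VSpace Ω} {η θ : Fin 4 → H12 Ω}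
    (h : IsGammaD v η) (k : IsGammaD w θ) : IsGammaD (v + w) (η + θ) := by
  obtain ⟨t, ht, rfl⟩ := h
  obtain ⟨r, hr, rfl⟩ := k
  exact ⟨t + r, ht.add hr, (map_add (mix ThetaD) t r).symm⟩

theorem IsGammaD.smul {d : ℕ} {Ω : Set (E d)} (c : ℂ) {w : VSpace Ω} {η : Fin 4 → H12 Ω}
    (h : IsGammaD w η) : IsGammaD (c • w) (c • η) := by
  obtain ⟨t, ht, rfl⟩ := h
  exact ⟨c • t, ht.smul c, (map_smul (mix ThetaD) c t).symm⟩

theorem IsNormalDeriv.add {d : ℕ} {Ω : Set (E d)} {v w : DSpace Ω} {t r : Fin 4 → Hm12 Ω}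
    (h : IsNormalDeriv v t) (k : IsNormalDeriv w r) : IsNormalDeriv (v + w) (t + r) := by
  unfold IsNormalDeriv at *
  rw [Prod.fst_add, Prod.snd_add, Pi.add_apply, Pi.add_apply, Pi.add_apply, Pi.add_apply]
  exact ⟨pair_add_mem _ h.1 k.1, pair_add_mem _ h.2.1 k.2.1, pair_add_mem _ h.2.2.1 k.2.2.1,
    pair_add_mem _ h.2.2.2 k.2.2.2⟩

theorem IsNormalDeriv.smul {d : ℕ} {Ω : Set (E d)} (c : ℂ) {w : DSpace Ω} {t : Fin 4 → Hm12 Ω}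
    (h : IsNormalDeriv w t) : IsNormalDeriv (c • w) (c • t) := by
  unfold IsNormalDeriv at *
  rw [Prod.smul_fst, Prod.smul_snd, Pi.smul_apply, Pi.smul_apply, Pi.smul_apply, Pi.smul_apply]
  exact ⟨pair_smul_mem _ c h.1, pair_smul_mem _ c h.2.1, pair_smul_mem _ c h.2.2.1,
    pair_smul_mem _ c h.2.2.2⟩

theorem IsGammaN.zero {d : ℕ} {Ω : Set (E d)} : IsGammaN (0 : DSpace Ω) (0 : Fin 4 → Hm12 Ω) :=
  ⟨0, ⟨Submodule.zero_mem _, Submodule.zero_mem _, Submodule.zero_mem _, Submodule.zero_mem _⟩,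
    (map_zero (mix ThetaN)).symm⟩

theorem IsGammaN.add {d : ℕ} {Ω : Set (E d)} {v w : DSpace Ω} {η θ : Fin 4 → Hm12 Ω}
    (h : IsGammaN v η) (k : IsGammaN w θ) : IsGammaN (v + w) (η + θ) := by
  obtain ⟨t, ht, rfl⟩ := h
  obtain ⟨r, hr, rfl⟩ := k
  exact ⟨t + r, ht.add hr, (map_add (mix ThetaN) t r).symm⟩

theorem IsGammaN.smul {d : ℕ} {Ω : Set (E d)} (c : ℂ) {w : DSpace Ω} {η : Fin 4 → Hm12 Ω}
    (h : IsGammaN w η) : IsGammaN (c • w) (c • η) := by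
  obtain ⟨t, ht, rfl⟩ := h
  exact ⟨c • t, ht.smul c, (map_smul (mix ThetaN) c t).symm⟩

/-- `X_h° = {φ ∈ H^{1/2}_Γ : ⟨μ, φ⟩_Γ = 0 for all μ ∈ X_h}`. -/
def polarX {d : ℕ} {Ω : Set (E d)} (Xh : Submodule ℂ (Hm12 Ω)) : Submodule ℂ (H12 Ω) where
  carrier := {φ | ∀ μ ∈ Xh, μ φ = 0}
  zero_mem' := fun μ _ => map_zero μ
  add_mem' := fun {a b} ha hb μ hμ => by rw [map_add, ha μ hμ, hb μ hμ, add_zero]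
  smul_mem' := fun c a ha μ hμ => by rw [map_smulₛₗ, ha μ hμ, smul_zero]

/-- `Y_h° = {λ ∈ H^{-1/2}_Γ : ⟨λ, φ⟩_Γ = 0 for all φ ∈ Y_h}`. -/
def polarY {d : ℕ} {Ω : Set (E d)} (Yh : Submodule ℂ (H12 Ω)) : Submodule ℂ (Hm12 Ω) where
  carrier := {l | ∀ φ ∈ Yh, l φ = 0}
  zero_mem' := fun _ _ => rfl
  add_mem' := fun {a b} ha hb φ hφ => by
    change a φ + b φ = 0
    rw [ha φ hφ, hb φ hφ, add_zero]
  smul_mem' := fun c a ha φ hφ => by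
    change c • a φ = 0
    rw [ha φ hφ, smul_zero]

/-- `M^{1/2} = {0} × X_h° × Y_h × H^{1/2}_Γ`. -/
def MPlus {d : ℕ} {Ω : Set (E d)} (Xh : Submodule ℂ (Hm12 Ω)) (Yh : Submodule ℂ (H12 Ω)) :
    Submodule ℂ (Fin 4 → H12 Ω) :=
  Submodule.pi univ ![⊥, polarX Xh, Yh, ⊤]

/-- `M^{-1/2} = H^{-1/2}_Γ × X_h × Y_h° × {0}`. -/
def MMinus {d : ℕ} {Ω : Set (E d)} (Xh : Submodule ℂ (Hm12 Ω)) (Yh : Submodule ℂ (H12 Ω)) :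
    Submodule ℂ (Fin 4 → Hm12 Ω) :=
  Submodule.pi univ ![⊤, Xh, polarY Yh, ⊥]

/-- `γ_D w - ξ_D ∈ M^{1/2}` and `γ_N κ w - ξ_N ∈ M^{-1/2}`. -/
def TransmissionCond {d : ℕ} {Ω : Set (E d)} (κ : ℝ) (Xh : Submodule ℂ (Hm12 Ω))
    (Yh : Submodule ℂ (H12 Ω)) (w : DSpace Ω) (ξD : Fin 4 → H12 Ω) (ξN : Fin 4 → Hm12 Ω) : Prop :=
  (∃ η, IsGammaD (pairV w) η ∧ η - ξD ∈ MPlus Xh Yh) ∧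
    ∃ η, IsGammaN (mulFst κ w) η ∧ η - ξN ∈ MMinus Xh Yh

/-- The steady state problem `w = A⋆ w + g`, `γ_D w - ξ_D ∈ M^{1/2}`, `γ_N κ w - ξ_N ∈ M^{-1/2}`. -/
def IsSteadyState {d : ℕ} {Ω : Set (E d)} (ρ κ : ℝ) (Xh : Submodule ℂ (Hm12 Ω))
    (Yh : Submodule ℂ (H12 Ω)) (g : L2Pair Ω) (ξD : Fin 4 → H12 Ω) (ξN : Fin 4 → Hm12 Ω)
    (w : DSpace Ω) : Prop :=
  pairFn w = Astar ρ κ w + g ∧ TransmissionCond κ Xh Yh w ξD ξN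

/-! ### The operator `A` -/

/-- `D_h`: the elements of `D` that satisfy the homogeneous transmission conditions. -/
def Dh {d : ℕ} {Ω : Set (E d)} (κ : ℝ) (Xh : Submodule ℂ (Hm12 Ω)) (Yh : Submodule ℂ (H12 Ω)) :
    Submodule ℂ (DSpace Ω) where
  carrier := {w | (∃ η, IsGammaD (pairV w) η ∧ η ∈ MPlus Xh Yh) ∧
    ∃ η, IsGammaN (mulFst κ w) η ∧ η ∈ MMinus Xh Yh}
  zero_mem' := by
    refine ⟨⟨0, ?_, Submodule.zero_mem _⟩, ⟨0, ?_, Submodule.zero_mem _⟩⟩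
    · rw [map_zero]
      exact IsGammaD.zero
    · rw [map_zero]
      exact IsGammaN.zero
  add_mem' := by
    rintro v w ⟨⟨η, h1, h2⟩, ⟨θ, h3, h4⟩⟩ ⟨⟨η', k1, k2⟩, ⟨θ', k3, k4⟩⟩
    refine ⟨⟨η + η', ?_, Submodule.add_mem _ h2 k2⟩, ⟨θ + θ', ?_, Submodule.add_mem _ h4 k4⟩⟩
    · rw [map_add]
      exact h1.add k1
    · rw [map_add]
      exact h3.add k3
  smul_mem' := by
    rintro c w ⟨⟨η, h1, h2⟩, ⟨θ, h3, h4⟩⟩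
    refine ⟨⟨c • η, ?_, Submodule.smul_mem _ c h2⟩, ⟨c • θ, ?_, Submodule.smul_mem _ c h4⟩⟩
    · rw [map_smul]
      exact h1.smul c
    · rw [map_smul]
      exact h3.smul c

/-- The Hilbert space `H`: the space `L²(ℝᵈ∖Γ)²` with the inner product
`(w, w')_H = (ρ w₋, w₋')_{ℝᵈ∖Γ} + (w₊, w₊')_{ℝᵈ∖Γ}`; the first factor is `L²` for the measure
`ρ dx`. -/
abbrev HSpace {d : ℕ} (Ω : Set (E d)) (ρ : ℝ) :=
  WithLp 2 (Lp ℂ 2 (ENNReal.ofReal ρ • volume.restrict (offGamma Ω)) × L2 (offGamma Ω))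

/-- The identity map of `L²(ℝᵈ∖Γ)²`, from the standard to the weighted inner product. -/
def toH {d : ℕ} (Ω : Set (E d)) (ρ : ℝ) : L2Pair Ω →ₗ[ℂ] HSpace Ω ρ where
  toFun w := WithLp.toLp 2
    (((Lp.memLp w.fst).smul_measure (ENNReal.ofReal_ne_top (r := ρ))).toLp _, w.snd)
  map_add' v w := by
    have h : ((Lp.memLp (v + w).fst).smul_measure (ENNReal.ofReal_ne_top (r := ρ))).toLp _
        = (((Lp.memLp v.fst).smul_measure (ENNReal.ofReal_ne_top (r := ρ))).add
          ((Lp.memLp w.fst).smul_measure (ENNReal.ofReal_ne_top (r := ρ)))).toLp _ :=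
      MemLp.toLp_congr _ _
        (Measure.smul_absolutelyContinuous.ae_le (Lp.coeFn_add v.fst w.fst))
    rw [h, MemLp.toLp_add ((Lp.memLp v.fst).smul_measure (ENNReal.ofReal_ne_top (r := ρ)))
      ((Lp.memLp w.fst).smul_measure (ENNReal.ofReal_ne_top (r := ρ)))]
    rfl
  map_smul' c w := by
    have h : ((Lp.memLp (c • w).fst).smul_measure (ENNReal.ofReal_ne_top (r := ρ))).toLp _
        = (((Lp.memLp w.fst).smul_measure (ENNReal.ofReal_ne_top (r := ρ))).const_smul c).toLp _ :=
      MemLp.toLp_congr _ _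
        (Measure.smul_absolutelyContinuous.ae_le (Lp.coeFn_smul c w.fst))
    rw [h, MemLp.toLp_const_smul c
      ((Lp.memLp w.fst).smul_measure (ENNReal.ofReal_ne_top (r := ρ)))]
    rfl

/-- `w ↦ (w, A⋆ w)` as a linear map `D → H × H`. -/
def graphMap {d : ℕ} (Ω : Set (E d)) (ρ κ : ℝ) : DSpace Ω →ₗ[ℂ] HSpace Ω ρ × HSpace Ω ρ :=
  (toH Ω ρ ∘ₗ pairFn).prod (toH Ω ρ ∘ₗ Astar ρ κ)

/-- The unbounded operator `A` in `H` with domain `D_h` and `A w = A⋆ w`, i.e. the operator whose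
graph is `{(w, A⋆ w) : w ∈ D_h}`. -/
def opA {d : ℕ} (Ω : Set (E d)) (ρ κ : ℝ) (Xh : Submodule ℂ (Hm12 Ω)) (Yh : Submodule ℂ (H12 Ω)) :
    HSpace Ω ρ →ₗ.[ℂ] HSpace Ω ρ :=
  ((Dh κ Xh Yh).map (graphMap Ω ρ κ)).toLinearPMap

/-! The values of `A` are well defined: the graph of `opA` is `{(w, A⋆ w) : w ∈ D_h}`. -/

theorem gradOf_eq_zero {d : ℕ} {O : Set (E d)} (hO : IsOpen O) (u : H1 O) (h : fnOf u = 0) :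
    gradOf u = 0 := by
  have key : ∀ i : Fin d, ∀ᵐ x, x ∈ O → gradOf u x i = 0 := by
    intro i
    refine hO.ae_eq_zero_of_integral_contDiff_smul_eq_zero ?_ ?_
    · have : LocallyIntegrable (fun x => gradOf u x i) (volume.restrict O) :=
        (memLp_coord (gradOf u) i).locallyIntegrable (by norm_num)
      exact (locallyIntegrableOn_of_locallyIntegrable_restrict this)
    · intro g g1 g2 g3
      have := u.2 g ⟨g1, g2, g3⟩ i
      change ∫ x in O, pderiv i g x • fnOf u x = -∫ x in O, g x • gradOf u x i at this
      rw [h] at this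
      have h0 : ∫ x in O, pderiv i g x • (0 : L2 O) x = 0 := by
        refine (integral_congr_ae (g := fun _ => 0) ?_).trans (by simp)
        filter_upwards [Lp.coeFn_zero ℂ 2 (volume.restrict O)] with x hx
        rw [hx, Pi.zero_apply, smul_zero]
      rw [h0, eq_comm, neg_eq_zero] at this
      rw [← this]
      symm
      refine setIntegral_eq_integral_of_forall_compl_eq_zero fun x hx => ?_
      rw [image_eq_zero_of_notMem_tsupport (fun h => hx (g3 h)), zero_smul]
  refine Lp.ext ?_
  filter_upwards [Lp.coeFn_zero (EuclideanSpace ℂ (Fin d)) 2 (volume.restrict O),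
    (ae_restrict_iff' hO.measurableSet).2 (ae_all_iff.2 key |>.mono fun x hx hO i => hx i hO)]
    with x hx h
  rw [hx]
  ext i
  exact h i

theorem lapOf_eq_zero {d : ℕ} {O : Set (E d)} (hO : IsOpen O) (u : H1Lap O)
    (h : fnOf (toH1 u) = 0) : lapOf u = 0 := by
  have hg := gradOf_eq_zero hO _ h
  have key : ∀ᵐ x, x ∈ O → lapOf u x = 0 := by
    refine hO.ae_eq_zero_of_integral_contDiff_smul_eq_zero ?_ ?_
    · have : LocallyIntegrable (lapOf u) (volume.restrict O) :=
        (Lp.memLp (lapOf u)).locallyIntegrable (by norm_num)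
      exact (locallyIntegrableOn_of_locallyIntegrable_restrict this)
    · intro g g1 g2 g3
      have := u.2 g ⟨g1, g2, g3⟩
      change ∫ x in O, ∑ i, pderiv i g x • gradOf (toH1 u) x i = -∫ x in O, g x • lapOf u x at this
      rw [hg] at this
      have h0 : ∫ x in O, ∑ i, pderiv i g x • (0 : L2v O) x i = 0 := by
        refine (integral_congr_ae (g := fun _ => 0) ?_).trans (by simp)
        filter_upwards [Lp.coeFn_zero (EuclideanSpace ℂ (Fin d)) 2 (volume.restrict O)] with x hx
        simp only [hx, Pi.zero_apply, PiLp.zero_apply, smul_zero, Finset.sum_const_zero]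
      rw [h0, eq_comm, neg_eq_zero] at this
      rw [← this]
      symm
      refine setIntegral_eq_integral_of_forall_compl_eq_zero fun x hx => ?_
      rw [image_eq_zero_of_notMem_tsupport (fun h => hx (g3 h)), zero_smul]
  refine Lp.ext ?_
  filter_upwards [Lp.coeFn_zero ℂ 2 (volume.restrict O),
    (ae_restrict_iff' hO.measurableSet).2 key] with x hx h
  rw [hx, h]
  rfl

theorem toH_injective {d : ℕ} (Ω : Set (E d)) {ρ : ℝ} (hρ : 0 < ρ) (w : L2Pair Ω)
    (h : toH Ω ρ w = 0) : w = 0 := by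
  have h2 : w.snd = 0 := congrArg (fun z => z.snd) h
  have h1 : ((Lp.memLp w.fst).smul_measure (ENNReal.ofReal_ne_top (r := ρ))).toLp _ = 0 :=
    congrArg (fun z => z.fst) h
  have h3 : w.fst =ᵐ[ENNReal.ofReal ρ • volume.restrict (offGamma Ω)] 0 := by
    refine (MemLp.coeFn_toLp
      ((Lp.memLp w.fst).smul_measure (ENNReal.ofReal_ne_top (r := ρ)))).symm.trans ?_
    rw [h1]
    exact Lp.coeFn_zero _ _ _
  have h4 : w.fst = 0 := by
    refine (Lp.eq_zero_iff_ae_eq_zero).2 ?_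
    exact (Measure.absolutelyContinuous_smul (ENNReal.ofReal_pos.2 hρ).ne').ae_le h3
  exact WithLp.ofLp_injective 2 (Prod.ext h4 h2)

theorem opA_graph {d : ℕ} (Ω : Set (E d)) {ρ : ℝ} (hρ : 0 < ρ) (κ : ℝ)
    (Xh : Submodule ℂ (Hm12 Ω)) (Yh : Submodule ℂ (H12 Ω)) :
    (opA Ω ρ κ Xh Yh).graph = (Dh κ Xh Yh).map (graphMap Ω ρ κ) := by
  refine Submodule.toLinearPMap_graph_eq _ ?_
  rintro _ ⟨w, -, rfl⟩ h
  have h0 : pairFn w = 0 := toH_injective Ω hρ _ h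
  have hO : IsOpen (offGamma Ω) := isClosed_frontier.isOpen_compl
  have h1 : lapOf w.1 = 0 := lapOf_eq_zero hO _ (congrArg (fun z => z.fst) h0)
  have h2 : lapOf w.2 = 0 := lapOf_eq_zero hO _ (congrArg (fun z => z.snd) h0)
  have : Astar ρ κ w = 0 := by
    change WithLp.toLp 2 (((ρ⁻¹ * κ : ℝ) : ℂ) • lapOf w.1, lapOf w.2) = 0
    rw [h1, h2, smul_zero]
    rfl
  change toH Ω ρ (Astar ρ κ w) = 0
  rw [this, map_zero]

/-! ### Unbounded operators and semigroups -/

/-- `A` is maximal dissipative: `Re (A x, x) ≤ 0` on `D(A)` and `I - A : D(A) → X` is onto. -/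
def IsMaximalDissipative {X : Type*} [NormedAddCommGroup X] [InnerProductSpace ℂ X]
    (A : X →ₗ.[ℂ] X) : Prop :=
  (∀ x : A.domain, (inner ℂ (x : X) (A x)).re ≤ 0) ∧
    ∀ y : X, ∃ x : A.domain, (x : X) - A x = y

/-- The open sector `{z ≠ 0 : |arg z| < δ}`. -/
def sector (δ : ℝ) : Set ℂ := {z | z ≠ 0 ∧ |z.arg| < δ}

/-- `T` is a contractive analytic semigroup of angle `δ`. -/
structure IsContractiveAnalyticSemigroup {X : Type*} [NormedAddCommGroup X] [NormedSpace ℂ X]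
    (T : ℂ → X →L[ℂ] X) (δ : ℝ) : Prop where
  pos : 0 < δ
  le : δ ≤ Real.pi / 2
  map_zero : T 0 = ContinuousLinearMap.id ℂ X
  map_add : ∀ z ∈ sector δ, ∀ z' ∈ sector δ, T (z + z') = (T z).comp (T z')
  analytic : DifferentiableOn ℂ T (sector δ)
  tendsto : ∀ δ', 0 < δ' → δ' < δ → ∀ x, Tendsto (fun z => T z x) (𝓝[sector δ'] 0) (𝓝 x)
  contractive : ∀ z ∈ sector δ, ‖T z‖ ≤ 1

/-- `A` is the infinitesimal generator of the semigroup `(T(t))_{t ≥ 0}`: `D(A)` consists of the `x`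
for which `(T(t)x - x)/t` converges as `t → 0⁺`, and `A x` is the limit. -/
def IsGenerator {X : Type*} [NormedAddCommGroup X] [NormedSpace ℂ X]
    (A : X →ₗ.[ℂ] X) (T : ℂ → X →L[ℂ] X) : Prop :=
  ∀ x y : X, (x, y) ∈ A.graph ↔
    Tendsto (fun t : ℝ => (t : ℂ)⁻¹ • (T (t : ℂ) x - x)) (𝓝[>] 0) (𝓝 y)

end HeatTransmission

end

open HeatTransmission

/-! ### Self-adjoint dissipative operators and their semigroups -/

namespace HeatTransmission

open MeasureTheory Set Filter Topology
open scoped ContDiff ENNReal NNReal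

section Semigroup

variable {X : Type*} [NormedAddCommGroup X] [InnerProductSpace ℂ X]

/-! The matrices satisfy `ThetaN`ᵀ `ThetaD` = diag(1, -1, 1, -1). Hence the sum of the four pairings
of `γ_N κ w` with `γ_D v` is exactly the boundary term of Green's formula for the pair `(κ w₋, w₊)`
on the two sides of `Γ` (`Traces.sum_gN_gD`). The steady state problem therefore has a weak form:
the sesquilinear form `ρ(w₋,v₋) + κ(∇w₋,∇v₋) + (w₊,v₊) + (∇w₊,∇v₊)` is tested with the `v` for which
`γ_D v` lies in `M^{1/2}`. The form is coercive with constant `min(ρ, κ, 1)` on all of `H¹(ℝᵈ∖Γ)²`,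
and `γ_D` has a bounded lifting, so existence, uniqueness and the estimate follow with constants
that never see `X_h` and `Y_h`. Going back from the weak form to the transmission conditions uses
that `M^{-1/2}` is the whole polar set of `M^{1/2}` (`mem_MMinus_of_forall`), which is where the
closedness of `X_h` enters.

With homogeneous data the boundary pairing vanishes, so `(v, A w)_H = -κ(∇v₋,∇w₋) - (∇v₊,∇w₊)` on
`D(A)` (`inner_pairFn_Astar`). Thus `A` is symmetric and dissipative, and `I - A` is onto by the
steady state problem. An abstract argument then gives density of the domain and self-adjointness,
and `R = (I - A)⁻¹` satisfies `0 ≤ R`, `‖R‖ ≤ 1`. Since `A = I - R⁻¹`, the semigroup is `exp(z(1 -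
1/r))` evaluated at `r = R` by the continuous functional calculus
(`IsMaximalDissipative.exists_semigroup`), and everything reduces to scalar estimates on `[0, 1]`.

Most of the work is to show that traces and normal derivatives, introduced only as linear relations,
are operators with the expected properties (`IsBoundedLipschitz.nonempty_traces`). This needs four
facts on one side `U` of a Lipschitz boundary: smooth functions are dense in `H¹`
(`IsSide.closure_smoothSub`, by mollifiers shifted into `U`); the `L²(Γ)` trace is bounded
(`IsSide.trace_le`); a smooth function on `U` extends to `H¹(ℝᵈ)` with the same trace and controlled
norm (`IsSide.exists_extension`, by folding across the graph), so one-sided traces lie in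
`H^{1/2}_Γ` boundedly; and Green's form vanishes on functions of zero trace
(`IsSide.greenL_eq_zero`, by cutting off in a thin layer), so normal derivatives are well defined
functionals on `H^{1/2}_Γ`. -/

/-- Dissipativity gives `‖x‖² ≤ Re (x, x - A x)`, and Cauchy–Schwarz finishes. It makes `I - A`
injective with a contractive inverse. -/
theorem IsMaximalDissipative.norm_le {A : X →ₗ.[ℂ] X} (hA : IsMaximalDissipative A)
    (x : A.domain) : ‖(x : X)‖ ≤ ‖(x : X) - A x‖ := by
  have h1 : ‖(x : X)‖ ^ 2 ≤ (inner ℂ (x : X) ((x : X) - A x)).re := by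
    rw [inner_sub_right, Complex.sub_re, inner_self_eq_norm_sq_to_K]
    have := hA.1 x
    norm_cast
    simp only [Complex.coe_algebraMap, Complex.ofReal_re]
    linarith
  have h2 : (inner ℂ (x : X) ((x : X) - A x)).re ≤ ‖(x : X)‖ * ‖(x : X) - A x‖ :=
    (Complex.re_le_norm _).trans (norm_inner_le_norm _ _)
  rcases (norm_nonneg (x : X)).eq_or_lt with h | h
  · rw [← h]; exact norm_nonneg _
  · nlinarith

/-- If `z` is orthogonal to `D(A)`, write `z = x - A x`. Then `‖x‖² = (x, A x)` has nonpositive real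
part, so `x = 0` and `z = 0`. -/
theorem IsMaximalDissipative.dense_domain [CompleteSpace X] {A : X →ₗ.[ℂ] X}
    (hA : IsMaximalDissipative A) : Dense (A.domain : Set X) := by
  rw [Submodule.dense_iff_topologicalClosure_eq_top, Submodule.topologicalClosure_eq_top_iff,
    Submodule.eq_bot_iff]
  intro z hz
  obtain ⟨x, hx⟩ := hA.2 z
  have h0 : inner ℂ (x : X) z = 0 := hz _ x.2
  rw [← hx, inner_sub_right, inner_self_eq_norm_sq_to_K, sub_eq_zero] at h0
  have h1 := hA.1 x
  rw [← h0] at h1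
  norm_cast at h1
  simp only [Complex.coe_algebraMap, Complex.ofReal_re] at h1
  have h2 : (x : X) = 0 := by
    rw [← norm_eq_zero]
    exact pow_eq_zero_iff two_ne_zero |>.1 (le_antisymm h1 (sq_nonneg ‖(x : X)‖))
  have h3 : x = 0 := Subtype.ext h2
  rw [← hx, h3]
  simp

/-- Symmetry says that the adjoint extends `A`. For `v` in the domain of the adjoint, surjectivity
of `I - A` yields `x ∈ D(A)` such that `u = v - x` is fixed by the adjoint. Such a `u` is orthogonal
to the range of `I - A`, which is everything, so `v = x`. -/
theorem IsMaximalDissipative.isSelfAdjoint [CompleteSpace X] {A : X →ₗ.[ℂ] X}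
    (hA : IsMaximalDissipative A)
    (hs : ∀ x y : A.domain, inner ℂ (A x) (y : X) = inner ℂ (x : X) (A y)) :
    IsSelfAdjoint A := by
  have hd := hA.dense_domain
  have hle : A ≤ A.adjoint := LinearPMap.IsFormalAdjoint.le_adjoint hd hs
  rw [LinearPMap.isSelfAdjoint_def]
  refine le_antisymm ?_ hle
  refine LinearPMap.le_of_eqLocus_ge fun v hv => ?_
  set v' : A.adjoint.domain := ⟨v, hv⟩
  obtain ⟨x, hx⟩ := hA.2 (v - A.adjoint v')
  have hx' : (x : X) ∈ A.adjoint.domain := hle.1 x.2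
  have hAx : A x = A.adjoint ⟨x, hx'⟩ := hle.2 rfl
  set u : A.adjoint.domain := v' - ⟨x, hx'⟩
  have hu : (u : X) = A.adjoint u := by
    change v - (x : X) = A.adjoint (v' - ⟨x, hx'⟩)
    rw [LinearPMap.map_sub, ← hAx]
    linear_combination (norm := module) -hx
  have hu0 : (u : X) = 0 := by
    obtain ⟨y, hy⟩ := hA.2 (u : X)
    have h1 := LinearPMap.adjoint_isFormalAdjoint hd u y
    have : inner ℂ (u : X) ((y : X) - A y) = 0 := by
      rw [inner_sub_right, ← h1, ← hu, sub_self]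
    rw [hy] at this
    exact inner_self_eq_zero.1 this
  have hvx : v = x := sub_eq_zero.1 hu0
  subst hvx
  exact ⟨hx', x.2, hAx.symm⟩

/-- The resolvent `(I - A)⁻¹` of a maximal dissipative symmetric operator. -/
theorem IsMaximalDissipative.exists_resolvent [CompleteSpace X] {A : X →ₗ.[ℂ] X}
    (hA : IsMaximalDissipative A)
    (hs : ∀ x y : A.domain, inner ℂ (A x) (y : X) = inner ℂ (x : X) (A y)) :
    ∃ R : X →L[ℂ] X, 0 ≤ R ∧ ‖R‖ ≤ 1 ∧ ∀ x y, (x, y) ∈ A.graph ↔ x = R (x - y) := by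
  choose r hr using hA.2
  have hinj : ∀ x y : A.domain, (x : X) - A x = (y : X) - A y → x = y := by
    intro x y h
    have := hA.norm_le (x - y)
    rw [LinearPMap.map_sub] at this
    have h0 : ((x - y : A.domain) : X) - (A x - A y) = 0 := by
      change (x : X) - y - (A x - A y) = 0
      linear_combination (norm := module) h
    rw [h0, norm_zero] at this
    exact sub_eq_zero.1 (Subtype.ext (norm_le_zero_iff.1 this))
  let R0 : X →ₗ[ℂ] X :=
    { toFun := fun y => r y
      map_add' := fun y z => by
        rw [← Submodule.coe_add]
        congr 1
        refine hinj _ _ ?_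
        rw [hr, LinearPMap.map_add, Submodule.coe_add]
        nth_rewrite 1 [← hr y, ← hr z]
        abel
      map_smul' := fun c y => by
        rw [RingHom.id_apply, ← Submodule.coe_smul]
        congr 1
        refine hinj _ _ ?_
        rw [hr, LinearPMap.map_smul, Submodule.coe_smul]
        nth_rewrite 1 [← hr y]
        rw [smul_sub] }
  have hb : ∀ y, ‖R0 y‖ ≤ 1 * ‖y‖ := fun y => by
    have := hA.norm_le (r y)
    rw [hr] at this
    rwa [one_mul]
  refine ⟨R0.mkContinuous 1 hb, ?_, LinearMap.mkContinuous_norm_le _ zero_le_one _, ?_⟩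
  · rw [ContinuousLinearMap.nonneg_iff_isPositive, ContinuousLinearMap.isPositive_def]
    constructor
    · intro x y
      change inner ℂ (r x : X) y = inner ℂ x (r y : X)
      nth_rewrite 1 [← hr y]
      nth_rewrite 2 [← hr x]
      rw [inner_sub_left, inner_sub_right, hs]
    · intro x
      change 0 ≤ (inner ℂ (r x : X) x).re
      nth_rewrite 2 [← hr x]
      rw [inner_sub_right, Complex.sub_re, inner_self_eq_norm_sq_to_K]
      have := hA.1 (r x)
      norm_cast
      simp only [Complex.coe_algebraMap, Complex.ofReal_re]
      nlinarith [sq_nonneg ‖(r x : X)‖]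
  · intro x y
    rw [LinearPMap.mem_graph_iff]
    constructor
    · rintro ⟨z, rfl, rfl⟩
      change (z : X) = (r ((z : X) - A z) : X)
      congr 1
      exact hinj _ _ (hr _).symm
    · intro h
      change x = (r (x - y) : X) at h
      refine ⟨r (x - y), h.symm, ?_⟩
      have := hr (x - y)
      rw [← h] at this
      linear_combination (norm := module) -this

end Semigroup

end HeatTransmission

namespace HeatTransmission

open MeasureTheory Set Filter Topology
open scoped ContDiff ENNReal NNReal

/-! ### Scalar estimates for the symbol `exp(z(1 - 1/r))` on `[0, 1]` -/

section ResolventCalculus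

/-- The symbol `r ↦ exp (z (1 - 1/r))`, extended by `0` to `r = 0`. -/
noncomputable def expSymbol (z r : ℂ) : ℂ := if r = 0 then 0 else Complex.exp (z * (1 - r⁻¹))

/-- The segment `[0, 1]` in `ℂ`. -/
def unitSegment : Set ℂ := (fun t : ℝ => (t : ℂ)) '' Icc 0 1

theorem expSymbol_add (z w r : ℂ) : expSymbol (z + w) r = expSymbol z r * expSymbol w r := by
  unfold expSymbol
  split_ifs with h
  · simp
  · rw [add_mul, Complex.exp_add]

theorem re_mul_one_sub_inv (z : ℂ) (t : ℝ) :
    (z * (1 - (t : ℂ)⁻¹)).re = z.re * (1 - t⁻¹) := by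
  rw [← Complex.ofReal_inv, ← Complex.ofReal_one, ← Complex.ofReal_sub, Complex.re_mul_ofReal]

theorem one_sub_inv_nonpos {t : ℝ} (ht : t ∈ Icc (0 : ℝ) 1) (h0 : t ≠ 0) : 1 - t⁻¹ ≤ 0 := by
  have : 1 ≤ t⁻¹ := (one_le_inv₀ (lt_of_le_of_ne ht.1 h0.symm)).2 ht.2
  linarith

theorem norm_expSymbol_le_one {z r : ℂ} (hz : 0 ≤ z.re) (hr : r ∈ unitSegment) :
    ‖expSymbol z r‖ ≤ 1 := by
  obtain ⟨t, ht, rfl⟩ := hr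
  unfold expSymbol
  split_ifs with h
  · simp
  · rw [Complex.norm_exp, re_mul_one_sub_inv, Real.exp_le_one_iff]
    exact mul_nonpos_of_nonneg_of_nonpos hz
      (one_sub_inv_nonpos ht (by simpa using h))

/-- From `exp(a/t) ≥ a/t` with `a = Re z`. The linear decay at `r = 0` makes the symbol continuous
there, as the functional calculus requires when `0` belongs to the spectrum. -/
theorem norm_expSymbol_le {z r : ℂ} (hz : 0 < z.re) (hr : r ∈ unitSegment) :
    ‖expSymbol z r‖ ≤ Real.exp z.re / z.re * ‖r‖ := by
  obtain ⟨t, ht, rfl⟩ := hr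
  unfold expSymbol
  split_ifs with h
  · simp only [norm_zero]; positivity
  · have h0 : 0 < t := lt_of_le_of_ne ht.1 (Ne.symm (by simpa using h))
    rw [Complex.norm_exp, re_mul_one_sub_inv, mul_sub, mul_one, Real.exp_sub,
      Complex.norm_real, Real.norm_of_nonneg h0.le, div_mul_eq_mul_div, mul_div_assoc,
      div_eq_mul_inv]
    refine mul_le_mul_of_nonneg_left ?_ (Real.exp_pos _).le
    rw [← inv_div, inv_le_inv₀ (Real.exp_pos _) (by positivity), div_eq_mul_inv]
    linarith [Real.add_one_le_exp (z.re * t⁻¹)]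

theorem continuousOn_expSymbol {z : ℂ} (hz : 0 < z.re) :
    ContinuousOn (expSymbol z) unitSegment := by
  intro r hr
  by_cases h : r = 0
  · subst h
    unfold ContinuousWithinAt
    have h0 : expSymbol z 0 = 0 := if_pos rfl
    rw [h0]
    refine squeeze_zero_norm' (eventually_mem_nhdsWithin.mono fun r hr => norm_expSymbol_le hz hr) ?_
    have : Tendsto (fun r : ℂ => Real.exp z.re / z.re * ‖r‖) (𝓝 0)
        (𝓝 (Real.exp z.re / z.re * ‖(0 : ℂ)‖)) := (by fun_prop : Continuous _).tendsto _
    rw [norm_zero, mul_zero] at this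
    exact this.mono_left nhdsWithin_le_nhds
  · refine ContinuousAt.continuousWithinAt ?_
    have : ContinuousAt (fun r : ℂ => Complex.exp (z * (1 - r⁻¹))) r :=
      Complex.continuous_exp.continuousAt.comp
        (continuousAt_const.mul (continuousAt_const.sub (continuousAt_inv₀ h)))
    refine this.congr ?_
    filter_upwards [isOpen_ne.mem_nhds h] with s hs
    exact (if_neg hs).symm

theorem norm_exp_sub_one_le_of_re_nonpos {w : ℂ} (hw : w.re ≤ 0) :
    ‖Complex.exp w - 1‖ ≤ 2 * ‖w‖ := by
  rcases le_total ‖w‖ 1 with h | h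
  · exact Complex.norm_exp_sub_one_le h
  · have : ‖Complex.exp w‖ ≤ 1 := by rwa [Complex.norm_exp, Real.exp_le_one_iff]
    have := norm_sub_le (Complex.exp w) 1
    rw [norm_one] at this
    linarith

theorem norm_exp_sub_one_sub_le_of_re_nonpos {w : ℂ} (hw : w.re ≤ 0) :
    ‖Complex.exp w - 1 - w‖ ≤ 3 * ‖w‖ ^ 2 := by
  rcases le_total ‖w‖ 1 with h | h
  · have := Complex.norm_exp_sub_one_sub_id_le h
    nlinarith [sq_nonneg ‖w‖]
  · have h1 := norm_exp_sub_one_le_of_re_nonpos hw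
    have h2 := norm_sub_le (Complex.exp w - 1) w
    nlinarith

theorem mul_one_sub_inv_mul {r z : ℂ} (h : r ≠ 0) : z * (1 - r⁻¹) * r = z * (r - 1) := by
  field_simp

theorem norm_sub_one_le {r : ℂ} (hr : r ∈ unitSegment) : ‖r - 1‖ ≤ 1 := by
  obtain ⟨t, ht, rfl⟩ := hr
  rw [← Complex.ofReal_one, ← Complex.ofReal_sub, Complex.norm_real, Real.norm_eq_abs, abs_le]
  constructor <;> linarith [ht.1, ht.2]

theorem re_mul_one_sub_inv_nonpos {z r : ℂ} (hz : 0 ≤ z.re) (hr : r ∈ unitSegment) (h : r ≠ 0) :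
    (z * (1 - r⁻¹)).re ≤ 0 := by
  obtain ⟨t, ht, rfl⟩ := hr
  rw [re_mul_one_sub_inv]
  exact mul_nonpos_of_nonneg_of_nonpos hz (one_sub_inv_nonpos ht (by simpa using h))

/-- The factor `r` cancels the singularity of `1 - 1/r`. In operator terms it restricts to the range
of `R`, that is to `D(A)`, where `T(z)x - x = O(|z|)`. -/
theorem norm_expSymbol_sub_one_mul_le {z r : ℂ} (hz : 0 ≤ z.re) (hr : r ∈ unitSegment) :
    ‖(expSymbol z r - 1) * r‖ ≤ 2 * ‖z‖ := by
  by_cases h : r = 0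
  · subst h; simp
  unfold expSymbol
  rw [if_neg h, norm_mul]
  calc _ ≤ 2 * ‖z * (1 - r⁻¹)‖ * ‖r‖ := by
        gcongr
        exact norm_exp_sub_one_le_of_re_nonpos (re_mul_one_sub_inv_nonpos hz hr h)
    _ = 2 * (‖z‖ * ‖r - 1‖) := by
        rw [mul_assoc, ← norm_mul, mul_one_sub_inv_mul h, norm_mul]
    _ ≤ 2 * ‖z‖ := by
        have := mul_le_mul_of_nonneg_left (norm_sub_one_le hr) (norm_nonneg z)
        linarith

/-- The second order Taylor remainder contains `(1 - 1/r)²`, so two factors `r` are needed; they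
correspond to vectors in the range of `R²`. -/
theorem norm_expSymbol_sub_one_sub_mul_le {z r : ℂ} (hz : 0 ≤ z.re) (hr : r ∈ unitSegment) :
    ‖((expSymbol z r - 1) * r - z * (r - 1)) * r‖ ≤ 3 * ‖z‖ ^ 2 := by
  by_cases h : r = 0
  · subst h
    simp only [mul_zero, norm_zero]
    positivity
  unfold expSymbol
  rw [if_neg h, ← mul_one_sub_inv_mul h, ← sub_mul, norm_mul, norm_mul]
  calc _ ≤ 3 * ‖z * (1 - r⁻¹)‖ ^ 2 * ‖r‖ * ‖r‖ := by
        gcongr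
        exact norm_exp_sub_one_sub_le_of_re_nonpos (re_mul_one_sub_inv_nonpos hz hr h)
    _ = 3 * (‖z‖ * ‖r - 1‖) ^ 2 := by
        rw [← norm_mul z, ← mul_one_sub_inv_mul h, norm_mul _ r]
        ring
    _ ≤ 3 * ‖z‖ ^ 2 := by
        have := mul_le_mul_of_nonneg_left (norm_sub_one_le hr) (norm_nonneg z)
        gcongr
        linarith

/-- The derivative of `expSymbol` in `z`. -/
noncomputable def expSymbolDeriv (z r : ℂ) : ℂ := (1 - r⁻¹) * expSymbol z r

theorem sq_mul_exp_neg_le {a x : ℝ} (ha : 0 < a) (hx : 0 ≤ x) :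
    x ^ 2 * Real.exp (-(a * x)) ≤ 2 / a ^ 2 := by
  have h1 := Real.quadratic_le_exp_of_nonneg (mul_nonneg ha.le hx)
  rw [Real.exp_neg, ← div_eq_mul_inv, div_le_div_iff₀ (Real.exp_pos _) (by positivity)]
  nlinarith [mul_nonneg ha.le hx]

/-- Uniform differentiability in `z`. With `x = 1/t - 1`, the remainder is at most `exp(-x Re z)
(‖h‖x)² exp(‖h‖x)`. Half of the decay rate `Re z` compensates `exp(‖h‖x)`, the other half bounds the
unbounded factor `x²`. -/
theorem norm_expSymbol_add_sub_le {z h r : ℂ} (hz : 0 < z.re) (hh : ‖h‖ ≤ z.re / 2)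
    (hr : r ∈ unitSegment) :
    ‖expSymbol (z + h) r - expSymbol z r - h * expSymbolDeriv z r‖
      ≤ 2 / (z.re / 2) ^ 2 * ‖h‖ ^ 2 := by
  unfold expSymbolDeriv expSymbol
  split_ifs with h0
  · simp only [mul_zero, sub_zero, norm_zero]; positivity
  obtain ⟨t, ht, rfl⟩ := hr
  set x : ℝ := -(1 - t⁻¹) with hx
  have hx0 : 0 ≤ x := by
    have := one_sub_inv_nonpos ht (by simpa using h0)
    linarith
  have hl : (1 - (t : ℂ)⁻¹) = ((-x : ℝ) : ℂ) := by rw [hx]; push_cast; ring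
  rw [hl, add_mul, Complex.exp_add]
  have h1 : Complex.exp (z * ((-x : ℝ) : ℂ)) * Complex.exp (h * ((-x : ℝ) : ℂ))
      - Complex.exp (z * ((-x : ℝ) : ℂ)) - h * (((-x : ℝ) : ℂ) * Complex.exp (z * ((-x : ℝ) : ℂ)))
      = Complex.exp (z * ((-x : ℝ) : ℂ)) *
        (Complex.exp (h * ((-x : ℝ) : ℂ)) - 1 - h * ((-x : ℝ) : ℂ)) := by ring
  have h2 : ‖h * ((-x : ℝ) : ℂ)‖ = ‖h‖ * x := by
    rw [norm_mul, Complex.norm_real, norm_neg, Real.norm_of_nonneg hx0]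
  have h3 := Complex.norm_exp_sub_sum_le_norm_mul_exp (h * ((-x : ℝ) : ℂ)) 2
  rw [h2] at h3
  simp only [Finset.sum_range_succ, Finset.sum_range_zero, pow_zero, pow_one, Nat.factorial_zero,
    Nat.factorial_one, Nat.cast_one, div_one, zero_add, ← sub_sub] at h3
  rw [h1, norm_mul, Complex.norm_exp, Complex.re_mul_ofReal]
  calc _ ≤ Real.exp (z.re * -x) * ((‖h‖ * x) ^ 2 * Real.exp (‖h‖ * x)) := by gcongr
    _ ≤ Real.exp (z.re * -x) * ((‖h‖ * x) ^ 2 * Real.exp (z.re / 2 * x)) := by gcongr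
    _ = x ^ 2 * Real.exp (-(z.re / 2 * x)) * ‖h‖ ^ 2 := by
        have : Real.exp (-(z.re / 2 * x)) = Real.exp (z.re * -x) * Real.exp (z.re / 2 * x) := by
          rw [← Real.exp_add]; congr 1; ring
        rw [this]; ring
    _ ≤ _ := by
        gcongr
        exact sq_mul_exp_neg_le (by positivity) hx0

theorem continuousOn_expSymbolDeriv {z : ℂ} (hz : 0 < z.re) :
    ContinuousOn (expSymbolDeriv z) unitSegment := by
  -- The exponential is split into two equal factors: one absorbs the singular factor `1 - 1/r`, the
  -- other still tends to `0` at `r = 0`.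
  have hd : ∀ r, expSymbolDeriv z r
      = (1 - r⁻¹) * expSymbol (z / 2) r * expSymbol (z / 2) r := fun r => by
    rw [expSymbolDeriv, mul_assoc, ← expSymbol_add, add_halves]
  have hz2 : 0 < (z / 2).re := by
    rw [Complex.div_ofNat_re]; positivity
  intro r hr
  by_cases h : r = 0
  · subst h
    unfold ContinuousWithinAt
    have h0 : expSymbolDeriv z 0 = 0 := by simp [expSymbolDeriv, expSymbol]
    rw [h0]
    set c := Real.exp (z / 2).re / (z / 2).re
    have hb : ∀ r ∈ unitSegment, ‖expSymbolDeriv z r‖ ≤ c * ‖expSymbol (z / 2) r‖ := by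
      intro r hr
      rw [hd, norm_mul]
      gcongr
      by_cases h1 : r = 0
      · subst h1
        simp only [expSymbol, if_true, mul_zero, norm_zero]
        positivity
      rw [norm_mul]
      calc _ ≤ ‖1 - r⁻¹‖ * (c * ‖r‖) := by
            gcongr
            exact norm_expSymbol_le hz2 hr
        _ = c * ‖r - 1‖ := by
            have := mul_one_sub_inv_mul (z := 1) h1
            rw [one_mul, one_mul] at this
            rw [← this, norm_mul]; ring
        _ ≤ c * 1 := by
            gcongr
            exact norm_sub_one_le hr
        _ = c := mul_one c
    refine squeeze_zero_norm' (eventually_mem_nhdsWithin.mono hb) ?_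
    have := ((continuousOn_expSymbol hz2 0 hr).norm).const_mul c
    have h00 : expSymbol (z / 2) 0 = 0 := if_pos rfl
    simpa only [ContinuousWithinAt, h00, norm_zero, mul_zero] using this
  · exact (continuousWithinAt_const.sub (continuousAt_inv₀ h).continuousWithinAt).mul
      (continuousOn_expSymbol hz r hr)

end ResolventCalculus

/-! ### The semigroup generated by `I - R⁻¹`, through the functional calculus of `R` -/

section ResolventSemigroup

theorem dense_range_of_forall_graph {X : Type*} [NormedAddCommGroup X]
    [InnerProductSpace ℂ X] {R : X →L[ℂ] X} {A : X →ₗ.[ℂ] X} (hd : Dense (A.domain : Set X))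
    (hR : ∀ x y, (x, y) ∈ A.graph ↔ x = R (x - y)) : DenseRange R := by
  refine hd.mono fun x hx => ?_
  exact ⟨x - A ⟨x, hx⟩, ((hR _ _).1 (A.mem_graph ⟨x, hx⟩)).symm⟩

variable {X : Type*} [NormedAddCommGroup X] [InnerProductSpace ℂ X] [CompleteSpace X]

theorem spectrum_subset_unitSegment {R : X →L[ℂ] X} (h0 : 0 ≤ R) (h1 : ‖R‖ ≤ 1) :
    spectrum ℂ R ⊆ unitSegment := by
  intro r hr
  have hs : IsSelfAdjoint R := .of_nonneg h0
  have hre := hs.mem_spectrum_eq_re hr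
  have hr' : r.re ∈ spectrum ℝ R := by
    rw [← spectrum.algebraMap_mem_iff ℂ]
    rw [hre] at hr
    exact hr
  refine ⟨r.re, ⟨spectrum_nonneg_of_nonneg h0 hr', ?_⟩, hre.symm⟩
  have h2 := spectrum.norm_le_norm_mul_of_mem hr
  have h3 : ‖(1 : X →L[ℂ] X)‖ ≤ 1 := ContinuousLinearMap.norm_id_le
  have h4 : ‖R‖ * ‖(1 : X →L[ℂ] X)‖ ≤ 1 * 1 := by gcongr
  linarith [Complex.re_le_norm r]

/-- The semigroup `exp (z (I - R⁻¹))` defined by functional calculus of `R`. -/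
noncomputable def resolventSemigroup (R : X →L[ℂ] X) (z : ℂ) : X →L[ℂ] X :=
  -- At `z = 0` the symbol is the indicator of `r ≠ 0`, which may be discontinuous on the spectrum,
  -- so the identity is prescribed separately.
  if z = 0 then 1 else cfc (expSymbol z) R

theorem sector_pi_div_two {z : ℂ} : z ∈ sector (Real.pi / 2) ↔ 0 < z.re := by
  constructor
  · rintro ⟨h0, h⟩
    rcases Complex.abs_arg_lt_pi_div_two_iff.1 h with h | h
    · exact h
    · exact absurd h h0
  · intro h
    exact ⟨fun h0 => by simp [h0] at h, Complex.abs_arg_lt_pi_div_two_iff.2 (Or.inl h)⟩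

theorem ne_zero_of_re_pos {z : ℂ} (h : 0 < z.re) : z ≠ 0 := fun h0 => by simp [h0] at h

variable {R : X →L[ℂ] X}

theorem resolventSemigroup_of_re_pos {z : ℂ} (h : 0 < z.re) :
    resolventSemigroup R z = cfc (expSymbol z) R := if_neg (ne_zero_of_re_pos h)

theorem norm_resolventSemigroup_le (h0 : 0 ≤ R) (h1 : ‖R‖ ≤ 1) {z : ℂ} (hz : 0 < z.re) :
    ‖resolventSemigroup R z‖ ≤ 1 := by
  rw [resolventSemigroup_of_re_pos hz]
  exact norm_cfc_le zero_le_one fun r hr =>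
    norm_expSymbol_le_one hz.le (spectrum_subset_unitSegment h0 h1 hr)

theorem resolventSemigroup_add (h0 : 0 ≤ R) (h1 : ‖R‖ ≤ 1) {z w : ℂ} (hz : 0 < z.re)
    (hw : 0 < w.re) :
    resolventSemigroup R (z + w) = resolventSemigroup R z * resolventSemigroup R w := by
  have hsp := spectrum_subset_unitSegment h0 h1
  rw [resolventSemigroup_of_re_pos hz, resolventSemigroup_of_re_pos hw,
    resolventSemigroup_of_re_pos (by rw [Complex.add_re]; positivity),
    ← cfc_mul _ _ R ((continuousOn_expSymbol hz).mono hsp) ((continuousOn_expSymbol hw).mono hsp)]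
  exact cfc_congr fun r _ => expSymbol_add z w r

theorem differentiableAt_resolventSemigroup (h0 : 0 ≤ R) (h1 : ‖R‖ ≤ 1) {z : ℂ} (hz : 0 < z.re) :
    DifferentiableAt ℂ (resolventSemigroup R) z := by
  have hsp := spectrum_subset_unitSegment h0 h1
  have hz2 : 0 < z.re / 2 := by positivity
  suffices HasDerivAt (resolventSemigroup R) (cfc (expSymbolDeriv z) R) z from this.differentiableAt
  rw [hasDerivAt_iff_isLittleO_nhds_zero]
  refine Asymptotics.IsBigO.trans_isLittleO (g := fun h : ℂ => ‖h‖ ^ 2) ?_ ?_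
  · refine Asymptotics.IsBigO.of_bound (2 / (z.re / 2) ^ 2) ?_
    filter_upwards [Metric.ball_mem_nhds (0 : ℂ) hz2] with h hh
    rw [mem_ball_zero_iff] at hh
    have hzh : 0 < (z + h).re := by
      have := (abs_le.1 ((Complex.abs_re_le_norm h).trans hh.le)).1
      rw [Complex.add_re]
      linarith
    have c1 := (continuousOn_expSymbol hzh).mono hsp
    have c2 := (continuousOn_expSymbol hz).mono hsp
    have c3 := (continuousOn_expSymbolDeriv hz).mono hsp
    rw [resolventSemigroup_of_re_pos hz, resolventSemigroup_of_re_pos hzh,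
      ← cfc_const_mul h (expSymbolDeriv z) R c3, ← cfc_sub _ _ R c1 c2,
      ← cfc_sub (fun r => expSymbol (z + h) r - expSymbol z r) (fun r => h * expSymbolDeriv z r) R
        (c1.sub c2) (continuousOn_const.mul c3), Real.norm_of_nonneg (by positivity)]
    exact norm_cfc_le (by positivity) fun r hr => norm_expSymbol_add_sub_le hz hh.le (hsp hr)
  · have : (fun h : ℂ => ‖h‖ ^ 2) =o[𝓝 0] fun h : ℂ => ‖h‖ ^ 1 :=
      (Asymptotics.isLittleO_pow_pow one_lt_two).comp_tendsto tendsto_norm_zero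
    simpa only [pow_one] using this.norm_right.trans_isBigO
      (Asymptotics.IsBigO.of_norm_right (by simpa using Asymptotics.isBigO_refl _ _))

theorem norm_resolventSemigroup_sub_apply_le (h0 : 0 ≤ R) (h1 : ‖R‖ ≤ 1) {z : ℂ} (hz : 0 < z.re)
    (y : X) : ‖resolventSemigroup R z (R y) - R y‖ ≤ 2 * ‖z‖ * ‖y‖ := by
  have hsp := spectrum_subset_unitSegment h0 h1
  have c1 := (continuousOn_expSymbol hz).mono hsp
  have hs : IsStarNormal R := (IsSelfAdjoint.of_nonneg h0).isStarNormal
  have h : (resolventSemigroup R z - 1) * R = cfc (fun r => (expSymbol z r - 1) * r) R := by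
    have c2 : ContinuousOn (fun r => expSymbol z r - 1) (spectrum ℂ R) := c1.sub continuousOn_const
    have hid : ContinuousOn (fun r : ℂ => r) (spectrum ℂ R) := continuousOn_id
    rw [cfc_mul _ _ R c2 hid, cfc_sub _ _ R c1 continuousOn_const,
      cfc_const_one ℂ R, cfc_id' ℂ R, resolventSemigroup_of_re_pos hz]
  have h2 : resolventSemigroup R z (R y) - R y = ((resolventSemigroup R z - 1) * R) y := rfl
  rw [h2, h]
  refine ContinuousLinearMap.le_of_opNorm_le _ ?_ y
  exact norm_cfc_le (by positivity) fun r hr => norm_expSymbol_sub_one_mul_le hz.le (hsp hr)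

theorem norm_resolventSemigroup_sub_sub_apply_le (h0 : 0 ≤ R) (h1 : ‖R‖ ≤ 1) {z : ℂ}
    (hz : 0 < z.re) (y : X) :
    ‖(resolventSemigroup R z (R (R y)) - R (R y)) - z • (R (R y) - R y)‖ ≤ 3 * ‖z‖ ^ 2 * ‖y‖ := by
  have hsp := spectrum_subset_unitSegment h0 h1
  have c1 := (continuousOn_expSymbol hz).mono hsp
  have hs : IsStarNormal R := (IsSelfAdjoint.of_nonneg h0).isStarNormal
  have hid : ContinuousOn (fun r : ℂ => r) (spectrum ℂ R) := continuousOn_id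
  have h : ((resolventSemigroup R z - 1) * R - z • (R - 1)) * R
      = cfc (fun r => ((expSymbol z r - 1) * r - z * (r - 1)) * r) R := by
    have c2 : ContinuousOn (fun r => expSymbol z r - 1) (spectrum ℂ R) := c1.sub continuousOn_const
    have c3 : ContinuousOn (fun r : ℂ => r - 1) (spectrum ℂ R) := hid.sub continuousOn_const
    have c4 : ContinuousOn (fun r => (expSymbol z r - 1) * r) (spectrum ℂ R) := c2.mul hid
    have c5 : ContinuousOn (fun r => z * (r - 1)) (spectrum ℂ R) := continuousOn_const.mul c3
    have c6 : ContinuousOn (fun r => (expSymbol z r - 1) * r - z * (r - 1)) (spectrum ℂ R) :=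
      c4.sub c5
    rw [cfc_mul _ _ R c6 hid, cfc_sub _ _ R c4 c5, cfc_mul _ _ R c2 hid,
      cfc_sub _ _ R c1 continuousOn_const, cfc_const_mul z _ R c3,
      cfc_sub _ _ R hid continuousOn_const, cfc_const_one ℂ R, cfc_id' ℂ R,
      resolventSemigroup_of_re_pos hz]
  have h2 : (resolventSemigroup R z (R (R y)) - R (R y)) - z • (R (R y) - R y)
      = (((resolventSemigroup R z - 1) * R - z • (R - 1)) * R) y := rfl
  rw [h2, h]
  refine ContinuousLinearMap.le_of_opNorm_le _ ?_ y
  exact norm_cfc_le (by positivity) fun r hr => norm_expSymbol_sub_one_sub_mul_le hz.le (hsp hr)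

/-- Convergence holds with rate `|z|` on the range of `R`; density of this range and contractivity
extend it to every `x`. -/
theorem tendsto_resolventSemigroup (h0 : 0 ≤ R) (h1 : ‖R‖ ≤ 1) (hd : DenseRange R) {S : Set ℂ}
    (hS : ∀ z ∈ S, 0 < z.re) (x : X) :
    Tendsto (fun z => resolventSemigroup R z x) (𝓝[S] 0) (𝓝 x) := by
  rw [Metric.tendsto_nhds]
  intro ε hε
  obtain ⟨y, hy⟩ := hd.exists_dist_lt x (by positivity : 0 < ε / 3)
  have h2 : ∀ᶠ z : ℂ in 𝓝[S] 0, 2 * ‖z‖ * ‖y‖ < ε / 3 := by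
    have : Tendsto (fun z : ℂ => 2 * ‖z‖ * ‖y‖) (𝓝 0) (𝓝 (2 * ‖(0 : ℂ)‖ * ‖y‖)) :=
      (by fun_prop : Continuous _).tendsto _
    rw [norm_zero, mul_zero, zero_mul] at this
    exact (this.mono_left nhdsWithin_le_nhds).eventually_lt_const (by positivity)
  filter_upwards [h2, eventually_mem_nhdsWithin] with z hz hzS
  have hz0 := hS z hzS
  have e1 := norm_resolventSemigroup_sub_apply_le h0 h1 hz0 y
  have e2 : ‖resolventSemigroup R z (x - R y)‖ ≤ 1 * ‖x - R y‖ :=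
    ContinuousLinearMap.le_of_opNorm_le _ (norm_resolventSemigroup_le h0 h1 hz0) _
  rw [dist_eq_norm] at hy ⊢
  have e3 : resolventSemigroup R z x - x = resolventSemigroup R z (x - R y)
      + (resolventSemigroup R z (R y) - R y) - (x - R y) := by
    rw [map_sub]; abel
  rw [e3]
  have e4 := norm_sub_le (resolventSemigroup R z (x - R y)
      + (resolventSemigroup R z (R y) - R y)) (x - R y)
  have e5 := norm_add_le (resolventSemigroup R z (x - R y)) (resolventSemigroup R z (R y) - R y)
  linarith

theorem commute_resolventSemigroup (h0 : 0 ≤ R) {z : ℂ} (hz : 0 < z.re) :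
    Commute (resolventSemigroup R z) R := by
  have hs : IsStarNormal R := (IsSelfAdjoint.of_nonneg h0).isStarNormal
  have := cfc_commute_cfc (expSymbol z) (fun r => r) R
  rwa [cfc_id' ℂ R, ← resolventSemigroup_of_re_pos hz] at this

/-- The limit is `A R x`, since `A = I - R⁻¹`. For `x = R y` the quotient converges with rate `t`;
in general the quotients at `R x` are bounded by `2‖x‖` uniformly in `t`, so density of the range of
`R` suffices. -/
theorem tendsto_resolventSemigroup_slope (h0 : 0 ≤ R) (h1 : ‖R‖ ≤ 1) (hd : DenseRange R) (x : X) :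
    Tendsto (fun t : ℝ => (t : ℂ)⁻¹ • (resolventSemigroup R t (R x) - R x)) (𝓝[>] 0)
      (𝓝 (R x - x)) := by
  rw [Metric.tendsto_nhds]
  intro ε hε
  -- The error will split into `2‖x - R y‖`, `3t‖y‖`, `‖R(x - R y)‖` and `‖x - R y‖`, in all less
  -- than five eighths of `ε`.
  obtain ⟨y, hy⟩ := hd.exists_dist_lt x (by positivity : 0 < ε / 8)
  have h2 : ∀ᶠ t : ℝ in 𝓝[>] 0, 3 * t * ‖y‖ < ε / 8 := by
    have : Tendsto (fun t : ℝ => 3 * t * ‖y‖) (𝓝 0) (𝓝 (3 * 0 * ‖y‖)) :=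
      (by fun_prop : Continuous _).tendsto _
    rw [mul_zero, zero_mul] at this
    exact (this.mono_left nhdsWithin_le_nhds).eventually_lt_const (by positivity)
  filter_upwards [h2, eventually_mem_nhdsWithin] with t ht ht0
  have ht0 : 0 < t := ht0
  have htre : 0 < ((t : ℂ)).re := by simpa using ht0
  have htn : ‖(t : ℂ)‖ = t := by rw [Complex.norm_real, Real.norm_of_nonneg ht0.le]
  have htc : (t : ℂ) ≠ 0 := by exact_mod_cast ht0.ne'
  have hti : ‖(t : ℂ)⁻¹‖ = t⁻¹ := by rw [norm_inv, htn]
  rw [dist_eq_norm] at hy ⊢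
  have e1 : ‖(t : ℂ)⁻¹ • ((resolventSemigroup R t (R (R y)) - R (R y)) - (t : ℂ) • (R (R y) - R y))‖
      ≤ 3 * t * ‖y‖ := by
    rw [norm_smul, hti]
    have := norm_resolventSemigroup_sub_sub_apply_le h0 h1 htre y
    rw [htn] at this
    calc _ ≤ t⁻¹ * (3 * t ^ 2 * ‖y‖) := by gcongr
      _ = 3 * t * ‖y‖ := by field_simp
  have e2 : ‖(t : ℂ)⁻¹ • (resolventSemigroup R t (R (x - R y)) - R (x - R y))‖
      ≤ 2 * ‖x - R y‖ := by
    rw [norm_smul, hti]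
    have := norm_resolventSemigroup_sub_apply_le h0 h1 htre (x - R y)
    rw [htn] at this
    calc _ ≤ t⁻¹ * (2 * t * ‖x - R y‖) := by gcongr
      _ = 2 * ‖x - R y‖ := by field_simp
  have e3 : ‖R (x - R y)‖ ≤ 1 * ‖x - R y‖ := ContinuousLinearMap.le_of_opNorm_le _ h1 _
  have e4 : (t : ℂ)⁻¹ • (resolventSemigroup R t (R x) - R x) - (R x - x)
      = (t : ℂ)⁻¹ • (resolventSemigroup R t (R (x - R y)) - R (x - R y))
        + (t : ℂ)⁻¹ • ((resolventSemigroup R t (R (R y)) - R (R y)) - (t : ℂ) • (R (R y) - R y))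
        - R (x - R y) + (x - R y) := by
    rw [smul_sub _ _ ((t : ℂ) • _), inv_smul_smul₀ htc]
    simp only [map_sub, smul_sub]
    abel
  rw [e4]
  refine (norm_add_le _ _).trans_lt ?_
  have e5 := norm_sub_le ((t : ℂ)⁻¹ • (resolventSemigroup R t (R (x - R y)) - R (x - R y))
        + (t : ℂ)⁻¹ • ((resolventSemigroup R t (R (R y)) - R (R y)) - (t : ℂ) • (R (R y) - R y)))
        (R (x - R y))
  have e6 := norm_add_le ((t : ℂ)⁻¹ • (resolventSemigroup R t (R (x - R y)) - R (x - R y)))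
    ((t : ℂ)⁻¹ • ((resolventSemigroup R t (R (R y)) - R (R y)) - (t : ℂ) • (R (R y) - R y)))
  linarith

/-- A maximal dissipative symmetric operator is densely defined and self-adjoint, and it generates
a contractive analytic semigroup. -/
theorem IsMaximalDissipative.exists_semigroup {A : X →ₗ.[ℂ] X} (hA : IsMaximalDissipative A)
    (hs : ∀ x y : A.domain, inner ℂ (A x) (y : X) = inner ℂ (x : X) (A y)) :
    ∃ (T : ℂ → X →L[ℂ] X) (δ : ℝ), IsContractiveAnalyticSemigroup T δ ∧ IsGenerator A T := by
  obtain ⟨R, h0, h1, hR⟩ := hA.exists_resolvent hs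
  have hd : DenseRange R := dense_range_of_forall_graph hA.dense_domain hR
  -- The full angle `π/2` is available because `1 - 1/r` is real and nonpositive on the spectrum, so
  -- the symbol has modulus at most `1` whenever `Re z ≥ 0`.
  refine ⟨resolventSemigroup R, Real.pi / 2, ⟨by positivity, le_rfl, if_pos rfl, ?_, ?_, ?_, ?_⟩, ?_⟩
  · intro z hz w hw
    exact resolventSemigroup_add h0 h1 (sector_pi_div_two.1 hz) (sector_pi_div_two.1 hw)
  · intro z hz
    exact (differentiableAt_resolventSemigroup h0 h1 (sector_pi_div_two.1 hz)).differentiableWithinAt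
  · intro δ hδ hδ' x
    exact tendsto_resolventSemigroup h0 h1 hd
      (fun z hz => sector_pi_div_two.1 ⟨hz.1, hz.2.trans hδ'⟩) x
  · intro z hz
    exact norm_resolventSemigroup_le h0 h1 (sector_pi_div_two.1 hz)
  · intro x y
    rw [hR]
    constructor
    · intro h
      have := tendsto_resolventSemigroup_slope h0 h1 hd (x - y)
      rwa [← h, sub_sub_cancel] at this
    · intro h
      -- If the quotients at `x` converge to `y`, applying `R`, which commutes with the semigroup,
      -- gives the quotients at `R x`, whose limit is known. Hence `R y = R x - x`, that is `x = R(x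
      -- - y)`.
      have e1 := (R.continuous.tendsto y).comp h
      have e2 := tendsto_resolventSemigroup_slope h0 h1 hd x
      have e3 : R y = R x - x := by
        refine tendsto_nhds_unique e1 (e2.congr' ?_)
        filter_upwards [eventually_mem_nhdsWithin] with t ht
        have htre : 0 < ((t : ℂ)).re := by simpa using ht
        have := congrArg (fun S : X →L[ℂ] X => S x) (commute_resolventSemigroup h0 htre).eq
        change resolventSemigroup R t (R x) = R (resolventSemigroup R t x) at this
        rw [Function.comp_apply, map_smul, map_sub, this]
      rw [map_sub, e3, sub_sub_cancel]

end ResolventSemigroup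

end HeatTransmission

/-! ### The Sobolev space `H¹(O)` -/

noncomputable section

namespace HeatTransmission

open MeasureTheory Set Filter Topology
open scoped ContDiff ENNReal NNReal

section SobolevBasics

variable {d : ℕ} {O : Set (E d)}

theorem sq_eLpNorm_two {α F : Type*} {m : MeasurableSpace α} {μ : Measure α} [NormedAddCommGroup F]
    (f : α → F) : eLpNorm f 2 μ ^ 2 = ∫⁻ x, ‖f x‖ₑ ^ 2 ∂μ := by
  have := eLpNorm_nnreal_pow_eq_lintegral (μ := μ) (f := f) (p := 2) two_ne_zero
  simpa using this

theorem enorm_sq_Lp {α F : Type*} {m : MeasurableSpace α} {μ : Measure α} [NormedAddCommGroup F]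
    (f : Lp F 2 μ) : ‖f‖ₑ ^ 2 = ∫⁻ x, ‖f x‖ₑ ^ 2 ∂μ := by
  rw [Lp.enorm_def, sq_eLpNorm_two]

/-- The complex gradient of a function. -/
def cgrad (φ : E d → ℂ) (x : E d) : EuclideanSpace ℂ (Fin d) :=
  WithLp.toLp 2 fun i => fderiv ℝ φ x (EuclideanSpace.single i 1)

/-- The gradient of a real function as a complex vector. -/
def rgrad (φ : E d → ℝ) (x : E d) : EuclideanSpace ℂ (Fin d) :=
  WithLp.toLp 2 fun i => (pderiv i φ x : ℂ)

theorem H1.norm_sq (u : H1 O) : ‖u‖ ^ 2 = ‖fnOf u‖ ^ 2 + ‖gradOf u‖ ^ 2 :=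
  WithLp.prod_norm_sq_eq_of_L2 (u : H1sub O).1

theorem H1.enorm_sq (u : H1 O) :
    ‖u‖ₑ ^ 2 = (∫⁻ x in O, ‖fnOf u x‖ₑ ^ 2) + ∫⁻ x in O, ‖gradOf u x‖ₑ ^ 2 := by
  rw [← enorm_sq_Lp, ← enorm_sq_Lp]
  simp only [← ofReal_norm]
  rw [← ENNReal.ofReal_pow (norm_nonneg _), ← ENNReal.ofReal_pow (norm_nonneg _),
    ← ENNReal.ofReal_pow (norm_nonneg _), H1.norm_sq, ENNReal.ofReal_add (by positivity)
    (by positivity)]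

theorem H1.norm_fnOf_le (u : H1 O) : ‖fnOf u‖ ≤ ‖u‖ := by
  have := H1.norm_sq u
  exact le_of_sq_le_sq (by nlinarith [sq_nonneg ‖gradOf u‖]) (norm_nonneg _)

theorem H1.norm_gradOf_le (u : H1 O) : ‖gradOf u‖ ≤ ‖u‖ := by
  have := H1.norm_sq u
  exact le_of_sq_le_sq (by nlinarith [sq_nonneg ‖fnOf u‖]) (norm_nonneg _)

/-- `fnOf` as a continuous linear map. -/
def fnOfL : H1 O →L[ℂ] L2 O :=
  fnOf.mkContinuous 1 fun u => by rw [one_mul]; exact u.norm_fnOf_le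

/-- `gradOf` as a continuous linear map. -/
def gradOfL : H1 O →L[ℂ] L2v O :=
  gradOf.mkContinuous 1 fun u => by rw [one_mul]; exact u.norm_gradOf_le

theorem H1.ext_fnOf (hO : IsOpen O) {u v : H1 O} (h : fnOf u = fnOf v) : u = v := by
  have h1 : fnOf (u - v) = 0 := by rw [map_sub, h, sub_self]
  have h2 := gradOf_eq_zero hO (u - v) h1
  have h3 := H1.norm_sq (u - v)
  rw [h1, h2, norm_zero, norm_zero] at h3
  rw [← sub_eq_zero, ← norm_eq_zero]
  nlinarith

theorem H1.ext_ae (hO : IsOpen O) {u v : H1 O} (h : fnOf u =ᵐ[volume.restrict O] fnOf v) : u = v :=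
  H1.ext_fnOf hO (Lp.ext h)

theorem integral_smul_eq_inner {μ : Measure (E d)} {φ : E d → ℝ} (hφ : MemLp φ 2 μ) (u : Lp ℂ 2 μ) :
    ∫ x, φ x • u x ∂μ = inner ℂ ((hφ.ofReal (K := ℂ)).toLp _) u := by
  rw [L2.inner_def]
  refine integral_congr_ae ?_
  filter_upwards [(hφ.ofReal (K := ℂ)).coeFn_toLp] with x hx
  rw [hx, RCLike.inner_apply, Complex.real_smul, mul_comm]
  simp

/-- The coordinate map `L²(O)ᵈ → L²(O)`. -/
def coordL (μ : Measure (E d)) (i : Fin d) :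
    Lp (EuclideanSpace ℂ (Fin d)) 2 μ →L[ℂ] Lp ℂ 2 μ :=
  ContinuousLinearMap.compLpL 2 μ (EuclideanSpace.proj (𝕜 := ℂ) i)

theorem coordL_ae (μ : Measure (E d)) (i : Fin d) (p : Lp (EuclideanSpace ℂ (Fin d)) 2 μ) :
    coordL μ i p =ᵐ[μ] fun x => p x i :=
  ContinuousLinearMap.coeFn_compLpL _ p

/-- Each test function and each coordinate impose one equation between continuous functionals.
Closedness makes `H¹(O)` complete, as the Riesz and coercivity arguments require. -/
theorem isClosed_H1sub : IsClosed (H1sub O : Set (WithLp 2 (L2 O × L2v O))) := by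
  have : (H1sub O : Set (WithLp 2 (L2 O × L2v O))) = ⋂ (φ : E d → ℝ) (hφ : IsTest O φ) (i : Fin d),
      {w | inner ℂ (((hφ.memLp_pderiv i).ofReal (K := ℂ)).toLp _) w.fst
        = -inner ℂ ((hφ.memLp.ofReal (K := ℂ)).toLp _) (coordL _ i w.snd)} := by
    ext w
    simp only [mem_iInter]
    refine forall_congr' fun φ => forall_congr' fun hφ => forall_congr' fun i => ?_
    rw [mem_ofPred_eq, ← integral_smul_eq_inner (hφ.memLp_pderiv i),
      ← integral_smul_eq_inner hφ.memLp]
    have : ∫ x in O, φ x • coordL (volume.restrict O) i w.snd x = ∫ x in O, φ x • w.snd x i := by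
      refine integral_congr_ae ?_
      filter_upwards [coordL_ae _ i w.snd] with x hx
      rw [hx]
    rw [this]
  rw [this]
  refine isClosed_iInter fun φ => isClosed_iInter fun hφ => isClosed_iInter fun i => ?_
  have hf : Continuous fun w : WithLp 2 (L2 O × L2v O) => w.fst :=
    (WithLp.prod_continuous_ofLp 2 _ _).fst
  have hs : Continuous fun w : WithLp 2 (L2 O × L2v O) => w.snd :=
    (WithLp.prod_continuous_ofLp 2 _ _).snd
  exact isClosed_eq (continuous_const.inner hf)
    (continuous_const.inner ((coordL _ i).continuous.comp hs)).neg

instance : CompleteSpace (H1 O) :=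
  haveI := (isClosed_H1sub (O := O)).completeSpace_coe
  inferInstanceAs (CompleteSpace (H1sub O))

/-- The element of `H¹(O)` given by an `L²` function and its weak gradient. -/
theorem exists_H1 {u : E d → ℂ} {p : E d → EuclideanSpace ℂ (Fin d)}
    (hu : MemLp u 2 (volume.restrict O)) (hp : MemLp p 2 (volume.restrict O))
    (h : ∀ φ : E d → ℝ, IsTest O φ → ∀ i : Fin d,
      ∫ x in O, pderiv i φ x • u x = -∫ x in O, φ x • p x i) :
    ∃ v : H1 O, fnOf v =ᵐ[volume.restrict O] u ∧ gradOf v =ᵐ[volume.restrict O] p := by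
  refine ⟨⟨WithLp.toLp 2 (hu.toLp u, hp.toLp p), ?_⟩, hu.coeFn_toLp, hp.coeFn_toLp⟩
  intro φ hφ i
  have h1 : ∫ x in O, pderiv i φ x • hu.toLp u x = ∫ x in O, pderiv i φ x • u x := by
    refine integral_congr_ae ?_
    filter_upwards [hu.coeFn_toLp] with x hx
    rw [hx]
  have h2 : ∫ x in O, φ x • hp.toLp p x i = ∫ x in O, φ x • p x i := by
    refine integral_congr_ae ?_
    filter_upwards [hp.coeFn_toLp] with x hx
    rw [hx]
  exact h1.trans ((h φ hφ i).trans (congrArg Neg.neg h2.symm))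

theorem H1.weak_grad (u : H1 O) {φ : E d → ℝ} (hφ : IsTest O φ) (i : Fin d) :
    ∫ x in O, pderiv i φ x • fnOf u x = -∫ x in O, φ x • gradOf u x i := u.2 φ hφ i

/-- Smooth compactly supported complex functions on `ℝᵈ`. -/
structure IsSmoothC (φ : E d → ℂ) : Prop where
  contDiff : ContDiff ℝ ∞ φ
  hasCompactSupport : HasCompactSupport φ

theorem continuous_cgrad {φ : E d → ℂ} (h : ContDiff ℝ ∞ φ) : Continuous (cgrad φ) :=
  (PiLp.continuous_toLp 2 _).comp
    (continuous_pi fun _ => (h.continuous_fderiv (by simp)).clm_apply continuous_const)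

theorem hasCompactSupport_cgrad {φ : E d → ℂ} (h : HasCompactSupport φ) :
    HasCompactSupport (cgrad φ) := by
  refine (h.fderiv ℝ).comp_left
    (g := fun L : E d →L[ℝ] ℂ => (WithLp.toLp 2 fun i => L (EuclideanSpace.single i 1) :
      EuclideanSpace ℂ (Fin d))) ?_
  ext i
  simp

theorem norm_cgrad_le (φ : E d → ℂ) (x : E d) : ‖cgrad φ x‖ ≤ √d * ‖fderiv ℝ φ x‖ := by
  rw [EuclideanSpace.norm_eq]
  have : ∑ i, ‖cgrad φ x i‖ ^ 2 ≤ d * ‖fderiv ℝ φ x‖ ^ 2 := by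
    calc _ ≤ ∑ _i : Fin d, ‖fderiv ℝ φ x‖ ^ 2 := by
          refine Finset.sum_le_sum fun i _ => ?_
          have := (fderiv ℝ φ x).le_opNorm (EuclideanSpace.single i 1)
          rw [PiLp.norm_single, norm_one, mul_one] at this
          exact pow_le_pow_left₀ (norm_nonneg _) this 2
      _ = _ := by simp
  calc _ ≤ √(d * ‖fderiv ℝ φ x‖ ^ 2) := Real.sqrt_le_sqrt this
    _ = _ := by rw [Real.sqrt_mul (by positivity), Real.sqrt_sq (norm_nonneg _)]

theorem norm_fderiv_apply_le (φ : E d → ℂ) (x v : E d) :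
    ‖fderiv ℝ φ x v‖ ≤ ‖cgrad φ x‖ * ‖v‖ := by
  have hv : v = ∑ i, v i • EuclideanSpace.single i (1 : ℝ) := by
    ext j
    simp [Finset.sum_apply, Pi.single_apply]
  have h1 : fderiv ℝ φ x v = ∑ i, v i • cgrad φ x i := by
    conv_lhs => rw [hv, map_sum]
    simp only [map_smul]
    rfl
  rw [h1, EuclideanSpace.norm_eq, EuclideanSpace.norm_eq]
  calc _ ≤ ∑ i, ‖cgrad φ x i‖ * ‖v i‖ := by
        refine (norm_sum_le _ _).trans (Finset.sum_le_sum fun i _ => ?_)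
        rw [norm_smul, mul_comm]
    _ ≤ _ := Real.sum_mul_le_sqrt_mul_sqrt _ _ _

theorem IsSmoothC.memLp {φ : E d → ℂ} (h : IsSmoothC φ) {μ : Measure (E d)}
    [IsFiniteMeasureOnCompacts μ] : MemLp φ 2 μ :=
  h.contDiff.continuous.memLp_of_hasCompactSupport h.hasCompactSupport

theorem IsSmoothC.memLp_cgrad {φ : E d → ℂ} (h : IsSmoothC φ) {μ : Measure (E d)}
    [IsFiniteMeasureOnCompacts μ] : MemLp (cgrad φ) 2 μ :=
  (continuous_cgrad h.contDiff).memLp_of_hasCompactSupport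
    (hasCompactSupport_cgrad h.hasCompactSupport)

theorem IsTest.differentiable {φ : E d → ℝ} (h : IsTest O φ) : Differentiable ℝ φ :=
  h.contDiff.differentiable (by simp)

theorem IsSmoothC.differentiable {φ : E d → ℂ} (h : IsSmoothC φ) : Differentiable ℝ φ :=
  h.contDiff.differentiable (by simp)

theorem IsTest.continuous_pderiv {φ : E d → ℝ} (h : IsTest O φ) (i : Fin d) :
    Continuous (pderiv i φ) :=
  (h.contDiff.continuous_fderiv (by simp)).clm_apply continuous_const

theorem IsTest.hasCompactSupport_pderiv {φ : E d → ℝ} (h : IsTest O φ) (i : Fin d) :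
    HasCompactSupport (pderiv i φ) :=
  h.hasCompactSupport.fderiv_apply (𝕜 := ℝ) (EuclideanSpace.single i 1)

theorem IsTest.eq_zero {φ : E d → ℝ} (h : IsTest O φ) {x : E d} (hx : x ∉ O) : φ x = 0 :=
  image_eq_zero_of_notMem_tsupport fun hs => hx (h.subset hs)

theorem IsTest.pderiv_eq_zero {φ : E d → ℝ} (h : IsTest O φ) {x : E d} (hx : x ∉ O) (i : Fin d) :
    pderiv i φ x = 0 := by
  have : fderiv ℝ φ x = 0 :=
    image_eq_zero_of_notMem_tsupport fun hs => hx (h.subset (tsupport_fderiv_subset ℝ hs))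
  rw [pderiv, this]
  rfl

/-- The restriction to `O` of a smooth compactly supported function as an element of `H¹(O)`. -/
theorem IsSmoothC.exists_H1 {φ : E d → ℂ} (h : IsSmoothC φ) (O : Set (E d)) :
    ∃ v : H1 O, fnOf v =ᵐ[volume.restrict O] φ ∧ gradOf v =ᵐ[volume.restrict O] cgrad φ := by
  refine HeatTransmission.exists_H1 h.memLp h.memLp_cgrad fun ψ hψ i => ?_
  rw [setIntegral_eq_integral_of_forall_compl_eq_zero
      fun x hx => by rw [hψ.pderiv_eq_zero hx, zero_smul],
    setIntegral_eq_integral_of_forall_compl_eq_zero fun x hx => by rw [hψ.eq_zero hx, zero_smul]]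
  have hφd : Continuous fun x => fderiv ℝ φ x (EuclideanSpace.single i 1) :=
    (h.contDiff.continuous_fderiv (by simp)).clm_apply continuous_const
  have := integral_bilinear_fderiv_right_eq_neg_left_of_integrable (μ := (volume : Measure (E d)))
    (f := ψ) (g := φ) (v := EuclideanSpace.single i 1) (B := ContinuousLinearMap.lsmul ℝ ℝ)
    (((hψ.continuous_pderiv i).smul h.contDiff.continuous).integrable_of_hasCompactSupport
      (hψ.hasCompactSupport_pderiv i).smul_right)
    ((hψ.contDiff.continuous.smul hφd).integrable_of_hasCompactSupport
      hψ.hasCompactSupport.smul_right)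
    ((hψ.contDiff.continuous.smul h.contDiff.continuous).integrable_of_hasCompactSupport
      hψ.hasCompactSupport.smul_right)
    (fun x _ => hψ.differentiable x) (fun x _ => h.differentiable x)
  rw [eq_neg_iff_add_eq_zero, add_comm]
  exact (eq_neg_iff_add_eq_zero.1 this)

theorem IsTest.mul {χ φ : E d → ℝ} (hχ : ContDiff ℝ ∞ χ) (hφ : IsTest O φ) :
    IsTest O fun x => χ x * φ x :=
  ⟨hχ.mul hφ.contDiff, hφ.hasCompactSupport.mul_left,
    (closure_mono (Function.support_mul_subset_right χ φ)).trans hφ.subset⟩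

theorem pderiv_mul {χ φ : E d → ℝ} (hχ : Differentiable ℝ χ) (hφ : Differentiable ℝ φ) (i : Fin d)
    (x : E d) : pderiv i (fun x => χ x * φ x) x = χ x * pderiv i φ x + pderiv i χ x * φ x := by
  have h := fderiv_mul (hχ x) (hφ x)
  unfold pderiv
  change fderiv ℝ (χ * φ) x _ = _
  rw [h]
  simp [mul_comm]

/-- Real valued smooth functions which are bounded together with their derivatives. -/
structure IsCutoff (χ : E d → ℝ) : Prop where
  contDiff : ContDiff ℝ ∞ χ
  bounded : ∃ C, ∀ x, |χ x| ≤ C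
  bounded_fderiv : ∃ C, ∀ x, ‖fderiv ℝ χ x‖ ≤ C

theorem IsCutoff.of_hasCompactSupport {χ : E d → ℝ} (h : ContDiff ℝ ∞ χ)
    (hs : HasCompactSupport χ) : IsCutoff χ :=
  ⟨h, hs.exists_bound_of_continuous h.continuous,
    (hs.fderiv ℝ).exists_bound_of_continuous (h.continuous_fderiv (by simp))⟩

theorem IsCutoff.differentiable {χ : E d → ℝ} (h : IsCutoff χ) : Differentiable ℝ χ :=
  h.contDiff.differentiable (by simp)

theorem norm_rgrad_le (φ : E d → ℝ) (x : E d) : ‖rgrad φ x‖ ≤ √d * ‖fderiv ℝ φ x‖ := by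
  rw [EuclideanSpace.norm_eq]
  have : ∑ i, ‖rgrad φ x i‖ ^ 2 ≤ d * ‖fderiv ℝ φ x‖ ^ 2 := by
    calc _ ≤ ∑ _i : Fin d, ‖fderiv ℝ φ x‖ ^ 2 := by
          refine Finset.sum_le_sum fun i _ => ?_
          have := (fderiv ℝ φ x).le_opNorm (EuclideanSpace.single i 1)
          rw [PiLp.norm_single, norm_one, mul_one] at this
          refine pow_le_pow_left₀ (norm_nonneg _) ?_ 2
          rwa [rgrad, PiLp.toLp_apply, Complex.norm_real]
      _ = _ := by simp
  calc _ ≤ √(d * ‖fderiv ℝ φ x‖ ^ 2) := Real.sqrt_le_sqrt this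
    _ = _ := by rw [Real.sqrt_mul (by positivity), Real.sqrt_sq (norm_nonneg _)]

theorem continuous_rgrad {χ : E d → ℝ} (h : ContDiff ℝ ∞ χ) : Continuous (rgrad χ) :=
  (PiLp.continuous_toLp 2 _).comp (continuous_pi fun _ => Complex.continuous_ofReal.comp
    ((h.continuous_fderiv (by simp)).clm_apply continuous_const))

theorem IsCutoff.memLp_mul {χ : E d → ℝ} (h : IsCutoff χ) {F : Type*} [NormedAddCommGroup F]
    [NormedSpace ℝ F] {μ : Measure (E d)} {u : E d → F} (hu : MemLp u 2 μ) :
    MemLp (fun x => χ x • u x) 2 μ := by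
  obtain ⟨C, hC⟩ := h.bounded
  refine hu.of_le_mul (c := C) (h.contDiff.continuous.aestronglyMeasurable.smul hu.1)
    (Eventually.of_forall fun x => ?_)
  rw [norm_smul]
  exact mul_le_mul_of_nonneg_right (hC x) (norm_nonneg _)

theorem IsCutoff.memLp_mul_rgrad {χ : E d → ℝ} (h : IsCutoff χ) {μ : Measure (E d)} {u : E d → ℂ}
    (hu : MemLp u 2 μ) : MemLp (fun x => u x • rgrad χ x) 2 μ := by
  obtain ⟨C, hC⟩ := h.bounded_fderiv
  refine hu.of_le_mul (c := √d * C) (hu.1.smul (continuous_rgrad h.contDiff).aestronglyMeasurable)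
    (Eventually.of_forall fun x => ?_)
  rw [norm_smul, mul_comm]
  refine mul_le_mul_of_nonneg_right ((norm_rgrad_le χ x).trans ?_) (norm_nonneg _)
  gcongr
  exact hC x

/-- The product rule in `H¹(O)`. -/
theorem IsCutoff.exists_mul {χ : E d → ℝ} (h : IsCutoff χ) (u : H1 O) :
    ∃ v : H1 O, fnOf v =ᵐ[volume.restrict O] (fun x => χ x • fnOf u x) ∧
      gradOf v =ᵐ[volume.restrict O] fun x => χ x • gradOf u x + fnOf u x • rgrad χ x := by
  have hu := Lp.memLp (fnOf u)
  have hp := Lp.memLp (gradOf u)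
  refine exists_H1 (h.memLp_mul hu) ((h.memLp_mul hp).add (h.memLp_mul_rgrad hu)) fun φ hφ i => ?_
  have h1 := u.weak_grad (hφ.mul h.contDiff) i
  have e1 : ∀ x, pderiv i (fun x => χ x * φ x) x • fnOf u x
      = pderiv i φ x • (χ x • fnOf u x) + φ x • ((fnOf u x • rgrad χ x) i) := by
    intro x
    rw [pderiv_mul h.differentiable hφ.differentiable, PiLp.smul_apply, rgrad, PiLp.toLp_apply]
    simp only [Complex.real_smul, smul_eq_mul]
    push_cast
    ring
  have i1 : Integrable (fun x => pderiv i φ x • (χ x • fnOf u x)) (volume.restrict O) :=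
    integrable_smul_of_memLp (hφ.memLp_pderiv i) (h.memLp_mul hu)
  have i2 : Integrable (fun x => φ x • ((fnOf u x • rgrad χ x) i)) (volume.restrict O) :=
    integrable_smul_of_memLp hφ.memLp
      ((EuclideanSpace.proj (𝕜 := ℂ) i : EuclideanSpace ℂ (Fin d) →L[ℂ] ℂ).comp_memLp'
        (h.memLp_mul_rgrad hu))
  have i3 : Integrable (fun x => φ x • (χ x • gradOf u x i)) (volume.restrict O) :=
    integrable_smul_of_memLp hφ.memLp (h.memLp_mul (memLp_coord _ i))
  simp only [e1] at h1
  rw [integral_add i1 i2] at h1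
  have e2 : ∀ x, φ x • ((χ x • gradOf u x + fnOf u x • rgrad χ x) i)
      = φ x • (χ x • gradOf u x i) + φ x • ((fnOf u x • rgrad χ x) i) := fun x => by
    rw [PiLp.add_apply, PiLp.smul_apply, smul_add]
  change _ = -∫ x in O, φ x • ((χ x • gradOf u x + fnOf u x • rgrad χ x) i)
  simp only [e2]
  rw [integral_add i3 i2]
  have e3 : ∀ x, (χ x * φ x) • gradOf u x i = φ x • (χ x • gradOf u x i) := fun x => by
    rw [smul_smul, mul_comm]
  simp only [e3] at h1
  linear_combination h1

end SobolevBasics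

end HeatTransmission

end

/-! ### Restriction to an open subset and to a side -/

noncomputable section

namespace HeatTransmission

open MeasureTheory Set Filter Topology
open scoped ContDiff ENNReal NNReal

section Sides

variable {d : ℕ} {O O' U : Set (E d)}

/-- `U` is an open subset of the open set `O` whose complement in `O` is open. -/
structure IsClopenIn (O U : Set (E d)) : Prop where
  isOpen : IsOpen U
  subset : U ⊆ O
  isOpen_diff : IsOpen (O \ U)

theorem IsClopenIn.isOpen_right (h : IsClopenIn O U) : IsOpen O := by
  rw [← union_sdiff_cancel h.subset]
  exact h.isOpen.union h.isOpen_diff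

theorem IsClopenIn.diff (h : IsClopenIn O U) : IsClopenIn O (O \ U) :=
  ⟨h.isOpen_diff, sdiff_subset, by rw [sdiff_sdiff_cancel_left h.subset]; exact h.isOpen⟩

/-- A point outside `U` lies either in the open set `O \ U` or off the support of `φ`. Hence cutting
`φ` with the indicator of `U` creates no jump, and smoothness is preserved. -/
theorem IsClopenIn.indicator_eventuallyEq_zero {F : Type*} [Zero F] (h : IsClopenIn O U)
    {φ : E d → F} (hs : tsupport φ ⊆ O) {x : E d} (hx : x ∉ U) : U.indicator φ =ᶠ[𝓝 x] 0 := by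
  by_cases hxO : x ∈ O
  · filter_upwards [h.isOpen_diff.mem_nhds ⟨hxO, hx⟩] with y hy
    exact indicator_of_notMem hy.2 _
  · have : x ∉ tsupport φ := fun hh => hxO (hs hh)
    filter_upwards [notMem_tsupport_iff_eventuallyEq.1 this] with y hy
    by_cases hyU : y ∈ U
    · rw [indicator_of_mem hyU, hy]
    · exact indicator_of_notMem hyU _

theorem IsClopenIn.indicator_eventuallyEq {F : Type*} [Zero F] (h : IsClopenIn O U)
    (φ : E d → F) {x : E d} (hx : x ∈ U) : U.indicator φ =ᶠ[𝓝 x] φ := by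
  filter_upwards [h.isOpen.mem_nhds hx] with y hy
  exact indicator_of_mem hy _

theorem IsClopenIn.contDiff_indicator {F : Type*} [NormedAddCommGroup F] [NormedSpace ℝ F]
    (h : IsClopenIn O U) {φ : E d → F} (hφ : ContDiff ℝ ∞ φ) (hs : tsupport φ ⊆ O) :
    ContDiff ℝ ∞ (U.indicator φ) := by
  rw [contDiff_iff_contDiffAt]
  intro x
  by_cases hx : x ∈ U
  · exact hφ.contDiffAt.congr_of_eventuallyEq (h.indicator_eventuallyEq φ hx)
  · exact contDiffAt_const.congr_of_eventuallyEq (h.indicator_eventuallyEq_zero hs hx)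

theorem IsClopenIn.fderiv_indicator {F : Type*} [NormedAddCommGroup F] [NormedSpace ℝ F]
    (h : IsClopenIn O U) {φ : E d → F} (hs : tsupport φ ⊆ O) (x : E d) :
    fderiv ℝ (U.indicator φ) x = U.indicator (fderiv ℝ φ) x := by
  by_cases hx : x ∈ U
  · rw [(h.indicator_eventuallyEq φ hx).fderiv_eq, indicator_of_mem hx]
  · rw [(h.indicator_eventuallyEq_zero hs hx).fderiv_eq, indicator_of_notMem hx]
    exact fderiv_const_apply _

theorem IsClopenIn.tsupport_indicator_subset {F : Type*} [Zero F]
    (h : IsClopenIn O U) {φ : E d → F} (hs : tsupport φ ⊆ O) : tsupport (U.indicator φ) ⊆ U := by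
  intro x hx
  by_contra hxU
  exact notMem_tsupport_iff_eventuallyEq.2 (h.indicator_eventuallyEq_zero hs hxU) hx

theorem IsTest.indicator {φ : E d → ℝ} (hφ : IsTest O φ) (h : IsClopenIn O U) :
    IsTest O (U.indicator φ) := by
  refine ⟨h.contDiff_indicator hφ.contDiff hφ.subset, ?_,
    (h.tsupport_indicator_subset hφ.subset).trans h.subset⟩
  exact hφ.hasCompactSupport.mono (by rw [support_indicator]; exact inter_subset_right)

theorem fnOf_add_ae (u v : H1 O) :
    fnOf (u + v) =ᵐ[volume.restrict O] fun x => fnOf u x + fnOf v x := by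
  rw [map_add]
  exact Lp.coeFn_add _ _

theorem fnOf_smul_ae (c : ℂ) (u : H1 O) :
    fnOf (c • u) =ᵐ[volume.restrict O] fun x => c • fnOf u x := by
  rw [map_smul]
  exact Lp.coeFn_smul _ _

theorem fnOf_sub_ae (u v : H1 O) :
    fnOf (u - v) =ᵐ[volume.restrict O] fun x => fnOf u x - fnOf v x := by
  rw [map_sub]
  exact Lp.coeFn_sub _ _

/-- The indicator of `U` maps test functions on `O` to test functions on `O`, so in the weak
gradient identity it can be moved from the test function to `u`. -/
theorem exists_cut (h : IsClopenIn O U) (u : H1 O) :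
    ∃ v : H1 O, fnOf v =ᵐ[volume.restrict O] U.indicator (fnOf u) ∧
      gradOf v =ᵐ[volume.restrict O] U.indicator (gradOf u) := by
  refine exists_H1 ((Lp.memLp _).indicator h.isOpen.measurableSet)
    ((Lp.memLp _).indicator h.isOpen.measurableSet) fun φ hφ i => ?_
  have h1 := u.weak_grad (hφ.indicator h) i
  have e1 : ∀ x, pderiv i (U.indicator φ) x • fnOf u x
      = pderiv i φ x • U.indicator (fnOf u) x := fun x => by
    rw [pderiv, h.fderiv_indicator hφ.subset, pderiv]
    by_cases hx : x ∈ U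
    · rw [indicator_of_mem hx, indicator_of_mem hx]
    · simp [indicator_of_notMem hx]
  have e2 : ∀ x, U.indicator φ x • gradOf u x i = φ x • U.indicator (gradOf u) x i := fun x => by
    by_cases hx : x ∈ U
    · rw [indicator_of_mem hx, indicator_of_mem hx]
    · simp [indicator_of_notMem hx]
  simpa only [e1, e2] using h1

theorem norm_le_of_ae {u v : H1 O} (h1 : ∀ᵐ x ∂volume.restrict O, ‖fnOf v x‖ ≤ ‖fnOf u x‖)
    (h2 : ∀ᵐ x ∂volume.restrict O, ‖gradOf v x‖ ≤ ‖gradOf u x‖) : ‖v‖ ≤ ‖u‖ := by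
  have e1 := Lp.norm_le_norm_of_ae_le h1
  have e2 := Lp.norm_le_norm_of_ae_le h2
  refine le_of_sq_le_sq ?_ (norm_nonneg _)
  rw [H1.norm_sq, H1.norm_sq]
  gcongr

/-- An element of `H¹(O)` multiplied by the indicator function of `U`. -/
def cutFn (h : IsClopenIn O U) (u : H1 O) : H1 O := (exists_cut h u).choose

theorem fnOf_cutFn (h : IsClopenIn O U) (u : H1 O) :
    fnOf (cutFn h u) =ᵐ[volume.restrict O] U.indicator (fnOf u) := (exists_cut h u).choose_spec.1

theorem gradOf_cutFn (h : IsClopenIn O U) (u : H1 O) :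
    gradOf (cutFn h u) =ᵐ[volume.restrict O] U.indicator (gradOf u) :=
  (exists_cut h u).choose_spec.2

theorem cutFn_add (h : IsClopenIn O U) (u v : H1 O) :
    cutFn h (u + v) = cutFn h u + cutFn h v := by
  refine H1.ext_ae h.isOpen_right ?_
  filter_upwards [fnOf_cutFn h (u + v), fnOf_cutFn h u, fnOf_cutFn h v, fnOf_add_ae u v,
    fnOf_add_ae (cutFn h u) (cutFn h v)] with x h1 h2 h3 h4 h5
  rw [h1, h5, h2, h3]
  by_cases hx : x ∈ U
  · simp only [indicator_of_mem hx]; exact h4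
  · simp only [indicator_of_notMem hx, add_zero]

theorem cutFn_smul (h : IsClopenIn O U) (c : ℂ) (u : H1 O) :
    cutFn h (c • u) = c • cutFn h u := by
  refine H1.ext_ae h.isOpen_right ?_
  filter_upwards [fnOf_cutFn h (c • u), fnOf_cutFn h u, fnOf_smul_ae c u,
    fnOf_smul_ae c (cutFn h u)] with x h1 h2 h4 h5
  rw [h1, h5, h2]
  by_cases hx : x ∈ U
  · simp only [indicator_of_mem hx]; exact h4
  · simp only [indicator_of_notMem hx, smul_zero]

theorem norm_cutFn_le (h : IsClopenIn O U) (u : H1 O) : ‖cutFn h u‖ ≤ ‖u‖ := by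
  refine norm_le_of_ae ?_ ?_
  · filter_upwards [fnOf_cutFn h u] with x hx
    rw [hx]
    exact norm_indicator_le_norm_self _ _
  · filter_upwards [gradOf_cutFn h u] with x hx
    rw [hx]
    exact norm_indicator_le_norm_self _ _

/-- Multiplication of an element of `H¹(O)` by the indicator function of `U`. -/
def cutL (h : IsClopenIn O U) : H1 O →L[ℂ] H1 O :=
  LinearMap.mkContinuous ⟨⟨cutFn h, cutFn_add h⟩, cutFn_smul h⟩ 1 fun u => by
    rw [one_mul]
    exact norm_cutFn_le h u

theorem fnOf_cutL (h : IsClopenIn O U) (u : H1 O) :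
    fnOf (cutL h u) =ᵐ[volume.restrict O] U.indicator (fnOf u) := fnOf_cutFn h u

theorem gradOf_cutL (h : IsClopenIn O U) (u : H1 O) :
    gradOf (cutL h u) =ᵐ[volume.restrict O] U.indicator (gradOf u) := gradOf_cutFn h u

theorem norm_cutL_le (h : IsClopenIn O U) (u : H1 O) : ‖cutL h u‖ ≤ ‖u‖ := norm_cutFn_le h u

theorem IsTest.mono {φ : E d → ℝ} (hφ : IsTest O φ) (h : O ⊆ O') : IsTest O' φ :=
  ⟨hφ.contDiff, hφ.hasCompactSupport, hφ.subset.trans h⟩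

theorem exists_restrict (h : O ⊆ O') (u : H1 O') :
    ∃ v : H1 O, fnOf v =ᵐ[volume.restrict O] fnOf u ∧
      gradOf v =ᵐ[volume.restrict O] gradOf u := by
  have hle : volume.restrict O ≤ volume.restrict O' := Measure.restrict_mono h le_rfl
  refine exists_H1 ((Lp.memLp _).mono_measure hle) ((Lp.memLp _).mono_measure hle) fun φ hφ i => ?_
  have h1 := u.weak_grad (hφ.mono h) i
  rw [setIntegral_eq_integral_of_forall_compl_eq_zero
      fun x hx => by rw [(hφ.mono h).pderiv_eq_zero hx, zero_smul],
    setIntegral_eq_integral_of_forall_compl_eq_zero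
      fun x hx => by rw [(hφ.mono h).eq_zero hx, zero_smul]] at h1
  rw [setIntegral_eq_integral_of_forall_compl_eq_zero
      fun x hx => by rw [hφ.pderiv_eq_zero hx, zero_smul],
    setIntegral_eq_integral_of_forall_compl_eq_zero fun x hx => by rw [hφ.eq_zero hx, zero_smul], h1]

theorem enorm_restrict_le (h : O ⊆ O') {u : H1 O'} {v : H1 O}
    (h1 : fnOf v =ᵐ[volume.restrict O] fnOf u) (h2 : gradOf v =ᵐ[volume.restrict O] gradOf u) :
    ‖v‖ ≤ ‖u‖ := by
  have : ‖v‖ₑ ^ 2 ≤ ‖u‖ₑ ^ 2 := by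
    have e1 : ∫⁻ x in O, ‖fnOf v x‖ₑ ^ 2 = ∫⁻ x in O, ‖fnOf u x‖ₑ ^ 2 :=
      lintegral_congr_ae (h1.mono fun x hx => congrArg (‖·‖ₑ ^ 2) hx)
    have e2 : ∫⁻ x in O, ‖gradOf v x‖ₑ ^ 2 = ∫⁻ x in O, ‖gradOf u x‖ₑ ^ 2 :=
      lintegral_congr_ae (h2.mono fun x hx => congrArg (‖·‖ₑ ^ 2) hx)
    rw [H1.enorm_sq, H1.enorm_sq, e1, e2]
    exact add_le_add (lintegral_mono_set h) (lintegral_mono_set h)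
  have := (ENNReal.pow_le_pow_left_iff two_ne_zero).1 this
  exact enorm_le_iff_norm_le.1 this

/-- The restriction of an element of `H¹(O')` to `O`. -/
def resFn (h : O ⊆ O') (u : H1 O') : H1 O := (exists_restrict h u).choose

theorem fnOf_resFn (h : O ⊆ O') (u : H1 O') :
    fnOf (resFn h u) =ᵐ[volume.restrict O] fnOf u := (exists_restrict h u).choose_spec.1

theorem gradOf_resFn (h : O ⊆ O') (u : H1 O') :
    gradOf (resFn h u) =ᵐ[volume.restrict O] gradOf u := (exists_restrict h u).choose_spec.2

theorem resFn_add (hO : IsOpen O) (h : O ⊆ O') (u v : H1 O') :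
    resFn h (u + v) = resFn h u + resFn h v := by
  have hle : volume.restrict O ≤ volume.restrict O' := Measure.restrict_mono h le_rfl
  refine H1.ext_ae hO ?_
  filter_upwards [fnOf_resFn h (u + v), fnOf_resFn h u, fnOf_resFn h v,
    ae_mono hle (fnOf_add_ae u v), fnOf_add_ae (resFn h u) (resFn h v)] with x h1 h2 h3 h4 h5
  rw [h1, h5, h2, h3, h4]

theorem resFn_smul (hO : IsOpen O) (h : O ⊆ O') (c : ℂ) (u : H1 O') :
    resFn h (c • u) = c • resFn h u := by
  have hle : volume.restrict O ≤ volume.restrict O' := Measure.restrict_mono h le_rfl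
  refine H1.ext_ae hO ?_
  filter_upwards [fnOf_resFn h (c • u), fnOf_resFn h u,
    ae_mono hle (fnOf_smul_ae c u), fnOf_smul_ae c (resFn h u)] with x h1 h2 h4 h5
  rw [h1, h5, h2, h4]

/-- The restriction `H¹(O') → H¹(O)`. -/
def resL (hO : IsOpen O) (h : O ⊆ O') : H1 O' →L[ℂ] H1 O :=
  LinearMap.mkContinuous ⟨⟨resFn h, resFn_add hO h⟩, resFn_smul hO h⟩ 1 fun u => by
    rw [one_mul]
    exact enorm_restrict_le h (fnOf_resFn h u) (gradOf_resFn h u)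

theorem fnOf_resL (hO : IsOpen O) (h : O ⊆ O') (u : H1 O') :
    fnOf (resL hO h u) =ᵐ[volume.restrict O] fnOf u := fnOf_resFn h u

theorem gradOf_resL (hO : IsOpen O) (h : O ⊆ O') (u : H1 O') :
    gradOf (resL hO h u) =ᵐ[volume.restrict O] gradOf u := gradOf_resFn h u

theorem norm_resL_le (hO : IsOpen O) (h : O ⊆ O') (u : H1 O') : ‖resL hO h u‖ ≤ ‖u‖ :=
  enorm_restrict_le h (fnOf_resL hO h u) (gradOf_resL hO h u)

/-- An element of `H¹(O)` which coincides on the open set `U` with a smooth function has there the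
classical gradient. -/
theorem gradOf_ae_eq_cgrad (hU : IsOpen U) (hUO : U ⊆ O) {u : H1 O} {φ : E d → ℂ}
    (hφ : IsSmoothC φ) (h : ∀ᵐ x ∂volume.restrict O, x ∈ U → fnOf u x = φ x) :
    ∀ᵐ x ∂volume.restrict O, x ∈ U → gradOf u x = cgrad φ x := by
  obtain ⟨v, hv, hv'⟩ := hφ.exists_H1 U
  have hle : volume.restrict U ≤ volume.restrict O := Measure.restrict_mono hUO le_rfl
  have e : resL hU hUO u = v := by
    refine H1.ext_ae hU ?_
    filter_upwards [fnOf_resL hU hUO u, hv, ae_mono hle h, ae_restrict_mem hU.measurableSet]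
      with x h1 h2 h3 hx
    rw [h1, h2, h3 hx]
  have h1 := gradOf_resL hU hUO u
  rw [e] at h1
  have h2 : ∀ᵐ x ∂volume.restrict U, gradOf u x = cgrad φ x := by
    filter_upwards [h1, hv'] with x h1 h2
    rw [← h1, h2]
  rw [ae_restrict_iff' hU.measurableSet] at h2
  exact ae_mono Measure.restrict_le_self h2

/-- The `H¹(U)`-norm of an element of `H¹(O)`. -/
theorem enorm_cutL_sq (h : IsClopenIn O U) (u : H1 O) :
    ‖cutL h u‖ₑ ^ 2 = (∫⁻ x in U, ‖fnOf u x‖ₑ ^ 2) + ∫⁻ x in U, ‖gradOf u x‖ₑ ^ 2 := by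
  have hr : (volume.restrict O).restrict U = volume.restrict U := by
    rw [Measure.restrict_restrict h.isOpen.measurableSet, inter_eq_left.2 h.subset]
  rw [H1.enorm_sq, ← hr, ← lintegral_indicator h.isOpen.measurableSet,
    ← lintegral_indicator h.isOpen.measurableSet]
  congr 1
  · refine lintegral_congr_ae ?_
    filter_upwards [fnOf_cutL h u] with x hx
    rw [hx]
    by_cases hxU : x ∈ U
    · rw [indicator_of_mem hxU, indicator_of_mem hxU]
    · rw [indicator_of_notMem hxU, indicator_of_notMem hxU]; simp
  · refine lintegral_congr_ae ?_
    filter_upwards [gradOf_cutL h u] with x hx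
    rw [hx]
    by_cases hxU : x ∈ U
    · rw [indicator_of_mem hxU, indicator_of_mem hxU]
    · rw [indicator_of_notMem hxU, indicator_of_notMem hxU]; simp

/-- For an element of `H¹(O)` which is a smooth function on the side `U`, the `H¹(U)`-norm in terms
of this function. -/
theorem enorm_cutL_sq_of_smooth (h : IsClopenIn O U) {u : H1 O} {φ : E d → ℂ}
    (hφ : IsSmoothC φ) (hu : ∀ᵐ x ∂volume.restrict O, x ∈ U → fnOf u x = φ x) :
    ‖cutL h u‖ₑ ^ 2 = (∫⁻ x in U, ‖φ x‖ₑ ^ 2) + ∫⁻ x in U, ‖cgrad φ x‖ₑ ^ 2 := by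
  have hle : volume.restrict U ≤ volume.restrict O := Measure.restrict_mono h.subset le_rfl
  rw [enorm_cutL_sq]
  congr 1
  · refine lintegral_congr_ae ?_
    filter_upwards [ae_mono hle hu, ae_restrict_mem h.isOpen.measurableSet] with x h1 hx
    rw [h1 hx]
  · refine lintegral_congr_ae ?_
    filter_upwards [ae_mono hle (gradOf_ae_eq_cgrad h.isOpen h.subset hφ hu),
      ae_restrict_mem h.isOpen.measurableSet] with x h1 hx
    rw [h1 hx]

end Sides

end HeatTransmission

end

/-! ### Lipschitz graphs -/

noncomputable section

namespace HeatTransmission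

open MeasureTheory Set Filter Topology
open scoped ContDiff ENNReal NNReal

section Graphs

variable {d : ℕ}

/-- `f` is a Lipschitz function of the variables orthogonal to the unit vector `e`. -/
structure IsLipGraph (e : E d) (f : E d → ℝ) (L : ℝ≥0) : Prop where
  norm_eq : ‖e‖ = 1
  lipschitz : LipschitzWith L f
  const : ∀ (y : E d) (t : ℝ), f (y + t • e) = f y

variable {e : E d} {f : E d → ℝ} {L : ℝ≥0}

theorem IsLipGraph.inner_self (h : IsLipGraph e f L) : inner ℝ e e = 1 := by
  rw [real_inner_self_eq_norm_sq, h.norm_eq, one_pow]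

theorem IsLipGraph.neg (h : IsLipGraph e f L) : IsLipGraph (-e) (fun y => -f y) L := by
  refine ⟨by rw [norm_neg, h.norm_eq], h.lipschitz.neg, fun y t => ?_⟩
  rw [smul_neg, ← neg_smul, h.const]

/-- The height of a point above the graph. -/
def IsLipGraph.height (_h : IsLipGraph e f L) (y : E d) : ℝ := inner ℝ e y - f y

theorem IsLipGraph.height_add_smul (h : IsLipGraph e f L) (y : E d) (t : ℝ) :
    h.height (y + t • e) = h.height y + t := by
  unfold IsLipGraph.height
  rw [h.const, inner_add_right, inner_smul_right, h.inner_self]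
  ring

theorem IsLipGraph.height_sub_smul (h : IsLipGraph e f L) (y : E d) (t : ℝ) :
    h.height (y - t • e) = h.height y - t := by
  rw [sub_eq_add_neg, ← neg_smul, h.height_add_smul, ← sub_eq_add_neg]

theorem IsLipGraph.abs_height_sub_le (h : IsLipGraph e f L) (y z : E d) :
    |h.height y - h.height z| ≤ (1 + L) * ‖y - z‖ := by
  have h1 : |inner ℝ e (y - z)| ≤ ‖y - z‖ := by
    have := abs_real_inner_le_norm e (y - z)
    rwa [h.norm_eq, one_mul] at this
  have h2 := h.lipschitz.dist_le_mul y z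
  rw [Real.dist_eq, dist_eq_norm] at h2
  have e1 : h.height y - h.height z = inner ℝ e (y - z) - (f y - f z) := by
    unfold IsLipGraph.height
    rw [inner_sub_right]
    ring
  rw [e1]
  refine (abs_sub _ _).trans ?_
  linarith

theorem IsLipGraph.continuous_height (h : IsLipGraph e f L) : Continuous h.height :=
  (continuous_const.inner continuous_id).sub h.lipschitz.continuous

/-- The measure `σ` is the image of the Hausdorff measure of the hyperplane `e^⊥` under the graph
map. Fubini in the coordinates `y + t e` becomes integration over the graph and over the depth `s`
below it. The comparison with the surface measure replaces an area formula: the graph map is `(1 +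
L)`-Lipschitz, and its inverse is an orthogonal projection, hence 1-Lipschitz. -/
theorem IsLipGraph.exists_measure (h : IsLipGraph e f L) (hd : 0 < d) :
    ∃ (σ : Measure (E d)) (c K : ℝ≥0∞), c ≠ 0 ∧ c ≠ ⊤ ∧ K ≠ ⊤ ∧
      (∀ F : E d → ℝ≥0∞, Measurable F → ∫⁻ z, F z = c * ∫⁻ x, (∫⁻ s : ℝ, F (x - s • e)) ∂σ) ∧
      (Measure.hausdorffMeasure ((d : ℝ) - 1)).restrict {z | h.height z = 0} ≤ K • σ ∧
      σ ≤ (Measure.hausdorffMeasure ((d : ℝ) - 1)).restrict {z | h.height z = 0} ∧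
      ∀ r, σ (Metric.closedBall 0 r) < ⊤ := by
  have he0 : e ≠ 0 := fun h0 => by simpa [h0] using h.norm_eq
  have hd1 : (0 : ℝ) ≤ (d : ℝ) - 1 := by
    have : (1 : ℝ) ≤ d := by exact_mod_cast hd
    linarith
  set Y := (Submodule.span ℝ {e})ᗮ with hY
  have hfin : Module.finrank ℝ Y = d - 1 := by
    obtain ⟨n, rfl⟩ : ∃ n, d = n + 1 := ⟨d - 1, by omega⟩
    have : Fact (Module.finrank ℝ (E (n + 1)) = n + 1) := ⟨by simp⟩
    simpa using Submodule.finrank_orthogonal_span_singleton (𝕜 := ℝ) he0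
  have hYe : ∀ y : Y, inner ℝ e (y : E d) = 0 := fun y =>
    Submodule.mem_orthogonal_singleton_iff_inner_right.1 y.2
  set ν : Measure Y := Measure.hausdorffMeasure ((d : ℝ) - 1) with hν
  have : ν.IsAddHaarMeasure := by
    have : ((d : ℝ) - 1) = ((Module.finrank ℝ Y : ℕ) : ℝ) := by
      rw [hfin, Nat.cast_sub hd, Nat.cast_one]
    rw [hν, this]
    infer_instance
  -- the linear coordinates
  let Ψ : (Y × ℝ) ≃L[ℝ] E d := LinearEquiv.toContinuousLinearEquiv
    { toFun := fun p => (p.1 : E d) + p.2 • e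
      map_add' := fun p q => by
        simp only [Prod.fst_add, Prod.snd_add, Submodule.coe_add]
        module
      map_smul' := fun c p => by
        simp only [Prod.smul_fst, Prod.smul_snd, Submodule.coe_smul, smul_eq_mul, RingHom.id_apply]
        module
      invFun := fun z => (⟨z - (inner ℝ e z : ℝ) • e, by
        rw [hY, Submodule.mem_orthogonal_singleton_iff_inner_right, inner_sub_right,
          inner_smul_right, h.inner_self, mul_one, sub_self]⟩, inner ℝ e z)
      left_inv := fun p => by
        have : (inner ℝ e ((p.1 : E d) + p.2 • e) : ℝ) = p.2 := by
          rw [inner_add_right, inner_smul_right, h.inner_self, hYe, zero_add, mul_one]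
        refine Prod.ext (Subtype.ext ?_) this
        change (p.1 : E d) + p.2 • e - (inner ℝ e ((p.1 : E d) + p.2 • e) : ℝ) • e = p.1
        rw [this, add_sub_cancel_right]
      right_inv := fun z => sub_add_cancel _ _ }
  have hΨ : ∀ p, Ψ p = (p.1 : E d) + p.2 • e := fun p => rfl
  have : (Measure.map Ψ (ν.prod volume)).IsAddHaarMeasure :=
    Ψ.isAddHaarMeasure_map (ν.prod volume)
  -- Lebesgue measure and the product measure are both Haar measures, so they differ by a finite
  -- nonzero factor; its value is irrelevant.
  obtain ⟨c, hc0, hct, hc⟩ : ∃ c : ℝ≥0∞, c ≠ 0 ∧ c ≠ ⊤ ∧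
      (volume : Measure (E d)) = c • Measure.map Ψ (ν.prod volume) :=
    ⟨_, ENNReal.coe_ne_zero.2
      (Measure.addHaarScalarFactor_pos_of_isAddHaarMeasure volume _).ne', ENNReal.coe_ne_top,
      Measure.isAddLeftInvariant_eq_smul (volume : Measure (E d)) (Measure.map Ψ (ν.prod volume))⟩
  -- the graph map
  set G : Y → E d := fun y => (y : E d) + f y • e with hG
  have hGlip : LipschitzWith (1 + L) G := by
    refine LipschitzWith.of_dist_le_mul fun y z => ?_
    rw [hG, dist_eq_norm, Subtype.dist_eq, dist_eq_norm]
    have e1 : (y : E d) + f y • e - ((z : E d) + f z • e) = (y - z : E d) + (f y - f z) • e := by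
      module
    have h2 := h.lipschitz.dist_le_mul y z
    rw [Real.dist_eq, dist_eq_norm] at h2
    rw [e1]
    refine (norm_add_le _ _).trans ?_
    rw [norm_smul, h.norm_eq, mul_one, Real.norm_eq_abs]
    push_cast
    linarith
  have hGm : Measurable G := hGlip.continuous.measurable
  have hheight : ∀ y : Y, h.height (G y) = 0 := fun y => by
    rw [hG, h.height_add_smul, IsLipGraph.height, hYe]
    ring
  have hgraph : MeasurableSet {z | h.height z = 0} :=
    (isClosed_singleton.preimage h.continuous_height).measurableSet
  refine ⟨Measure.map G ν, c, (((1 + L : ℝ≥0) : ℝ≥0∞)) ^ ((d : ℝ) - 1), hc0, hct,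
    ENNReal.rpow_ne_top_of_nonneg hd1 ENNReal.coe_ne_top, ?_, ?_, ?_, ?_⟩
  · intro F hF
    have hm : Measurable fun p : E d × ℝ => F (p.1 - p.2 • e) :=
      hF.comp (measurable_fst.sub (measurable_snd.smul_const e))
    rw [hc, lintegral_smul_measure, smul_eq_mul, lintegral_map hF Ψ.continuous.measurable,
      lintegral_prod (fun p => F (Ψ p)) (hF.comp Ψ.continuous.measurable).aemeasurable,
      lintegral_map hm.lintegral_prod_right' hGm]
    congr 1
    refine lintegral_congr fun y => ?_
    -- The substitution `t = f y - s` turns the coordinate along `e` into the depth below the graph.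
    rw [← lintegral_sub_left_eq_self _ (f y)]
    refine lintegral_congr fun s => ?_
    rw [hΨ, hG]
    congr 1
    module
  · refine Measure.le_iff.2 fun s hs => ?_
    rw [Measure.restrict_apply hs, Measure.smul_apply, Measure.map_apply hGm hs, smul_eq_mul]
    refine le_trans (measure_mono ?_) (hGlip.hausdorffMeasure_image_le hd1 (G ⁻¹' s))
    rintro z ⟨hzs, hz⟩
    have hz' : inner ℝ e z = f z := sub_eq_zero.1 hz
    have hfz : f (z - (inner ℝ e z : ℝ) • e) = f z := by
      rw [sub_eq_add_neg, ← neg_smul, h.const]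
    have hGz : G (Ψ.symm z).1 = z := by
      change z - (inner ℝ e z : ℝ) • e + f (z - (inner ℝ e z : ℝ) • e) • e = z
      rw [hfz, hz', sub_add_cancel]
    exact ⟨(Ψ.symm z).1, by rwa [mem_preimage, hGz], hGz⟩
  · refine Measure.le_iff.2 fun s hs => ?_
    rw [Measure.restrict_apply hs, Measure.map_apply hGm hs]
    have hP : ∀ y : Y, Y.orthogonalProjectionOnto (G y) = y := fun y => by
      rw [hG, map_add, map_smul, Submodule.orthogonalProjectionOnto_mem_subspace_eq_self]
      have : Y.orthogonalProjectionOnto e = 0 := by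
        rw [Submodule.orthogonalProjectionOnto_eq_zero_iff, hY, Submodule.orthogonal_orthogonal]
        exact Submodule.mem_span_singleton_self e
      rw [this, smul_zero, add_zero]
    have := Y.lipschitzWith_orthogonalProjectionOnto.hausdorffMeasure_image_le hd1
      (s ∩ {z | h.height z = 0})
    rw [ENNReal.coe_one, ENNReal.one_rpow, one_mul] at this
    refine le_trans (measure_mono ?_) this
    intro y hy
    exact ⟨G y, ⟨hy, hheight y⟩, hP y⟩
  · intro r
    rw [Measure.map_apply hGm Metric.isClosed_closedBall.measurableSet]
    refine (measure_mono (fun y hy => ?_)).trans_lt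
      (measure_closedBall_lt_top (μ := ν) (x := 0) (r := r))
    rw [mem_preimage, mem_closedBall_zero_iff] at hy
    rw [mem_closedBall_zero_iff]
    -- By Pythagoras, since `y` is orthogonal to `e`; so the preimage of a ball is bounded in the
    -- hyperplane.
    have h1 : ‖(y : E d)‖ ^ 2 ≤ ‖G y‖ ^ 2 := by
      rw [hG, norm_add_sq_real, inner_smul_right, real_inner_comm, hYe]
      nlinarith [sq_nonneg ‖f y • e‖]
    exact (le_of_sq_le_sq h1 (norm_nonneg _)).trans hy

end Graphs

end HeatTransmission

end

/-! ### Trace and boundary layer inequalities -/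

noncomputable section

namespace HeatTransmission

open MeasureTheory Set Filter Topology
open scoped ContDiff ENNReal NNReal

section Layers

variable {d : ℕ}

theorem lintegral_mul_sq_le {α : Type*} {m : MeasurableSpace α} {μ : Measure α} {f g : α → ℝ≥0∞}
    (hf : AEMeasurable f μ) (hg : AEMeasurable g μ) :
    (∫⁻ x, f x * g x ∂μ) ^ 2 ≤ (∫⁻ x, f x ^ 2 ∂μ) * ∫⁻ x, g x ^ 2 ∂μ := by
  have h := ENNReal.lintegral_mul_le_Lp_mul_Lq μ Real.HolderConjugate.two_two hf hg
  simp only [ENNReal.rpow_two, Pi.mul_apply] at h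
  refine (pow_le_pow_left' h 2).trans_eq ?_
  rw [mul_pow, ← ENNReal.rpow_natCast, ← ENNReal.rpow_natCast, ← ENNReal.rpow_mul,
    ← ENNReal.rpow_mul]
  norm_num

theorem lintegral_sq_le {α : Type*} {m : MeasurableSpace α} {μ : Measure α} {f : α → ℝ≥0∞}
    (hf : AEMeasurable f μ) : (∫⁻ x, f x ∂μ) ^ 2 ≤ μ univ * ∫⁻ x, f x ^ 2 ∂μ := by
  have := lintegral_mul_sq_le (aemeasurable_const (b := (1 : ℝ≥0∞))) hf
  simpa using this

theorem add_sq_le_two (a b : ℝ≥0∞) : (a + b) ^ 2 ≤ 2 * a ^ 2 + 2 * b ^ 2 := by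
  by_cases ha : a = ⊤
  · simp [ha]
  by_cases hb : b = ⊤
  · simp [hb]
  lift a to ℝ≥0 using ha
  lift b to ℝ≥0 using hb
  norm_cast
  rw [← NNReal.coe_le_coe]
  push_cast
  nlinarith [sq_nonneg ((a : ℝ) - b)]

theorem enorm_sub_sq_le {g : ℝ → ℂ} (hg : ContDiff ℝ 1 g) {s : ℝ} (hs : 0 ≤ s) :
    ‖g s - g 0‖ₑ ^ 2 ≤ ENNReal.ofReal s * ∫⁻ t in Ioc 0 s, ‖deriv g t‖ₑ ^ 2 := by
  have hc : Continuous (deriv g) := hg.continuous_deriv le_rfl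
  have h1 : g s - g 0 = ∫ t in (0 : ℝ)..s, deriv g t :=
    (intervalIntegral.integral_deriv_eq_sub (fun x _ => hg.differentiable one_ne_zero x)
      (hc.intervalIntegrable _ _)).symm
  rw [h1, intervalIntegral.integral_of_le hs]
  have h2 := lintegral_sq_le (μ := volume.restrict (Ioc 0 s)) (f := fun t => ‖deriv g t‖ₑ)
    hc.enorm.aemeasurable
  rw [Measure.restrict_apply_univ, Real.volume_Ioc, sub_zero] at h2
  exact (pow_le_pow_left' (enorm_integral_le_lintegral_enorm _) 2).trans h2

theorem enorm_sq_le_of_sub {F : Type*} [NormedAddCommGroup F] (a b : F) :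
    ‖a‖ₑ ^ 2 ≤ 2 * ‖b‖ₑ ^ 2 + 2 * ‖a - b‖ₑ ^ 2 := by
  refine le_trans (pow_le_pow_left' ?_ 2) (add_sq_le_two _ _)
  calc ‖a‖ₑ = ‖b + (a - b)‖ₑ := by rw [add_sub_cancel]
    _ ≤ _ := enorm_add_le _ _

variable {e : E d} {f : E d → ℝ} {L : ℝ≥0} {Γ U : Set (E d)}

/-- In the ball `B(x, r)` the set `U` lies below the Lipschitz graph and `Γ` is the graph. -/
structure IsChart (Γ U : Set (E d)) (h : IsLipGraph e f L) (x : E d) (r : ℝ) : Prop where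
  pos : 0 < r
  mem_iff : ∀ y ∈ Metric.ball x r, y ∈ U ↔ h.height y < 0
  mem_bdry_iff : ∀ y ∈ Metric.ball x r, y ∈ Γ ↔ h.height y = 0

/-- The compact set `Γ` is locally a Lipschitz graph, and the open set `U` lies on one side. -/
structure IsSide (Γ U : Set (E d)) : Prop where
  isCompact : IsCompact Γ
  isOpen : IsOpen U
  exists_chart : ∀ x ∈ Γ, ∃ (e : E d) (f : E d → ℝ) (L : ℝ≥0) (h : IsLipGraph e f L) (r : ℝ),
    IsChart Γ U h x r

theorem IsLipGraph.sub_smul_mem_ball (h : IsLipGraph e f L) {x x₀ : E d} {r s δ : ℝ}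
    (hx : x ∈ Metric.closedBall x₀ (r / 2)) (hs : s ∈ Ioc 0 δ) (hδ : δ < r / 2) :
    x - s • e ∈ Metric.ball x₀ r := by
  rw [Metric.mem_closedBall, dist_eq_norm] at hx
  rw [Metric.mem_ball, dist_eq_norm]
  have h1 : x - s • e - x₀ = (x - x₀) - s • e := by abel
  rw [h1]
  have h2 := norm_sub_le (x - x₀) (s • e)
  rw [norm_smul, h.norm_eq, mul_one, Real.norm_of_nonneg hs.1.le] at h2
  linarith [hs.2]

theorem IsChart.sub_smul_mem {h : IsLipGraph e f L} {x x₀ : E d} {r s δ : ℝ}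
    (hc : IsChart Γ U h x₀ r) (h0 : h.height x = 0)
    (hx : x ∈ Metric.closedBall x₀ (r / 2)) (hs : s ∈ Ioc 0 δ) (hδ : δ < r / 2) :
    x - s • e ∈ U := by
  rw [hc.mem_iff _ (h.sub_smul_mem_ball hx hs hδ), h.height_sub_smul, h0]
  linarith [hs.1]

/-- The piece of the graph in the closed ball of radius `r / 2`. -/
def IsLipGraph.piece (h : IsLipGraph e f L) (x₀ : E d) (r : ℝ) : Set (E d) :=
  {z | h.height z = 0} ∩ Metric.closedBall x₀ (r / 2)

theorem IsLipGraph.measurableSet_graph (h : IsLipGraph e f L) :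
    MeasurableSet {z | h.height z = 0} :=
  (isClosed_singleton.preimage h.continuous_height).measurableSet

theorem IsLipGraph.measurableSet_piece (h : IsLipGraph e f L) (x₀ : E d) (r : ℝ) :
    MeasurableSet (h.piece x₀ r) :=
  h.measurableSet_graph.inter Metric.isClosed_closedBall.measurableSet

/-- The segments of length `δ < r / 2` that hang below the piece stay in the chart ball, hence in
`U`, so Fubini counts only part of the integral over `U`. -/
theorem IsChart.lintegral_layer_le {h : IsLipGraph e f L} {x₀ : E d} {r δ : ℝ}
    (hc : IsChart Γ U h x₀ r) (hU : MeasurableSet U) (hδ : δ < r / 2) {σ : Measure (E d)}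
    {c : ℝ≥0∞}
    (hσ : ∀ F : E d → ℝ≥0∞, Measurable F →
      ∫⁻ z, F z = c * ∫⁻ x, (∫⁻ s : ℝ, F (x - s • e)) ∂σ)
    {F : E d → ℝ≥0∞} (hF : Measurable F) :
    c * ∫⁻ x in h.piece x₀ r, (∫⁻ s in Ioc 0 δ, F (x - s • e)) ∂σ ≤ ∫⁻ z in U, F z := by
  rw [← lintegral_indicator hU, hσ _ (hF.indicator hU)]
  refine mul_le_mul_right ?_ c
  refine le_trans ?_ (setLIntegral_le_lintegral (h.piece x₀ r) _)
  refine setLIntegral_mono' (h.measurableSet_piece x₀ r) fun x hx => ?_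
  refine le_trans ?_ (setLIntegral_le_lintegral (Ioc 0 δ) _)
  refine setLIntegral_mono' measurableSet_Ioc fun s hs => ?_
  rw [indicator_of_mem (hc.sub_smul_mem hx.1 hx.2 hs hδ)]

theorem deriv_line {φ : E d → ℂ} (hφ : IsSmoothC φ) (x e : E d) :
    ContDiff ℝ 1 (fun s : ℝ => φ (x - s • e)) ∧
      ∀ s, deriv (fun s : ℝ => φ (x - s • e)) s = -fderiv ℝ φ (x - s • e) e := by
  refine ⟨?_, fun s => ?_⟩
  · exact (hφ.contDiff.of_le (by simp)).comp (contDiff_const.sub (contDiff_id.smul contDiff_const))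
  · have h1 : HasDerivAt (fun s : ℝ => x - s • e) (-((1 : ℝ) • e)) s :=
      ((hasDerivAt_id s).smul_const e).const_sub x
    have := (hφ.differentiable (x - s • e)).hasFDerivAt.comp_hasDerivAt s h1
    rw [one_smul, map_neg] at this
    exact this.deriv

theorem IsLipGraph.enorm_sub_sq_le (h : IsLipGraph e f L) {φ : E d → ℂ} (hφ : IsSmoothC φ)
    (x : E d) {s δ : ℝ} (hs : s ∈ Ioc 0 δ) :
    ‖φ (x - s • e) - φ x‖ₑ ^ 2
      ≤ ENNReal.ofReal δ * ∫⁻ t in Ioc 0 δ, ‖cgrad φ (x - t • e)‖ₑ ^ 2 := by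
  obtain ⟨h1, h2⟩ := deriv_line hφ x e
  have h3 := HeatTransmission.enorm_sub_sq_le h1 hs.1.le
  simp only [zero_smul, sub_zero] at h3
  refine h3.trans ?_
  refine mul_le_mul' (ENNReal.ofReal_le_ofReal hs.2) ?_
  refine (lintegral_mono_set (Ioc_subset_Ioc_right hs.2)).trans ?_
  refine lintegral_mono fun t => ?_
  refine pow_le_pow_left' ?_ 2
  rw [h2, enorm_neg, enorm_le_iff_norm_le]
  have := norm_fderiv_apply_le φ (x - t • e) e
  rwa [h.norm_eq, mul_one] at this

theorem measurable_layer {F : E d → ℝ≥0∞} (hF : Measurable F) (e : E d) (δ : ℝ) :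
    Measurable fun x => ∫⁻ s in Ioc 0 δ, F (x - s • e) :=
  Measurable.lintegral_prod_right' (f := fun p : E d × ℝ => F (p.1 - p.2 • e))
    (hF.comp (measurable_fst.sub (measurable_snd.smul_const e)))

theorem IsSmoothC.measurable_sq {φ : E d → ℂ} (hφ : IsSmoothC φ) :
    Measurable fun x => ‖φ x‖ₑ ^ 2 :=
  (hφ.contDiff.continuous.enorm.measurable).pow_const 2

theorem IsSmoothC.measurable_cgrad_sq {φ : E d → ℂ} (hφ : IsSmoothC φ) :
    Measurable fun x => ‖cgrad φ x‖ₑ ^ 2 :=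
  ((continuous_cgrad hφ.contDiff).enorm.measurable).pow_const 2

/-- The local trace inequality. -/
theorem IsChart.trace_le {h : IsLipGraph e f L} {x₀ : E d} {r : ℝ}
    (hc : IsChart Γ U h x₀ r) (hU : MeasurableSet U) {σ : Measure (E d)} {c : ℝ≥0∞} (hc0 : c ≠ 0)
    (hct : c ≠ ⊤)
    (hσ : ∀ F : E d → ℝ≥0∞, Measurable F →
      ∫⁻ z, F z = c * ∫⁻ x, (∫⁻ s : ℝ, F (x - s • e)) ∂σ) :
    ∃ C : ℝ≥0∞, C ≠ ⊤ ∧ ∀ φ : E d → ℂ, IsSmoothC φ → ∫⁻ x in h.piece x₀ r, ‖φ x‖ₑ ^ 2 ∂σ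
      ≤ C * ((∫⁻ x in U, ‖φ x‖ₑ ^ 2) + ∫⁻ x in U, ‖cgrad φ x‖ₑ ^ 2) := by
  set δ : ℝ := r / 4 with hδ
  have hδ0 : 0 < δ := by have := hc.pos; positivity
  have hδr : δ < r / 2 := by linarith [hc.pos]
  set D := ENNReal.ofReal δ with hD
  have hD0 : D ≠ 0 := (ENNReal.ofReal_pos.2 hδ0).ne'
  have hDt : D ≠ ⊤ := ENNReal.ofReal_ne_top
  refine ⟨c⁻¹ * D⁻¹ * (2 + 2 * D * D), ?_, fun φ hφ => ?_⟩
  · exact ENNReal.mul_ne_top (ENNReal.mul_ne_top (ENNReal.inv_ne_top.2 hc0)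
      (ENNReal.inv_ne_top.2 hD0)) (by finiteness)
  -- The boundary value is compared with the values along the segment `x - s e` and the comparison
  -- is averaged over `0 < s ≤ δ`.
  have key : ∀ x, D * ‖φ x‖ₑ ^ 2 ≤ 2 * (∫⁻ s in Ioc 0 δ, ‖φ (x - s • e)‖ₑ ^ 2)
      + 2 * D * D * ∫⁻ t in Ioc 0 δ, ‖cgrad φ (x - t • e)‖ₑ ^ 2 := by
    intro x
    have e1 : D * ‖φ x‖ₑ ^ 2 = ∫⁻ _ in Ioc 0 δ, ‖φ x‖ₑ ^ 2 := by
      rw [lintegral_const, Measure.restrict_apply_univ, Real.volume_Ioc, sub_zero, mul_comm]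
    rw [e1]
    set I := ∫⁻ t in Ioc 0 δ, ‖cgrad φ (x - t • e)‖ₑ ^ 2 with hI
    calc _ ≤ ∫⁻ s in Ioc 0 δ, (2 * ‖φ (x - s • e)‖ₑ ^ 2 + 2 * (D * I)) := by
          refine setLIntegral_mono' measurableSet_Ioc fun s hs => ?_
          refine (enorm_sq_le_of_sub _ (φ (x - s • e))).trans ?_
          gcongr
          rw [enorm_sub_rev]
          exact h.enorm_sub_sq_le hφ x hs
      _ = _ := by
          rw [lintegral_add_right _ measurable_const, lintegral_const_mul' _ _ (by simp),
            lintegral_const, Measure.restrict_apply_univ, Real.volume_Ioc, sub_zero, ← hD]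
          ring
  have h1 : D * ∫⁻ x in h.piece x₀ r, ‖φ x‖ₑ ^ 2 ∂σ
      ≤ 2 * ∫⁻ x in h.piece x₀ r, (∫⁻ s in Ioc 0 δ, ‖φ (x - s • e)‖ₑ ^ 2) ∂σ
        + 2 * D * D * ∫⁻ x in h.piece x₀ r, (∫⁻ s in Ioc 0 δ, ‖cgrad φ (x - s • e)‖ₑ ^ 2) ∂σ := by
    rw [← lintegral_const_mul' _ _ hDt, ← lintegral_const_mul' _ _ (by simp),
      ← lintegral_const_mul' _ _ (by finiteness),
      ← lintegral_add_right _ ((measurable_layer hφ.measurable_cgrad_sq e δ).const_mul _)]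
    exact lintegral_mono key
  have h2 := hc.lintegral_layer_le hU hδr hσ hφ.measurable_sq
  have h3 := hc.lintegral_layer_le hU hδr hσ hφ.measurable_cgrad_sq
  have h4 : D * (c * ∫⁻ x in h.piece x₀ r, ‖φ x‖ₑ ^ 2 ∂σ) ≤ (2 + 2 * D * D) *
      ((∫⁻ x in U, ‖φ x‖ₑ ^ 2) + ∫⁻ x in U, ‖cgrad φ x‖ₑ ^ 2) := by
    calc _ = c * (D * ∫⁻ x in h.piece x₀ r, ‖φ x‖ₑ ^ 2 ∂σ) := by ring
      _ ≤ c * _ := mul_le_mul_right h1 c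
      _ = 2 * (c * ∫⁻ x in h.piece x₀ r, (∫⁻ s in Ioc 0 δ, ‖φ (x - s • e)‖ₑ ^ 2) ∂σ)
          + 2 * D * D *
            (c * ∫⁻ x in h.piece x₀ r, (∫⁻ s in Ioc 0 δ, ‖cgrad φ (x - s • e)‖ₑ ^ 2) ∂σ) := by ring
      _ ≤ 2 * (∫⁻ x in U, ‖φ x‖ₑ ^ 2) + 2 * D * D * ∫⁻ x in U, ‖cgrad φ x‖ₑ ^ 2 := by gcongr
      _ ≤ (2 + 2 * D * D) * (∫⁻ x in U, ‖φ x‖ₑ ^ 2)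
          + (2 + 2 * D * D) * ∫⁻ x in U, ‖cgrad φ x‖ₑ ^ 2 := by
          gcongr
          · exact le_self_add
          · exact le_add_self
      _ = _ := by ring
  calc ∫⁻ x in h.piece x₀ r, ‖φ x‖ₑ ^ 2 ∂σ
      = c⁻¹ * D⁻¹ * (D * (c * ∫⁻ x in h.piece x₀ r, ‖φ x‖ₑ ^ 2 ∂σ)) := by
        have : c⁻¹ * D⁻¹ * (D * (c * ∫⁻ x in h.piece x₀ r, ‖φ x‖ₑ ^ 2 ∂σ))
          = (c⁻¹ * c) * ((D⁻¹ * D) * ∫⁻ x in h.piece x₀ r, ‖φ x‖ₑ ^ 2 ∂σ) := by ring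
        rw [this, ENNReal.inv_mul_cancel hc0 hct, ENNReal.inv_mul_cancel hD0 hDt, one_mul, one_mul]
    _ ≤ _ := by
        rw [mul_assoc (c⁻¹ * D⁻¹)]
        gcongr

/-- The local boundary layer inequality. -/
theorem IsChart.layer_le {h : IsLipGraph e f L} {x₀ : E d} {r η : ℝ}
    (hc : IsChart Γ U h x₀ r) (hU : MeasurableSet U) (hη : η < r / 4) {σ : Measure (E d)}
    {c : ℝ≥0∞}
    (hσ : ∀ F : E d → ℝ≥0∞, Measurable F →
      ∫⁻ z, F z = c * ∫⁻ x, (∫⁻ s : ℝ, F (x - s • e)) ∂σ)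
    (hσ0 : ∀ᵐ x ∂σ, h.height x = 0) {φ : E d → ℂ} (hφ : IsSmoothC φ) {T : Set (E d)}
    (hT : T ⊆ Metric.ball x₀ (r / 4)) (hT' : ∀ x ∈ T, -η < h.height x ∧ h.height x < 0) :
    ∫⁻ x in T, ‖φ x‖ₑ ^ 2
      ≤ 2 * c * ENNReal.ofReal η * (∫⁻ x in h.piece x₀ r, ‖φ x‖ₑ ^ 2 ∂σ)
        + 2 * ENNReal.ofReal η ^ 2 * ∫⁻ x in U, ‖cgrad φ x‖ₑ ^ 2 := by
  set D := ENNReal.ofReal η with hD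
  set S : Set (E d) := {x | x ∈ Metric.ball x₀ (r / 4) ∧ -η < h.height x ∧ h.height x < 0} with hS
  have hSm : MeasurableSet S :=
    (Metric.isOpen_ball.inter ((isOpen_lt continuous_const h.continuous_height).inter
      (isOpen_lt h.continuous_height continuous_const))).measurableSet
  have hTS : T ⊆ S := fun x hx => ⟨hT hx, hT' x hx⟩
  refine (lintegral_mono_set hTS).trans ?_
  rw [← lintegral_indicator hSm, hσ _ (hφ.measurable_sq.indicator hSm)]
  -- A point of `S` has the form `x - s e` with `x` on the graph and `0 < s < η`. As `η < r / 4`,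
  -- its foot `x` is within `r / 2` of the centre, so it belongs to the piece.
  have key : ∀ᵐ x ∂σ, (∫⁻ s : ℝ, S.indicator (fun x => ‖φ x‖ₑ ^ 2) (x - s • e))
      ≤ (h.piece x₀ r).indicator (fun x => ∫⁻ s in Ioc 0 η, ‖φ (x - s • e)‖ₑ ^ 2) x := by
    filter_upwards [hσ0] with x hx
    by_cases hxp : x ∈ h.piece x₀ r
    · rw [indicator_of_mem hxp, ← lintegral_indicator measurableSet_Ioc]
      refine lintegral_mono fun s => ?_
      by_cases hs : x - s • e ∈ S
      · have h1 := hs.2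
        rw [h.height_sub_smul, hx] at h1
        have h2 : s ∈ Ioc 0 η := ⟨by linarith, by linarith⟩
        simp only [indicator_of_mem hs, indicator_of_mem h2, le_refl]
      · simp only [indicator_of_notMem hs, zero_le]
    · have : ∀ s : ℝ, S.indicator (fun x => ‖φ x‖ₑ ^ 2) (x - s • e) = 0 := by
        intro s
        refine indicator_of_notMem (fun hs => hxp ⟨hx, ?_⟩) _
        have h1 := hs.2
        rw [h.height_sub_smul, hx] at h1
        have h2 := hs.1
        rw [Metric.mem_ball, dist_eq_norm] at h2
        rw [Metric.mem_closedBall, dist_eq_norm]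
        have h3 : x - x₀ = (x - s • e - x₀) + s • e := by abel
        rw [h3]
        have h4 := norm_add_le (x - s • e - x₀) (s • e)
        rw [norm_smul, h.norm_eq, mul_one, Real.norm_of_nonneg (by linarith)] at h4
        linarith
      simp only [this, lintegral_zero, zero_le]
  have key2 : ∀ x, (∫⁻ s in Ioc 0 η, ‖φ (x - s • e)‖ₑ ^ 2) ≤ 2 * D * ‖φ x‖ₑ ^ 2
      + 2 * D ^ 2 * ∫⁻ s in Ioc 0 η, ‖cgrad φ (x - s • e)‖ₑ ^ 2 := by
    intro x
    set I := ∫⁻ t in Ioc 0 η, ‖cgrad φ (x - t • e)‖ₑ ^ 2 with hI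
    calc _ ≤ ∫⁻ s in Ioc 0 η, (2 * ‖φ x‖ₑ ^ 2 + 2 * (D * I)) := by
          refine setLIntegral_mono' measurableSet_Ioc fun s hs => ?_
          refine (enorm_sq_le_of_sub _ (φ x)).trans ?_
          gcongr
          exact h.enorm_sub_sq_le hφ x hs
      _ = _ := by
          rw [lintegral_const, Measure.restrict_apply_univ, Real.volume_Ioc, sub_zero, ← hD]
          ring
  have h3 := hc.lintegral_layer_le hU (by linarith [hc.pos] : η < r / 2) hσ
    hφ.measurable_cgrad_sq
  calc _ ≤ c * ∫⁻ x in h.piece x₀ r, (∫⁻ s in Ioc 0 η, ‖φ (x - s • e)‖ₑ ^ 2) ∂σ := by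
        rw [← lintegral_indicator (h.measurableSet_piece x₀ r)]
        gcongr 1
        exact lintegral_mono_ae key
    _ ≤ c * ∫⁻ x in h.piece x₀ r, (2 * D * ‖φ x‖ₑ ^ 2
      + 2 * D ^ 2 * ∫⁻ s in Ioc 0 η, ‖cgrad φ (x - s • e)‖ₑ ^ 2) ∂σ := by
        gcongr 1
        exact lintegral_mono key2
    _ = 2 * c * D * (∫⁻ x in h.piece x₀ r, ‖φ x‖ₑ ^ 2 ∂σ) + 2 * D ^ 2 *
        (c * ∫⁻ x in h.piece x₀ r, (∫⁻ s in Ioc 0 η, ‖cgrad φ (x - s • e)‖ₑ ^ 2) ∂σ) := by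
        rw [lintegral_add_left (hφ.measurable_sq.const_mul _),
          lintegral_const_mul _ hφ.measurable_sq,
          lintegral_const_mul _ (measurable_layer hφ.measurable_cgrad_sq e η)]
        ring
    _ ≤ _ := by gcongr

end Layers

end HeatTransmission

end

noncomputable section

namespace HeatTransmission

open MeasureTheory Set Filter Topology
open scoped ContDiff ENNReal NNReal

/-! ### From charts to the whole boundary: surface measure, trace and layer inequalities, the two
sides of a Lipschitz domain -/

section GlobalInequalities

variable {d : ℕ} {e : E d} {f : E d → ℝ} {L : ℝ≥0} {Γ U : Set (E d)}

theorem IsChart.piece_subset {h : IsLipGraph e f L} {x : E d} {r : ℝ} (hc : IsChart Γ U h x r) :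
    h.piece x r ⊆ Γ := fun z hz => by
  have := hc.pos
  exact (hc.mem_bdry_iff z (Metric.closedBall_subset_ball (by linarith) hz.2)).2 hz.1

theorem IsChart.inter_ball_subset {h : IsLipGraph e f L} {x : E d} {r : ℝ}
    (hc : IsChart Γ U h x r) : Γ ∩ Metric.ball x (r / 2) ⊆ h.piece x r := fun z hz => by
  have := hc.pos
  exact ⟨(hc.mem_bdry_iff z (Metric.ball_subset_ball (by linarith) hz.2)).1 hz.1,
    Metric.ball_subset_closedBall hz.2⟩

theorem IsLipGraph.piece_inter_graph (h : IsLipGraph e f L) {x : E d} {r : ℝ} :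
    h.piece x r ∩ {z | h.height z = 0} = h.piece x r :=
  inter_eq_left.2 inter_subset_left

theorem IsLipGraph.restrict_piece_le (h : IsLipGraph e f L) {σ μ : Measure (E d)} {K : ℝ≥0∞}
    (hμ : μ.restrict {z | h.height z = 0} ≤ K • σ) (x : E d) (r : ℝ) :
    μ.restrict (h.piece x r) ≤ K • σ.restrict (h.piece x r) := by
  have := Measure.restrict_mono' (μ := μ.restrict {z | h.height z = 0}) (ν := K • σ)
    (s := h.piece x r) (s' := h.piece x r) Filter.EventuallyLE.rfl hμ
  rwa [Measure.restrict_restrict (h.measurableSet_piece x r),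
    h.piece_inter_graph, Measure.restrict_smul] at this

theorem IsLipGraph.restrict_piece_ge (h : IsLipGraph e f L) {σ μ : Measure (E d)}
    (hμ : σ ≤ μ.restrict {z | h.height z = 0}) (x : E d) (r : ℝ) :
    σ.restrict (h.piece x r) ≤ μ.restrict (h.piece x r) := by
  have := Measure.restrict_mono' (μ := σ) (ν := μ.restrict {z | h.height z = 0})
    (s := h.piece x r) (s' := h.piece x r) Filter.EventuallyLE.rfl hμ
  rwa [Measure.restrict_restrict (h.measurableSet_piece x r),
    h.piece_inter_graph] at this

/-- The surface measure of `Γ` is finite. -/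
theorem IsSide.measure_lt_top (hS : IsSide Γ U) (hd : 0 < d) :
    Measure.hausdorffMeasure ((d : ℝ) - 1) Γ < ⊤ := by
  refine hS.isCompact.induction_on (p := fun S => Measure.hausdorffMeasure ((d : ℝ) - 1) S < ⊤)
    (by simp) (fun s t hst ht => (measure_mono hst).trans_lt ht)
    (fun s t hs ht => (measure_union_le s t).trans_lt (ENNReal.add_lt_top.2 ⟨hs, ht⟩)) ?_
  intro x hx
  obtain ⟨e, f, L, h, r, hc⟩ := hS.exists_chart x hx
  obtain ⟨σ, c, K, -, -, hK, -, h1, -, h2⟩ := h.exists_measure hd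
  refine ⟨Γ ∩ Metric.ball x (r / 2),
    inter_mem_nhdsWithin _ (Metric.ball_mem_nhds x (half_pos hc.pos)), ?_⟩
  refine (measure_mono hc.inter_ball_subset).trans_lt ?_
  have h3 := Measure.le_iff'.1 (h.restrict_piece_le h1 x r) univ
  rw [Measure.restrict_apply_univ, Measure.smul_apply, Measure.restrict_apply_univ] at h3
  refine h3.trans_lt (ENNReal.mul_lt_top hK.lt_top ((measure_mono ?_).trans_lt (h2 (‖x‖ + r))))
  intro z hz
  have := hz.2
  rw [Metric.mem_closedBall, dist_eq_norm] at this
  rw [mem_closedBall_zero_iff]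
  have h4 := norm_add_le (z - x) x
  rw [sub_add_cancel] at h4
  linarith [hc.pos]

/-- The trace inequality. -/
theorem IsSide.trace_le (hS : IsSide Γ U) (hd : 0 < d) :
    ∃ C : ℝ≥0∞, C ≠ ⊤ ∧ ∀ φ : E d → ℂ, IsSmoothC φ →
      ∫⁻ x in Γ, ‖φ x‖ₑ ^ 2 ∂(Measure.hausdorffMeasure ((d : ℝ) - 1))
        ≤ C * ((∫⁻ x in U, ‖φ x‖ₑ ^ 2) + ∫⁻ x in U, ‖cgrad φ x‖ₑ ^ 2) := by
  refine hS.isCompact.induction_on (p := fun S => ∃ C : ℝ≥0∞, C ≠ ⊤ ∧ ∀ φ : E d → ℂ,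
    IsSmoothC φ → ∫⁻ x in S, ‖φ x‖ₑ ^ 2 ∂(Measure.hausdorffMeasure ((d : ℝ) - 1))
        ≤ C * ((∫⁻ x in U, ‖φ x‖ₑ ^ 2) + ∫⁻ x in U, ‖cgrad φ x‖ₑ ^ 2)) ?_ ?_ ?_ ?_
  · exact ⟨0, by simp, fun φ _ => by simp⟩
  · rintro s t hst ⟨C, hC, h⟩
    exact ⟨C, hC, fun φ hφ => (lintegral_mono_set hst).trans (h φ hφ)⟩
  · rintro s t ⟨C, hC, h⟩ ⟨C', hC', h'⟩
    refine ⟨C + C', by finiteness, fun φ hφ => (lintegral_union_le _ s t).trans ?_⟩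
    rw [add_mul]
    exact add_le_add (h φ hφ) (h' φ hφ)
  · intro x hx
    obtain ⟨e, f, L, h, r, hc⟩ := hS.exists_chart x hx
    obtain ⟨σ, c, K, hc0, hct, hK, hσ, h1, -, -⟩ := h.exists_measure hd
    obtain ⟨C, hC, hC'⟩ := hc.trace_le hS.isOpen.measurableSet hc0 hct hσ
    refine ⟨Γ ∩ Metric.ball x (r / 2),
      inter_mem_nhdsWithin _ (Metric.ball_mem_nhds x (half_pos hc.pos)), K * C,
      by finiteness, fun φ hφ => ?_⟩
    refine (lintegral_mono_set hc.inter_ball_subset).trans ?_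
    refine (lintegral_mono' (h.restrict_piece_le h1 x r) le_rfl).trans ?_
    rw [lintegral_smul_measure, smul_eq_mul, mul_assoc]
    exact mul_le_mul_right (hC' φ hφ) K

/-- The boundary layer inequality. -/
theorem IsSide.layer_le (hS : IsSide Γ U) (hd : 0 < d) :
    ∃ C : ℝ≥0∞, C ≠ ⊤ ∧ ∃ ε₀ : ℝ, 0 < ε₀ ∧ ∀ φ : E d → ℂ, IsSmoothC φ → ∀ ε, 0 < ε → ε < ε₀ →
      ∫⁻ x in U ∩ Metric.thickening ε Γ, ‖φ x‖ₑ ^ 2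
        ≤ C * (ENNReal.ofReal ε *
            (∫⁻ x in Γ, ‖φ x‖ₑ ^ 2 ∂(Measure.hausdorffMeasure ((d : ℝ) - 1)))
          + ENNReal.ofReal ε ^ 2 * ∫⁻ x in U, ‖cgrad φ x‖ₑ ^ 2) := by
  refine hS.isCompact.induction_on (p := fun S => ∃ C : ℝ≥0∞, C ≠ ⊤ ∧ ∃ ε₀ : ℝ, 0 < ε₀ ∧
    ∀ φ : E d → ℂ, IsSmoothC φ → ∀ ε, 0 < ε → ε < ε₀ →
      ∫⁻ x in U ∩ Metric.thickening ε S, ‖φ x‖ₑ ^ 2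
        ≤ C * (ENNReal.ofReal ε *
            (∫⁻ x in Γ, ‖φ x‖ₑ ^ 2 ∂(Measure.hausdorffMeasure ((d : ℝ) - 1)))
          + ENNReal.ofReal ε ^ 2 * ∫⁻ x in U, ‖cgrad φ x‖ₑ ^ 2)) ?_ ?_ ?_ ?_
  · exact ⟨0, by simp, 1, one_pos, fun φ _ ε _ _ => by simp⟩
  · rintro s t hst ⟨C, hC, ε₀, hε₀, h⟩
    exact ⟨C, hC, ε₀, hε₀, fun φ hφ ε h1 h2 => (lintegral_mono_set (inter_subset_inter_right _
      (Metric.thickening_subset_of_subset ε hst))).trans (h φ hφ ε h1 h2)⟩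
  · rintro s t ⟨C, hC, ε₀, hε₀, h⟩ ⟨C', hC', ε₀', hε₀', h'⟩
    refine ⟨C + C', by finiteness, min ε₀ ε₀', lt_min hε₀ hε₀', fun φ hφ ε h1 h2 => ?_⟩
    rw [Metric.thickening_union, inter_union_distrib_left, add_mul]
    exact (lintegral_union_le _ _ _).trans (add_le_add
      (h φ hφ ε h1 (h2.trans_le (min_le_left _ _))) (h' φ hφ ε h1 (h2.trans_le (min_le_right _ _))))
  · intro x hx
    obtain ⟨e, f, L, h, r, hc⟩ := hS.exists_chart x hx
    obtain ⟨σ, c, K, hc0, hct, hK, hσ, -, h1, -⟩ := h.exists_measure hd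
    have hr := hc.pos
    have hσ0 : ∀ᵐ z ∂σ, h.height z = 0 :=
      (Measure.absolutelyContinuous_of_le h1).ae_le (ae_restrict_mem h.measurableSet_graph)
    set M : ℝ≥0∞ := ((1 + L : ℝ≥0) : ℝ≥0∞) with hM
    -- The height is `(1 + L)`-Lipschitz and vanishes on `Γ`, so points of `U` within `ε` of this
    -- set have depth less than `(1 + L) ε`. The bound on `ε` keeps this depth below `r / 8`, inside
    -- the range of the local inequality.
    refine ⟨Γ ∩ Metric.ball x (r / 8),
      inter_mem_nhdsWithin _ (Metric.ball_mem_nhds x (by positivity)),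
      2 * c * M + 2 * M ^ 2, by finiteness, r / 8 / (1 + L), by positivity,
      fun φ hφ ε hε0 hε => ?_⟩
    have hL : (1 : ℝ) ≤ 1 + L := by linarith [L.2]
    rw [lt_div_iff₀ (by positivity)] at hε
    have hε' : ε < r / 8 := by nlinarith
    have e1 : ENNReal.ofReal ((1 + L) * ε) = M * ENNReal.ofReal ε := by
      rw [ENNReal.ofReal_mul (by positivity), hM]
      congr 1
      exact ENNReal.ofReal_coe_nnreal (p := 1 + L)
    have h2 := hc.layer_le (T := U ∩ Metric.thickening ε (Γ ∩ Metric.ball x (r / 8)))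
      hS.isOpen.measurableSet (by linarith : (1 + L) * ε < r / 4) hσ hσ0 hφ ?_ ?_
    · refine h2.trans ?_
      have h3 : ∫⁻ z in h.piece x r, ‖φ z‖ₑ ^ 2 ∂σ
          ≤ ∫⁻ z in Γ, ‖φ z‖ₑ ^ 2 ∂(Measure.hausdorffMeasure ((d : ℝ) - 1)) :=
        (lintegral_mono' (h.restrict_piece_ge h1 x r) le_rfl).trans
          (lintegral_mono_set hc.piece_subset)
      rw [e1]
      calc _ ≤ 2 * c * (M * ENNReal.ofReal ε) *
            (∫⁻ z in Γ, ‖φ z‖ₑ ^ 2 ∂(Measure.hausdorffMeasure ((d : ℝ) - 1)))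
            + 2 * (M * ENNReal.ofReal ε) ^ 2 * ∫⁻ x in U, ‖cgrad φ x‖ₑ ^ 2 := by gcongr
        _ = 2 * c * M * (ENNReal.ofReal ε *
              ∫⁻ z in Γ, ‖φ z‖ₑ ^ 2 ∂(Measure.hausdorffMeasure ((d : ℝ) - 1)))
            + 2 * M ^ 2 * (ENNReal.ofReal ε ^ 2 * ∫⁻ x in U, ‖cgrad φ x‖ₑ ^ 2) := by ring
        _ ≤ (2 * c * M + 2 * M ^ 2) * (ENNReal.ofReal ε *
              ∫⁻ z in Γ, ‖φ z‖ₑ ^ 2 ∂(Measure.hausdorffMeasure ((d : ℝ) - 1)))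
            + (2 * c * M + 2 * M ^ 2) *
              (ENNReal.ofReal ε ^ 2 * ∫⁻ x in U, ‖cgrad φ x‖ₑ ^ 2) := by
            gcongr
            · exact le_self_add
            · exact le_add_self
        _ = _ := by ring
    · rintro z ⟨-, hz⟩
      obtain ⟨y, hy, hzy⟩ := Metric.mem_thickening_iff.1 hz
      have := hy.2
      rw [Metric.mem_ball] at this ⊢
      linarith [dist_triangle z y x]
    · rintro z ⟨hzU, hz⟩
      obtain ⟨y, hy, hzy⟩ := Metric.mem_thickening_iff.1 hz
      have hyx := hy.2
      rw [Metric.mem_ball] at hyx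
      have hyr : y ∈ Metric.ball x r := by rw [Metric.mem_ball]; linarith
      have hzr : z ∈ Metric.ball x r := by rw [Metric.mem_ball]; linarith [dist_triangle z y x]
      have h3 := h.abs_height_sub_le z y
      rw [(hc.mem_bdry_iff y hyr).1 hy.1, sub_zero] at h3
      rw [dist_eq_norm] at hzy
      have h4 : (1 + (L : ℝ)) * ‖z - y‖ < (1 + L) * ε := by gcongr
      exact ⟨by linarith [neg_abs_le (h.height z)], (hc.mem_iff z hzr).1 hzU⟩

theorem IsBoundedLipschitz.isCompact_frontier {Ω : Set (E d)} (hΩ : IsBoundedLipschitz Ω) :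
    IsCompact (frontier Ω) :=
  Metric.isCompact_of_isClosed_isBounded isClosed_frontier
    (hΩ.isBounded.closure.subset frontier_subset_closure)

/-- The definition describes `Ω` only. Moving a point down along `e` shows that in the ball the
closure is `height ≤ 0`; the frontier and the exterior are then `height = 0` and `height > 0`. -/
theorem IsBoundedLipschitz.exists_chart {Ω : Set (E d)} (hΩ : IsBoundedLipschitz Ω) {x : E d}
    (hx : x ∈ frontier Ω) : ∃ (e : E d) (f : E d → ℝ) (L : ℝ≥0) (h : IsLipGraph e f L) (r : ℝ),
      IsChart (frontier Ω) Ω h x r ∧ ∀ y ∈ Metric.ball x r, y ∈ exterior Ω ↔ 0 < h.height y := by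
  obtain ⟨e, f, L, r, h1, h2, h3, hr, h4⟩ := hΩ.lipschitz x hx
  have h : IsLipGraph e f L := ⟨h1, h2, h3⟩
  have hO : ∀ y ∈ Metric.ball x r, y ∈ Ω ↔ h.height y < 0 := fun y hy => by
    rw [h4 y hy, IsLipGraph.height, sub_neg]
  have hcl : ∀ y ∈ Metric.ball x r, y ∈ closure Ω ↔ h.height y ≤ 0 := by
    intro y hy
    constructor
    · intro hyc
      by_contra hlt
      rw [not_le] at hlt
      have : Metric.ball x r ∩ {z | 0 < h.height z} ∈ 𝓝 y :=
        inter_mem (Metric.isOpen_ball.mem_nhds hy)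
          ((isOpen_lt continuous_const h.continuous_height).mem_nhds hlt)
      obtain ⟨z, ⟨hz1, hz2⟩, hz3⟩ := mem_closure_iff_nhds.1 hyc _ this
      have hz2 : 0 < h.height z := hz2
      linarith [(hO z hz1).1 hz3]
    · intro hyh
      have hlim : Tendsto (fun t : ℝ => y - t • e) (𝓝[>] 0) (𝓝 y) := by
        have : Tendsto (fun t : ℝ => y - t • e) (𝓝 0) (𝓝 (y - (0 : ℝ) • e)) :=
          (by fun_prop : Continuous fun t : ℝ => y - t • e).tendsto 0
        rw [zero_smul, sub_zero] at this
        exact this.mono_left nhdsWithin_le_nhds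
      refine mem_closure_of_tendsto hlim ?_
      filter_upwards [hlim.eventually (Metric.isOpen_ball.mem_nhds hy),
        eventually_mem_nhdsWithin] with t ht1 ht2
      have ht2 : 0 < t := ht2
      rw [hO _ ht1, h.height_sub_smul]
      linarith
  refine ⟨e, f, L, h, r, ⟨hr, hO, fun y hy => ?_⟩, fun y hy => ?_⟩
  · rw [hΩ.isOpen.frontier_eq, Set.mem_sdiff, hcl y hy, hO y hy, not_lt]
    exact ⟨fun h => le_antisymm h.1 h.2, fun h => ⟨h.le, h.ge⟩⟩
  · rw [exterior, mem_compl_iff, hcl y hy, not_le]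

theorem IsBoundedLipschitz.isSide {Ω : Set (E d)} (hΩ : IsBoundedLipschitz Ω) :
    IsSide (frontier Ω) Ω := by
  refine ⟨hΩ.isCompact_frontier, hΩ.isOpen, fun x hx => ?_⟩
  obtain ⟨e, f, L, h, r, hc, -⟩ := hΩ.exists_chart hx
  exact ⟨e, f, L, h, r, hc⟩

/-- Replacing `(e, f)` by `(-e, -f)` changes the sign of the height, so the exterior lies below a
graph too and every one-sided estimate serves both sides. -/
theorem IsBoundedLipschitz.isSide_exterior {Ω : Set (E d)} (hΩ : IsBoundedLipschitz Ω) :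
    IsSide (frontier Ω) (exterior Ω) := by
  refine ⟨hΩ.isCompact_frontier, isClosed_closure.isOpen_compl, fun x hx => ?_⟩
  obtain ⟨e, f, L, h, r, hc, hext⟩ := hΩ.exists_chart hx
  have hneg : ∀ y, h.neg.height y = -h.height y := fun y => by
    unfold IsLipGraph.height
    rw [inner_neg_left]
    ring
  refine ⟨-e, _, L, h.neg, r, hc.pos, fun y hy => ?_, fun y hy => ?_⟩
  · rw [hext y hy, hneg, neg_lt_zero]
  · rw [hc.mem_bdry_iff y hy, hneg, neg_eq_zero]

theorem offGamma_diff {Ω : Set (E d)} (hΩ : IsOpen Ω) : offGamma Ω \ Ω = exterior Ω := by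
  ext x
  rw [Set.mem_sdiff, offGamma, mem_compl_iff, hΩ.frontier_eq, Set.mem_sdiff, exterior, mem_compl_iff]
  have : x ∈ Ω → x ∈ closure Ω := fun h => subset_closure h
  tauto

theorem IsBoundedLipschitz.isClopenIn {Ω : Set (E d)} (hΩ : IsBoundedLipschitz Ω) :
    IsClopenIn (offGamma Ω) Ω := by
  refine ⟨hΩ.isOpen, fun x hx hxf => ?_, ?_⟩
  · rw [hΩ.isOpen.frontier_eq] at hxf
    exact hxf.2 hx
  · rw [offGamma_diff hΩ.isOpen]
    exact isClosed_closure.isOpen_compl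

theorem IsBoundedLipschitz.isClopenIn_exterior {Ω : Set (E d)} (hΩ : IsBoundedLipschitz Ω) :
    IsClopenIn (offGamma Ω) (exterior Ω) := by
  have := hΩ.isClopenIn.diff
  rwa [offGamma_diff hΩ.isOpen] at this

theorem isClopenIn_self {O : Set (E d)} (hO : IsOpen O) : IsClopenIn O O :=
  ⟨hO, Subset.rfl, by rw [sdiff_self]; exact isOpen_empty⟩

end GlobalInequalities

end HeatTransmission

end

/-! ### Mollification -/

noncomputable section

namespace HeatTransmission

open MeasureTheory Set Filter Topology
open scoped ContDiff ENNReal NNReal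

section Mollification

variable {d : ℕ} {F : Type*} [NormedAddCommGroup F]

/-- Translations are continuous in `L²`. -/
theorem exists_translate_le {G : E d → F} (hG : MemLp G 2 volume) {δ : ℝ≥0∞} (hδ : 0 < δ) :
    ∃ η : ℝ, 0 < η ∧ ∀ z : E d, ‖z‖ < η → ∫⁻ y, ‖G (y - z) - G y‖ₑ ^ 2 ≤ δ := by
  let g : E d → C(E d, E d) := fun z => ⟨fun y => y - z, by fun_prop⟩
  have hg : Continuous g := ContinuousMap.continuous_of_continuous_uncurry _ (by
    change Continuous fun p : E d × E d => p.2 - p.1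
    fun_prop)
  have hgm : ∀ z, MeasurePreserving (g z) (volume : Measure (E d)) volume := fun z =>
    measurePreserving_sub_right _ z
  have hc : Continuous fun z => Lp.compMeasurePreserving (g z) (hgm z) (hG.toLp G) :=
    Continuous.compMeasurePreservingLp continuous_const hg hgm (by simp)
  have h2 : Tendsto (fun z => ‖Lp.compMeasurePreserving (g z) (hgm z) (hG.toLp G)
      - Lp.compMeasurePreserving (g 0) (hgm 0) (hG.toLp G)‖ₑ ^ 2) (𝓝 0) (𝓝 0) := by
    have h3 : Continuous fun z => ‖Lp.compMeasurePreserving (g z) (hgm z) (hG.toLp G)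
      - Lp.compMeasurePreserving (g 0) (hgm 0) (hG.toLp G)‖ₑ ^ 2 :=
      (ENNReal.continuous_pow 2).comp (hc.sub continuous_const).enorm
    convert! h3.tendsto 0
    simp
  obtain ⟨η, hη, h⟩ := Metric.eventually_nhds_iff.1 (h2.eventually_lt_const hδ)
  refine ⟨η, hη, fun z hz => ?_⟩
  refine le_trans (le_of_eq ?_) (h (y := z) (by simpa using hz)).le
  rw [enorm_sq_Lp]
  refine lintegral_congr_ae ?_
  filter_upwards [Lp.coeFn_sub (Lp.compMeasurePreserving (g z) (hgm z) (hG.toLp G))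
      (Lp.compMeasurePreserving (g 0) (hgm 0) (hG.toLp G)),
    Lp.coeFn_compMeasurePreserving (hG.toLp G) (hgm z),
    Lp.coeFn_compMeasurePreserving (hG.toLp G) (hgm 0), hG.coeFn_toLp,
    (hgm z).quasiMeasurePreserving.ae hG.coeFn_toLp] with y h1 h2 h3 h4 h5
  rw [h1, Pi.sub_apply, h2, h3]
  simp only [Function.comp_apply]
  rw [h5]
  have : g 0 y = y := sub_zero y
  rw [this, h4]
  rfl

/-- Smooth probability densities supported in `closedBall q ρ`. -/
structure IsKernel (k : E d → ℝ) (q : E d) (ρ : ℝ) : Prop where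
  contDiff : ContDiff ℝ ∞ k
  nonneg : ∀ x, 0 ≤ k x
  integral_eq : ∫ x, k x = 1
  tsupport_subset : tsupport k ⊆ Metric.closedBall q ρ

theorem exists_isKernel (q : E d) {ρ : ℝ} (hρ : 0 < ρ) : ∃ k, IsKernel k q ρ := by
  let b : ContDiffBump q := ⟨ρ / 2, ρ, by positivity, by linarith⟩
  exact ⟨b.normed volume, b.contDiff_normed, b.nonneg_normed, b.integral_normed,
    b.tsupport_normed_eq.le⟩

theorem IsKernel.hasCompactSupport {k : E d → ℝ} {q : E d} {ρ : ℝ} (h : IsKernel k q ρ) :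
    HasCompactSupport k :=
  (isCompact_closedBall q ρ).of_isClosed_subset (isClosed_tsupport k) h.tsupport_subset

variable [NormedSpace ℝ F]

/-- The convolution of `G` with `k`. -/
def moll (k : E d → ℝ) (G : E d → F) : E d → F :=
  convolution k G (ContinuousLinearMap.lsmul ℝ ℝ) volume

theorem moll_apply (k : E d → ℝ) (G : E d → F) (y : E d) :
    moll k G y = ∫ z, k z • G (y - z) := rfl

theorem moll_apply' (k : E d → ℝ) (G : E d → F) (y : E d) :
    moll k G y = ∫ z, k (y - z) • G z := convolution_eq_swap _

theorem IsKernel.integrable_smul {k : E d → ℝ} {q : E d} {ρ : ℝ} (h : IsKernel k q ρ)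
    {G : E d → F} (hG : LocallyIntegrable G) (y : E d) :
    Integrable fun z => k z • G (y - z) :=
  h.hasCompactSupport.convolutionExists_left (ContinuousLinearMap.lsmul ℝ ℝ)
    h.contDiff.continuous hG y

theorem IsKernel.isProbabilityMeasure {k : E d → ℝ} {q : E d} {ρ : ℝ} (h : IsKernel k q ρ) :
    IsProbabilityMeasure ((volume : Measure (E d)).withDensity fun z => ENNReal.ofReal (k z)) := by
  refine ⟨?_⟩
  rw [withDensity_apply _ MeasurableSet.univ, Measure.restrict_univ,
    ← ofReal_integral_eq_lintegral_ofReal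
      (h.contDiff.continuous.integrable_of_hasCompactSupport h.hasCompactSupport)
      (Eventually.of_forall h.nonneg), h.integral_eq, ENNReal.ofReal_one]

/-- Jensen's inequality for the probability measure with density `k`. -/
theorem IsKernel.enorm_moll_sub_sq_le [CompleteSpace F] {k : E d → ℝ} {q : E d} {ρ : ℝ}
    (h : IsKernel k q ρ) {G : E d → F} (hG : StronglyMeasurable G) (hl : LocallyIntegrable G)
    (y : E d) :
    ‖moll k G y - G y‖ₑ ^ 2 ≤ ∫⁻ z, ‖G (y - z) - G y‖ₑ ^ 2
      ∂((volume : Measure (E d)).withDensity fun z => ENNReal.ofReal (k z)) := by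
  have hp := h.isProbabilityMeasure
  have hm : Measurable fun z => ‖G (y - z) - G y‖ₑ :=
    ((hG.comp_measurable (measurable_const.sub measurable_id)).sub stronglyMeasurable_const).enorm
  have h1 : moll k G y - G y = ∫ z, k z • (G (y - z) - G y) := by
    simp only [smul_sub]
    rw [integral_sub (h.integrable_smul hl y)
      ((h.contDiff.continuous.integrable_of_hasCompactSupport h.hasCompactSupport).smul_const _),
      integral_smul_const, h.integral_eq, one_smul, moll_apply]
  have h2 : ‖moll k G y - G y‖ₑ ≤ ∫⁻ z, ‖G (y - z) - G y‖ₑ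
      ∂((volume : Measure (E d)).withDensity fun z => ENNReal.ofReal (k z)) := by
    rw [h1, lintegral_withDensity_eq_lintegral_mul _
      h.contDiff.continuous.measurable.ennreal_ofReal hm]
    refine (enorm_integral_le_lintegral_enorm _).trans (lintegral_mono fun z => ?_)
    rw [enorm_smul, Real.enorm_of_nonneg (h.nonneg z)]
    rfl
  refine (pow_le_pow_left₀ zero_le h2 2).trans ?_
  refine (lintegral_sq_le hm.aemeasurable).trans ?_
  rw [measure_univ, one_mul]

/-- After exchanging integrals, only the `L²` modulus of continuity under translations in the
support of `k` remains. Kernels with off-centre support are thus as good as centred ones, as long as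
the support is close to `0`. -/
theorem IsKernel.lintegral_moll_sub_sq_le [CompleteSpace F] {k : E d → ℝ} {q : E d} {ρ η : ℝ}
    (h : IsKernel k q ρ) {G : E d → F} (hG : StronglyMeasurable G) (hG2 : MemLp G 2 volume)
    {δ : ℝ≥0∞} (hη : ∀ z : E d, ‖z‖ < η → ∫⁻ y, ‖G (y - z) - G y‖ₑ ^ 2 ≤ δ)
    (hq : ‖q‖ + ρ < η) : ∫⁻ y, ‖moll k G y - G y‖ₑ ^ 2 ≤ δ := by
  have hp := h.isProbabilityMeasure
  refine (lintegral_mono fun y =>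
    h.enorm_moll_sub_sq_le hG (hG2.locallyIntegrable (by norm_num)) y).trans ?_
  have hm : Measurable (Function.uncurry fun (y z : E d) => ‖G (y - z) - G y‖ₑ ^ 2) :=
    (((hG.comp_measurable (measurable_fst.sub measurable_snd)).sub
      (hG.comp_measurable measurable_fst)).enorm).pow_const 2
  rw [lintegral_lintegral_swap hm.aemeasurable]
  have h0 : ∀ᵐ z ∂((volume : Measure (E d)).withDensity fun z => ENNReal.ofReal (k z)),
      ∫⁻ y, ‖G (y - z) - G y‖ₑ ^ 2 ≤ δ := by
    rw [ae_withDensity_iff h.contDiff.continuous.measurable.ennreal_ofReal]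
    refine Eventually.of_forall fun z hz => hη z ?_
    have : z ∈ tsupport k := subset_tsupport _ fun h0 => hz (by simp [h0])
    have := mem_closedBall_iff_norm.1 (h.tsupport_subset this)
    linarith [norm_le_norm_add_norm_sub' z q]
  refine (lintegral_mono_ae h0).trans ?_
  rw [lintegral_const, measure_univ, mul_one]

/-- Convolution with a smooth kernel gives smooth compactly supported functions. -/
theorem IsKernel.isSmoothC_moll {k : E d → ℝ} {q : E d} {ρ : ℝ} (h : IsKernel k q ρ)
    {G : E d → ℂ} (hl : LocallyIntegrable G) (hc : HasCompactSupport G) :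
    IsSmoothC (moll k G) :=
  ⟨h.hasCompactSupport.contDiff_convolution_left _ h.contDiff hl,
    HasCompactSupport.convolution _ h.hasCompactSupport hc⟩

theorem IsKernel.tsupport_comp_sub {k : E d → ℝ} {q : E d} {ρ : ℝ} (h : IsKernel k q ρ) (y : E d) :
    tsupport (fun z => k (y - z)) ⊆ Metric.closedBall (y - q) ρ := by
  refine closure_minimal (fun z hz => ?_) Metric.isClosed_closedBall
  have := mem_closedBall_iff_norm.1 (h.tsupport_subset (subset_tsupport _ hz))
  rw [mem_closedBall_iff_norm, ← norm_neg]
  convert! this using 2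
  abel

theorem IsKernel.isTest_comp_sub {k : E d → ℝ} {q : E d} {ρ : ℝ} (h : IsKernel k q ρ) {O : Set (E d)}
    {y : E d} (hy : Metric.closedBall (y - q) ρ ⊆ O) : IsTest O fun z => k (y - z) :=
  ⟨h.contDiff.comp (contDiff_const.sub contDiff_id),
    (isCompact_closedBall (y - q) ρ).of_isClosed_subset (isClosed_tsupport _)
      (h.tsupport_comp_sub y), (h.tsupport_comp_sub y).trans hy⟩

theorem IsKernel.pderiv_comp_sub {k : E d → ℝ} {q : E d} {ρ : ℝ} (h : IsKernel k q ρ) (y z : E d)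
    (i : Fin d) : pderiv i (fun z => k (y - z)) z = -pderiv i k (y - z) := by
  unfold pderiv
  have h1 : HasFDerivAt k (fderiv ℝ k (y - z)) (y - z) :=
    ((h.contDiff.differentiable (by simp)) _).hasFDerivAt
  have h2 := h1.comp z ((hasFDerivAt_id z).const_sub y)
  have h3 : fderiv ℝ (fun z => k (y - z)) z = _ := h2.fderiv
  rw [h3]
  simp

theorem IsKernel.fderiv_moll {k : E d → ℝ} {q : E d} {ρ : ℝ} (h : IsKernel k q ρ)
    {G : E d → ℂ} (hG : LocallyIntegrable G) (y v : E d) :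
    fderiv ℝ (moll k G) y v = ∫ z, fderiv ℝ k z v • G (y - z) := by
  let L : (E d →L[ℝ] ℝ) →L[ℝ] ℂ →L[ℝ] (E d →L[ℝ] ℂ) :=
    (ContinuousLinearMap.lsmul ℝ ℝ : ℝ →L[ℝ] ℂ →L[ℝ] ℂ).precompL (E d)
  have h1 : fderiv ℝ (moll k G) y = ∫ t, L (fderiv ℝ k t) (G (y - t)) :=
    (h.hasCompactSupport.hasFDerivAt_convolution_left (𝕜 := ℝ) (μ := volume)
      (ContinuousLinearMap.lsmul ℝ ℝ) (h.contDiff.of_le (by simp)) hG y).fderiv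
  have h2 : Integrable fun t => L (fderiv ℝ k t) (G (y - t)) :=
    (h.hasCompactSupport.fderiv ℝ).convolutionExists_left L
        (h.contDiff.continuous_fderiv (by simp)) hG y
  rw [h1, ContinuousLinearMap.integral_apply h2]
  rfl

/-- The gradient of a mollification is the mollification of the weak gradient. -/
theorem IsKernel.cgrad_moll {k : E d → ℝ} {q : E d} {ρ : ℝ} (h : IsKernel k q ρ)
    {G : E d → ℂ} {P : E d → EuclideanSpace ℂ (Fin d)} (hG : LocallyIntegrable G)
    (hP : LocallyIntegrable P) {y : E d}
    (hy : ∀ i, ∫ z, pderiv i (fun z => k (y - z)) z • G z = -∫ z, k (y - z) • P z i) :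
    cgrad (moll k G) y = moll k P y := by
  ext i
  have h2 : cgrad (moll k G) y i = ∫ z, pderiv i k z • G (y - z) := h.fderiv_moll hG y _
  have h3 : moll k P y i = ∫ z, k (y - z) • P z i := by
    have h4 : Integrable fun z => k (y - z) • P z := by
      have := (h.integrable_smul hP y).comp_sub_left y
      simpa using this
    have := (EuclideanSpace.proj (𝕜 := ℂ) i :
      EuclideanSpace ℂ (Fin d) →L[ℂ] ℂ).restrictScalars ℝ |>.integral_comp_comm h4
    rw [moll_apply']
    exact this.symm
  rw [h2, h3, ← neg_inj, ← hy i]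
  rw [← integral_sub_left_eq_self _ _ y, ← integral_neg]
  refine integral_congr_ae (Eventually.of_forall fun z => ?_)
  simp only [h.pderiv_comp_sub, sub_sub_cancel, neg_smul]

end Mollification

end HeatTransmission

end

/-! ### Density of smooth functions -/

noncomputable section

namespace HeatTransmission

open MeasureTheory Set Filter Topology
open scoped ContDiff ENNReal NNReal

section Density

variable {d : ℕ} {O U Γ K : Set (E d)} {e : E d} {f : E d → ℝ} {L : ℝ≥0}

/-- The elements of `H¹(O)` which agree on `U` with a smooth compactly supported function. -/
def smoothSub (O U : Set (E d)) : Submodule ℂ (H1 O) where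
  carrier := {u | ∃ φ, IsSmoothC φ ∧ ∀ᵐ x ∂volume.restrict O, x ∈ U → fnOf u x = φ x}
  zero_mem' := by
    refine ⟨0, ⟨contDiff_const, HasCompactSupport.zero⟩, ?_⟩
    filter_upwards [Lp.coeFn_zero ℂ 2 (volume.restrict O)] with x hx _
    rw [map_zero, hx]
  add_mem' := by
    rintro u v ⟨φ, h1, h2⟩ ⟨ψ, k1, k2⟩
    refine ⟨φ + ψ, ⟨h1.1.add k1.1, h1.2.add k1.2⟩, ?_⟩
    filter_upwards [fnOf_add_ae u v, h2, k2] with x hx h k hU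
    rw [hx, h hU, k hU, Pi.add_apply]
  smul_mem' := by
    rintro c u ⟨φ, h1, h2⟩
    refine ⟨c • φ, ⟨contDiff_const.smul h1.1, h1.2.smul_left (f := fun _ => c)⟩, ?_⟩
    filter_upwards [fnOf_smul_ae c u, h2] with x hx h hU
    rw [hx, h hU, Pi.smul_apply]

/-- `u` vanishes almost everywhere outside `K`. -/
def IsSupportedIn (u : H1 O) (K : Set (E d)) : Prop :=
  ∀ᵐ x ∂volume.restrict O, x ∉ K → fnOf u x = 0

theorem IsSupportedIn.gradOf_eq_zero (hO : IsOpen O) (hK : IsClosed K) {u : H1 O}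
    (h : IsSupportedIn u K) : ∀ᵐ x ∂volume.restrict O, x ∉ K → gradOf u x = 0 := by
  have h0 : IsSmoothC (0 : E d → ℂ) := ⟨contDiff_const, HasCompactSupport.zero⟩
  have := gradOf_ae_eq_cgrad (hO.sdiff hK) sdiff_subset h0 (u := u)
    (by filter_upwards [h] with x hx hxU using hx hxU.2)
  filter_upwards [this, self_mem_ae_restrict hO.measurableSet] with x hx hxO hxK
  rw [hx ⟨hxO, hxK⟩]
  ext i
  change fderiv ℝ (fun _ => (0 : ℂ)) x _ = 0
  simp

theorem integral_smul_indicator {F : Type*} [NormedAddCommGroup F] [NormedSpace ℝ F]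
    (hO : MeasurableSet O) {φ : E d → ℝ} {u : E d → F}
    (hK : ∀ᵐ x ∂volume.restrict O, x ∉ K → u x = 0) :
    ∫ x, φ x • (O ∩ K).indicator u x = ∫ x in O, φ x • u x := by
  rw [← integral_indicator hO]
  refine integral_congr_ae ?_
  filter_upwards [(ae_restrict_iff' hO).1 hK] with x hx
  by_cases hxO : x ∈ O
  · rw [indicator_of_mem hxO]
    by_cases hxK : x ∈ K
    · rw [indicator_of_mem (show x ∈ O ∩ K from ⟨hxO, hxK⟩)]
    · rw [indicator_of_notMem (fun hh => hxK hh.2), hx hxO hxK]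
  · rw [indicator_of_notMem hxO, indicator_of_notMem (fun hh => hxO hh.1), smul_zero]

/-- Mollification approximates in `H¹` on the side `U`, provided that the kernel does not reach
across the boundary of `O`. -/
theorem exists_moll_approx (hU : IsClopenIn O U) (hK : IsCompact K) {u : H1 O}
    (hu : IsSupportedIn u K) {ε : ℝ} (hε : 0 < ε) :
    ∃ η : ℝ, 0 < η ∧ ∀ (k : E d → ℝ) (q : E d) (ρ : ℝ), IsKernel k q ρ → ‖q‖ + ρ < η →
      (∀ y ∈ U, (Metric.closedBall (y - q) ρ ∩ K).Nonempty → Metric.closedBall (y - q) ρ ⊆ O) →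
      IsSmoothC (moll k ((O ∩ K).indicator (fnOf u))) ∧
      ∃ a : H1 O, fnOf a =ᵐ[volume.restrict O] moll k ((O ∩ K).indicator (fnOf u)) ∧
        ‖cutL hU (a - u)‖ < ε := by
  have hO := hU.isOpen_right
  have hg := hu.gradOf_eq_zero hO hK.isClosed
  have hOK : MeasurableSet (O ∩ K) := hO.measurableSet.inter hK.measurableSet
  set G : E d → ℂ := (O ∩ K).indicator (fnOf u) with hGdef
  set P : E d → EuclideanSpace ℂ (Fin d) := (O ∩ K).indicator (gradOf u) with hPdef
  have hGm : StronglyMeasurable G := (Lp.stronglyMeasurable (fnOf u)).indicator hOK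
  have hPm : StronglyMeasurable P := (Lp.stronglyMeasurable (gradOf u)).indicator hOK
  have hG2 : MemLp G 2 volume := (memLp_indicator_iff_restrict hOK).2
    ((Lp.memLp (fnOf u)).mono_measure (Measure.restrict_mono inter_subset_left le_rfl))
  have hP2 : MemLp P 2 volume := (memLp_indicator_iff_restrict hOK).2
    ((Lp.memLp (gradOf u)).mono_measure (Measure.restrict_mono inter_subset_left le_rfl))
  have hGl : LocallyIntegrable G := hG2.locallyIntegrable (by norm_num)
  have hPl : LocallyIntegrable P := hP2.locallyIntegrable (by norm_num)
  have hGc : HasCompactSupport G := HasCompactSupport.intro hK fun x hx =>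
    indicator_of_notMem (fun hh => hx hh.2) _
  have hGu : ∀ᵐ x ∂volume.restrict O, fnOf u x = G x := by
    filter_upwards [hu, self_mem_ae_restrict hO.measurableSet] with x hx hxO
    by_cases hxK : x ∈ K
    · rw [hGdef, indicator_of_mem (show x ∈ O ∩ K from ⟨hxO, hxK⟩)]
    · rw [hx hxK, hGdef, indicator_of_notMem (fun hh => hxK hh.2)]
  have hPu : ∀ᵐ x ∂volume.restrict O, gradOf u x = P x := by
    filter_upwards [hg, self_mem_ae_restrict hO.measurableSet] with x hx hxO
    by_cases hxK : x ∈ K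
    · rw [hPdef, indicator_of_mem (show x ∈ O ∩ K from ⟨hxO, hxK⟩)]
    · rw [hx hxK, hPdef, indicator_of_notMem (fun hh => hxK hh.2)]
  -- The function and its gradient contribute `δ` each, and `ε² / 2 < ε²` leaves a strict
  -- inequality.
  set δ : ℝ≥0∞ := ENNReal.ofReal (ε ^ 2 / 4) with hδ
  have hδ0 : 0 < δ := ENNReal.ofReal_pos.2 (by positivity)
  obtain ⟨η₁, hη₁, hG⟩ := exists_translate_le hG2 hδ0
  obtain ⟨η₂, hη₂, hP⟩ := exists_translate_le hP2 hδ0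
  refine ⟨min η₁ η₂, lt_min hη₁ hη₂, fun k q ρ hk hqρ hball => ?_⟩
  have b1 := hk.lintegral_moll_sub_sq_le hGm hG2 hG (hqρ.trans_le (min_le_left _ _))
  have b2 := hk.lintegral_moll_sub_sq_le hPm hP2 hP (hqρ.trans_le (min_le_right _ _))
  have hφ := hk.isSmoothC_moll hGl hGc
  have hgr : ∀ y ∈ U, cgrad (moll k G) y = moll k P y := by
    intro y hy
    refine hk.cgrad_moll hGl hPl fun i => ?_
    have hc : ∀ z, P z i = (O ∩ K).indicator (fun x => gradOf u x i) z := fun z => by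
      by_cases hz : z ∈ O ∩ K
      · rw [hPdef, indicator_of_mem hz, indicator_of_mem hz]
      · rw [hPdef, indicator_of_notMem hz, indicator_of_notMem hz]; rfl
    -- If the ball meets `K`, it lies in `O` and the kernel seen from `y` is an admissible test
    -- function. Otherwise both integrands vanish identically.
    by_cases hne : (Metric.closedBall (y - q) ρ ∩ K).Nonempty
    · have ht := hk.isTest_comp_sub (hball y hy hne)
      simp only [hc]
      rw [hGdef, integral_smul_indicator hO.measurableSet hu,
        integral_smul_indicator hO.measurableSet (u := fun x => gradOf u x i)
          (by filter_upwards [hg] with x hx hxK; rw [hx hxK]; rfl)]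
      exact u.weak_grad ht i
    · have hz0 : ∀ z, z ∈ O ∩ K → z ∉ tsupport fun z => k (y - z) := fun z hz hzt =>
        hne ⟨z, hk.tsupport_comp_sub y hzt, hz.2⟩
      have e1 : ∀ z, pderiv i (fun z => k (y - z)) z • G z = 0 := fun z => by
        by_cases hz : z ∈ O ∩ K
        · have : fderiv ℝ (fun z => k (y - z)) z = 0 := image_eq_zero_of_notMem_tsupport
            fun hs => hz0 z hz (tsupport_fderiv_subset ℝ hs)
          rw [pderiv, this]
          simp
        · rw [hGdef, indicator_of_notMem hz, smul_zero]
      have e2 : ∀ z, k (y - z) • P z i = 0 := fun z => by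
        by_cases hz : z ∈ O ∩ K
        · have : k (y - z) = 0 := image_eq_zero_of_notMem_tsupport
            (f := fun z => k (y - z)) (hz0 z hz)
          rw [this, zero_smul]
        · rw [hc, indicator_of_notMem hz, smul_zero]
      simp [e1, e2]
  obtain ⟨a, ha1, ha2⟩ := hφ.exists_H1 O
  refine ⟨hφ, a, ha1, ?_⟩
  · have hUO : volume.restrict U ≤ volume.restrict O := Measure.restrict_mono hU.subset le_rfl
    have key : ‖cutL hU (a - u)‖ₑ ^ 2 ≤ δ + δ := by
      rw [enorm_cutL_sq]
      refine add_le_add (le_trans ?_ b1) (le_trans ?_ b2)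
      · refine le_trans (le_of_eq ?_) (setLIntegral_le_lintegral U _)
        refine lintegral_congr_ae ?_
        filter_upwards [ae_mono hUO (fnOf_sub_ae a u), ae_mono hUO ha1, ae_mono hUO hGu]
          with x h1 h2 h3
        rw [h1, h2, h3]
      · refine le_trans (le_of_eq ?_) (setLIntegral_le_lintegral U _)
        refine lintegral_congr_ae ?_
        have hs : gradOf (a - u) =ᵐ[volume.restrict O] fun x => gradOf a x - gradOf u x := by
          rw [map_sub]
          exact Lp.coeFn_sub _ _
        filter_upwards [ae_mono hUO hs, ae_mono hUO ha2, ae_mono hUO hPu,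
          self_mem_ae_restrict hU.isOpen.measurableSet] with x h1 h2 h3 hx
        rw [h1, h2, h3, hgr x hx]
    have h2 : ENNReal.ofReal (‖cutL hU (a - u)‖ ^ 2) ≤ ENNReal.ofReal (ε ^ 2 / 4 + ε ^ 2 / 4) := by
      rw [ENNReal.ofReal_add (by positivity) (by positivity), ENNReal.ofReal_pow (norm_nonneg _),
        ofReal_norm]
      exact key
    have h3 := (ENNReal.ofReal_le_ofReal_iff (by positivity)).1 h2
    exact lt_of_pow_lt_pow_left₀ 2 hε.le (by nlinarith)

/-- Mollification with kernels whose supports are shifted into `O`. -/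
theorem mem_closure_smoothSub_of_kernel (hU : IsClopenIn O U) (hK : IsCompact K) {u : H1 O}
    (hu : IsSupportedIn u K)
    (hk : ∀ η : ℝ, 0 < η → ∃ (q : E d) (ρ : ℝ), 0 < ρ ∧ ‖q‖ + ρ < η ∧ ∀ y ∈ U,
      (Metric.closedBall (y - q) ρ ∩ K).Nonempty → Metric.closedBall (y - q) ρ ⊆ O) :
    u ∈ (smoothSub O U).topologicalClosure := by
  refine Metric.mem_closure_iff.2 fun ε hε => ?_
  obtain ⟨η, hη, H⟩ := exists_moll_approx hU hK hu hε
  obtain ⟨q, ρ, hρ, hqρ, hball⟩ := hk η hη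
  obtain ⟨k, hk⟩ := exists_isKernel q hρ
  obtain ⟨hφ, a, ha1, ha2⟩ := H k q ρ hk hqρ hball
  -- The mollification is close to `u` only on `U`, so `u` is modified on `U` and kept elsewhere in
  -- `O`; membership in `smoothSub` concerns only `U`.
  refine ⟨u + cutL hU (a - u), ⟨_, hφ, ?_⟩, ?_⟩
  · filter_upwards [fnOf_add_ae u (cutL hU (a - u)), fnOf_cutL hU (a - u), fnOf_sub_ae a u, ha1]
      with x h1 h2 h3 h4 hx
    rw [h1, h2, indicator_of_mem hx, h3, h4]
    ring
  · rwa [dist_eq_norm, sub_add_cancel_left, norm_neg]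

/-- Centring the kernel at `ε e` makes the mollification at `y` sample around `y - ε e`, at depth
`ε` below `y`. With radius `ε / (2 + L)` the height varies by at most `(1 + L) ε / (2 + L) ≤ ε`, so
the samples stay below the graph. -/
theorem IsChart.exists_kernel {h : IsLipGraph e f L} {x : E d} {r : ℝ} (hc : IsChart Γ U h x r)
    (hU : U ⊆ O) (hK : K ⊆ Metric.closedBall x (r / 2)) {η : ℝ} (hη : 0 < η) :
    ∃ (q : E d) (ρ : ℝ), 0 < ρ ∧ ‖q‖ + ρ < η ∧ ∀ y ∈ U,
      (Metric.closedBall (y - q) ρ ∩ K).Nonempty → Metric.closedBall (y - q) ρ ⊆ O := by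
  have hr := hc.pos
  set ε := min (η / 4) (r / 16) with hε
  have hε0 : 0 < ε := lt_min (by positivity) (by positivity)
  have hε1 : ε ≤ η / 4 := min_le_left _ _
  have hε2 : ε ≤ r / 16 := min_le_right _ _
  have hL : (0 : ℝ) < 2 + L := by positivity
  have hρε : ε / (2 + L) ≤ ε := div_le_self hε0.le (by linarith [L.2, show (0 : ℝ) ≤ L from L.2])
  have hρ : (1 + L) * (ε / (2 + L)) ≤ ε := by
    rw [mul_div_assoc', div_le_iff₀ hL]
    nlinarith
  have hq : ‖ε • e‖ = ε := by rw [norm_smul, h.norm_eq, mul_one, Real.norm_of_nonneg hε0.le]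
  refine ⟨ε • e, ε / (2 + L), by positivity, by rw [hq]; linarith, fun y hy hne => ?_⟩
  obtain ⟨z₀, hz₀, hz₀K⟩ := hne
  have hz₀x := mem_closedBall_iff_norm.1 (hK hz₀K)
  rw [mem_closedBall_iff_norm] at hz₀
  have hyx : y ∈ Metric.ball x r := by
    rw [mem_ball_iff_norm]
    have : y - x = (z₀ - x) - (z₀ - (y - ε • e)) + ε • e := by abel
    rw [this]
    have h1 := norm_add_le ((z₀ - x) - (z₀ - (y - ε • e))) (ε • e)
    have h2 := norm_sub_le (z₀ - x) (z₀ - (y - ε • e))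
    linarith
  have hhy := (hc.mem_iff y hyx).1 hy
  intro z hz
  rw [mem_closedBall_iff_norm] at hz
  have hzx : z ∈ Metric.ball x r := by
    rw [mem_ball_iff_norm]
    have : z - x = (z₀ - x) - (z₀ - (y - ε • e)) + (z - (y - ε • e)) := by abel
    rw [this]
    have h1 := norm_add_le ((z₀ - x) - (z₀ - (y - ε • e))) (z - (y - ε • e))
    have h2 := norm_sub_le (z₀ - x) (z₀ - (y - ε • e))
    linarith
  refine hU ((hc.mem_iff z hzx).2 ?_)
  have h1 := h.abs_height_sub_le z (y - ε • e)
  rw [h.height_sub_smul] at h1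
  have h2 : (1 + (L : ℝ)) * ‖z - (y - ε • e)‖ ≤ ε :=
    (mul_le_mul_of_nonneg_left hz (by positivity)).trans hρ
  linarith [le_abs_self (h.height z - (h.height y - ε))]

/-- Away from the boundary no shift is needed: a ball of radius at most `δ / 2` meeting `K` stays in
the `δ`-neighbourhood of `K`. -/
theorem exists_kernel_of_subset (hO : IsOpen O) (hK : IsCompact K) (hKO : K ⊆ O) {η : ℝ}
    (hη : 0 < η) :
    ∃ (q : E d) (ρ : ℝ), 0 < ρ ∧ ‖q‖ + ρ < η ∧ ∀ y ∈ U,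
      (Metric.closedBall (y - q) ρ ∩ K).Nonempty → Metric.closedBall (y - q) ρ ⊆ O := by
  obtain ⟨δ, hδ, hδO⟩ := hK.exists_cthickening_subset_open hO hKO
  refine ⟨0, min (δ / 2) (η / 2), lt_min (by positivity) (by positivity), ?_, ?_⟩
  · rw [norm_zero, zero_add]
    linarith [min_le_right (δ / 2) (η / 2)]
  · rintro y - ⟨z₀, hz₀, hz₀K⟩ z hz
    refine hδO (Metric.mem_cthickening_of_dist_le z z₀ δ K hz₀K ?_)
    have := min_le_left (δ / 2) (η / 2)
    rw [Metric.mem_closedBall] at hz hz₀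
    linarith [dist_triangle_right z z₀ (y - 0)]

theorem IsSupportedIn.of_cutoff {u v : H1 O} {χ : E d → ℝ}
    (hv : fnOf v =ᵐ[volume.restrict O] fun x => χ x • fnOf u x) {K' : Set (E d)}
    (hK : ∀ x, x ∉ K' → x ∈ K → χ x = 0) (hu : IsSupportedIn u K) : IsSupportedIn v K' := by
  filter_upwards [hv, hu] with x h1 h2 hx
  rw [h1]
  by_cases hxK : x ∈ K
  · rw [hK x hx hxK, zero_smul]
  · rw [h2 hxK, smul_zero]

/-- Elements of `H¹(O)` of compact support are dense. -/
theorem mem_closure_compactSupport (u : H1 O) :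
    u ∈ closure {v : H1 O | ∃ K, IsCompact K ∧ IsSupportedIn v K} := by
  let b : ContDiffBump (0 : E d) := ⟨1, 2, one_pos, one_lt_two⟩
  let s : ℕ → ℝ := fun n => ((n : ℝ) + 1)⁻¹
  have hs0 : ∀ n, 0 < s n := fun n => by positivity
  have hs1 : ∀ n, s n ≤ 1 := fun n => inv_le_one_of_one_le₀ (by linarith [n.cast_nonneg (α := ℝ)])
  -- Dilations of one bump: the gradients are bounded uniformly in `n` and the functions are
  -- eventually `1` near each point, so dominated convergence applies.
  let χ : ℕ → E d → ℝ := fun n x => b (s n • x)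
  have hbd : Differentiable ℝ b := (b.contDiff (n := 1)).differentiable (by simp)
  obtain ⟨C, hC⟩ := (b.hasCompactSupport.fderiv ℝ).exists_bound_of_continuous
    ((b.contDiff (n := 1)).continuous_fderiv (by simp))
  have hfd : ∀ n x, fderiv ℝ (χ n) x = s n • fderiv ℝ b (s n • x) := fun n x => by
    have h1 := (hbd (s n • x)).hasFDerivAt.comp x ((hasFDerivAt_id x).const_smul (s n))
    have h2 : fderiv ℝ (χ n) x = _ := h1.fderiv
    rw [h2]
    ext v
    simp
  have hfC : ∀ n x, ‖fderiv ℝ (χ n) x‖ ≤ C := fun n x => by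
    rw [hfd, norm_smul, Real.norm_of_nonneg (hs0 n).le]
    exact (mul_le_of_le_one_left (norm_nonneg _) (hs1 n)).trans (hC _)
  have hχ : ∀ n, IsCutoff (χ n) := fun n =>
    ⟨b.contDiff.comp (contDiff_const_smul (s n)),
      ⟨1, fun x => by rw [abs_of_nonneg b.nonneg]; exact b.le_one⟩, ⟨C, hfC n⟩⟩
  have hone : ∀ x : E d, ∀ᶠ n in atTop, χ n x = 1 ∧ fderiv ℝ (χ n) x = 0 := by
    intro x
    obtain ⟨N, hN⟩ := exists_nat_gt ‖x‖
    filter_upwards [eventually_ge_atTop N] with n hn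
    have hx : ‖x‖ < n + 1 := by
      have : (N : ℝ) ≤ n := by exact_mod_cast hn
      linarith
    have hev : χ n =ᶠ[𝓝 x] fun _ => 1 := by
      filter_upwards [(isOpen_lt continuous_norm continuous_const).mem_nhds hx] with y hy
      refine b.one_of_mem_closedBall ?_
      rw [mem_closedBall_zero_iff, norm_smul, Real.norm_of_nonneg (hs0 n).le,
        inv_mul_le_iff₀ (by positivity)]
      change _ ≤ _ * (1 : ℝ)
      rw [mul_one]
      exact le_of_lt hy
    exact ⟨hev.self_of_nhds, by rw [hev.fderiv_eq]; simp⟩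
  choose v hv1 hv2 using fun n => (hχ n).exists_mul u
  refine mem_closure_of_tendsto (f := v) (b := atTop) ?_ (Eventually.of_forall fun n => ?_)
  · have hfn : ∀ n, ∀ᵐ x ∂volume.restrict O, fnOf (v n - u) x = (χ n x - 1) • fnOf u x := fun n => by
      filter_upwards [fnOf_sub_ae (v n) u, hv1 n] with x h1 h2
      rw [h1, h2, sub_smul, one_smul]
    have hgn : ∀ n, ∀ᵐ x ∂volume.restrict O, gradOf (v n - u) x
        = (χ n x - 1) • gradOf u x + fnOf u x • rgrad (χ n) x := fun n => by
      have : gradOf (v n - u) =ᵐ[volume.restrict O] fun x => gradOf (v n) x - gradOf u x := by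
        rw [map_sub]
        exact Lp.coeFn_sub _ _
      filter_upwards [this, hv2 n] with x h1 h2
      rw [h1, h2, sub_smul, one_smul]
      abel
    have hle1 : ∀ n x, ‖χ n x - 1‖ ≤ 1 := fun n x => by
      rw [Real.norm_eq_abs, abs_le]
      constructor
      · linarith [show 0 ≤ χ n x from b.nonneg]
      · linarith [show χ n x ≤ 1 from b.le_one]
    set D : ℝ≥0∞ := ENNReal.ofReal (√d * C) with hD
    have hbound : ∀ n, ∀ᵐ x ∂volume.restrict O, ‖fnOf (v n - u) x‖ₑ ^ 2
        + ‖gradOf (v n - u) x‖ₑ ^ 2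
        ≤ ‖fnOf u x‖ₑ ^ 2 + (2 * ‖gradOf u x‖ₑ ^ 2 + 2 * (‖fnOf u x‖ₑ ^ 2 * D ^ 2)) := fun n => by
      filter_upwards [hfn n, hgn n] with x h1 h2
      have hle : ‖χ n x - 1‖ₑ ≤ 1 := by
        rw [← ofReal_norm]
        exact ENNReal.ofReal_le_one.2 (hle1 n x)
      rw [h1, h2]
      refine add_le_add ?_ ?_
      · rw [enorm_smul]
        exact pow_le_pow_left₀ zero_le (mul_le_of_le_one_left' hle) 2
      · refine (pow_le_pow_left₀ zero_le (enorm_add_le _ _) 2).trans ?_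
        refine (add_sq_le_two _ _).trans ?_
        gcongr
        · rw [enorm_smul]
          exact mul_le_of_le_one_left' hle
        · rw [enorm_smul, mul_pow]
          gcongr
          rw [← ofReal_norm]
          exact ENNReal.ofReal_le_ofReal ((norm_rgrad_le _ _).trans
            (mul_le_mul_of_nonneg_left (hfC n x) (Real.sqrt_nonneg _)))
    have hfin : ∫⁻ x in O, (‖fnOf u x‖ₑ ^ 2 + (2 * ‖gradOf u x‖ₑ ^ 2
        + 2 * (‖fnOf u x‖ₑ ^ 2 * D ^ 2))) ≠ ⊤ := by
      have m1 : AEMeasurable (fun x => ‖fnOf u x‖ₑ ^ 2) (volume.restrict O) :=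
        ((Lp.aestronglyMeasurable _).enorm).pow_const 2
      have m2 : AEMeasurable (fun x => ‖gradOf u x‖ₑ ^ 2) (volume.restrict O) :=
        ((Lp.aestronglyMeasurable _).enorm).pow_const 2
      rw [lintegral_add_left' m1, lintegral_add_left' (m2.const_mul 2),
        lintegral_const_mul'' _ m2, lintegral_const_mul'' _ (m1.mul_const _),
        lintegral_mul_const'' _ m1, ← enorm_sq_Lp, ← enorm_sq_Lp]
      have : D ≠ ⊤ := ENNReal.ofReal_ne_top
      finiteness
    have hlim : Tendsto (fun n => ∫⁻ x in O, (‖fnOf (v n - u) x‖ₑ ^ 2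
        + ‖gradOf (v n - u) x‖ₑ ^ 2)) atTop (𝓝 (∫⁻ _ in O, 0)) := by
      refine tendsto_lintegral_of_dominated_convergence' _ (fun n => ?_) hbound hfin ?_
      · exact (((Lp.aestronglyMeasurable _).enorm).pow_const 2).add
          (((Lp.aestronglyMeasurable _).enorm).pow_const 2)
      · filter_upwards [ae_all_iff.2 hfn, ae_all_iff.2 hgn] with x h1 h2
        refine tendsto_const_nhds.congr' ?_
        filter_upwards [hone x] with n hn
        have hr : rgrad (χ n) x = 0 := by
          ext i
          change ((fderiv ℝ (χ n) x (EuclideanSpace.single i 1) : ℝ) : ℂ) = 0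
          rw [hn.2]
          simp
        rw [h1, h2, hn.1, hr]
        simp
    rw [lintegral_zero] at hlim
    have heq : ∀ n, ∫⁻ x in O, (‖fnOf (v n - u) x‖ₑ ^ 2 + ‖gradOf (v n - u) x‖ₑ ^ 2)
        = ‖v n - u‖ₑ ^ 2 := fun n => by
      rw [H1.enorm_sq, lintegral_add_left' (((Lp.aestronglyMeasurable _).enorm).pow_const 2)]
    simp only [heq] at hlim
    rw [tendsto_iff_norm_sub_tendsto_zero]
    have h5 := (ENNReal.tendsto_toReal ENNReal.zero_ne_top).comp hlim
    have h6 : ∀ n, (‖v n - u‖ₑ ^ 2).toReal = ‖v n - u‖ ^ 2 := fun n => by simp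
    have h7 := h5.sqrt
    simpa [Function.comp_def, h6] using h7
  · refine ⟨Metric.closedBall 0 (2 / s n), isCompact_closedBall _ _, ?_⟩
    filter_upwards [hv1 n] with x h1 hx
    rw [h1]
    have : χ n x = 0 := by
      refine b.zero_of_le_dist ?_
      rw [dist_zero_right, norm_smul, Real.norm_of_nonneg (hs0 n).le]
      rw [mem_closedBall_zero_iff, not_le, div_lt_iff₀ (hs0 n)] at hx
      change (2 : ℝ) ≤ _
      linarith
    rw [this, zero_smul]

/-- Restrictions of smooth compactly supported functions to a side of `Γ` are dense. -/
theorem IsSide.closure_smoothSub (hS : IsSide Γ U) (hU : IsClopenIn O U) (hO : O = Γᶜ) :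
    (smoothSub O U).topologicalClosure = ⊤ := by
  set S := (smoothSub O U).topologicalClosure with hSdef
  have hSc : IsClosed (S : Set (H1 O)) := Submodule.isClosed_topologicalClosure _
  have hOo := hU.isOpen_right
  suffices hmain : ∀ (u : H1 O) (K : Set (E d)), IsCompact K → IsSupportedIn u K → u ∈ S by
    rw [eq_top_iff]
    rintro u -
    have := mem_closure_compactSupport u
    refine (closure_minimal ?_ hSc) this
    rintro v ⟨K, hK, hv⟩
    exact hmain v K hK hv
  intro u K hK hu
  choose! e f L h r hc using hS.exists_chart
  obtain ⟨t, ht, hcov⟩ := hS.isCompact.elim_nhds_subcover (fun x => Metric.ball x (r x / 4))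
    fun x hx => Metric.ball_mem_nhds x (by have := (hc x hx).pos; positivity)
  -- In place of a partition of unity, the charts are treated one at a time: the bump of the chart
  -- times the current remainder lies in the closure and is subtracted, after which the remainder
  -- vanishes on one more ball.
  have peel : ∀ t : Finset (E d), (∀ x ∈ t, x ∈ Γ) → ∃ u' : H1 O, u - u' ∈ S ∧
      IsSupportedIn u' (K \ ⋃ x ∈ t, Metric.ball x (r x / 4)) := by
    intro t
    induction t using Finset.induction_on with
    | empty =>
      intro _
      refine ⟨u, by simp, ?_⟩
      simpa using hu
    | insert x t hxt ih =>
      intro hΓ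
      obtain ⟨u', h1, h2⟩ := ih fun y hy => hΓ y (Finset.mem_insert_of_mem hy)
      have hcx := hc x (hΓ x (Finset.mem_insert_self x t))
      have hr := hcx.pos
      let b : ContDiffBump x := ⟨r x / 4, r x / 2, by positivity, by linarith⟩
      obtain ⟨w, hw, -⟩ := (IsCutoff.of_hasCompactSupport b.contDiff b.hasCompactSupport).exists_mul u'
      have hw1 : IsSupportedIn w (Metric.closedBall x (r x / 2)) := by
        refine IsSupportedIn.of_cutoff hw (K := univ) (fun y hy _ => b.zero_of_le_dist ?_)
          (Eventually.of_forall fun y hy => absurd (mem_univ y) hy)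
        rw [Metric.mem_closedBall, not_le] at hy
        exact hy.le
      have hwS : w ∈ S := mem_closure_smoothSub_of_kernel hU (isCompact_closedBall _ _) hw1
        fun η hη => hcx.exists_kernel hU.subset le_rfl hη
      refine ⟨u' - w, ?_, ?_⟩
      · have : u - (u' - w) = (u - u') + w := by abel
        rw [this]
        exact S.add_mem h1 hwS
      · filter_upwards [fnOf_sub_ae u' w, hw, h2] with y e1 e2 e3 hy
        rw [e1, e2]
        by_cases hyx : y ∈ Metric.ball x (r x / 4)
        · rw [b.one_of_mem_closedBall (Metric.ball_subset_closedBall hyx), one_smul, sub_self]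
        · have : y ∉ K \ ⋃ x ∈ t, Metric.ball x (r x / 4) := fun hh => hy ⟨hh.1, by
            simp only [Finset.mem_insert, iUnion_iUnion_eq_or_left, mem_union, not_or]
            exact ⟨hyx, hh.2⟩⟩
          rw [e3 this, smul_zero, sub_zero]
  obtain ⟨u', h1, h2⟩ := peel t ht
  have h3 : u' ∈ S := by
    refine mem_closure_smoothSub_of_kernel hU (hK.diff (isOpen_biUnion fun _ _ => Metric.isOpen_ball))
      h2 fun η hη => exists_kernel_of_subset hOo
        (hK.diff (isOpen_biUnion fun _ _ => Metric.isOpen_ball)) ?_ hη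
    rintro y ⟨-, hy⟩
    rw [hO]
    exact fun hyΓ => hy (hcov hyΓ)
  have := S.add_mem h1 h3
  rwa [sub_add_cancel] at this

/-- With empty boundary, `IsSide.closure_smoothSub` becomes the density of smooth compactly
supported functions in `H¹(ℝᵈ)`. -/
theorem isSide_empty_univ : IsSide (∅ : Set (E d)) univ :=
  ⟨isCompact_empty, isOpen_univ, fun x hx => absurd hx (notMem_empty x)⟩

end Density

end HeatTransmission

end

/-! ### Extension by reflection -/

noncomputable section

namespace HeatTransmission

open MeasureTheory Set Filter Topology
open scoped ContDiff ENNReal NNReal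

section Reflection

variable {d : ℕ} {U Γ Ω : Set (E d)} {e : E d} {f : E d → ℝ} {L C : ℝ≥0}

/-- By Rademacher's theorem the classical gradient exists almost everywhere, and integration by
parts holds for real Lipschitz functions; it is applied to the real and imaginary parts of `φ`. -/
theorem integral_pderiv_of_lipschitz {φ : E d → ℂ} (hφ : LipschitzWith C φ)
    (hc : HasCompactSupport φ) (hp : MemLp (cgrad φ) 2 volume) {ψ : E d → ℝ} (hψ : IsTest univ ψ)
    (i : Fin d) : ∫ x, pderiv i ψ x • φ x = -∫ x, ψ x • cgrad φ x i := by
  have hφi : MemLp φ 2 volume := hφ.continuous.memLp_of_hasCompactSupport hc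
  have hψ2 : MemLp ψ 2 volume := by simpa using hψ.memLp
  have hψ3 : MemLp (pderiv i ψ) 2 volume := by simpa using hψ.memLp_pderiv i
  have I1 : Integrable fun x => pderiv i ψ x • φ x := integrable_smul_of_memLp hψ3 hφi
  have I2 : Integrable fun x => ψ x • cgrad φ x i := integrable_smul_of_memLp hψ2
    ((EuclideanSpace.proj (𝕜 := ℂ) i : EuclideanSpace ℂ (Fin d) →L[ℂ] ℂ).comp_memLp' hp)
  obtain ⟨D, hD⟩ := (hψ.hasCompactSupport.fderiv ℝ).exists_bound_of_continuous
    (hψ.contDiff.continuous_fderiv (by simp))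
  have hψL : LipschitzWith D.toNNReal ψ := lipschitzWith_of_nnnorm_fderiv_le hψ.differentiable
    fun x => by rw [← NNReal.coe_le_coe, coe_nnnorm]; exact (hD x).trans (Real.le_coe_toNNReal D)
  have key : ∀ T : ℂ →L[ℝ] ℝ, T (∫ x, pderiv i ψ x • φ x) = T (-∫ x, ψ x • cgrad φ x i) := by
    intro T
    rw [map_neg, ← T.integral_comp_comm I1, ← T.integral_comp_comm I2]
    have h := LipschitzWith.integral_lineDeriv_mul_eq (μ := (volume : Measure (E d)))
      (T.lipschitz.comp hφ) hψL hψ.hasCompactSupport (EuclideanSpace.single i (1 : ℝ))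
    have e1 : ∀ x, lineDeriv ℝ ψ x (-EuclideanSpace.single i (1 : ℝ)) * (T ∘ φ) x
        = -T (pderiv i ψ x • φ x) := fun x => by
      rw [(hψ.differentiable x).lineDeriv_eq_fderiv, map_neg, map_smul, smul_eq_mul, neg_mul]
      rfl
    have e2 : ∀ᵐ x, lineDeriv ℝ (T ∘ φ) x (EuclideanSpace.single i (1 : ℝ)) * ψ x
        = T (ψ x • cgrad φ x i) := by
      filter_upwards [hφ.ae_differentiableAt] with x hx
      have h1 : HasFDerivAt (T ∘ φ) (T.comp (fderiv ℝ φ x)) x :=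
        T.hasFDerivAt.comp x hx.hasFDerivAt
      rw [h1.differentiableAt.lineDeriv_eq_fderiv, h1.fderiv, map_smul, smul_eq_mul, mul_comm]
      rfl
    rw [integral_congr_ae e2] at h
    simp only [e1] at h
    rw [integral_neg] at h
    rw [h, neg_neg]
  exact Complex.ext (key Complex.reCLM) (key Complex.imCLM)

/-- Compactly supported Lipschitz functions belong to `H¹`. -/
theorem exists_H1_of_lipschitz {φ : E d → ℂ} (hφ : LipschitzWith C φ) (hc : HasCompactSupport φ) :
    ∃ v : H1 (univ : Set (E d)), fnOf v =ᵐ[volume] φ ∧ gradOf v =ᵐ[volume] cgrad φ := by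
  have hm : Measurable (cgrad φ) := (PiLp.continuous_toLp 2 _).measurable.comp
    (measurable_pi_lambda _ fun i => measurable_fderiv_apply_const ℝ φ _)
  have hz : ∀ x, x ∉ tsupport φ → cgrad φ x = 0 := fun x hx => by
    have : fderiv ℝ φ x = 0 := image_eq_zero_of_notMem_tsupport
      fun hs => hx (tsupport_fderiv_subset ℝ hs)
    ext i
    simp [cgrad, this]
  have hp : MemLp (cgrad φ) 2 volume := by
    have hb : MemLp (cgrad φ) 2 (volume.restrict (tsupport φ)) := by
      have : IsFiniteMeasure ((volume : Measure (E d)).restrict (tsupport φ)) :=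
        ⟨by rw [Measure.restrict_apply_univ]; exact hc.isCompact.measure_lt_top⟩
      refine MemLp.of_bound hm.aestronglyMeasurable (√d * C) (Eventually.of_forall fun x => ?_)
      refine (norm_cgrad_le φ x).trans ?_
      gcongr
      exact norm_fderiv_le_of_lipschitz ℝ hφ
    have := (memLp_indicator_iff_restrict (isClosed_tsupport φ).measurableSet).2 hb
    rwa [indicator_eq_self.2 fun x hx => by_contra fun hh => hx (hz x hh)] at this
  have hφi : MemLp φ 2 volume := hφ.continuous.memLp_of_hasCompactSupport hc
  have := exists_H1 (O := univ) (u := φ) (p := cgrad φ) (by simpa using hφi) (by simpa using hp)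
    fun ψ hψ i => by simpa using integral_pderiv_of_lipschitz hφ hc hp hψ i
  simpa using this

theorem IsKernel.norm_moll_sub_le {φ : E d → ℂ} (hφ : LipschitzWith C φ) {k : E d → ℝ}
    {ρ : ℝ} (hk : IsKernel k 0 ρ) (hρ : 0 ≤ ρ) (y : E d) : ‖moll k φ y - φ y‖ ≤ C * ρ := by
  have hp := hk.isProbabilityMeasure
  have h1 := hk.enorm_moll_sub_sq_le hφ.continuous.stronglyMeasurable
    hφ.continuous.locallyIntegrable y
  have h0 : ∀ᵐ z ∂((volume : Measure (E d)).withDensity fun z => ENNReal.ofReal (k z)),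
      ‖φ (y - z) - φ y‖ₑ ^ 2 ≤ ENNReal.ofReal (C * ρ) ^ 2 := by
    rw [ae_withDensity_iff hk.contDiff.continuous.measurable.ennreal_ofReal]
    refine Eventually.of_forall fun z hz => pow_le_pow_left₀ zero_le ?_ 2
    have : z ∈ tsupport k := subset_tsupport _ fun h0 => hz (by simp [h0])
    have h2 := mem_closedBall_iff_norm.1 (hk.tsupport_subset this)
    rw [sub_zero] at h2
    rw [← ofReal_norm]
    refine ENNReal.ofReal_le_ofReal ((hφ.norm_sub_le _ _).trans ?_)
    rw [sub_sub_cancel_left, norm_neg]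
    gcongr
  have h3 := h1.trans (lintegral_mono_ae h0)
  rw [lintegral_const, measure_univ, mul_one] at h3
  have h4 : ‖moll k φ y - φ y‖ₑ ≤ ENNReal.ofReal (C * ρ) := (ENNReal.pow_le_pow_left_iff two_ne_zero).1 h3
  rw [← ofReal_norm] at h4
  exact (ENNReal.ofReal_le_ofReal_iff (by positivity)).1 h4

theorem mem_traceGraph_of_smooth {O : Set (E d)} {u : H1 O} {g : Lp ℂ 2 (surf Ω)} {φ : E d → ℂ}
    (hφ : IsSmoothC φ) (hu : ∀ᵐ x ∂volume.restrict O, x ∈ U → fnOf u x = φ x)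
    (hg : g =ᵐ[surf Ω] φ) : (u, g) ∈ traceGraph Ω O U :=
  subset_closure ⟨φ, hφ.1, hφ.2, hu, hg⟩

theorem isClosed_traceGraph (Ω O U : Set (E d)) :
    IsClosed (traceGraph Ω O U : Set (H1 O × Lp ℂ 2 (surf Ω))) :=
  Submodule.isClosed_topologicalClosure _

/-- `v` has the trace `φ|_Γ`. -/
def HasTrace (Ω : Set (E d)) (v : H1 (univ : Set (E d))) (φ : E d → ℂ) : Prop :=
  ∃ g : Lp ℂ 2 (surf Ω), g =ᵐ[surf Ω] φ ∧ (v, g) ∈ traceGraph Ω univ univ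

theorem HasTrace.add {v w : H1 (univ : Set (E d))} {φ ψ : E d → ℂ} (h : HasTrace Ω v φ)
    (k : HasTrace Ω w ψ) : HasTrace Ω (v + w) (fun x => φ x + ψ x) := by
  obtain ⟨g, h1, h2⟩ := h
  obtain ⟨g', k1, k2⟩ := k
  refine ⟨g + g', ?_, Submodule.add_mem _ h2 k2⟩
  filter_upwards [Lp.coeFn_add g g', h1, k1] with x e1 e2 e3
  rw [e1, Pi.add_apply, e2, e3]

theorem HasTrace.congr {v : H1 (univ : Set (E d))} {φ ψ : E d → ℂ} (h : HasTrace Ω v φ)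
    (hφ : φ =ᵐ[surf Ω] ψ) : HasTrace Ω v ψ := by
  obtain ⟨g, h1, h2⟩ := h
  exact ⟨g, h1.trans hφ, h2⟩

/-- The trace is a closure of restrictions of smooth functions. Mollifications of `φ` converge in
`H¹` and uniformly, hence in `L²(Γ)` because the surface measure is finite. -/
theorem hasTrace_of_lipschitz [IsFiniteMeasure (surf Ω)] {φ : E d → ℂ} (hφ : LipschitzWith C φ)
    (hc : HasCompactSupport φ) {v : H1 (univ : Set (E d))} (hv : fnOf v =ᵐ[volume] φ) :
    HasTrace Ω v φ := by
  have hm : MemLp φ 2 (surf Ω) := hφ.continuous.memLp_of_hasCompactSupport hc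
  refine ⟨hm.toLp φ, hm.coeFn_toLp, ?_⟩
  have hcl : (v, hm.toLp φ) ∈ closure (traceGraph Ω univ univ : Set (H1 univ × Lp ℂ 2 (surf Ω))) := by
    refine Metric.mem_closure_iff.2 fun ε hε => ?_
    have hsupp : IsSupportedIn v (tsupport φ) := by
      have hv' : ∀ᵐ x ∂volume.restrict univ, fnOf v x = φ x := ae_mono Measure.restrict_le_self hv
      filter_upwards [hv'] with x hx hxs
      rw [hx, image_eq_zero_of_notMem_tsupport hxs]
    have hU := isClopenIn_self (isOpen_univ (X := E d))
    obtain ⟨η, hη, H⟩ := exists_moll_approx hU hc hsupp hε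
    set m : ℝ := (measureUnivNNReal (surf Ω) : ℝ) ^ ((2 : ℝ≥0∞).toReal)⁻¹ with hmdef
    have hm0 : 0 ≤ m := by positivity
    -- The first bound controls the `H¹` error. The second gives `m C ρ < ε`, where `m` is the
    -- square root of the surface measure of `Γ` and `C ρ` the uniform error; the summand `1` avoids
    -- division by zero.
    set ρ : ℝ := min (η / 2) (ε / (2 * (m * C + 1))) with hρ
    have hden : 0 < m * C + 1 := by positivity
    have hρ0 : 0 < ρ := lt_min (by positivity) (by positivity)
    obtain ⟨k, hk⟩ := exists_isKernel (0 : E d) hρ0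
    obtain ⟨hs, a, ha1, ha2⟩ := H k 0 ρ hk
      (by rw [norm_zero, zero_add]; linarith [min_le_left (η / 2) (ε / (2 * (m * C + 1)))])
      fun y _ _ => subset_univ _
    have hmoll : moll k ((univ ∩ tsupport φ).indicator (fnOf v)) = moll k φ := by
      funext y
      rw [moll_apply', moll_apply']
      refine integral_congr_ae ?_
      filter_upwards [hv] with z hz
      by_cases hzs : z ∈ tsupport φ
      · rw [indicator_of_mem (show z ∈ univ ∩ tsupport φ from ⟨mem_univ z, hzs⟩), hz]
      · rw [indicator_of_notMem (fun hh => hzs hh.2), image_eq_zero_of_notMem_tsupport hzs]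
    rw [hmoll] at hs ha1
    have hm' : MemLp (moll k φ) 2 (surf Ω) := hs.memLp
    refine ⟨(a, hm'.toLp _), mem_traceGraph_of_smooth hs
      (by filter_upwards [ha1] with x hx _ using hx) hm'.coeFn_toLp, ?_⟩
    rw [dist_comm, Prod.dist_eq, max_lt_iff, dist_eq_norm, dist_eq_norm]
    refine ⟨?_, ?_⟩
    · have : cutL hU (a - v) = a - v := by
        refine H1.ext_ae isOpen_univ ?_
        have := fnOf_cutL hU (a - v)
        rwa [indicator_univ] at this
      rwa [this] at ha2
    · have hb : ∀ᵐ x ∂surf Ω, ‖(hm'.toLp (moll k φ) - hm.toLp φ : Lp ℂ 2 (surf Ω)) x‖ ≤ C * ρ := by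
        filter_upwards [Lp.coeFn_sub (hm'.toLp (moll k φ)) (hm.toLp φ), hm'.coeFn_toLp,
          hm.coeFn_toLp] with x h1 h2 h3
        rw [h1, Pi.sub_apply, h2, h3]
        exact hk.norm_moll_sub_le hφ hρ0.le x
      refine (Lp.norm_le_of_ae_bound (by positivity) hb).trans_lt ?_
      have h1 : ρ ≤ ε / (2 * (m * C + 1)) := min_le_right _ _
      rw [le_div_iff₀ (by positivity)] at h1
      change m * (C * ρ) < ε
      nlinarith
  rwa [(isClosed_traceGraph Ω univ univ).closure_eq] at hcl

/-- Reflection of the points above the graph. -/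
def IsLipGraph.fold (h : IsLipGraph e f L) (y : E d) : E d := y - (2 * max (h.height y) 0) • e

theorem IsLipGraph.fold_of_nonpos (h : IsLipGraph e f L) {y : E d} (hy : h.height y ≤ 0) :
    h.fold y = y := by rw [fold, max_eq_right hy, mul_zero, zero_smul, sub_zero]

theorem IsLipGraph.height_fold (h : IsLipGraph e f L) (y : E d) :
    h.height (h.fold y) = -|h.height y| := by
  rw [fold, h.height_sub_smul]
  rcases le_total (h.height y) 0 with hy | hy
  · rw [max_eq_right hy, abs_of_nonpos hy]; ring
  · rw [max_eq_left hy, abs_of_nonneg hy]; ring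

theorem IsLipGraph.norm_fold_sub_le (h : IsLipGraph e f L) (y z : E d) :
    ‖h.fold y - h.fold z‖ ≤ (3 + 2 * L) * ‖y - z‖ := by
  have h1 : h.fold y - h.fold z = (y - z) - (2 * (max (h.height y) 0 - max (h.height z) 0)) • e := by
    unfold fold
    module
  rw [h1]
  refine (norm_sub_le _ _).trans ?_
  rw [norm_smul, h.norm_eq, mul_one, Real.norm_eq_abs, abs_mul, abs_two]
  have h2 := (abs_max_sub_max_le_abs (h.height y) (h.height z) 0).trans (h.abs_height_sub_le y z)
  linarith

theorem IsLipGraph.continuous_fold (h : IsLipGraph e f L) : Continuous h.fold := by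
  have := h.continuous_height
  unfold fold
  fun_prop

theorem lintegral_comp_abs_le {F : ℝ → ℝ≥0∞} (hF : Measurable F) :
    ∫⁻ s : ℝ, F |s| ≤ 2 * ∫⁻ s in Ioi 0, F s := by
  have h1 : ∫⁻ s in Iio (0 : ℝ), F |s| = ∫⁻ s in Ioi 0, F s := by
    have := (Measure.measurePreserving_neg (volume : Measure ℝ)).setLIntegral_comp_preimage
      (measurableSet_Ioi (a := (0 : ℝ))) hF
    rw [← this]
    have h2 : Neg.neg ⁻¹' Ioi (0 : ℝ) = Iio 0 := by ext; simp
    rw [h2]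
    exact setLIntegral_congr_fun measurableSet_Iio fun s hs => by rw [abs_of_neg hs]
  have h2 : ∫⁻ s in Ici (0 : ℝ), F |s| = ∫⁻ s in Ioi 0, F s := by
    rw [setLIntegral_congr Ioi_ae_eq_Ici.symm]
    exact setLIntegral_congr_fun measurableSet_Ioi fun s hs => by rw [abs_of_pos hs]
  rw [← lintegral_add_compl (fun s : ℝ => F |s|) (measurableSet_Iio (a := (0 : ℝ))), compl_Iio, h1,
    h2, two_mul]

/-- On the line through a point of the graph, with depth coordinate `s`, the fold is `s ↦ |s|`. The
one-dimensional bound and Fubini suffice, without any Jacobian. -/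
theorem IsLipGraph.lintegral_comp_fold_le (h : IsLipGraph e f L) (hd : 0 < d) {G : E d → ℝ≥0∞}
    (hG : Measurable G) : ∫⁻ y, G (h.fold y) ≤ 2 * ∫⁻ y in {y | h.height y < 0}, G y := by
  obtain ⟨σ, c, K, -, -, -, hF, -, hσ, -⟩ := h.exists_measure hd
  have hσ0 : ∀ᵐ x ∂σ, h.height x = 0 := ae_mono hσ (ae_restrict_mem h.measurableSet_graph)
  have hA : MeasurableSet {y | h.height y < 0} :=
    (isOpen_lt h.continuous_height continuous_const).measurableSet
  have hGf : Measurable fun y => G (h.fold y) := hG.comp h.continuous_fold.measurable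
  rw [← lintegral_indicator hA, hF _ hGf,
    hF _ (hG.indicator hA), mul_left_comm]
  have hm : Measurable fun x : E d => ∫⁻ s : ℝ, {y | h.height y < 0}.indicator G (x - s • e) := by
    have h0 : Measurable (Function.uncurry fun (x : E d) (s : ℝ) =>
        {y | h.height y < 0}.indicator G (x - s • e)) :=
      (hG.indicator hA).comp (measurable_fst.sub (measurable_snd.smul_const e))
    exact h0.lintegral_prod_right
  rw [← lintegral_const_mul _ hm]
  gcongr 1
  refine lintegral_mono_ae ?_
  filter_upwards [hσ0] with x hx
  have e1 : ∀ s : ℝ, h.fold (x - s • e) = x - |s| • e := fun s => by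
    rw [fold, h.height_sub_smul, hx, zero_sub, sub_sub, ← add_smul]
    congr 2
    rcases le_total s 0 with hs | hs
    · rw [max_eq_left (by linarith), abs_of_nonpos hs]; ring
    · rw [max_eq_right (by linarith), abs_of_nonneg hs]; ring
  have e2 : ∫⁻ s : ℝ, {y | h.height y < 0}.indicator G (x - s • e)
      = ∫⁻ s in Ioi (0 : ℝ), G (x - s • e) := by
    rw [← lintegral_indicator measurableSet_Ioi]
    refine lintegral_congr fun s => ?_
    have : x - s • e ∈ {y | h.height y < 0} ↔ s ∈ Ioi (0 : ℝ) := by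
      change h.height _ < 0 ↔ 0 < s
      rw [h.height_sub_smul, hx, zero_sub, neg_lt_zero]
    by_cases hs : s ∈ Ioi (0 : ℝ)
    · rw [indicator_of_mem (this.2 hs), indicator_of_mem hs]
    · rw [indicator_of_notMem (fun hh => hs (this.1 hh)), indicator_of_notMem hs]
  simp only [e1, e2]
  exact lintegral_comp_abs_le (F := fun s => G (x - s • e))
    (hG.comp (measurable_const.sub (measurable_id.smul_const e)))

/-- The fold need not be differentiable, so no chain rule is used: near `y` the composition varies
at most at the rate of `φ` at `h.fold y`, up to `ε`, times the Lipschitz constant of the fold. Such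
a pointwise Lipschitz bound controls `fderiv` also where it takes its default value `0`. -/
theorem IsLipGraph.norm_cgrad_comp_fold_le (h : IsLipGraph e f L) {φ : E d → ℂ} (hφ : IsSmoothC φ)
    (y : E d) : ‖cgrad (φ ∘ h.fold) y‖ ≤ √d * (3 + 2 * L) * ‖cgrad φ (h.fold y)‖ := by
  refine (norm_cgrad_le _ y).trans ?_
  rw [mul_assoc]
  refine mul_le_mul_of_nonneg_left ?_ (Real.sqrt_nonneg _)
  refine le_of_forall_pos_le_add fun ε hε => ?_
  set M : ℝ := 3 + 2 * L with hM
  have hM0 : 0 < M := by positivity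
  refine norm_fderiv_le_of_lip' ℝ (by positivity) ?_
  have hd := (hφ.differentiable (h.fold y)).hasFDerivAt.isLittleO
  have hev := (h.continuous_fold.tendsto y).eventually
    (Asymptotics.isLittleO_iff.1 hd (c := ε / M) (by positivity))
  filter_upwards [hev] with z hz
  have h1 : ‖φ (h.fold z) - φ (h.fold y)‖
      ≤ (‖cgrad φ (h.fold y)‖ + ε / M) * ‖h.fold z - h.fold y‖ := by
    have h2 := norm_fderiv_apply_le φ (h.fold y) (h.fold z - h.fold y)
    have h3 := norm_le_norm_add_norm_sub' (φ (h.fold z) - φ (h.fold y))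
      (fderiv ℝ φ (h.fold y) (h.fold z - h.fold y))
    have h4 := h3.trans (add_le_add h2 hz)
    linarith
  refine h1.trans ?_
  refine (mul_le_mul_of_nonneg_left (h.norm_fold_sub_le z y) (by positivity)).trans ?_
  rw [← mul_assoc]
  refine mul_le_mul_of_nonneg_right (le_of_eq ?_) (norm_nonneg _)
  rw [← hM]
  field_simp

/-- The squared `H¹(U)` norm of a smooth function. -/
def energy (U : Set (E d)) (φ : E d → ℂ) : ℝ≥0∞ :=
  (∫⁻ x in U, ‖φ x‖ₑ ^ 2) + ∫⁻ x in U, ‖cgrad φ x‖ₑ ^ 2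

theorem IsChart.setLIntegral_height_le {h : IsLipGraph e f L} {x : E d} {r : ℝ}
    (hc : IsChart Γ U h x r) (hU : MeasurableSet U) {G : E d → ℝ≥0∞}
    (hG : ∀ y, y ∉ Metric.ball x r → G y = 0) :
    ∫⁻ y in {y | h.height y < 0}, G y ≤ ∫⁻ y in U, G y := by
  rw [← lintegral_indicator (isOpen_lt h.continuous_height continuous_const).measurableSet,
    ← lintegral_indicator hU]
  refine lintegral_mono fun y => ?_
  by_cases hy : y ∈ Metric.ball x r
  · have := hc.mem_iff y hy
    by_cases hyU : y ∈ U
    · rw [indicator_of_mem hyU]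
      exact indicator_le_self _ _ _
    · have hn : y ∉ {y | h.height y < 0} := fun hh => hyU (this.2 hh)
      rw [indicator_of_notMem hn]
      exact zero_le
  · refine (indicator_le_self _ _ _).trans ?_
    rw [hG y hy]
    exact zero_le

/-- The extension is `φ ∘ h.fold`. It is Lipschitz, coincides with `φ` on the boundary, and its norm
depends on the values of `φ` below the graph only. -/
theorem IsChart.exists_extension [IsFiniteMeasure (surf Ω)] (hd : 0 < d) {h : IsLipGraph e f L}
    {x : E d} {r : ℝ} (hc : IsChart (frontier Ω) U h x r) (hU : MeasurableSet U)
    (hx : x ∈ frontier Ω) :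
    ∃ D : ℝ≥0∞, D ≠ ⊤ ∧ ∀ φ : E d → ℂ, IsSmoothC φ →
      tsupport φ ⊆ Metric.closedBall x (r / (4 + 2 * L)) →
      ∃ v : H1 (univ : Set (E d)), HasTrace Ω v φ ∧ ‖v‖ₑ ^ 2 ≤ D * energy U φ := by
  have hr := hc.pos
  -- A point folded into the ball of radius `r₁` started within `(3 + 2 L) r₁ < r` of `x`, so the
  -- extension is supported in the chart ball.
  set r₁ := r / (4 + 2 * (L : ℝ)) with hr₁
  have hL : (0 : ℝ) ≤ L := L.2
  have hr₁0 : 0 < r₁ := by positivity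
  have hrr : (3 + 2 * L) * r₁ < r := by
    have : r = (4 + 2 * L) * r₁ := by rw [hr₁]; field_simp
    nlinarith
  have hhx : h.height x = 0 := (hc.mem_bdry_iff x (Metric.mem_ball_self hr)).1 hx
  have hfold : ∀ y, h.fold y ∈ Metric.closedBall x r₁ → y ∈ Metric.closedBall x ((3 + 2 * L) * r₁) := by
    intro y hy
    rw [mem_closedBall_iff_norm] at hy ⊢
    have h1 := h.abs_height_sub_le (h.fold y) x
    rw [hhx, sub_zero, h.height_fold, abs_neg, abs_abs] at h1
    have h2 : y - x = (h.fold y - x) + (2 * max (h.height y) 0) • e := by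
      unfold IsLipGraph.fold
      abel
    have h3 : max (h.height y) 0 ≤ (1 + L) * r₁ :=
      max_le ((le_abs_self _).trans (h1.trans (by gcongr))) (by positivity)
    rw [h2]
    refine (norm_add_le _ _).trans ?_
    rw [norm_smul, h.norm_eq, mul_one, Real.norm_of_nonneg (by positivity)]
    linarith
  -- Each factor `2` comes from folding the integral; the square is the loss in the gradient.
  set D : ℝ≥0∞ := 2 + 2 * ENNReal.ofReal (√d * (3 + 2 * L)) ^ 2 with hD
  have hDt : D ≠ ⊤ := by
    have : ENNReal.ofReal (√d * (3 + 2 * L)) ≠ ⊤ := ENNReal.ofReal_ne_top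
    finiteness
  refine ⟨D, hDt, fun φ hφ hs => ?_⟩
  have hφ0 : ∀ y, y ∉ Metric.closedBall x r₁ → φ y = 0 := fun y hy =>
    image_eq_zero_of_notMem_tsupport fun hh => hy (hs hh)
  have hφg : ∀ y, y ∉ Metric.closedBall x r₁ → cgrad φ y = 0 := fun y hy => by
    have : fderiv ℝ φ y = 0 := image_eq_zero_of_notMem_tsupport
      fun hh => hy (hs (tsupport_fderiv_subset ℝ hh))
    ext i
    simp [cgrad, this]
  obtain ⟨B, hB⟩ := (hφ.hasCompactSupport.fderiv ℝ).exists_bound_of_continuous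
    (hφ.contDiff.continuous_fderiv (by simp))
  have hφL : LipschitzWith B.toNNReal φ := lipschitzWith_of_nnnorm_fderiv_le hφ.differentiable
    fun x => by rw [← NNReal.coe_le_coe, coe_nnnorm]; exact (hB x).trans (Real.le_coe_toNNReal B)
  have hFL : LipschitzWith (3 + 2 * L) h.fold := LipschitzWith.of_dist_le_mul fun y z => by
    rw [dist_eq_norm, dist_eq_norm]
    simpa using h.norm_fold_sub_le y z
  have hcs : HasCompactSupport (φ ∘ h.fold) :=
    HasCompactSupport.intro (isCompact_closedBall x ((3 + 2 * L) * r₁)) fun y hy =>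
      hφ0 _ fun hh => hy (hfold y hh)
  obtain ⟨v, hv1, hv2⟩ := exists_H1_of_lipschitz (hφL.comp hFL) hcs
  refine ⟨v, (hasTrace_of_lipschitz (hφL.comp hFL) hcs hv1).congr ?_, ?_⟩
  · have hmem : ∀ᵐ y ∂surf Ω, y ∈ frontier Ω := ae_restrict_mem isClosed_frontier.measurableSet
    filter_upwards [hmem] with y hy
    by_cases hyb : y ∈ Metric.ball x r
    · have := (hc.mem_bdry_iff y hyb).1 hy
      rw [Function.comp_apply, h.fold_of_nonpos this.le]
    · have h1 : y ∉ Metric.closedBall x ((3 + 2 * L) * r₁) := fun hh =>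
        hyb (Metric.closedBall_subset_ball hrr hh)
      have h2 : y ∉ Metric.closedBall x r₁ := fun hh =>
        h1 (Metric.closedBall_subset_closedBall (by nlinarith) hh)
      rw [Function.comp_apply, hφ0 _ fun hh => h1 (hfold y hh), hφ0 y h2]
  · have hr₁r : Metric.closedBall x r₁ ⊆ Metric.ball x r :=
      Metric.closedBall_subset_ball (by nlinarith)
    rw [H1.enorm_sq, energy, mul_add]
    simp only [Measure.restrict_univ]
    refine add_le_add ?_ ?_
    · have : ∫⁻ y, ‖fnOf v y‖ₑ ^ 2 = ∫⁻ y, (fun z => ‖φ z‖ₑ ^ 2) (h.fold y) :=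
        lintegral_congr_ae (by filter_upwards [hv1] with y hy; rw [hy]; rfl)
      rw [this]
      refine (h.lintegral_comp_fold_le hd hφ.measurable_sq).trans ?_
      refine mul_le_mul' le_self_add (hc.setLIntegral_height_le hU fun y hy => ?_)
      rw [hφ0 y fun hh => hy (hr₁r hh)]
      simp
    · have : ∫⁻ y, ‖gradOf v y‖ₑ ^ 2 ≤ ∫⁻ y, (fun z => ENNReal.ofReal (√d * (3 + 2 * L)) ^ 2
          * ‖cgrad φ z‖ₑ ^ 2) (h.fold y) := by
        refine lintegral_mono_ae ?_
        filter_upwards [hv2] with y hy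
        rw [hy, ← mul_pow]
        refine pow_le_pow_left₀ zero_le ?_ 2
        rw [← ofReal_norm, ← ofReal_norm, ← ENNReal.ofReal_mul (by positivity)]
        exact ENNReal.ofReal_le_ofReal (h.norm_cgrad_comp_fold_le hφ y)
      refine this.trans ?_
      refine (h.lintegral_comp_fold_le hd (hφ.measurable_cgrad_sq.const_mul _)).trans ?_
      rw [lintegral_const_mul _ hφ.measurable_cgrad_sq, ← mul_assoc]
      refine mul_le_mul' le_add_self (hc.setLIntegral_height_le hU fun y hy => ?_)
      rw [hφg y fun hh => hy (hr₁r hh)]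
      simp

end Reflection

end HeatTransmission

end

/-! ### The trace operators -/

noncomputable section

namespace HeatTransmission

open MeasureTheory Set Filter Topology
open scoped ContDiff ENNReal NNReal

section GraphOperators

variable {X Y : Type*} [NormedAddCommGroup X] [NormedSpace ℂ X] [NormedAddCommGroup Y]
  [NormedSpace ℂ Y]

/-- A closed bounded linear relation which is defined on a dense subspace is everywhere defined. -/
theorem exists_mem_of_dense [CompleteSpace X] [CompleteSpace Y] {T : Submodule ℂ (X × Y)}
    (hT : IsClosed (T : Set (X × Y))) {C : ℝ} (hb : ∀ p ∈ T, ‖p.2‖ ≤ C * ‖p.1‖)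
    {D : Submodule ℂ X} (hD : D.topologicalClosure = ⊤) (hDT : ∀ x ∈ D, ∃ y, (x, y) ∈ T) (x : X) :
    ∃ y, (x, y) ∈ T := by
  have hTc : CompleteSpace T := hT.completeSpace_coe
  let F : T → X := fun p => p.1.1
  have hanti : AntilipschitzWith (max 1 C).toNNReal F := AntilipschitzWith.of_le_mul_dist fun p q => by
    have h1 := hb (p.1 - q.1) (T.sub_mem p.2 q.2)
    have h0 : 0 ≤ ‖(p.1 - q.1).1‖ := norm_nonneg _
    rw [Subtype.dist_eq, dist_eq_norm, dist_eq_norm, Real.coe_toNNReal _ (by positivity), Prod.norm_def]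
    change _ ≤ _ * ‖(p.1 - q.1).1‖
    refine max_le ?_ (h1.trans ?_)
    · exact le_mul_of_one_le_left h0 (le_max_left _ _)
    · exact mul_le_mul_of_nonneg_right (le_max_right _ _) h0
  have hF : UniformContinuous F := uniformContinuous_fst.comp uniformContinuous_subtype_val
  have hcl : IsClosed (range F) := hanti.isClosed_range hF
  have hx : x ∈ D.topologicalClosure := by rw [hD]; trivial
  have : x ∈ range F := closure_minimal (fun z hz => by
    obtain ⟨y, hy⟩ := hDT z hz
    exact ⟨⟨(z, y), hy⟩, rfl⟩) hcl hx
  obtain ⟨p, rfl⟩ := this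
  exact ⟨p.1.2, p.2⟩

/-- An everywhere defined bounded linear relation is the graph of a bounded operator. -/
theorem exists_clm_of_graph {T : Submodule ℂ (X × Y)} (htot : ∀ x, ∃ y, (x, y) ∈ T) {C : ℝ}
    (hb : ∀ p ∈ T, ‖p.2‖ ≤ C * ‖p.1‖) :
    ∃ A : X →L[ℂ] Y, ∀ x y, (x, y) ∈ T ↔ y = A x := by
  choose a ha using htot
  have huniq : ∀ x y z, (x, y) ∈ T → (x, z) ∈ T → y = z := fun x y z h k => by
    have h1 := hb ((x, y) - (x, z)) (T.sub_mem h k)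
    rw [Prod.mk_sub_mk, sub_self, norm_zero, mul_zero] at h1
    exact sub_eq_zero.1 (norm_le_zero_iff.1 h1)
  let A₀ : X →ₗ[ℂ] Y :=
    { toFun := a
      map_add' := fun x y => huniq (x + y) _ _ (ha _) (T.add_mem (ha x) (ha y))
      map_smul' := fun c x => huniq (c • x) _ _ (ha _) (T.smul_mem c (ha x)) }
  exact ⟨A₀.mkContinuous C fun x => hb _ (ha x), fun x y =>
    ⟨fun h => huniq x _ _ h (ha x), fun h => h ▸ ha x⟩⟩

end GraphOperators

/-! ### Bounded extension from a side, and the one-sided trace operators into `L²(Γ)` and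
`H^{1/2}_Γ` -/

section Traces

variable {d : ℕ} {O U W Ω : Set (E d)}

theorem IsCutoff.isSmoothC_smul {χ : E d → ℝ} (hχ : IsCutoff χ) {φ : E d → ℂ} (hφ : IsSmoothC φ) :
    IsSmoothC fun x => χ x • φ x :=
  ⟨hχ.contDiff.smul hφ.contDiff, hφ.hasCompactSupport.smul_left (f := χ)⟩

theorem cgrad_smul {χ : E d → ℝ} (hχ : Differentiable ℝ χ) {φ : E d → ℂ} (hφ : Differentiable ℝ φ)
    (x : E d) : cgrad (fun x => χ x • φ x) x = χ x • cgrad φ x + φ x • rgrad χ x := by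
  have h1 := ((hχ x).hasFDerivAt.smul (hφ x).hasFDerivAt).fderiv
  have h2 : fderiv ℝ (fun x => χ x • φ x) x = _ := h1
  ext i
  change fderiv ℝ (fun x => χ x • φ x) x _ = _
  rw [h2]
  simp [cgrad, rgrad, pderiv, mul_comm]

theorem IsCutoff.energy_le {χ : E d → ℝ} (hχ : IsCutoff χ) :
    ∃ D : ℝ≥0∞, D ≠ ⊤ ∧ ∀ (U : Set (E d)) (φ : E d → ℂ), IsSmoothC φ →
      energy U (fun x => χ x • φ x) ≤ D * energy U φ := by
  obtain ⟨B, hB⟩ := hχ.bounded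
  obtain ⟨C, hC⟩ := hχ.bounded_fderiv
  set b : ℝ≥0∞ := ENNReal.ofReal B with hb
  set c : ℝ≥0∞ := ENNReal.ofReal (√d * C) with hc
  have hbt : b ≠ ⊤ := ENNReal.ofReal_ne_top
  have hct : c ≠ ⊤ := ENNReal.ofReal_ne_top
  refine ⟨b ^ 2 + 2 * c ^ 2 + 2 * b ^ 2, by finiteness, fun U φ hφ => ?_⟩
  have hχb : ∀ x, ‖χ x‖ₑ ≤ b := fun x => by
    rw [← ofReal_norm]
    exact ENNReal.ofReal_le_ofReal (hB x)
  have hχc : ∀ x, ‖rgrad χ x‖ₑ ≤ c := fun x => by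
    rw [← ofReal_norm]
    exact ENNReal.ofReal_le_ofReal ((norm_rgrad_le _ _).trans
      (mul_le_mul_of_nonneg_left (hC x) (Real.sqrt_nonneg _)))
  have h1 : ∫⁻ x in U, ‖χ x • φ x‖ₑ ^ 2 ≤ b ^ 2 * ∫⁻ x in U, ‖φ x‖ₑ ^ 2 := by
    rw [← lintegral_const_mul _ hφ.measurable_sq]
    refine lintegral_mono fun x => ?_
    rw [enorm_smul, mul_pow]
    gcongr
    exact hχb x
  have h2 : ∫⁻ x in U, ‖cgrad (fun x => χ x • φ x) x‖ₑ ^ 2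
      ≤ 2 * b ^ 2 * (∫⁻ x in U, ‖cgrad φ x‖ₑ ^ 2) + 2 * c ^ 2 * ∫⁻ x in U, ‖φ x‖ₑ ^ 2 := by
    rw [← lintegral_const_mul _ hφ.measurable_sq, ← lintegral_const_mul _ hφ.measurable_cgrad_sq,
      ← lintegral_add_left (hφ.measurable_cgrad_sq.const_mul _)]
    refine lintegral_mono fun x => ?_
    rw [cgrad_smul hχ.differentiable hφ.differentiable]
    refine (pow_le_pow_left₀ zero_le (enorm_add_le _ _) 2).trans ((add_sq_le_two _ _).trans ?_)
    rw [enorm_smul, enorm_smul, mul_pow, mul_pow, mul_assoc, mul_assoc, mul_comm (‖φ x‖ₑ ^ 2)]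
    gcongr
    · exact hχb x
    · exact hχc x
  unfold energy
  refine (add_le_add h1 h2).trans ?_
  rw [mul_add, add_mul, add_mul, add_mul, add_mul]
  rw [show ∀ p q r s t v : ℝ≥0∞, p + q + r + (s + t + v) = (p + (v + q)) + (r + s + t) from
    fun p q r s t v => by ring]
  exact le_self_add

theorem energy_mono (h : U ⊆ W) (φ : E d → ℂ) : energy U φ ≤ energy W φ :=
  add_le_add (lintegral_mono_set h) (lintegral_mono_set h)

theorem IsSide.isFiniteMeasure_surf (hS : IsSide (frontier Ω) U) (hd : 0 < d) :
    IsFiniteMeasure (surf Ω) :=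
  ⟨by rw [surf, Measure.restrict_apply_univ]; exact hS.measure_lt_top hd⟩

/-- Bounded extension operators from a side to the whole space, with the same trace. -/
theorem IsSide.exists_extension (hS : IsSide (frontier Ω) U) (hd : 0 < d) :
    ∃ D : ℝ≥0∞, D ≠ ⊤ ∧ ∀ φ : E d → ℂ, IsSmoothC φ →
      ∃ v : H1 (univ : Set (E d)), HasTrace Ω v φ ∧ ‖v‖ₑ ^ 2 ≤ D * energy U φ := by
  have hfin := hS.isFiniteMeasure_surf hd
  choose! e f L h r hc using hS.exists_chart
  set s : E d → ℝ := fun x => r x / (4 + 2 * L x) with hs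
  have hs0 : ∀ x ∈ frontier Ω, 0 < s x := fun x hx => by
    have := (hc x hx).pos
    have hL : (0 : ℝ) ≤ L x := (L x).2
    positivity
  obtain ⟨t, ht, hcov⟩ := hS.isCompact.elim_nhds_subcover (fun x => Metric.ball x (s x / 2))
    fun x hx => Metric.ball_mem_nhds x (by have := hs0 x hx; positivity)
  -- Chart by chart, the bump times the current function is extended by reflection, and `1 - bump`
  -- times it is carried on. Each step costs a fixed factor in energy, and at the end `φ'` vanishes
  -- on `Γ`, so the collected extension has trace `φ`.
  have peel : ∀ t : Finset (E d), (∀ x ∈ t, x ∈ frontier Ω) → ∃ D : ℝ≥0∞, D ≠ ⊤ ∧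
      ∀ φ : E d → ℂ, IsSmoothC φ → ∃ φ' : E d → ℂ, IsSmoothC φ' ∧ energy U φ' ≤ D * energy U φ ∧
        (∀ x ∈ t, ∀ y ∈ Metric.ball x (s x / 2), φ' y = 0) ∧
        ∃ v : H1 (univ : Set (E d)), HasTrace Ω v (fun x => φ x - φ' x) ∧
          ‖v‖ₑ ^ 2 ≤ D * energy U φ := by
    intro t
    induction t using Finset.induction_on with
    | empty =>
      refine fun _ => ⟨1, by simp, fun φ hφ => ⟨φ, hφ, by rw [one_mul], by simp, 0, ?_, by simp⟩⟩
      refine ⟨0, ?_, Submodule.zero_mem _⟩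
      filter_upwards [Lp.coeFn_zero ℂ 2 (surf Ω)] with x hx
      rw [hx, sub_self]
      rfl
    | insert x t hxt ih =>
      intro hΓ
      obtain ⟨D₁, hD₁, H₁⟩ := ih fun y hy => hΓ y (Finset.mem_insert_of_mem hy)
      have hx := hΓ x (Finset.mem_insert_self x t)
      have hsx := hs0 x hx
      let b : ContDiffBump x := ⟨s x / 2, s x, by positivity, by linarith⟩
      have hb := IsCutoff.of_hasCompactSupport b.contDiff b.hasCompactSupport
      have hb' : IsCutoff fun y => 1 - b y := by
        obtain ⟨B, hB⟩ := hb.bounded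
        obtain ⟨C, hC⟩ := hb.bounded_fderiv
        refine ⟨contDiff_const.sub b.contDiff, ⟨1 + B, fun y => ?_⟩, ⟨C, fun y => ?_⟩⟩
        · refine (abs_sub _ _).trans ?_
          rw [abs_one]
          linarith [hB y]
        · rw [fderiv_const_sub, norm_neg]
          exact hC y
      obtain ⟨D₂, hD₂, H₂⟩ := hb.energy_le
      obtain ⟨D₃, hD₃, H₃⟩ := hb'.energy_le
      obtain ⟨D₄, hD₄, H₄⟩ := (hc x hx).exists_extension hd hS.isOpen.measurableSet hx
      refine ⟨D₃ * D₁ + (2 * D₁ + 2 * (D₄ * (D₂ * D₁))), by finiteness, fun φ hφ => ?_⟩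
      obtain ⟨φ', h1, h2, h3, v, hv, h4⟩ := H₁ φ hφ
      obtain ⟨w, hw, h5⟩ := H₄ _ (hb.isSmoothC_smul h1) <| by
        refine (closure_mono (Function.support_smul_subset_left (fun y => b y) φ')).trans ?_
        exact b.tsupport_eq.le
      have e1 : energy U (fun y => (1 - b y) • φ' y) ≤ D₃ * D₁ * energy U φ := by
        rw [mul_assoc]
        exact (H₃ U φ' h1).trans (mul_le_mul_right h2 _)
      have e2 : ‖w‖ₑ ^ 2 ≤ D₄ * (D₂ * D₁) * energy U φ := by
        rw [mul_assoc, mul_assoc]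
        exact h5.trans (mul_le_mul_right ((H₂ U φ' h1).trans (mul_le_mul_right h2 _)) _)
      refine ⟨fun y => (1 - b y) • φ' y, hb'.isSmoothC_smul h1, ?_, ?_, v + w, ?_, ?_⟩
      · rw [add_mul]
        exact e1.trans le_self_add
      · intro z hz y hy
        rcases Finset.mem_insert.1 hz with rfl | hz
        · change (1 - b y) • φ' y = 0
          rw [b.one_of_mem_closedBall (Metric.ball_subset_closedBall hy), sub_self, zero_smul]
        · change (1 - b y) • φ' y = 0
          rw [h3 z hz y hy, smul_zero]
      · refine (hv.add hw).congr (Eventually.of_forall fun y => ?_)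
        simp only [sub_smul, one_smul]
        ring
      · rw [add_mul, add_mul, mul_assoc 2, mul_assoc 2]
        refine le_trans ?_ le_add_self
        refine (pow_le_pow_left₀ zero_le (enorm_add_le v w) 2).trans ((add_sq_le_two _ _).trans ?_)
        gcongr
  obtain ⟨D, hD, H⟩ := peel t ht
  refine ⟨D, hD, fun φ hφ => ?_⟩
  obtain ⟨φ', -, -, h3, v, hv, h4⟩ := H φ hφ
  refine ⟨v, hv.congr ?_, h4⟩
  have hmem : ∀ᵐ y ∂surf Ω, y ∈ frontier Ω := ae_restrict_mem isClosed_frontier.measurableSet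
  filter_upwards [hmem] with y hy
  obtain ⟨x, hx, hyx⟩ := mem_iUnion₂.1 (hcov hy)
  rw [h3 x hx y hyx, sub_zero]

theorem norm_le_of_enorm_sq_le {X Y : Type*} [NormedAddCommGroup X] [NormedAddCommGroup Y] {x : X}
    {y : Y} {D : ℝ≥0∞} (hD : D ≠ ⊤) (h : ‖x‖ₑ ^ 2 ≤ D * ‖y‖ₑ ^ 2) :
    ‖x‖ ≤ √D.toReal * ‖y‖ := by
  have h1 := ENNReal.toReal_mono (by finiteness) h
  rw [ENNReal.toReal_mul, ENNReal.toReal_pow, ENNReal.toReal_pow, toReal_enorm, toReal_enorm] at h1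
  refine le_of_sq_le_sq ?_ (by positivity)
  rw [mul_pow, Real.sq_sqrt ENNReal.toReal_nonneg]
  exact h1

/-- The trace inequality for the trace relations. -/
theorem IsSide.norm_trace_le (hS : IsSide (frontier Ω) W) (hd : 0 < d) (hU : IsClopenIn O U)
    (hWU : W ⊆ U) : ∃ C : ℝ, ∀ p ∈ traceGraph Ω O U, ‖p.2‖ ≤ C * ‖p.1‖ := by
  obtain ⟨D, hD, H⟩ := hS.trace_le hd
  refine ⟨√D.toReal, fun p hp => ?_⟩
  refine closure_minimal (t := {p : H1 O × Lp ℂ 2 (surf Ω) | ‖p.2‖ ≤ √D.toReal * ‖p.1‖}) ?_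
    (isClosed_le (by fun_prop) (by fun_prop)) hp
  rintro q ⟨φ, h1, h2, h3, h4⟩
  have hφ : IsSmoothC φ := ⟨h1, h2⟩
  refine (norm_le_of_enorm_sq_le hD (y := cutL hU q.1) ?_).trans
    (mul_le_mul_of_nonneg_left (norm_cutL_le hU q.1) (Real.sqrt_nonneg _))
  rw [enorm_cutL_sq_of_smooth hU hφ h3, enorm_sq_Lp]
  have e1 : ∫⁻ x, ‖q.2 x‖ₑ ^ 2 ∂surf Ω = ∫⁻ x, ‖φ x‖ₑ ^ 2 ∂surf Ω :=
    lintegral_congr_ae (by filter_upwards [h4] with x hx; rw [hx])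
  rw [e1]
  exact (H φ hφ).trans (mul_le_mul_right (energy_mono hWU φ) D)

theorem exists_mem_traceGraph_of_smooth [IsFiniteMeasure (surf Ω)] {u : H1 O}
    (hu : u ∈ smoothSub O U) : ∃ g, (u, g) ∈ traceGraph Ω O U := by
  obtain ⟨φ, hφ, h⟩ := hu
  have hm : MemLp φ 2 (surf Ω) := hφ.memLp
  exact ⟨hm.toLp φ, mem_traceGraph_of_smooth hφ h hm.coeFn_toLp⟩

/-- The `L²(Γ)`-trace operator of a side. -/
theorem IsSide.exists_trace (hS : IsSide (frontier Ω) U) (hd : 0 < d)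
    (hU : IsClopenIn (offGamma Ω) U) :
    ∃ A : H1 (offGamma Ω) →L[ℂ] Lp ℂ 2 (surf Ω),
      ∀ u g, (u, g) ∈ traceGraph Ω (offGamma Ω) U ↔ g = A u := by
  have hfin := hS.isFiniteMeasure_surf hd
  obtain ⟨C, hC⟩ := hS.norm_trace_le hd hU le_rfl
  exact exists_clm_of_graph (exists_mem_of_dense (isClosed_traceGraph _ _ _) hC
    (hS.closure_smoothSub hU rfl) fun u hu => exists_mem_traceGraph_of_smooth hu) hC

/-- The `L²(Γ)`-trace operator of the whole space. -/
theorem IsSide.exists_trace_univ (hS : IsSide (frontier Ω) U) (hd : 0 < d) :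
    ∃ A : H1 (univ : Set (E d)) →L[ℂ] Lp ℂ 2 (surf Ω),
      ∀ v g, (v, g) ∈ traceGraph Ω univ univ ↔ g = A v := by
  have hfin := hS.isFiniteMeasure_surf hd
  have hU := isClopenIn_self (isOpen_univ (X := E d))
  obtain ⟨C, hC⟩ := hS.norm_trace_le hd hU (subset_univ _)
  exact exists_clm_of_graph (exists_mem_of_dense (isClosed_traceGraph _ _ _) hC
    (isSide_empty_univ.closure_smoothSub hU (by simp))
      fun u hu => exists_mem_traceGraph_of_smooth hu) hC

instance (Ω : Set (E d)) : CompleteSpace (H12 Ω) :=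
  inferInstanceAs (CompleteSpace (H1 (univ : Set (E d)) ⧸ traceKer Ω))

theorem isOpenQuotientMap_traceOp (Ω : Set (E d)) : IsOpenQuotientMap (traceOp Ω) :=
  (traceKer Ω).isOpenQuotientMap_mkQ

theorem traceOp_surjective (Ω : Set (E d)) : Function.Surjective (traceOp Ω) :=
  (traceKer Ω).mkQ_surjective

theorem traceOp_eq_zero_iff {v : H1 (univ : Set (E d))} :
    traceOp Ω v = 0 ↔ (v, (0 : Lp ℂ 2 (surf Ω))) ∈ traceGraph Ω univ univ :=
  Submodule.Quotient.mk_eq_zero (traceKer Ω)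

theorem norm_traceOp_le (v : H1 (univ : Set (E d))) : ‖traceOp Ω v‖ ≤ ‖v‖ :=
  Submodule.Quotient.norm_mk_le (traceKer Ω) v

/-- Linear maps which vanish on the kernel of the trace operator factor through it. -/
theorem exists_factor_traceOp {Y : Type*} [NormedAddCommGroup Y] [NormedSpace ℂ Y] {σ : ℂ →+* ℂ}
    (A : H1 (univ : Set (E d)) →SL[σ] Y) (hA : ∀ v, traceOp Ω v = 0 → A v = 0) :
    ∃ B : H12 Ω →SL[σ] Y, ∀ v, B (traceOp Ω v) = A v := by
  let B₀ : H12 Ω →ₛₗ[σ] Y := (traceKer Ω).liftQ A.toLinearMap fun v hv =>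
    hA v (traceOp_eq_zero_iff.2 hv)
  have hB : ∀ v, B₀ (traceOp Ω v) = A v := fun v => rfl
  refine ⟨⟨B₀, ?_⟩, hB⟩
  have h1 : Continuous (B₀ ∘ traceOp Ω) := A.continuous
  exact (isOpenQuotientMap_traceOp Ω).isQuotientMap.continuous_iff.2 h1

/-- The bounded trace operator from a side into `H^{1/2}_Γ`. -/
theorem IsSide.exists_sideTrace (hS : IsSide (frontier Ω) U) (hd : 0 < d)
    (hU : IsClopenIn (offGamma Ω) U) :
    ∃ γ : H1 (offGamma Ω) →L[ℂ] H12 Ω, (∀ u c, (u, c) ∈ sideTrace Ω U ↔ c = γ u) ∧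
      (∀ u, γ (cutL hU u) = γ u) ∧
      ∀ v, γ (resL hU.isOpen_right (subset_univ _) v) = traceOp Ω v := by
  have hfin := hS.isFiniteMeasure_surf hd
  obtain ⟨A, hA⟩ := hS.exists_trace_univ hd
  obtain ⟨a, ha⟩ := hS.exists_trace hd hU
  have hker : ∀ v, traceOp Ω v = 0 ↔ A v = 0 := fun v => by
    rw [traceOp_eq_zero_iff, hA, eq_comm]
  obtain ⟨B, hB⟩ := exists_factor_traceOp (Ω := Ω) A fun v hv => (hker v).1 hv
  -- `B` is the embedding of `H^{1/2}_Γ` into `L²(Γ)`; injectivity allows identities in `H^{1/2}_Γ`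
  -- to be checked on `L²` traces.
  have hBinj : ∀ c c', B c = B c' → c = c' := fun c c' h => by
    obtain ⟨v, rfl⟩ := traceOp_surjective Ω c
    obtain ⟨v', rfl⟩ := traceOp_surjective Ω c'
    rw [hB, hB, ← sub_eq_zero, ← map_sub, ← hker, map_sub, sub_eq_zero] at h
    exact h
  have hside : ∀ u c, (u, c) ∈ sideTrace Ω U ↔ a u = B c := fun u c => by
    constructor
    · rintro ⟨v, g, h1, h2, h3⟩
      rw [ha] at h1
      rw [hA] at h2
      change traceOp Ω v = c at h3
      rw [← h3, hB, ← h2, h1]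
    · intro h
      obtain ⟨v, rfl⟩ := traceOp_surjective Ω c
      exact ⟨v, a u, (ha _ _).2 rfl, (hA _ _).2 (by rw [h, hB]), rfl⟩
  obtain ⟨D, hD, H⟩ := hS.exists_extension hd
  -- On functions smooth in `U` the extension provides a bound in the quotient norm. The bound
  -- passes to the closure of `R`, and density makes this closure everywhere defined.
  let R : Submodule ℂ (H1 (offGamma Ω) × H12 Ω) :=
    { carrier := {p | p ∈ sideTrace Ω U ∧ p.1 ∈ smoothSub (offGamma Ω) U}
      zero_mem' := ⟨Submodule.zero_mem _, Submodule.zero_mem _⟩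
      add_mem' := fun h k => ⟨Submodule.add_mem _ h.1 k.1, Submodule.add_mem _ h.2 k.2⟩
      smul_mem' := fun c p h => ⟨Submodule.smul_mem _ c h.1, Submodule.smul_mem _ c h.2⟩ }
  have hsm : ∀ (u : H1 (offGamma Ω)) (φ : E d → ℂ), IsSmoothC φ →
      (∀ᵐ x ∂volume.restrict (offGamma Ω), x ∈ U → fnOf u x = φ x) →
      ∀ v, HasTrace Ω v φ → (u, traceOp Ω v) ∈ sideTrace Ω U := by
    rintro u φ hφ hu v ⟨g, h1, h2⟩
    exact ⟨v, g, mem_traceGraph_of_smooth hφ hu h1, h2, rfl⟩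
  have hRb : ∀ p ∈ R, ‖p.2‖ ≤ √D.toReal * ‖p.1‖ := by
    rintro ⟨u, c⟩ ⟨h1, φ, hφ, hu⟩
    obtain ⟨v, hv1, hv2⟩ := H φ hφ
    have hc : c = traceOp Ω v := hBinj _ _ (by
      rw [← (hside u c).1 h1, ← (hside u _).1 (hsm u φ hφ hu v hv1)])
    change ‖c‖ ≤ _ * ‖u‖
    rw [hc]
    refine (norm_traceOp_le v).trans ((norm_le_of_enorm_sq_le hD (y := cutL hU u) ?_).trans
      (mul_le_mul_of_nonneg_left (norm_cutL_le hU u) (Real.sqrt_nonneg _)))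
    rw [enorm_cutL_sq_of_smooth hU hφ hu]
    exact hv2
  have hRb' : ∀ p ∈ R.topologicalClosure, ‖p.2‖ ≤ √D.toReal * ‖p.1‖ := fun p hp =>
    closure_minimal (t := {p : H1 (offGamma Ω) × H12 Ω | ‖p.2‖ ≤ √D.toReal * ‖p.1‖}) hRb
      (isClosed_le (by fun_prop) (by fun_prop)) hp
  have htot := exists_mem_of_dense R.isClosed_topologicalClosure hRb'
    (hS.closure_smoothSub hU rfl) fun u hu => by
      obtain ⟨φ, hφ, h⟩ := hu
      obtain ⟨v, hv1, hv2⟩ := H φ hφ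
      exact ⟨traceOp Ω v, subset_closure ⟨hsm u φ hφ h v hv1, φ, hφ, h⟩⟩
  obtain ⟨γ, hγ⟩ := exists_clm_of_graph htot hRb'
  -- Both sides are continuous and agree on `R`; hence the operator obtained from the closure has
  -- the side trace relation as its graph.
  have hγB : ∀ u, a u = B (γ u) := fun u => by
    have : (u, γ u) ∈ R.topologicalClosure := (hγ _ _).2 rfl
    exact closure_minimal (t := {p : H1 (offGamma Ω) × H12 Ω | a p.1 = B p.2})
      (fun p hp => (hside _ _).1 hp.1) (isClosed_eq (by fun_prop) (by fun_prop)) this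
  refine ⟨γ, fun u c => ?_, fun u => ?_, fun v => ?_⟩
  · rw [hside, hγB]
    exact ⟨fun h => (hBinj _ _ h).symm, fun h => by rw [h]⟩
  · refine hBinj _ _ ?_
    rw [← hγB, ← hγB]
    have hcl : ∀ p ∈ traceGraph Ω (offGamma Ω) U, a (cutL hU p.1) = a p.1 := fun p hp =>
      closure_minimal (t := {p : H1 (offGamma Ω) × Lp ℂ 2 (surf Ω) | a (cutL hU p.1) = a p.1})
        (by
          rintro q ⟨φ, h1, h2, h3, h4⟩
          have e1 := (ha _ _).1 (mem_traceGraph_of_smooth ⟨h1, h2⟩ h3 h4)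
          have e2 := (ha _ _).1 (mem_traceGraph_of_smooth (u := cutL hU q.1) ⟨h1, h2⟩ (by
            filter_upwards [fnOf_cutL hU q.1, h3] with x e1 e2 hx
            rw [e1, indicator_of_mem hx, e2 hx]) h4)
          exact e2.symm.trans e1)
        (isClosed_eq (by fun_prop) (by fun_prop)) hp
    exact hcl (u, a u) ((ha _ _).2 rfl)
  · refine hBinj _ _ ?_
    rw [← hγB, hB]
    have hcl : ∀ p ∈ traceGraph Ω univ univ,
        a (resL hU.isOpen_right (subset_univ _) p.1) = A p.1 := fun p hp =>
      closure_minimal (t := {p : H1 (univ : Set (E d)) × Lp ℂ 2 (surf Ω) |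
          a (resL hU.isOpen_right (subset_univ _) p.1) = A p.1})
        (by
          rintro q ⟨φ, h1, h2, h3, h4⟩
          have e1 := (hA _ _).1 (mem_traceGraph_of_smooth ⟨h1, h2⟩ h3 h4)
          have e2 := (ha _ _).1 (mem_traceGraph_of_smooth
            (u := resL hU.isOpen_right (subset_univ _) q.1) ⟨h1, h2⟩ (by
              have h3' := ae_mono (Measure.restrict_mono (subset_univ (offGamma Ω)) le_rfl) h3
              filter_upwards [fnOf_resL hU.isOpen_right (subset_univ _) q.1, h3'] with x e1 e2 hx
              rw [e1, e2 (mem_univ x)]) h4)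
          exact e2.symm.trans e1)
        (isClosed_eq (by fun_prop) (by fun_prop)) hp
    exact hcl (v, A v) ((hA _ _).2 rfl)

end Traces

end HeatTransmission

end

/-! ### Green's identity for functions with vanishing trace -/

noncomputable section

namespace HeatTransmission

open MeasureTheory Set Filter Topology
open scoped ContDiff ENNReal NNReal

section Green

variable {d : ℕ} {O U W Ω Γ : Set (E d)}

/-- Smooth cutoff functions concentrated near `Γ`. -/
theorem exists_cutoff_near (Γ : Set (E d)) {ε : ℝ} (hε : 0 < ε) :
    ∃ χ : E d → ℝ, ContDiff ℝ ∞ χ ∧ (∀ x, |χ x| ≤ 1) ∧ (∀ x, ‖fderiv ℝ χ x‖ ≤ 2 / ε) ∧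
      (∀ x ∈ Metric.thickening (ε / 8) Γ, χ x = 1) ∧ ∀ x, x ∉ Metric.cthickening ε Γ → χ x = 0 := by
  have hε2 : 0 < ε / 2 := by positivity
  -- The plateau has width `ε/4`, the linear ramp `ε/2`, the mollifier radius `ε/8`. So the result
  -- is `1` within `ε/8` of `Γ`, vanishes beyond `7ε/8`, and has slope at most `2/ε`.
  set T : Set (E d) := Metric.cthickening (ε / 4) Γ with hT
  let g : E d → ℝ := fun x => (thickenedIndicator hε2 T x : ℝ)
  have hgL : LipschitzWith (ε / 2).toNNReal⁻¹ g := by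
    have := lipschitzWith_thickenedIndicator hε2 T
    exact fun x y => this x y
  have hg0 : ∀ x, 0 ≤ g x := fun x => (thickenedIndicator hε2 T x).2
  have hg1 : ∀ x, g x ≤ 1 := fun x => by exact_mod_cast thickenedIndicator_le_one hε2 T x
  have hε8 : 0 < ε / 8 := by positivity
  obtain ⟨k, hk⟩ := exists_isKernel (0 : E d) hε8
  have hgl : LocallyIntegrable g := hgL.continuous.locallyIntegrable
  have hI := fun y => hk.integrable_smul hgl y
  have hconst : ∀ (y : E d) (c : ℝ), (∀ z, ‖z‖ ≤ ε / 8 → g (y - z) = c) → moll k g y = c := by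
    intro y c hc
    have : ∀ z, k z • g (y - z) = k z • c := fun z => by
      by_cases hz : z ∈ tsupport k
      · rw [hc z (by simpa using hk.tsupport_subset hz)]
      · rw [image_eq_zero_of_notMem_tsupport hz, zero_smul, zero_smul]
    rw [moll_apply, integral_congr_ae (Eventually.of_forall this), integral_smul_const,
      hk.integral_eq, one_smul]
  have hkI : Integrable k := hk.contDiff.continuous.integrable_of_hasCompactSupport
    hk.hasCompactSupport
  have hlip : LipschitzWith (ε / 2).toNNReal⁻¹ (moll k g) := by
    refine LipschitzWith.of_dist_le_mul fun x y => ?_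
    rw [dist_eq_norm, moll_apply, moll_apply, ← integral_sub (hI x) (hI y)]
    refine (norm_integral_le_of_norm_le (g := fun z => k z * (((ε / 2).toNNReal⁻¹ : ℝ≥0) * dist x y))
      (hkI.mul_const _) (Eventually.of_forall fun z => ?_)).trans (le_of_eq ?_)
    · rw [← smul_sub, norm_smul, Real.norm_of_nonneg (hk.nonneg z)]
      refine mul_le_mul_of_nonneg_left ?_ (hk.nonneg z)
      have := hgL.dist_le_mul (x - z) (y - z)
      rwa [dist_sub_right, dist_eq_norm] at this
    · rw [integral_mul_const, hk.integral_eq, one_mul]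
  refine ⟨moll k g, hk.hasCompactSupport.contDiff_convolution_left _ hk.contDiff hgl, fun x => ?_,
    fun x => ?_, fun x hx => ?_, fun x hx => ?_⟩
  · rw [moll_apply, ← Real.norm_eq_abs]
    refine (norm_integral_le_of_norm_le (g := k) hkI (Eventually.of_forall fun z => ?_)).trans
      hk.integral_eq.le
    rw [norm_smul, Real.norm_of_nonneg (hk.nonneg z), Real.norm_of_nonneg (hg0 _)]
    exact mul_le_of_le_one_right (hk.nonneg z) (hg1 _)
  · refine (norm_fderiv_le_of_lipschitz ℝ hlip).trans (le_of_eq ?_)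
    rw [NNReal.coe_inv, Real.coe_toNNReal _ hε2.le, inv_div]
  · refine hconst x 1 fun z hz => ?_
    have : x - z ∈ T := by
      obtain ⟨y, hy, hxy⟩ := Metric.mem_thickening_iff.1 hx
      refine Metric.mem_cthickening_of_dist_le (x - z) y _ Γ hy ?_
      rw [dist_eq_norm] at hxy ⊢
      have h1 : x - z - y = (x - y) - z := by abel
      rw [h1]
      linarith [norm_sub_le (x - y) z]
    change ((thickenedIndicator hε2 T (x - z) : ℝ≥0) : ℝ) = 1
    rw [thickenedIndicator_one hε2 T this, NNReal.coe_one]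
  · refine hconst x 0 fun z hz => ?_
    have : x - z ∉ Metric.thickening (ε / 2) T := fun hh => by
      obtain ⟨y, hy, hxy⟩ := Metric.mem_thickening_iff.1 hh
      have h2 : Metric.infEDist x Γ ≤ ENNReal.ofReal ε := by
        have h3 : Metric.infEDist y Γ ≤ ENNReal.ofReal (ε / 4) := hy
        have h4 : edist x y ≤ ENNReal.ofReal (5 * ε / 8) := by
          rw [edist_dist]
          refine ENNReal.ofReal_le_ofReal ?_
          rw [dist_eq_norm] at hxy ⊢
          have h1 : x - y = (x - z - y) + z := by abel
          rw [h1]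
          linarith [norm_add_le (x - z - y) z]
        refine Metric.infEDist_le_edist_add_infEDist.trans ((add_le_add h4 h3).trans ?_)
        rw [← ENNReal.ofReal_add (by positivity) (by positivity)]
        exact ENNReal.ofReal_le_ofReal (by linarith)
      exact hx h2
    change ((thickenedIndicator hε2 T (x - z) : ℝ≥0) : ℝ) = 0
    rw [thickenedIndicator_zero hε2 T this, NNReal.coe_zero]

/-- The form `v ↦ (∇w, ∇v) + (Δw, v)`, antilinear in `v`. -/
def greenL (w : H1Lap O) : H1 O →SL[starRingEnd ℂ] ℂ :=
  ((innerSLFlip ℂ (gradOf (toH1 w))).comp gradOfL) + ((innerSLFlip ℂ (lapOf w)).comp fnOfL)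

theorem greenL_apply (w : H1Lap O) (v : H1 O) :
    greenL w v = inner ℂ (gradOf v) (gradOf (toH1 w)) + inner ℂ (fnOf v) (lapOf w) := rfl

theorem H1Lap.weak_div (w : H1Lap O) {φ : E d → ℝ} (hφ : IsTest O φ) :
    ∫ x in O, ∑ i, pderiv i φ x • gradOf (toH1 w) x i = -∫ x in O, φ x • lapOf w x := w.2 φ hφ

/-- The pairing of `p ∈ L²(O)ᵈ`, `f ∈ L²(O)` with a real test function. -/
theorem inner_test_eq {φ : E d → ℝ} {v : H1 O}
    (hv : fnOf v =ᵐ[volume.restrict O] fun x => (φ x : ℂ))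
    (hg : gradOf v =ᵐ[volume.restrict O] rgrad φ) (p : L2v O) (f : L2 O) :
    inner ℂ (gradOf v) p = ∫ x in O, ∑ i, pderiv i φ x • p x i ∧
      inner ℂ (fnOf v) f = ∫ x in O, φ x • f x := by
  constructor
  · rw [L2.inner_def]
    refine integral_congr_ae ?_
    filter_upwards [hg] with x hx
    rw [hx, PiLp.inner_apply]
    refine Finset.sum_congr rfl fun i _ => ?_
    rw [RCLike.inner_apply, Complex.real_smul, rgrad, PiLp.toLp_apply, Complex.conj_ofReal, mul_comm]
  · rw [L2.inner_def]
    refine integral_congr_ae ?_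
    filter_upwards [hv] with x hx
    rw [hx, RCLike.inner_apply, Complex.real_smul, Complex.conj_ofReal, mul_comm]

theorem IsTest.exists_H1 {φ : E d → ℝ} (hφ : IsTest O φ) :
    ∃ v : H1 O, fnOf v =ᵐ[volume.restrict O] (fun x => (φ x : ℂ)) ∧
      gradOf v =ᵐ[volume.restrict O] rgrad φ := by
  have hs : IsSmoothC fun x => (φ x : ℂ) :=
    ⟨Complex.ofRealCLM.contDiff.comp hφ.contDiff,
      hφ.hasCompactSupport.comp_left (g := fun r : ℝ => (r : ℂ)) Complex.ofReal_zero⟩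
  obtain ⟨v, h1, h2⟩ := hs.exists_H1 O
  refine ⟨v, h1, h2.trans (Eventually.of_forall fun x => ?_)⟩
  ext i
  have := (Complex.ofRealCLM.hasFDerivAt.comp x (hφ.differentiable x).hasFDerivAt).fderiv
  have h3 : fderiv ℝ (fun x => (φ x : ℂ)) x = _ := this
  change fderiv ℝ (fun x => (φ x : ℂ)) x _ = _
  rw [h3]
  rfl

/-- This is the definition of the weak Laplacian, extended from real to complex test functions by
antilinearity. -/
theorem greenL_test (hO : IsOpen O) (w : H1Lap O) {φ : E d → ℂ} (hφ : IsSmoothC φ)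
    (hs : tsupport φ ⊆ O) {v : H1 O} (hv : fnOf v =ᵐ[volume.restrict O] φ) : greenL w v = 0 := by
  have hreal : ∀ ψ : E d → ℝ, IsTest O ψ → ∃ v : H1 O,
      fnOf v =ᵐ[volume.restrict O] (fun x => (ψ x : ℂ)) ∧ greenL w v = 0 := by
    intro ψ hψ
    obtain ⟨v, h1, h2⟩ := hψ.exists_H1
    obtain ⟨e1, e2⟩ := inner_test_eq h1 h2 (gradOf (toH1 w)) (lapOf w)
    exact ⟨v, h1, by rw [greenL_apply, e1, e2, w.weak_div hψ, neg_add_cancel]⟩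
  have hts : ∀ (T : ℂ →L[ℝ] ℝ), IsTest O fun x => T (φ x) := fun T =>
    ⟨T.contDiff.comp hφ.contDiff, hφ.hasCompactSupport.comp_left (g := T) (map_zero T),
      (tsupport_comp_subset (g := T) (map_zero T) φ).trans hs⟩
  obtain ⟨a, ha1, ha2⟩ := hreal _ (hts Complex.reCLM)
  obtain ⟨b, hb1, hb2⟩ := hreal _ (hts Complex.imCLM)
  have : v = a + Complex.I • b := by
    refine H1.ext_ae hO ?_
    filter_upwards [hv, ha1, hb1, fnOf_add_ae a (Complex.I • b), fnOf_smul_ae Complex.I b]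
      with x h1 h2 h3 h4 h5
    rw [h4, h5, h1, h2, h3, smul_eq_mul, mul_comm]
    exact (Complex.re_add_im (φ x)).symm
  rw [this, map_add, map_smulₛₗ, ha2, hb2, smul_zero, add_zero]

theorem enorm_inner_sq_le {F : Type*} [NormedAddCommGroup F] [InnerProductSpace ℂ F]
    {K : Set (E d)} (hK : MeasurableSet K) (p q : Lp F 2 (volume.restrict O))
    (hp : ∀ᵐ x ∂volume.restrict O, x ∉ K → p x = 0) :
    ‖(inner ℂ p q : ℂ)‖ₑ ^ 2 ≤ ‖p‖ₑ ^ 2 * ∫⁻ x in K, ‖q x‖ₑ ^ 2 ∂(volume.restrict O) := by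
  have h1 : ‖(inner ℂ p q : ℂ)‖ₑ ≤ ∫⁻ x in K, ‖p x‖ₑ * ‖q x‖ₑ ∂(volume.restrict O) := by
    rw [L2.inner_def, ← lintegral_indicator hK]
    refine (enorm_integral_le_lintegral_enorm _).trans (lintegral_mono_ae ?_)
    filter_upwards [hp] with x hx
    by_cases hxK : x ∈ K
    · rw [indicator_of_mem hxK, ← ofReal_norm, ← ofReal_norm, ← ofReal_norm,
        ← ENNReal.ofReal_mul (norm_nonneg _)]
      exact ENNReal.ofReal_le_ofReal (norm_inner_le_norm _ _)
    · rw [hx hxK, inner_zero_left, enorm_zero]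
      exact zero_le
  refine (pow_le_pow_left₀ zero_le h1 2).trans ?_
  refine (lintegral_mul_sq_le (Lp.aestronglyMeasurable p).enorm.restrict
    (Lp.aestronglyMeasurable q).enorm.restrict).trans ?_
  rw [enorm_sq_Lp]
  exact mul_le_mul_left (setLIntegral_le_lintegral K _) _

/-- Only `∇w` and `Δw` on `K` appear, so the bound becomes small when `K` shrinks to a null set
while `‖z‖` stays bounded. -/
theorem enorm_greenL_sq_le (hO : IsOpen O) {K : Set (E d)} (hK : IsClosed K) (w : H1Lap O)
    {z : H1 O} (hz : IsSupportedIn z K) :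
    ‖greenL w z‖ₑ ^ 2 ≤ 2 * ‖z‖ₑ ^ 2 * ((∫⁻ x in K, ‖gradOf (toH1 w) x‖ₑ ^ 2 ∂(volume.restrict O))
      + ∫⁻ x in K, ‖lapOf w x‖ₑ ^ 2 ∂(volume.restrict O)) := by
  have h1 := enorm_inner_sq_le hK.measurableSet (gradOf z) (gradOf (toH1 w))
    (hz.gradOf_eq_zero hO hK)
  have h2 := enorm_inner_sq_le hK.measurableSet (fnOf z) (lapOf w) hz
  have e1 : ‖gradOf z‖ₑ ^ 2 ≤ ‖z‖ₑ ^ 2 := by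
    rw [H1.enorm_sq, ← enorm_sq_Lp (gradOf z)]
    exact le_add_self
  have e2 : ‖fnOf z‖ₑ ^ 2 ≤ ‖z‖ₑ ^ 2 := by
    rw [H1.enorm_sq, ← enorm_sq_Lp (fnOf z)]; exact le_self_add
  rw [greenL_apply]
  refine (pow_le_pow_left₀ zero_le (enorm_add_le _ _) 2).trans ((add_sq_le_two _ _).trans ?_)
  rw [mul_assoc, ← mul_add, mul_add (‖z‖ₑ ^ 2)]
  gcongr
  · exact h1.trans (mul_le_mul_left e1 _)
  · exact h2.trans (mul_le_mul_left e2 _)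

/-- The energy of a function cut off near `Γ`. -/
theorem IsSide.energy_cutoff_le (hS : IsSide Γ U) (hd : 0 < d) :
    ∃ D : ℝ≥0∞, D ≠ ⊤ ∧ ∃ ε₀ : ℝ, 0 < ε₀ ∧ ∀ ε, 0 < ε → ε < ε₀ → ∃ D' : ℝ≥0∞, D' ≠ ⊤ ∧
      ∀ χ : E d → ℝ, ContDiff ℝ ∞ χ → (∀ x, |χ x| ≤ 1) → (∀ x, ‖fderiv ℝ χ x‖ ≤ 2 / ε) →
        (∀ x, x ∉ Metric.cthickening ε Γ → χ x = 0) → ∀ φ : E d → ℂ, IsSmoothC φ →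
        energy U (fun x => χ x • φ x)
          ≤ D' * (∫⁻ x in Γ, ‖φ x‖ₑ ^ 2 ∂(Measure.hausdorffMeasure ((d : ℝ) - 1)))
            + D * energy U φ := by
  -- The gradient of `χ` costs a factor of order `1/ε²` on `|φ|²` in the layer. The layer inequality
  -- returns `ε²` times the gradient energy, which cancels this factor, so `D` does not depend on
  -- `ε`. The surface term keeps a constant `D'` that may blow up as `ε → 0`, which is harmless for
  -- functions of zero trace.
  obtain ⟨C, hC, ε₀, hε₀, H⟩ := hS.layer_le hd
  refine ⟨C * ENNReal.ofReal (4 + 32 * d) + 2, ?_, min (ε₀ / 2) 1, lt_min (by positivity) one_pos,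
    fun ε hε hlt => ?_⟩
  · have : ENNReal.ofReal (4 + 32 * d) ≠ ⊤ := ENNReal.ofReal_ne_top
    finiteness
  have hlt1 : 2 * ε < ε₀ := by linarith [hlt.trans_le (min_le_left _ _)]
  have hlt2 : ε ≤ 1 := (hlt.trans_le (min_le_right _ _)).le
  set c : ℝ≥0∞ := ENNReal.ofReal (1 + 8 * d / ε ^ 2) with hc
  have hct : c ≠ ⊤ := ENNReal.ofReal_ne_top
  have h2ε : ENNReal.ofReal (2 * ε) ≠ ⊤ := ENNReal.ofReal_ne_top
  refine ⟨c * (C * ENNReal.ofReal (2 * ε)), by finiteness, ?_⟩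
  intro χ hχ hχ1 hχ2 hχ3 φ hφ
  have hKc : IsClosed (Metric.cthickening ε Γ) := Metric.isClosed_cthickening
  have hN : ∀ x, x ∉ Metric.cthickening ε Γ → fderiv ℝ χ x = 0 := fun x hx => by
    refine image_eq_zero_of_notMem_tsupport fun hs => hx ?_
    refine closure_minimal (fun y hy => ?_) hKc (tsupport_fderiv_subset ℝ hs)
    by_contra hh
    exact hy (hχ3 y hh)
  have hχb : ∀ x, ‖χ x‖ₑ ≤ 1 := fun x => by
    rw [← ofReal_norm]
    exact ENNReal.ofReal_le_one.2 (hχ1 x)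
  have hχd : Differentiable ℝ χ := hχ.differentiable (by simp)
  have hr : ∀ x, 2 * ‖rgrad χ x‖ₑ ^ 2 ≤ ENNReal.ofReal (8 * d / ε ^ 2) := fun x => by
    have h1 : ‖rgrad χ x‖ ≤ √d * (2 / ε) :=
      (norm_rgrad_le χ x).trans (mul_le_mul_of_nonneg_left (hχ2 x) (Real.sqrt_nonneg _))
    have h2 : ‖rgrad χ x‖ ^ 2 ≤ 4 * d / ε ^ 2 := by
      refine (pow_le_pow_left₀ (norm_nonneg _) h1 2).trans (le_of_eq ?_)
      rw [mul_pow, Real.sq_sqrt (by positivity)]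
      ring
    have h3 : (2 : ℝ≥0∞) = ENNReal.ofReal 2 := (ENNReal.ofReal_ofNat 2).symm
    rw [← ofReal_norm, ← ENNReal.ofReal_pow (norm_nonneg _)]
    calc _ ≤ 2 * ENNReal.ofReal (4 * d / ε ^ 2) := by gcongr
      _ = _ := by rw [h3, ← ENNReal.ofReal_mul (by norm_num)]; congr 1; ring
  have key : energy U (fun x => χ x • φ x)
      ≤ c * (∫⁻ x in U ∩ Metric.thickening (2 * ε) Γ, ‖φ x‖ₑ ^ 2)
        + 2 * ∫⁻ x in U, ‖cgrad φ x‖ₑ ^ 2 := by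
    have hNm : MeasurableSet (Metric.thickening (2 * ε) Γ) := Metric.isOpen_thickening.measurableSet
    have hsub : Metric.cthickening ε Γ ⊆ Metric.thickening (2 * ε) Γ :=
      Metric.cthickening_subset_thickening' (by positivity) (by linarith) Γ
    rw [energy, inter_comm, ← setLIntegral_indicator hNm,
      ← lintegral_const_mul _ (hφ.measurable_sq.indicator hNm),
      ← lintegral_const_mul _ hφ.measurable_cgrad_sq,
      ← lintegral_add_left ((hφ.measurable_sq.indicator hNm).const_mul c)]
    have hm : Measurable fun x => ‖χ x • φ x‖ₑ ^ 2 :=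
      ((hχ.continuous.smul hφ.contDiff.continuous).enorm.measurable).pow_const 2
    rw [← lintegral_add_left hm]
    refine lintegral_mono fun x => ?_
    rw [cgrad_smul hχd hφ.differentiable]
    by_cases hx : x ∈ Metric.cthickening ε Γ
    · rw [indicator_of_mem (hsub hx)]
      have h1 : ‖χ x • φ x‖ₑ ^ 2 ≤ ‖φ x‖ₑ ^ 2 := by
        rw [enorm_smul]
        exact pow_le_pow_left₀ zero_le (mul_le_of_le_one_left' (hχb x)) 2
      have h2 : ‖χ x • cgrad φ x + φ x • rgrad χ x‖ₑ ^ 2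
          ≤ 2 * ‖cgrad φ x‖ₑ ^ 2 + ENNReal.ofReal (8 * d / ε ^ 2) * ‖φ x‖ₑ ^ 2 := by
        refine (pow_le_pow_left₀ zero_le (enorm_add_le _ _) 2).trans ((add_sq_le_two _ _).trans ?_)
        refine add_le_add ?_ ?_
        · gcongr
          rw [enorm_smul]
          exact mul_le_of_le_one_left' (hχb x)
        · rw [enorm_smul, mul_pow, mul_left_comm, mul_comm]
          gcongr
          exact hr x
      refine (add_le_add h1 h2).trans (le_of_eq ?_)
      rw [hc, ENNReal.ofReal_add zero_le_one (by positivity), ENNReal.ofReal_one]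
      ring
    · have h0 : rgrad χ x = 0 := by
        ext i
        simp [rgrad, pderiv, hN x hx]
      rw [hχ3 x hx, h0]
      simp
  refine key.trans ?_
  have hl := H φ hφ (2 * ε) (by positivity) hlt1
  have h3 : c * ENNReal.ofReal (2 * ε) ^ 2 ≤ ENNReal.ofReal (4 + 32 * d) := by
    rw [hc, ← ENNReal.ofReal_pow (by positivity), ← ENNReal.ofReal_mul (by positivity)]
    refine ENNReal.ofReal_le_ofReal ?_
    have : (1 + 8 * d / ε ^ 2) * (2 * ε) ^ 2 = 4 * ε ^ 2 + 32 * d := by field_simp; ring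
    rw [this]
    nlinarith
  refine (add_le_add (mul_le_mul_right hl c) le_rfl).trans ?_
  set a := ∫⁻ x in Γ, ‖φ x‖ₑ ^ 2 ∂(Measure.hausdorffMeasure ((d : ℝ) - 1))
  set b := ∫⁻ x in U, ‖cgrad φ x‖ₑ ^ 2 with hb
  have hbe : b ≤ energy U φ := le_add_self
  calc c * (C * (ENNReal.ofReal (2 * ε) * a + ENNReal.ofReal (2 * ε) ^ 2 * b)) + 2 * b
      = c * (C * ENNReal.ofReal (2 * ε)) * a + (C * (c * ENNReal.ofReal (2 * ε) ^ 2) + 2) * b := by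
        ring
    _ ≤ _ := by gcongr

/-- Green's identity on a side for functions with vanishing trace. -/
theorem IsSide.greenL_eq_zero (hS : IsSide (frontier Ω) U) (hd : 0 < d)
    (hU : IsClopenIn (offGamma Ω) U) (w : H1Lap (offGamma Ω)) {v : H1 (offGamma Ω)}
    (hv : (v, (0 : Lp ℂ 2 (surf Ω))) ∈ traceGraph Ω (offGamma Ω) U) :
    greenL w (cutL hU v) = 0 := by
  have hO := hU.isOpen_right
  obtain ⟨D, hD, ε₀, hε₀, H⟩ := hS.energy_cutoff_le hd
  let μ : Measure (E d) := volume.restrict (offGamma Ω)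
  let K : ℝ → Set (E d) := fun ε => Metric.cthickening ε (frontier Ω)
  let m : ℝ → ℝ≥0∞ := fun ε =>
    (∫⁻ x in K ε, ‖gradOf (toH1 w) x‖ₑ ^ 2 ∂μ) + ∫⁻ x in K ε, ‖lapOf w x‖ₑ ^ 2 ∂μ
  have hf1 : ∫⁻ x, ‖gradOf (toH1 w) x‖ₑ ^ 2 ∂μ ≠ ⊤ := by rw [← enorm_sq_Lp]; finiteness
  have hf2 : ∫⁻ x, ‖lapOf w x‖ₑ ^ 2 ∂μ ≠ ⊤ := by rw [← enorm_sq_Lp]; finiteness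
  have hm : ∀ ε, m ε ≠ ⊤ := fun ε => ENNReal.add_ne_top.2
    ⟨ne_top_of_le_ne_top hf1 (setLIntegral_le_lintegral _ _),
      ne_top_of_le_ne_top hf2 (setLIntegral_le_lintegral _ _)⟩
  have hμ : Tendsto (fun ε => μ (K ε)) (𝓝[>] 0) (𝓝 0) := by
    have h1 := tendsto_measure_cthickening_of_isClosed (μ := μ) (s := frontier Ω)
      ⟨1, one_pos, ((Measure.restrict_apply_le _ _).trans_lt
        hS.isCompact.cthickening.measure_lt_top).ne⟩ isClosed_frontier
    have h2 : μ (frontier Ω) = 0 := by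
      rw [Measure.restrict_apply isClosed_frontier.measurableSet, inter_compl_self, measure_empty]
    rw [h2] at h1
    exact h1.mono_left nhdsWithin_le_nhds
  have hlim : Tendsto m (𝓝[>] 0) (𝓝 0) := by
    have := (tendsto_setLIntegral_zero hf1 hμ).add (tendsto_setLIntegral_zero hf2 hμ)
    rwa [add_zero] at this
  have hcutle : ∀ u : H1 (offGamma Ω), ‖cutL hU u‖ₑ ^ 2 ≤ ‖u‖ₑ ^ 2 := fun u => by
    refine pow_le_pow_left₀ zero_le ?_ 2
    rw [← ofReal_norm, ← ofReal_norm]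
    exact ENNReal.ofReal_le_ofReal (norm_cutL_le hU u)
  -- With `χ` a cutoff near `Γ`, the part `(1 - χ)v` is an admissible test function and contributes
  -- nothing. The part `χ v` lives in `K ε` and has energy at most `D ‖v‖²`, so only the small
  -- factor `m ε` remains.
  have hbound : ∀ ε, 0 < ε → ε < ε₀ →
      ‖greenL w (cutL hU v)‖ₑ ^ 2 ≤ 2 * (D * ‖v‖ₑ ^ 2) * m ε := by
    intro ε hε hlt
    obtain ⟨D', hD', H'⟩ := H ε hε hlt
    obtain ⟨χ, c1, c2, c3, c4, c5⟩ := exists_cutoff_near (frontier Ω) hε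
    have hχ : IsCutoff χ := ⟨c1, ⟨1, c2⟩, ⟨2 / ε, c3⟩⟩
    -- The inequality is proved for smooth functions with their surface term kept, then passed to
    -- the closure at fixed `ε`; the surface term disappears only when the limit pair `(v, 0)` is
    -- inserted.
    have hcl : ∀ p ∈ traceGraph Ω (offGamma Ω) U, ‖greenL w (cutL hU p.1)‖ₑ ^ 2
        ≤ 2 * (D' * ‖p.2‖ₑ ^ 2 + D * ‖p.1‖ₑ ^ 2) * m ε := fun p hp => by
      refine closure_minimal (t := {p : H1 (offGamma Ω) × Lp ℂ 2 (surf Ω) |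
        ‖greenL w (cutL hU p.1)‖ₑ ^ 2 ≤ 2 * (D' * ‖p.2‖ₑ ^ 2 + D * ‖p.1‖ₑ ^ 2) * m ε}) ?_ ?_ hp
      · rintro q ⟨φ, h1, h2, h3, h4⟩
        have hφ : IsSmoothC φ := ⟨h1, h2⟩
        obtain ⟨a, ha, -⟩ := hχ.exists_mul q.1
        have hae : ∀ᵐ x ∂volume.restrict (offGamma Ω), x ∈ U → fnOf a x = χ x • φ x := by
          filter_upwards [ha, h3] with x e1 e2 hx
          rw [e1, e2 hx]
        have hz : IsSupportedIn (cutL hU a) (K ε) := by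
          filter_upwards [fnOf_cutL hU a, ha] with x e1 e2 hx
          rw [e1]
          by_cases hxU : x ∈ U
          · rw [indicator_of_mem hxU, e2, c5 x hx, zero_smul]
          · exact indicator_of_notMem hxU _
        have h0 : greenL w (cutL hU q.1 - cutL hU a) = 0 := by
          have hψ : IsSmoothC fun x => (1 - χ x) • φ x :=
            ⟨(contDiff_const.sub c1).smul h1, h2.smul_left (f := fun x => 1 - χ x)⟩
          have hts : tsupport (fun x => (1 - χ x) • φ x) ⊆ offGamma Ω := by
            have : tsupport (fun x => (1 - χ x) • φ x)
                ⊆ (Metric.thickening (ε / 8) (frontier Ω))ᶜ := by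
              refine closure_minimal (fun x hx hxt => hx ?_) Metric.isOpen_thickening.isClosed_compl
              change (1 - χ x) • φ x = 0
              rw [c4 x hxt, sub_self, zero_smul]
            exact this.trans (compl_subset_compl.2 (Metric.self_subset_thickening (by positivity) _))
          refine greenL_test hO w (φ := U.indicator fun x => (1 - χ x) • φ x)
            ⟨hU.contDiff_indicator hψ.1 hts, hψ.2.mono (support_indicator.trans_subset inter_subset_right)⟩
            ((hU.tsupport_indicator_subset hts).trans hU.subset) ?_
          filter_upwards [fnOf_sub_ae (cutL hU q.1) (cutL hU a), fnOf_cutL hU q.1, fnOf_cutL hU a,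
            h3, hae] with x e1 e2 e3 e4 e5
          rw [e1, e2, e3]
          by_cases hx : x ∈ U
          · rw [indicator_of_mem hx, indicator_of_mem hx, indicator_of_mem hx, e4 hx, e5 hx, sub_smul,
              one_smul]
          · rw [indicator_of_notMem hx, indicator_of_notMem hx, indicator_of_notMem hx, sub_zero]
        rw [map_sub, sub_eq_zero] at h0
        change ‖greenL w (cutL hU q.1)‖ₑ ^ 2 ≤ 2 * (D' * ‖q.2‖ₑ ^ 2 + D * ‖q.1‖ₑ ^ 2) * m ε
        rw [h0]
        refine (enorm_greenL_sq_le hO Metric.isClosed_cthickening w hz).trans ?_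
        refine mul_le_mul_left (mul_le_mul_right ?_ 2) _
        rw [enorm_cutL_sq_of_smooth hU (hχ.isSmoothC_smul hφ) hae]
        refine (H' χ c1 c2 c3 c5 φ hφ).trans (add_le_add (mul_le_mul_right (le_of_eq ?_) D')
          (mul_le_mul_right ?_ D))
        · rw [enorm_sq_Lp]
          exact (lintegral_congr_ae (by filter_upwards [h4] with x hx; rw [hx])).symm
        · refine le_trans (le_of_eq ?_) (hcutle q.1)
          rw [enorm_cutL_sq_of_smooth hU hφ h3]
          rfl
      · have c1 : Continuous fun p : H1 (offGamma Ω) × Lp ℂ 2 (surf Ω) =>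
            ‖greenL w (cutL hU p.1)‖ₑ ^ 2 :=
          (ENNReal.continuous_pow 2).comp
            ((greenL w).continuous.comp ((cutL hU).continuous.comp continuous_fst)).enorm
        have c2 : Continuous fun p : H1 (offGamma Ω) × Lp ℂ 2 (surf Ω) =>
            2 * (D' * ‖p.2‖ₑ ^ 2 + D * ‖p.1‖ₑ ^ 2) * m ε :=
          (ENNReal.continuous_mul_const (hm ε)).comp ((ENNReal.continuous_const_mul (by simp)).comp
            (((ENNReal.continuous_const_mul hD').comp
              ((ENNReal.continuous_pow 2).comp continuous_snd.enorm)).add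
            ((ENNReal.continuous_const_mul hD).comp
              ((ENNReal.continuous_pow 2).comp continuous_fst.enorm))))
        exact isClosed_le c1 c2
    have := hcl _ hv
    simpa using this
  have hfin : 2 * (D * ‖v‖ₑ ^ 2) ≠ ⊤ := by finiteness
  have h0 : ‖greenL w (cutL hU v)‖ₑ ^ 2 ≤ 0 := by
    have hl2 := ENNReal.Tendsto.const_mul hlim (Or.inr hfin)
    rw [mul_zero] at hl2
    refine ge_of_tendsto hl2 ?_
    filter_upwards [Ioo_mem_nhdsGT hε₀] with ε hε using hbound ε hε.1 hε.2
  simpa using h0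

end Green

end HeatTransmission

end

/-! ### Traces and normal derivatives on both sides -/

noncomputable section

namespace HeatTransmission

open MeasureTheory Set Filter Topology
open scoped ContDiff ENNReal NNReal

section TwoSides

variable {d : ℕ} {O U W Ω Γ : Set (E d)}

/-- The bounded trace operators and the normal derivatives from the two sides of `Γ`. -/
structure Traces (Ω : Set (E d)) where
  γm : H1 (offGamma Ω) →L[ℂ] H12 Ω
  γp : H1 (offGamma Ω) →L[ℂ] H12 Ω
  νm : H1Lap (offGamma Ω) → Hm12 Ω
  νp : H1Lap (offGamma Ω) → Hm12 Ω
  mem_γm : ∀ u c, (u, c) ∈ sideTrace Ω Ω ↔ c = γm u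
  mem_γp : ∀ u c, (u, c) ∈ sideTrace Ω (exterior Ω) ↔ c = γp u
  mem_νm : ∀ w n, (w, n) ∈ sideNormal Ω Ω 1 ↔ n = νm w
  mem_νp : ∀ w n, (w, n) ∈ sideNormal Ω (exterior Ω) (-1) ↔ n = νp w
  green : ∀ w v, greenL w v = νm w (γm v) - νp w (γp v)
  lift : ∀ a b, ∃ v, γm v = a ∧ γp v = b ∧ ‖v‖ ≤ 2 * (‖a‖ + ‖b‖)

/-- The factor `2` leaves room above the infimum in the quotient norm, so that attainment need not
be discussed. -/
theorem exists_lift_traceOp (c : H12 Ω) : ∃ v, traceOp Ω v = c ∧ ‖v‖ ≤ 2 * ‖c‖ := by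
  rcases eq_or_ne c 0 with rfl | hc
  · exact ⟨0, map_zero _, by simp⟩
  · obtain ⟨v, h1, h2⟩ := Submodule.Quotient.norm_mk_lt (S := traceKer Ω) c (norm_pos_iff.2 hc)
    exact ⟨v, h1, by rw [two_mul]; exact h2.le⟩

theorem greenForm_eq (hU : IsClopenIn (offGamma Ω) U) (w : H1Lap (offGamma Ω))
    (v : H1 (univ : Set (E d))) :
    greenForm Ω U w v = greenL w (cutL hU (resL hU.isOpen_right (subset_univ _) v)) := by
  have hm := hU.isOpen.measurableSet
  rw [greenForm, greenL_apply, L2.inner_def, L2.inner_def,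
    ← integral_add (L2.integrable_inner _ _) (L2.integrable_inner _ _), ← integral_indicator hm]
  refine integral_congr_ae ?_
  filter_upwards [fnOf_cutL hU (resL hU.isOpen_right (subset_univ _) v),
    gradOf_cutL hU (resL hU.isOpen_right (subset_univ _) v),
    fnOf_resL hU.isOpen_right (subset_univ _) v, gradOf_resL hU.isOpen_right (subset_univ _) v]
    with x h1 h2 h3 h4
  rw [h1, h2]
  by_cases hx : x ∈ U
  · rw [indicator_of_mem hx, indicator_of_mem hx, indicator_of_mem hx, h3, h4]
  · rw [indicator_of_notMem hx, indicator_of_notMem hx, indicator_of_notMem hx, inner_zero_left,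
      inner_zero_left, add_zero]

theorem IsSide.greenL_eq_zero' (hS : IsSide (frontier Ω) U) (hd : 0 < d)
    (hU : IsClopenIn (offGamma Ω) U) (w : H1Lap (offGamma Ω)) {v : H1 (offGamma Ω)}
    (hv : (v, (0 : H12 Ω)) ∈ sideTrace Ω U) : greenL w (cutL hU v) = 0 := by
  obtain ⟨A, hA⟩ := hS.exists_trace_univ hd
  obtain ⟨v', g, h1, h2, h3⟩ := hv
  have h4 := (hA _ _).1 (traceOp_eq_zero_iff.1 h3)
  rw [hA] at h2
  rw [h2, ← h4] at h1
  exact hS.greenL_eq_zero hd hU w h1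

/-- Existence, uniqueness and Green's formula for the normal derivative on a side. -/
theorem IsSide.exists_normal (hS : IsSide (frontier Ω) U) (hd : 0 < d)
    (hU : IsClopenIn (offGamma Ω) U) {γ : H1 (offGamma Ω) →L[ℂ] H12 Ω}
    (hγ : ∀ u c, (u, c) ∈ sideTrace Ω U ↔ c = γ u)
    (hγr : ∀ v, γ (resL hU.isOpen_right (subset_univ _) v) = traceOp Ω v) (s : ℂ)
    (w : H1Lap (offGamma Ω)) :
    ∃ n : Hm12 Ω, (∀ n', (w, n') ∈ sideNormal Ω U s ↔ n' = n) ∧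
      ∀ v, n (γ v) = s * greenL w (cutL hU v) := by
  -- Green's form thus depends on `v` only through its trace and factors through `H^{1/2}_Γ`; this
  -- one fact yields existence and Green's formula for the normal derivative.
  have hz : ∀ v, γ v = 0 → greenL w (cutL hU v) = 0 := fun v hv =>
    hS.greenL_eq_zero' hd hU w ((hγ _ _).2 hv.symm)
  obtain ⟨n, hn⟩ := exists_factor_traceOp (Ω := Ω)
    (s • ((greenL w).comp ((cutL hU).comp (resL hU.isOpen_right (subset_univ (offGamma Ω))))))
    fun v hv => by
      have := hz (resL hU.isOpen_right (subset_univ _) v) (by rw [hγr, hv])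
      change s * greenL w (cutL hU (resL hU.isOpen_right (subset_univ _) v)) = 0
      rw [this, mul_zero]
  have hn' : ∀ v, n (traceOp Ω v)
      = s * greenL w (cutL hU (resL hU.isOpen_right (subset_univ _) v)) := hn
  refine ⟨n, fun n' => ⟨fun h => ?_, ?_⟩, fun v => ?_⟩
  · ext c
    obtain ⟨v, rfl⟩ := traceOp_surjective Ω c
    have h1 : n' (traceOp Ω v) = s * greenForm Ω U w v := h v
    rw [h1, hn', greenForm_eq hU]
  · rintro rfl
    intro v
    change n' (traceOp Ω v) = s * greenForm Ω U w v
    rw [hn', greenForm_eq hU]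
  · obtain ⟨v', hv'⟩ := traceOp_surjective Ω (γ v)
    have h1 := hz (v - resL hU.isOpen_right (subset_univ _) v') (by rw [map_sub, hγr, hv', sub_self])
    rw [map_sub, map_sub, sub_eq_zero] at h1
    rw [← hv', hn', h1]

theorem cutL_cutL_of_disjoint (hU : IsClopenIn O U) (hW : IsClopenIn O W) (h : Disjoint U W)
    (u : H1 O) : cutL hU (cutL hW u) = 0 := by
  refine H1.ext_ae hU.isOpen_right ?_
  have h0 : fnOf (0 : H1 O) =ᵐ[volume.restrict O] 0 := by
    rw [map_zero]
    exact Lp.coeFn_zero _ _ _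
  filter_upwards [fnOf_cutL hU (cutL hW u), fnOf_cutL hW u, h0] with x h1 h2 h3
  rw [h1, h3]
  by_cases hx : x ∈ U
  · rw [indicator_of_mem hx, h2, indicator_of_notMem (h.notMem_of_mem_left hx)]
    rfl
  · rw [indicator_of_notMem hx]
    rfl

theorem cutL_add_cutL (hU : IsClopenIn O U) (hW : IsClopenIn O W) (h : O \ U = W) (u : H1 O) :
    cutL hU u + cutL hW u = u := by
  refine H1.ext_ae hU.isOpen_right ?_
  filter_upwards [fnOf_add_ae (cutL hU u) (cutL hW u), fnOf_cutL hU u, fnOf_cutL hW u,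
    self_mem_ae_restrict hU.isOpen_right.measurableSet] with x h1 h2 h3 hxO
  rw [h1, h2, h3]
  by_cases hx : x ∈ U
  · have : x ∉ W := fun hh => by rw [← h] at hh; exact hh.2 hx
    rw [indicator_of_mem hx, indicator_of_notMem this, add_zero]
  · have : x ∈ W := by rw [← h]; exact ⟨hxO, hx⟩
    rw [indicator_of_notMem hx, indicator_of_mem this, zero_add]

/-- Indicator cuts separate the sides: Green's formula is the sum of its two one-sided versions, and
prescribed traces are lifted by independent functions glued along `Γ`. -/
theorem IsBoundedLipschitz.nonempty_traces (hΩ : IsBoundedLipschitz Ω) (hd : 0 < d) :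
    Nonempty (Traces Ω) := by
  have hU := hΩ.isClopenIn
  have hW := hΩ.isClopenIn_exterior
  have hUW := offGamma_diff hΩ.isOpen
  have hdisj : Disjoint Ω (exterior Ω) := by
    rw [← hUW]
    exact disjoint_sdiff_right
  obtain ⟨γm, a1, a2, a3⟩ := hΩ.isSide.exists_sideTrace hd hU
  obtain ⟨γp, b1, b2, b3⟩ := hΩ.isSide_exterior.exists_sideTrace hd hW
  choose νm c1 c2 using hΩ.isSide.exists_normal hd hU a1 a3 1
  choose νp e1 e2 using hΩ.isSide_exterior.exists_normal hd hW b1 b3 (-1)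
  refine ⟨⟨γm, γp, νm, νp, a1, b1, c1, e1, fun w v => ?_, fun a b => ?_⟩⟩
  · rw [c2, e2]
    conv_lhs => rw [← cutL_add_cutL hU hW hUW v, map_add]
    ring
  · obtain ⟨va, h1, h2⟩ := exists_lift_traceOp a
    obtain ⟨vb, h3, h4⟩ := exists_lift_traceOp b
    refine ⟨cutL hU (resL hU.isOpen_right (subset_univ _) va)
      + cutL hW (resL hW.isOpen_right (subset_univ _) vb), ?_, ?_, ?_⟩
    · rw [map_add, a2, a3, h1, ← a2 (cutL hW _), cutL_cutL_of_disjoint hU hW hdisj, map_zero, add_zero]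
    · rw [map_add, b2, b3, h3, ← b2 (cutL hU _), cutL_cutL_of_disjoint hW hU hdisj.symm, map_zero,
        zero_add]
    · refine (norm_add_le _ _).trans ?_
      have k1 := (norm_cutL_le hU _).trans (norm_resL_le hU.isOpen_right (subset_univ _) va)
      have k2 := (norm_cutL_le hW _).trans (norm_resL_le hW.isOpen_right (subset_univ _) vb)
      linarith

/-- Test functions have vanishing traces. -/
theorem mem_sideTrace_of_test {φ : E d → ℝ} (hφ : IsTest (offGamma Ω) φ)
    {v : H1 (offGamma Ω)} (hv : fnOf v =ᵐ[volume.restrict (offGamma Ω)] fun x => (φ x : ℂ)) :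
    (v, (0 : H12 Ω)) ∈ sideTrace Ω U := by
  have hs : IsSmoothC fun x => (φ x : ℂ) :=
    ⟨Complex.ofRealCLM.contDiff.comp hφ.contDiff,
      hφ.hasCompactSupport.comp_left (g := fun r : ℝ => (r : ℂ)) Complex.ofReal_zero⟩
  refine ⟨0, 0, mem_traceGraph_of_smooth hs (by filter_upwards [hv] with x hx _ using hx) ?_,
    Submodule.zero_mem _, map_zero _⟩
  have hmem : ∀ᵐ y ∂surf Ω, y ∈ frontier Ω := ae_restrict_mem isClosed_frontier.measurableSet
  filter_upwards [hmem, Lp.coeFn_zero ℂ 2 (surf Ω)] with x hx h0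
  rw [h0, hφ.eq_zero (fun hh => hh hx)]
  simp

/-- The Riesz representation of an antilinear functional. -/
theorem exists_riesz {X : Type*} [NormedAddCommGroup X] [InnerProductSpace ℂ X] [CompleteSpace X]
    (f : X →SL[starRingEnd ℂ] ℂ) : ∃ r : X, ∀ v, inner ℂ v r = f v := by
  let f' : X →L[ℂ] ℂ := LinearMap.mkContinuous
    { toFun := fun v => starRingEnd ℂ (f v)
      map_add' := fun u v => by simp
      map_smul' := fun c v => by simp } ‖f‖ fun v => by
        change ‖starRingEnd ℂ (f v)‖ ≤ _
        rw [RCLike.norm_conj]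
        exact f.le_opNorm v
  refine ⟨(InnerProductSpace.toDual ℂ X).symm f', fun v => ?_⟩
  rw [← inner_conj_symm, InnerProductSpace.toDual_symm_apply]
  exact Complex.conj_conj (f v)

/-- A closed subspace of `H^{-1/2}_Γ` is the polar set of its polar set. -/
theorem mem_of_forall_polarX {Xh : Submodule ℂ (Hm12 Ω)} (hX : IsClosed (Xh : Set (Hm12 Ω)))
    {l : Hm12 Ω} (hl : ∀ φ ∈ polarX Xh, l φ = 0) : l ∈ Xh := by
  -- Pulling functionals back along the trace and applying Riesz embeds `H^{-1/2}_Γ` in the Hilbert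
  -- space `H¹(ℝᵈ)` with equivalent norms, so `X_h` becomes a closed subspace there.
  let τ : H1 (univ : Set (E d)) →L[ℂ] H12 Ω := ⟨traceOp Ω, (isOpenQuotientMap_traceOp Ω).continuous⟩
  choose R hR using fun μ : Hm12 Ω => exists_riesz (μ.comp τ)
  have hR' : ∀ (μ : Hm12 Ω) v, inner ℂ v (R μ) = μ (traceOp Ω v) := hR
  let Rl : Hm12 Ω →ₗ[ℂ] H1 (univ : Set (E d)) :=
    { toFun := R
      map_add' := fun μ ν => ext_inner_left ℂ fun v => by
        rw [inner_add_right, hR', hR', hR']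
        rfl
      map_smul' := fun c μ => ext_inner_left ℂ fun v => by
        rw [RingHom.id_apply, inner_smul_right, hR', hR']
        rfl }
  have hle : ∀ μ, ‖μ‖ ≤ 2 * ‖Rl μ‖ := fun μ => by
    refine ContinuousLinearMap.opNorm_le_bound _ (by positivity) fun c => ?_
    obtain ⟨v, rfl, hv⟩ := exists_lift_traceOp c
    rw [← hR']
    refine (norm_inner_le_norm _ _).trans ?_
    have := mul_le_mul_of_nonneg_right hv (norm_nonneg (R μ))
    change _ ≤ 2 * ‖R μ‖ * _
    linarith
  have hge : ∀ μ, ‖Rl μ‖ ≤ 1 * ‖μ‖ := fun μ => by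
    have h1 : ‖R μ‖ ^ 2 ≤ ‖μ‖ * ‖R μ‖ := by
      have h2 := (μ.le_opNorm (traceOp Ω (R μ))).trans
        (mul_le_mul_of_nonneg_left (norm_traceOp_le (R μ)) (norm_nonneg μ))
      rw [← hR', inner_self_eq_norm_sq_to_K] at h2
      simpa using h2
    change ‖R μ‖ ≤ _
    nlinarith [norm_nonneg (R μ), norm_nonneg μ]
  let Rc : Hm12 Ω →L[ℂ] H1 (univ : Set (E d)) := Rl.mkContinuous 1 hge
  have hanti : AntilipschitzWith 2 Rc := AddMonoidHomClass.antilipschitz_of_bound Rc hle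
  have hcl : IsClosed ((Xh.map Rl : Submodule ℂ _) : Set (H1 (univ : Set (E d)))) := by
    exact ((isComplete_image_iff
      (hanti.isUniformInducing Rc.uniformContinuous)).2 hX.isComplete).isClosed
  have : CompleteSpace (Xh.map Rl) := hcl.completeSpace_coe
  -- The trace of the orthogonal component `z` lies in the polar set of `X_h`, so `l` kills it. This
  -- says `‖z‖² = 0`, hence `R l` lies in the image of `X_h`.
  obtain ⟨p, hp, z, hz, hpz⟩ := (Xh.map Rl).exists_add_mem_mem_orthogonal (R l)
  have hz0 : l (traceOp Ω z) = 0 := hl _ fun μ hμ => by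
    rw [← hR']
    exact (Submodule.mem_orthogonal' _ z).1 hz _ (Submodule.mem_map_of_mem hμ)
  have hz1 : inner ℂ z z = (0 : ℂ) := by
    have h1 := (Submodule.mem_orthogonal' _ z).1 hz p hp
    rw [← hR', hpz, inner_add_right, h1, zero_add] at hz0
    exact hz0
  rw [inner_self_eq_zero.1 hz1, add_zero] at hpz
  obtain ⟨μ, hμ, hμl⟩ := hp
  rw [← hpz] at hμl
  exact hanti.injective hμl ▸ hμ

end TwoSides

end HeatTransmission

end

/-! ### The weak form of the steady state problem -/

noncomputable section

namespace HeatTransmission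

open MeasureTheory Set Filter Topology
open scoped ContDiff ENNReal NNReal

section Variational

variable {d : ℕ} {Ω : Set (E d)}

/-- Solution of a coercive problem on a closed subspace. -/
theorem exists_mem_forall_inner_eq {X : Type*} [NormedAddCommGroup X] [InnerProductSpace ℂ X]
    [CompleteSpace X] (B : X →L[ℂ] X) {c : ℝ} (hc : 0 < c)
    (hB : ∀ x, c * ‖x‖ ^ 2 ≤ (inner ℂ x (B x)).re) {S : Submodule ℂ X}
    (hS : IsClosed (S : Set X)) (f : X →SL[starRingEnd ℂ] ℂ) :
    ∃ w ∈ S, ∀ v ∈ S, inner ℂ v (B w) = f v := by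
  have : CompleteSpace S := hS.completeSpace_coe
  -- Lax–Milgram for the compression of `B` to `S`: coercivity is inherited and makes `T`
  -- invertible.
  let T : S →L[ℂ] S := S.subtypeL.adjoint ∘L B ∘L S.subtypeL
  have hT : ∀ x y : S, inner ℂ x (T y) = inner ℂ (x : X) (B y) := fun x y =>
    ContinuousLinearMap.adjoint_inner_right S.subtypeL x (B (y : X))
  have hu : IsUnit T := by
    refine ContinuousLinearMap.isUnit_of_forall_le_norm_inner_map T (c := ⟨c, hc.le⟩) hc fun x => ?_
    rw [norm_inner_symm, hT, mul_comm]
    exact (hB x).trans (Complex.re_le_norm _)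
  obtain ⟨r, hr⟩ := exists_riesz (f.comp S.subtypeL)
  obtain ⟨w, hw⟩ := (ContinuousLinearMap.isUnit_iff_bijective.1 hu).2 r
  refine ⟨w, w.2, fun v hv => ?_⟩
  have := hT ⟨v, hv⟩ w
  rw [hw, hr] at this
  exact this.symm

/-- `H¹(ℝᵈ∖Γ)²` as a Hilbert space. -/
abbrev VHilbert (Ω : Set (E d)) := WithLp 2 (H1 (offGamma Ω) × H1 (offGamma Ω))

def vfst (Ω : Set (E d)) : VHilbert Ω →L[ℂ] H1 (offGamma Ω) := WithLp.fstL 2 ℂ _ _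

def vsnd (Ω : Set (E d)) : VHilbert Ω →L[ℂ] H1 (offGamma Ω) := WithLp.sndL 2 ℂ _ _

theorem inner_adjoint_comp {X Y : Type*} [NormedAddCommGroup X] [InnerProductSpace ℂ X]
    [CompleteSpace X] [NormedAddCommGroup Y] [InnerProductSpace ℂ Y] [CompleteSpace Y]
    (F : X →L[ℂ] Y) (v w : X) : inner ℂ v ((F.adjoint ∘L F) w) = inner ℂ (F v) (F w) :=
  F.adjoint_inner_right v (F w)

/-- The operator `B` of the form `(v, B w) = ρ (v₋, w₋) + κ (∇v₋, ∇w₋) + (v₊, w₊) + (∇v₊, ∇w₊)`. -/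
def formOp (Ω : Set (E d)) (ρ κ : ℝ) : VHilbert Ω →L[ℂ] VHilbert Ω :=
  (ρ : ℂ) • ((fnOfL ∘L vfst Ω).adjoint ∘L (fnOfL ∘L vfst Ω))
    + (κ : ℂ) • ((gradOfL ∘L vfst Ω).adjoint ∘L (gradOfL ∘L vfst Ω))
    + (fnOfL ∘L vsnd Ω).adjoint ∘L (fnOfL ∘L vsnd Ω)
    + (gradOfL ∘L vsnd Ω).adjoint ∘L (gradOfL ∘L vsnd Ω)

theorem inner_formOp (ρ κ : ℝ) (v w : VHilbert Ω) :
    inner ℂ v (formOp Ω ρ κ w) = ρ * inner ℂ (fnOf v.fst) (fnOf w.fst)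
      + κ * inner ℂ (gradOf v.fst) (gradOf w.fst) + inner ℂ (fnOf v.snd) (fnOf w.snd)
      + inner ℂ (gradOf v.snd) (gradOf w.snd) := by
  simp only [formOp, add_apply, smul_apply, inner_add_right,
    inner_smul_right]
  rw [inner_adjoint_comp, inner_adjoint_comp, inner_adjoint_comp, inner_adjoint_comp]
  rfl

theorem le_re_inner_formOp {ρ κ c : ℝ} (h1 : c ≤ ρ) (h2 : c ≤ κ) (h3 : c ≤ 1) (v : VHilbert Ω) :
    c * ‖v‖ ^ 2 ≤ (inner ℂ v (formOp Ω ρ κ v)).re := by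
  have hr : ∀ (r : ℝ) (t : ℝ), ((r : ℂ) * (t : ℂ) ^ 2).re = r * t ^ 2 := fun r t => by norm_cast
  have h1' : ∀ t : ℝ, ((t : ℂ) ^ 2).re = t ^ 2 := fun t => by norm_cast
  rw [inner_formOp, WithLp.prod_norm_sq_eq_of_L2, H1.norm_sq, H1.norm_sq]
  simp only [inner_self_eq_norm_sq_to_K, Complex.add_re, Complex.coe_algebraMap, hr, h1']
  nlinarith [mul_le_mul_of_nonneg_right h1 (sq_nonneg ‖fnOf v.fst‖),
    mul_le_mul_of_nonneg_right h2 (sq_nonneg ‖gradOf v.fst‖),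
    mul_le_mul_of_nonneg_right h3 (sq_nonneg ‖fnOf v.snd‖),
    mul_le_mul_of_nonneg_right h3 (sq_nonneg ‖gradOf v.snd‖)]

/-- `v ↦ ρ (g₋, v₋) + (g₊, v₊)`. -/
def load (ρ : ℝ) (g : L2Pair Ω) : VHilbert Ω →SL[starRingEnd ℂ] ℂ :=
  (ρ : ℂ) • (innerSLFlip ℂ g.fst).comp (fnOfL ∘L vfst Ω) + (innerSLFlip ℂ g.snd).comp (fnOfL ∘L vsnd Ω)

theorem load_apply (ρ : ℝ) (g : L2Pair Ω) (v : VHilbert Ω) :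
    load ρ g v = ρ * inner ℂ (fnOf v.fst) g.fst + inner ℂ (fnOf v.snd) g.snd := rfl

theorem norm_load_le {ρ : ℝ} (hρ : 0 ≤ ρ) (g : L2Pair Ω) (v : VHilbert Ω) :
    ‖load ρ g v‖ ≤ (ρ + 1) * ‖g‖ * ‖v‖ := by
  have h1 : ‖inner ℂ (fnOf v.fst) g.fst‖ ≤ ‖v‖ * ‖g‖ := (norm_inner_le_norm _ _).trans
    (mul_le_mul ((H1.norm_fnOf_le _).trans (WithLp.norm_fst_le (p := 2) (x := v))) (WithLp.norm_fst_le (p := 2) (x := g))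
      (norm_nonneg _) (norm_nonneg _))
  have h2 : ‖inner ℂ (fnOf v.snd) g.snd‖ ≤ ‖v‖ * ‖g‖ := (norm_inner_le_norm _ _).trans
    (mul_le_mul ((H1.norm_fnOf_le _).trans (WithLp.norm_snd_le (p := 2) (x := v))) (WithLp.norm_snd_le (p := 2) (x := g))
      (norm_nonneg _) (norm_nonneg _))
  rw [load_apply]
  refine (norm_add_le _ _).trans ?_
  rw [norm_mul, Complex.norm_real, Real.norm_of_nonneg hρ]
  nlinarith

namespace Traces

variable (tr : Traces Ω)

/-- The Dirichlet transmission operator `γ_D`. -/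
def gD : VHilbert Ω →L[ℂ] (Fin 4 → H12 Ω) :=
  ContinuousLinearMap.pi ![tr.γm ∘L vfst Ω - tr.γp ∘L vfst Ω + tr.γm ∘L vsnd Ω - tr.γp ∘L vsnd Ω,
    tr.γp ∘L vfst Ω - tr.γm ∘L vsnd Ω, tr.γm ∘L vfst Ω - tr.γp ∘L vfst Ω, tr.γp ∘L vsnd Ω]

/-- The Neumann transmission operator `γ_N`. -/
def gN (w : DSpace Ω) : Fin 4 → Hm12 Ω :=
  ![tr.νm w.1 - tr.νp w.1 + tr.νm w.2, tr.νm w.1 - tr.νp w.1, tr.νp w.1 - tr.νm w.2,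
    tr.νm w.1 - tr.νp w.1 + tr.νm w.2 - tr.νp w.2]

theorem mix_thetaD {M : Type*} [AddCommGroup M] [Module ℂ M] (t : Fin 4 → M) :
    mix ThetaD t = ![t 0 - t 1 + t 2 - t 3, t 1 - t 2, t 0 - t 1, t 3] := by
  ext i
  fin_cases i <;> simp [mix, ThetaD, Fin.sum_univ_four] <;> abel

theorem mix_thetaN {M : Type*} [AddCommGroup M] [Module ℂ M] (t : Fin 4 → M) :
    mix ThetaN t = ![t 0 - t 1 + t 2, t 0 - t 1, t 1 - t 2, t 0 - t 1 + t 2 - t 3] := by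
  ext i
  fin_cases i <;> simp [mix, ThetaN, Fin.sum_univ_four] <;> abel

theorem gD_apply (v : VHilbert Ω) :
    tr.gD v = ![tr.γm v.fst - tr.γp v.fst + tr.γm v.snd - tr.γp v.snd,
      tr.γp v.fst - tr.γm v.snd, tr.γm v.fst - tr.γp v.fst, tr.γp v.snd] := by
  ext i
  fin_cases i <;> rfl

theorem isGammaD_iff (v : VSpace Ω) (η : Fin 4 → H12 Ω) :
    IsGammaD v η ↔ η = tr.gD (WithLp.toLp 2 v) := by
  rw [gD_apply]
  constructor
  · rintro ⟨t, ⟨h0, h1, h2, h3⟩, rfl⟩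
    rw [tr.mem_γm] at h0 h2
    rw [tr.mem_γp] at h1 h3
    rw [mix_thetaD, h0, h1, h2, h3]
    rfl
  · rintro rfl
    exact ⟨![tr.γm v.1, tr.γp v.1, tr.γm v.2, tr.γp v.2],
      ⟨(tr.mem_γm _ _).2 rfl, (tr.mem_γp _ _).2 rfl, (tr.mem_γm _ _).2 rfl, (tr.mem_γp _ _).2 rfl⟩,
      (mix_thetaD ![tr.γm v.1, tr.γp v.1, tr.γm v.2, tr.γp v.2]).symm⟩

theorem isGammaN_iff (w : DSpace Ω) (η : Fin 4 → Hm12 Ω) : IsGammaN w η ↔ η = tr.gN w := by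
  unfold gN
  constructor
  · rintro ⟨t, ⟨h0, h1, h2, h3⟩, rfl⟩
    rw [tr.mem_νm] at h0 h2
    rw [tr.mem_νp] at h1 h3
    rw [mix_thetaN, h0, h1, h2, h3]
  · rintro rfl
    exact ⟨![tr.νm w.1, tr.νp w.1, tr.νm w.2, tr.νp w.2],
      ⟨(tr.mem_νm w.1 (tr.νm w.1)).2 rfl, (tr.mem_νp w.1 (tr.νp w.1)).2 rfl,
        (tr.mem_νm w.2 (tr.νm w.2)).2 rfl, (tr.mem_νp w.2 (tr.νp w.2)).2 rfl⟩,
      (mix_thetaN ![tr.νm w.1, tr.νp w.1, tr.νm w.2, tr.νp w.2]).symm⟩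

/-- Green's formula in terms of `γ_D` and `γ_N`. -/
theorem sum_gN_gD (w : DSpace Ω) (v : VHilbert Ω) :
    ∑ i, tr.gN w i (tr.gD v i) = greenL w.1 v.fst + greenL w.2 v.snd := by
  -- The cancellation is the identity `ThetaN`ᵀ `ThetaD` = diag(1, -1, 1, -1), whose signs are those
  -- of Green's formula on the two sides.
  rw [tr.green, tr.green, gD_apply, Fin.sum_univ_four]
  simp only [gN, Matrix.cons_val, add_apply, sub_apply,
    map_add, map_sub]
  ring

/-- `ThetaD` is inverted by back substitution: `γ⁺v₊ = η 3`, then `γ⁻v₊`, `γ⁺v₋` and `γ⁻v₋` in turn.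
Counting terms, `‖v₊‖ ≤ 2(3 + 1)` and `‖v₋‖ ≤ 2(5 + 4)` times the norm of `η`, whence `26`. -/
theorem exists_lift (η : Fin 4 → H12 Ω) :
    ∃ v, tr.gD v = η ∧ ‖v‖ ≤ 26 * ‖WithLp.toLp 2 η‖ := by
  have hle : ∀ i, ‖η i‖ ≤ ‖WithLp.toLp 2 η‖ := fun i => PiLp.norm_apply_le (WithLp.toLp 2 η) i
  obtain ⟨v2, a1, a2, a3⟩ := tr.lift (η 0 - η 2 + η 3) (η 3)
  obtain ⟨v1, b1, b2, b3⟩ := tr.lift (η 2 + (η 1 + (η 0 - η 2 + η 3))) (η 1 + (η 0 - η 2 + η 3))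
  refine ⟨WithLp.toLp 2 (v1, v2), ?_, ?_⟩
  · rw [gD_apply]
    ext i
    fin_cases i <;> (simp [a1, a2, b1, b2]; try abel)
  · have h : ‖WithLp.toLp 2 (v1, v2)‖ ≤ ‖v1‖ + ‖v2‖ := by
      have h1 := WithLp.prod_norm_sq_eq_of_L2 (WithLp.toLp 2 (v1, v2))
      change _ = ‖v1‖ ^ 2 + ‖v2‖ ^ 2 at h1
      refine abs_le_of_sq_le_sq' ?_ (by positivity) |>.2
      nlinarith [norm_nonneg v1, norm_nonneg v2]
    have n1 : ‖η 0 - η 2 + η 3‖ ≤ ‖η 0‖ + ‖η 2‖ + ‖η 3‖ := 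
      (norm_add_le _ _).trans (by gcongr; exact norm_sub_le _ _)
    have n2 := norm_add_le (η 1) (η 0 - η 2 + η 3)
    have n3 := norm_add_le (η 2) (η 1 + (η 0 - η 2 + η 3))
    have := hle 0
    have := hle 1
    have := hle 2
    have := hle 3
    linarith

/-- `v ↦ ⟨ξ, γ_D v⟩`. -/
def bdry (ξ : Fin 4 → Hm12 Ω) : VHilbert Ω →SL[starRingEnd ℂ] ℂ :=
  ∑ i, (ξ i).comp (ContinuousLinearMap.proj i ∘L tr.gD)

theorem bdry_apply (ξ : Fin 4 → Hm12 Ω) (v : VHilbert Ω) :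
    tr.bdry ξ v = ∑ i, ξ i (tr.gD v i) := by
  simp [bdry]

theorem norm_bdry_le (ξ : Fin 4 → Hm12 Ω) (v : VHilbert Ω) :
    ‖tr.bdry ξ v‖ ≤ 4 * ‖tr.gD‖ * ‖WithLp.toLp 2 ξ‖ * ‖v‖ := by
  rw [bdry_apply]
  refine (norm_sum_le _ _).trans ?_
  have h : ∀ i ∈ Finset.univ, ‖ξ i (tr.gD v i)‖ ≤ ‖tr.gD‖ * ‖WithLp.toLp 2 ξ‖ * ‖v‖ := fun i _ => by
    refine ((ξ i).le_opNorm _).trans ?_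
    have h1 : ‖ξ i‖ ≤ ‖WithLp.toLp 2 ξ‖ := PiLp.norm_apply_le (WithLp.toLp 2 ξ) i
    have h2 : ‖tr.gD v i‖ ≤ ‖tr.gD‖ * ‖v‖ := (norm_le_pi_norm _ i).trans (tr.gD.le_opNorm v)
    calc _ ≤ ‖WithLp.toLp 2 ξ‖ * (‖tr.gD‖ * ‖v‖) := by gcongr
      _ = _ := by ring
  refine (Finset.sum_le_sum h).trans (le_of_eq ?_)
  simp
  ring

end Traces

/-- The two spaces are polar to each other slot by slot. This removes all unknown boundary terms,
both from the estimate and from the symmetry of `A`. -/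
theorem sum_eq_zero_of_mem {Xh : Submodule ℂ (Hm12 Ω)} {Yh : Submodule ℂ (H12 Ω)}
    {η : Fin 4 → H12 Ω} (hη : η ∈ MPlus Xh Yh) {μ : Fin 4 → Hm12 Ω} (hμ : μ ∈ MMinus Xh Yh) :
    ∑ i, μ i (η i) = 0 := by
  have h0 : η 0 = 0 := hη 0 trivial
  have h1 : η 1 ∈ polarX Xh := hη 1 trivial
  have h2 : η 2 ∈ Yh := hη 2 trivial
  have k1 : μ 1 ∈ Xh := hμ 1 trivial
  have k2 : μ 2 ∈ polarY Yh := hμ 2 trivial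
  have k3 : μ 3 = 0 := hμ 3 trivial
  rw [Fin.sum_univ_four, h0, map_zero, h1 _ k1, k2 _ h2, k3]
  simp

theorem isClosed_MPlus {Xh : Submodule ℂ (Hm12 Ω)} {Yh : Submodule ℂ (H12 Ω)}
    (hY : IsClosed (Yh : Set (H12 Ω))) : IsClosed (MPlus Xh Yh : Set (Fin 4 → H12 Ω)) := by
  have hX : IsClosed (polarX Xh : Set (H12 Ω)) := by
    have : (polarX Xh : Set (H12 Ω)) = ⋂ μ ∈ Xh, {φ | μ φ = 0} := by
      ext φ
      simp [polarX]
    rw [this]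
    exact isClosed_biInter fun μ _ => isClosed_eq μ.continuous continuous_const
  refine isClosed_set_pi (s := fun i => ((![⊥, polarX Xh, Yh, ⊤] : Fin 4 → Submodule ℂ (H12 Ω)) i : Set (H12 Ω))) fun i _ => ?_
  fin_cases i
  · exact isClosed_singleton
  · exact hX
  · exact hY
  · exact isClosed_univ

/-- `M^{-1/2}` is the polar set of `M^{1/2}`. -/
theorem mem_MMinus_of_forall {Xh : Submodule ℂ (Hm12 Ω)} {Yh : Submodule ℂ (H12 Ω)}
    (hX : IsClosed (Xh : Set (Hm12 Ω))) {μ : Fin 4 → Hm12 Ω}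
    (h : ∀ η ∈ MPlus Xh Yh, ∑ i, μ i (η i) = 0) : μ ∈ MMinus Xh Yh := by
  -- Tuples with a single nonzero entry decouple the four slots; afterwards only the slot of `X_h`
  -- needs more than the definitions.
  have hs : ∀ (i : Fin 4) (φ : H12 Ω), φ ∈ (![⊥, polarX Xh, Yh, ⊤] : Fin 4 → Submodule ℂ (H12 Ω)) i →
      μ i φ = 0 := fun i φ hφ => by
    have hm : Pi.single i φ ∈ MPlus Xh Yh := fun j _ => by
      by_cases hj : j = i
      · subst hj
        rw [Pi.single_eq_same]
        exact hφ
      · rw [Pi.single_eq_of_ne hj]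
        exact Submodule.zero_mem _
    have := h _ hm
    rwa [Finset.sum_eq_single i (fun j _ hj => by rw [Pi.single_eq_of_ne hj, map_zero])
      (fun hh => absurd (Finset.mem_univ i) hh), Pi.single_eq_same] at this
  intro i _
  fin_cases i
  · exact trivial
  · exact mem_of_forall_polarX hX (hs 1)
  · exact hs 2
  · exact ContinuousLinearMap.ext fun φ => hs 3 φ trivial

end Variational

end HeatTransmission

end

/-! ### The steady state problem -/

noncomputable section

namespace HeatTransmission

open MeasureTheory Set Filter Topology
open scoped ContDiff ENNReal NNReal

section SteadyState

variable {d : ℕ} {Ω : Set (E d)} {ρ κ : ℝ}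

theorem greenL_ofReal_smul {O : Set (E d)} (c : ℝ) (w : H1Lap O) (v : H1 O) :
    greenL ((c : ℂ) • w) v = c * greenL w v := by
  rw [greenL_apply, greenL_apply, map_smul, map_smul, map_smul, inner_smul_right, inner_smul_right]
  ring

namespace Traces

/-- The weak form of the equation `w = A⋆ w + g`. -/
theorem inner_formOp_of_eq (tr : Traces Ω) (hρ : ρ ≠ 0) {g : L2Pair Ω} {w : DSpace Ω}
    (hw : pairFn w = Astar ρ κ w + g) (v : VHilbert Ω) :
    inner ℂ v (formOp Ω ρ κ (WithLp.toLp 2 (pairV w)))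
      = ∑ i, tr.gN (mulFst κ w) i (tr.gD v i) + load ρ g v := by
  have h1 : fnOf (toH1 w.1) = ((ρ⁻¹ * κ : ℝ) : ℂ) • lapOf w.1 + g.fst :=
    congrArg (fun z : L2Pair Ω => z.fst) hw
  have h2 : fnOf (toH1 w.2) = lapOf w.2 + g.snd := congrArg (fun z : L2Pair Ω => z.snd) hw
  rw [tr.sum_gN_gD, inner_formOp, load_apply]
  change (ρ : ℂ) * inner ℂ (fnOf v.fst) (fnOf (toH1 w.1))
      + κ * inner ℂ (gradOf v.fst) (gradOf (toH1 w.1)) + inner ℂ (fnOf v.snd) (fnOf (toH1 w.2))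
      + inner ℂ (gradOf v.snd) (gradOf (toH1 w.2))
      = greenL ((κ : ℂ) • w.1) v.fst + greenL w.2 v.snd + _
  rw [greenL_ofReal_smul, greenL_apply, greenL_apply, h1, h2, inner_add_right, inner_add_right,
    inner_smul_right]
  have : (ρ : ℂ) ≠ 0 := Complex.ofReal_ne_zero.2 hρ
  push_cast
  field_simp
  ring

theorem transmissionCond_iff (tr : Traces Ω) {Xh : Submodule ℂ (Hm12 Ω)} {Yh : Submodule ℂ (H12 Ω)} {w : DSpace Ω}
    {ξD : Fin 4 → H12 Ω} {ξN : Fin 4 → Hm12 Ω} :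
    TransmissionCond κ Xh Yh w ξD ξN ↔ tr.gD (WithLp.toLp 2 (pairV w)) - ξD ∈ MPlus Xh Yh ∧
      tr.gN (mulFst κ w) - ξN ∈ MMinus Xh Yh := by
  simp only [TransmissionCond, tr.isGammaD_iff, tr.isGammaN_iff, exists_eq_left]

/-- The constant in the a priori estimate. -/
theorem norm_le_of_isSteadyState (tr : Traces Ω) (hρ : 0 < ρ) (hκ : 0 < κ) :
    ∃ C, ∀ (Xh : Submodule ℂ (Hm12 Ω)) (Yh : Submodule ℂ (H12 Ω)) (g : L2Pair Ω)
      (ξD : Fin 4 → H12 Ω) (ξN : Fin 4 → Hm12 Ω) (w : DSpace Ω),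
      IsSteadyState ρ κ Xh Yh g ξD ξN w →
      ‖WithLp.toLp 2 (pairV w)‖ ≤ C * (‖g‖ + ‖WithLp.toLp 2 ξD‖ + ‖WithLp.toLp 2 ξN‖) := by
  obtain ⟨c, hc, c1, c2, c3⟩ : ∃ c : ℝ, 0 < c ∧ c ≤ ρ ∧ c ≤ κ ∧ c ≤ 1 :=
    ⟨min ρ (min κ 1), by positivity, min_le_left _ _, (min_le_right _ _).trans (min_le_left _ _),
      (min_le_right _ _).trans (min_le_right _ _)⟩
  -- The three terms bound the load, the boundary functional and the form applied to the lifting of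
  -- `ξ_D`.
  let K := (ρ + 1) + 4 * ‖tr.gD‖ + ‖formOp Ω ρ κ‖ * 26
  refine ⟨K / c + 26, fun Xh Yh g ξD ξN w hw => ?_⟩
  obtain ⟨hD, hN⟩ := (tr.transmissionCond_iff).1 hw.2
  obtain ⟨wD, hwD, hle⟩ := tr.exists_lift ξD
  set u : VHilbert Ω := WithLp.toLp 2 (pairV w) with hu
  -- Subtracting the lifting makes the difference an admissible test function, so `γ_N κ w` can be
  -- replaced by the datum `ξ_N` in Green's formula and coercivity applies.
  have hM : tr.gD (u - wD) ∈ MPlus Xh Yh := by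
    rw [map_sub, hwD]
    exact hD
  have h1 : inner ℂ (u - wD) (formOp Ω ρ κ (u - wD)) = tr.bdry ξN (u - wD) + load ρ g (u - wD)
      - inner ℂ (u - wD) (formOp Ω ρ κ wD) := by
    have h2 := sum_eq_zero_of_mem hM hN
    simp only [Pi.sub_apply (tr.gN (mulFst κ w)) ξN, sub_apply, Finset.sum_sub_distrib] at h2
    rw [map_sub (formOp Ω ρ κ), inner_sub_right, hu, tr.inner_formOp_of_eq hρ.ne' hw.1, ← hu,
      tr.bdry_apply, sub_eq_zero.1 h2]
  have h3 := (le_re_inner_formOp c1 c2 c3 (u - wD)).trans (Complex.re_le_norm _)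
  rw [h1] at h3
  have h4 := norm_sub_le (tr.bdry ξN (u - wD) + load ρ g (u - wD))
    (inner ℂ (u - wD) (formOp Ω ρ κ wD))
  have h5 := norm_add_le (tr.bdry ξN (u - wD)) (load ρ g (u - wD))
  have h6 := tr.norm_bdry_le ξN (u - wD)
  have h7 := norm_load_le hρ.le g (u - wD)
  have h8 : ‖inner ℂ (u - wD) (formOp Ω ρ κ wD)‖ ≤
      ‖u - wD‖ * (‖formOp Ω ρ κ‖ * (26 * ‖WithLp.toLp 2 ξD‖)) :=
    (norm_inner_le_norm _ _).trans (mul_le_mul_of_nonneg_left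
      (((formOp Ω ρ κ).le_opNorm wD).trans (mul_le_mul_of_nonneg_left hle (norm_nonneg _)))
      (norm_nonneg _))
  have h9 : ‖u‖ ≤ ‖u - wD‖ + ‖wD‖ := by
    simpa using norm_add_le (u - wD) wD
  set a := ‖u - wD‖
  set x := ‖g‖
  set y := ‖WithLp.toLp 2 ξD‖
  set z := ‖WithLp.toLp 2 ξN‖
  have ha : 0 ≤ a := norm_nonneg _
  have hx : 0 ≤ x := norm_nonneg _
  have hy : 0 ≤ y := norm_nonneg _
  have hz : 0 ≤ z := norm_nonneg _
  have hG : 0 ≤ ‖tr.gD‖ := norm_nonneg tr.gD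
  have hF : 0 ≤ ‖formOp Ω ρ κ‖ := norm_nonneg _
  have h10 : c * a ^ 2 ≤ (K * (x + y + z)) * a := by
    have : (ρ + 1) * x + 4 * ‖tr.gD‖ * z + ‖formOp Ω ρ κ‖ * 26 * y ≤ K * (x + y + z) := by
      have e1 : 0 ≤ (ρ + 1) * (y + z) := by positivity
      have e2 : 0 ≤ 4 * ‖tr.gD‖ * (x + y) := by positivity
      have e3 : 0 ≤ ‖formOp Ω ρ κ‖ * 26 * (x + z) := by positivity
      simp only [K]
      nlinarith
    have := mul_le_mul_of_nonneg_right this ha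
    nlinarith
  have h11 : a ≤ K / c * (x + y + z) := by
    rcases ha.eq_or_lt with h0 | h0
    · rw [← h0]
      positivity
    · rw [div_mul_eq_mul_div, le_div_iff₀ hc]
      nlinarith
  nlinarith

/-- The Laplacians are read off from the equation: `Δw₋ = κ⁻¹ρ(w₋ - g₋)` and `Δw₊ = w₊ - g₊`. -/
theorem norm_add_norm_le_of_isSteadyState (tr : Traces Ω) (hρ : 0 < ρ) (hκ : 0 < κ) :
    ∃ C, ∀ (Xh : Submodule ℂ (Hm12 Ω)) (Yh : Submodule ℂ (H12 Ω)) (g : L2Pair Ω)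
      (ξD : Fin 4 → H12 Ω) (ξN : Fin 4 → Hm12 Ω) (w : DSpace Ω),
      IsSteadyState ρ κ Xh Yh g ξD ξN w →
      ‖WithLp.toLp 2 (pairV w)‖ + ‖pairLap w‖ ≤
        C * (‖g‖ + ‖WithLp.toLp 2 ξD‖ + ‖WithLp.toLp 2 ξN‖) := by
  obtain ⟨C, hC⟩ := tr.norm_le_of_isSteadyState hρ hκ
  let b := ρ / κ + 1
  refine ⟨C + b * (C + 1), fun Xh Yh g ξD ξN w hw => ?_⟩
  have h0 := hC Xh Yh g ξD ξN w hw
  have h1 : fnOf (toH1 w.1) = ((ρ⁻¹ * κ : ℝ) : ℂ) • lapOf w.1 + g.fst :=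
    congrArg (fun z : L2Pair Ω => z.fst) hw.1
  have h2 : fnOf (toH1 w.2) = lapOf w.2 + g.snd := congrArg (fun z : L2Pair Ω => z.snd) hw.1
  set u : VHilbert Ω := WithLp.toLp 2 (pairV w) with hu
  have n1 : ‖fnOf (toH1 w.1)‖ ≤ ‖u‖ := (H1.norm_fnOf_le _).trans (WithLp.norm_fst_le (p := 2) (x := u))
  have n2 : ‖fnOf (toH1 w.2)‖ ≤ ‖u‖ := (H1.norm_fnOf_le _).trans (WithLp.norm_snd_le (p := 2) (x := u))
  have n3 : ‖g.fst‖ ≤ ‖g‖ := WithLp.norm_fst_le (p := 2) (x := g)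
  have n4 : ‖g.snd‖ ≤ ‖g‖ := WithLp.norm_snd_le (p := 2) (x := g)
  have k1 : ‖lapOf w.1‖ ≤ ρ / κ * (‖u‖ + ‖g‖) := by
    have : (ρ⁻¹ * κ) * ‖lapOf w.1‖ ≤ ‖u‖ + ‖g‖ := by
      have e : ((ρ⁻¹ * κ : ℝ) : ℂ) • lapOf w.1 = fnOf (toH1 w.1) - g.fst := by rw [h1]; abel
      have e2 := norm_sub_le (fnOf (toH1 w.1)) g.fst
      rw [← e, norm_smul, Complex.norm_real, Real.norm_of_nonneg (by positivity)] at e2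
      linarith
    calc ‖lapOf w.1‖ = ρ / κ * ((ρ⁻¹ * κ) * ‖lapOf w.1‖) := by field_simp
      _ ≤ _ := by gcongr
  have k2 : ‖lapOf w.2‖ ≤ ‖u‖ + ‖g‖ := by
    have e : lapOf w.2 = fnOf (toH1 w.2) - g.snd := by rw [h2]; abel
    have e2 := norm_sub_le (fnOf (toH1 w.2)) g.snd
    rw [← e] at e2
    linarith
  have k3 : ‖pairLap w‖ ≤ ‖lapOf w.1‖ + ‖lapOf w.2‖ := by
    have e := WithLp.prod_norm_sq_eq_of_L2 (pairLap w)
    change _ = ‖lapOf w.1‖ ^ 2 + ‖lapOf w.2‖ ^ 2 at e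
    refine abs_le_of_sq_le_sq' ?_ (by positivity) |>.2
    nlinarith [norm_nonneg (lapOf w.1), norm_nonneg (lapOf w.2)]
  have k4 : ‖pairLap w‖ ≤ b * (‖u‖ + ‖g‖) := by
    simp only [b]
    linarith
  have k5 : b * (‖u‖ + ‖g‖) ≤
      b * ((C + 1) * (‖g‖ + ‖WithLp.toLp 2 ξD‖ + ‖WithLp.toLp 2 ξN‖)) := by
    refine mul_le_mul_of_nonneg_left ?_ (by positivity)
    have := norm_nonneg (WithLp.toLp 2 ξD)
    have := norm_nonneg (WithLp.toLp 2 ξN)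
    linarith
  nlinarith

theorem gD_eq_zero_of_test (tr : Traces Ω) {φ ψ : E d → ℝ} (hφ : IsTest (offGamma Ω) φ)
    (hψ : IsTest (offGamma Ω) ψ)
    {v : VHilbert Ω} (h1 : fnOf v.fst =ᵐ[volume.restrict (offGamma Ω)] fun x => (φ x : ℂ))
    (h2 : fnOf v.snd =ᵐ[volume.restrict (offGamma Ω)] fun x => (ψ x : ℂ)) : tr.gD v = 0 := by
  rw [gD_apply, ← (tr.mem_γm _ _).1 (mem_sideTrace_of_test hφ h1),
    ← (tr.mem_γm _ _).1 (mem_sideTrace_of_test hψ h2),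
    ← (tr.mem_γp _ _).1 (mem_sideTrace_of_test hφ h1),
    ← (tr.mem_γp _ _).1 (mem_sideTrace_of_test hψ h2)]
  ext i
  fin_cases i <;> simp

end Traces

/-- A weak form of `div p = f`. -/
theorem isWeakDiv_of_inner {O : Set (E d)} {p : L2v O} {f : L2 O}
    (h : ∀ φ : E d → ℝ, IsTest O φ → ∀ v : H1 O, (fnOf v =ᵐ[volume.restrict O] fun x => (φ x : ℂ)) →
      gradOf v =ᵐ[volume.restrict O] rgrad φ → inner ℂ (gradOf v) p + inner ℂ (fnOf v) f = 0) :
    IsWeakDiv p f := fun φ hφ => by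
  obtain ⟨v, h1, h2⟩ := hφ.exists_H1
  have h3 := h φ hφ v h1 h2
  rw [(inner_test_eq h1 h2 p f).1, (inner_test_eq h1 h2 p f).2] at h3
  exact eq_neg_of_add_eq_zero_left h3

theorem isTest_zero {O : Set (E d)} : IsTest O (0 : E d → ℝ) :=
  ⟨contDiff_const, HasCompactSupport.zero, by simp [tsupport]⟩

namespace Traces

/-- The weak problem is solved for the unknown minus a lifting of `ξ_D`. Test functions off `Γ`
recover the differential equation. Then Green's formula leaves `⟨γ_N κ w - ξ_N, γ_D v⟩ = 0` whenever
`γ_D v` is in `M^{1/2}`; as `γ_D` is onto, polarity gives the Neumann condition. -/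
theorem exists_isSteadyState (tr : Traces Ω) (hρ : 0 < ρ) (hκ : 0 < κ) {Xh : Submodule ℂ (Hm12 Ω)}
    {Yh : Submodule ℂ (H12 Ω)} (hX : IsClosed (Xh : Set (Hm12 Ω))) (hY : IsClosed (Yh : Set (H12 Ω)))
    (g : L2Pair Ω) (ξD : Fin 4 → H12 Ω) (ξN : Fin 4 → Hm12 Ω) :
    ∃ w, IsSteadyState ρ κ Xh Yh g ξD ξN w := by
  obtain ⟨c, hc, c1, c2, c3⟩ : ∃ c : ℝ, 0 < c ∧ c ≤ ρ ∧ c ≤ κ ∧ c ≤ 1 :=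
    ⟨min ρ (min κ 1), by positivity, min_le_left _ _, (min_le_right _ _).trans (min_le_left _ _),
      (min_le_right _ _).trans (min_le_right _ _)⟩
  obtain ⟨wD, hwD, -⟩ := tr.exists_lift ξD
  have hS : IsClosed (((MPlus Xh Yh).comap (tr.gD : VHilbert Ω →ₗ[ℂ] (Fin 4 → H12 Ω)) :
      Submodule ℂ (VHilbert Ω)) : Set (VHilbert Ω)) := (isClosed_MPlus hY).preimage tr.gD.continuous
  obtain ⟨w0, hw0, h⟩ := exists_mem_forall_inner_eq (formOp Ω ρ κ) hc (le_re_inner_formOp c1 c2 c3) hS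
    (tr.bdry ξN + load ρ g - (innerSLFlip ℂ (formOp Ω ρ κ wD)))
  set u : VHilbert Ω := w0 + wD with hu
  have hw : ∀ v, tr.gD v ∈ MPlus Xh Yh →
      inner ℂ v (formOp Ω ρ κ u) = ∑ i, ξN i (tr.gD v i) + load ρ g v := fun v hv => by
    rw [hu, map_add, inner_add_right, h v hv, ← tr.bdry_apply]
    change tr.bdry ξN v + load ρ g v - inner ℂ v (formOp Ω ρ κ wD) + _ = _
    ring
  have hv : ∀ v, tr.gD v = 0 → inner ℂ v (formOp Ω ρ κ u) = load ρ g v := fun v hv => by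
    rw [hw v (by rw [hv]; exact Submodule.zero_mem _), hv]
    simp
  have hρ' : (ρ : ℂ) ≠ 0 := Complex.ofReal_ne_zero.2 hρ.ne'
  have hκ' : (κ : ℂ) ≠ 0 := Complex.ofReal_ne_zero.2 hκ.ne'
  have hz : fnOf (0 : H1 (offGamma Ω)) =ᵐ[volume.restrict (offGamma Ω)]
      fun x => ((0 : E d → ℝ) x : ℂ) := by
    rw [map_zero]
    filter_upwards [Lp.coeFn_zero ℂ 2 (volume.restrict (offGamma Ω))] with x hx
    rw [hx]
    simp
  have d1 : IsWeakDiv (gradOf u.fst) (((κ⁻¹ * ρ : ℝ) : ℂ) • (fnOf u.fst - g.fst)) := by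
    refine isWeakDiv_of_inner fun φ hφ v h1 h2 => ?_
    have := hv (WithLp.toLp 2 (v, 0)) (tr.gD_eq_zero_of_test hφ isTest_zero h1 hz)
    rw [inner_formOp, load_apply] at this
    change (ρ : ℂ) * inner ℂ (fnOf v) (fnOf u.fst) + κ * inner ℂ (gradOf v) (gradOf u.fst)
      + inner ℂ (fnOf (0 : H1 (offGamma Ω))) (fnOf u.snd)
      + inner ℂ (gradOf (0 : H1 (offGamma Ω))) (gradOf u.snd)
      = ρ * inner ℂ (fnOf v) g.fst + inner ℂ (fnOf (0 : H1 (offGamma Ω))) g.snd at this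
    rw [map_zero, map_zero, inner_zero_left, inner_zero_left, inner_zero_left] at this
    rw [inner_smul_right, inner_sub_right]
    push_cast
    field_simp
    linear_combination this
  have d2 : IsWeakDiv (gradOf u.snd) (fnOf u.snd - g.snd) := by
    refine isWeakDiv_of_inner fun φ hφ v h1 h2 => ?_
    have := hv (WithLp.toLp 2 (0, v)) (tr.gD_eq_zero_of_test isTest_zero hφ hz h1)
    rw [inner_formOp, load_apply] at this
    change (ρ : ℂ) * inner ℂ (fnOf (0 : H1 (offGamma Ω))) (fnOf u.fst)
      + κ * inner ℂ (gradOf (0 : H1 (offGamma Ω))) (gradOf u.fst)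
      + inner ℂ (fnOf v) (fnOf u.snd) + inner ℂ (gradOf v) (gradOf u.snd)
      = ρ * inner ℂ (fnOf (0 : H1 (offGamma Ω))) g.fst + inner ℂ (fnOf v) g.snd at this
    rw [map_zero, map_zero, inner_zero_left, inner_zero_left, inner_zero_left] at this
    rw [inner_sub_right]
    linear_combination this
  -- The Laplacian component is defined by the equation itself, so the strong equation holds by
  -- algebra and only the membership `d1`, `d2` carries content.
  let w : DSpace Ω := (⟨(u.fst, ((κ⁻¹ * ρ : ℝ) : ℂ) • (fnOf u.fst - g.fst)), d1⟩,
    ⟨(u.snd, fnOf u.snd - g.snd), d2⟩)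
  have hwu : WithLp.toLp 2 (pairV w) = u := rfl
  have heq : pairFn w = Astar ρ κ w + g := by
    refine WithLp.ofLp_injective 2 (Prod.ext ?_ ?_)
    · change fnOf u.fst = ((ρ⁻¹ * κ : ℝ) : ℂ) • ((κ⁻¹ * ρ : ℝ) : ℂ) • (fnOf u.fst - g.fst) + g.fst
      have : ((ρ⁻¹ * κ : ℝ) : ℂ) * ((κ⁻¹ * ρ : ℝ) : ℂ) = 1 := by
        push_cast
        field_simp
      rw [smul_smul, this, one_smul, sub_add_cancel]
    · exact (sub_add_cancel _ _).symm
  refine ⟨w, heq, tr.transmissionCond_iff.2 ⟨?_, mem_MMinus_of_forall hX fun η hη => ?_⟩⟩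
  · rw [hwu, hu, map_add, hwD, add_sub_cancel_right]
    exact hw0
  · obtain ⟨v, rfl, -⟩ := tr.exists_lift η
    have h1 := tr.inner_formOp_of_eq hρ.ne' heq v
    rw [hwu, hw v hη, add_left_inj] at h1
    simp only [Pi.sub_apply (tr.gN (mulFst κ w)) ξN, sub_apply, Finset.sum_sub_distrib]
    rw [h1, sub_self]

end Traces

theorem DSpace.ext_pairV {v w : DSpace Ω} (h : pairV v = pairV w) : v = w := by
  have hO : IsOpen (offGamma Ω) := isClosed_frontier.isOpen_compl
  have key : ∀ a b : H1Lap (offGamma Ω), toH1 a = toH1 b → a = b := fun a b hab => by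
    have h1 : lapOf (a - b) = 0 := lapOf_eq_zero hO _ (by rw [map_sub, hab, sub_self, map_zero])
    rw [map_sub, sub_eq_zero] at h1
    exact Subtype.ext (Prod.ext hab h1)
  have h1 : toH1 v.1 = toH1 w.1 := congrArg (fun z : VSpace Ω => z.1) h
  have h2 : toH1 v.2 = toH1 w.2 := congrArg (fun z : VSpace Ω => z.2) h
  exact Prod.ext (key _ _ h1) (key _ _ h2)

theorem IsSteadyState.sub {Xh : Submodule ℂ (Hm12 Ω)} {Yh : Submodule ℂ (H12 Ω)} {g : L2Pair Ω}
    {ξD : Fin 4 → H12 Ω} {ξN : Fin 4 → Hm12 Ω} {v w : DSpace Ω}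
    (hv : IsSteadyState ρ κ Xh Yh g ξD ξN v) (hw : IsSteadyState ρ κ Xh Yh g ξD ξN w) :
    IsSteadyState ρ κ Xh Yh 0 0 0 (v - w) := by
  obtain ⟨h1, ⟨η, h2, h3⟩, θ, h4, h5⟩ := hv
  obtain ⟨k1, ⟨η', k2, k3⟩, θ', k4, k5⟩ := hw
  refine ⟨?_, ⟨η - η', ?_, ?_⟩, θ - θ', ?_, ?_⟩
  · rw [map_sub, map_sub, h1, k1]
    abel
  · have := h2.add (k2.smul (-1))
    rw [neg_one_smul, neg_one_smul, ← sub_eq_add_neg, ← sub_eq_add_neg] at this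
    rw [map_sub]
    exact this
  · have := Submodule.sub_mem _ h3 k3
    rwa [sub_sub_sub_cancel_right, ← sub_zero (η - η')] at this
  · have := h4.add (k4.smul (-1))
    rw [neg_one_smul, neg_one_smul ℂ (θ' : Fin 4 → Hm12 Ω), ← sub_eq_add_neg, ← sub_eq_add_neg] at this
    rw [map_sub]
    exact this
  · have := Submodule.sub_mem _ h5 k5
    rwa [sub_sub_sub_cancel_right, ← sub_zero (θ - θ')] at this

/-- Well-posedness of the steady state problem, uniformly in `X_h` and `Y_h`. -/
theorem Traces.wellPosed (tr : Traces Ω) (hρ : 0 < ρ) (hκ : 0 < κ) :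
    ∃ C : ℝ, ∀ (Xh : Submodule ℂ (Hm12 Ω)) (Yh : Submodule ℂ (H12 Ω)),
      IsClosed (Xh : Set (Hm12 Ω)) → IsClosed (Yh : Set (H12 Ω)) →
      ∀ (g : L2Pair Ω) (ξD : Fin 4 → H12 Ω) (ξN : Fin 4 → Hm12 Ω),
        (∃! w : DSpace Ω, IsSteadyState ρ κ Xh Yh g ξD ξN w) ∧
        ∀ w : DSpace Ω, IsSteadyState ρ κ Xh Yh g ξD ξN w →
          ‖WithLp.toLp 2 (pairV w)‖ + ‖pairLap w‖ ≤
            C * (‖g‖ + ‖WithLp.toLp 2 ξD‖ + ‖WithLp.toLp 2 ξN‖) := by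
  obtain ⟨C, hC⟩ := tr.norm_add_norm_le_of_isSteadyState hρ hκ
  refine ⟨C, fun Xh Yh hX hY g ξD ξN => ⟨?_, hC Xh Yh g ξD ξN⟩⟩
  obtain ⟨w, hw⟩ := tr.exists_isSteadyState hρ hκ hX hY g ξD ξN
  refine ⟨w, hw, fun v hv => DSpace.ext_pairV ?_⟩
  -- Uniqueness is the estimate with zero data, applied to the difference of two solutions.
  have h := hC _ _ _ _ _ _ (hv.sub hw)
  have h0 : ‖WithLp.toLp 2 (pairV (v - w))‖ ≤ 0 := by
    refine (le_add_of_nonneg_right (norm_nonneg (pairLap (v - w)))).trans (h.trans (le_of_eq ?_))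
    simp
  have h1 : WithLp.toLp 2 (pairV (v - w)) = 0 := norm_le_zero_iff.1 h0
  have h2 : pairV (v - w) = 0 := (WithLp.toLp_injective 2) h1
  rwa [map_sub, sub_eq_zero] at h2

end SteadyState

end HeatTransmission

end

/-! ### The operator `A` -/

noncomputable section

namespace HeatTransmission

open MeasureTheory Set Filter Topology
open scoped ContDiff ENNReal NNReal

section OperatorA

variable {d : ℕ} {Ω : Set (E d)} {ρ κ : ℝ} {Xh : Submodule ℂ (Hm12 Ω)} {Yh : Submodule ℂ (H12 Ω)}

theorem toH_fst_ae (ρ : ℝ) (u : L2Pair Ω) : ((toH Ω ρ u).fst : E d → ℂ)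
    =ᵐ[ENNReal.ofReal ρ • volume.restrict (offGamma Ω)] u.fst :=
  MemLp.coeFn_toLp ((Lp.memLp u.fst).smul_measure (ENNReal.ofReal_ne_top (r := ρ)))

theorem inner_toH (hρ : 0 < ρ) (v w : L2Pair Ω) :
    inner ℂ (toH Ω ρ v) (toH Ω ρ w) = ρ * inner ℂ v.fst w.fst + inner ℂ v.snd w.snd := by
  rw [WithLp.prod_inner_apply]
  congr 1
  rw [L2.inner_def, L2.inner_def]
  have h1 : ∫ x, inner ℂ ((toH Ω ρ v).fst x) ((toH Ω ρ w).fst x)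
        ∂(ENNReal.ofReal ρ • volume.restrict (offGamma Ω))
      = ∫ x, inner ℂ (v.fst x) (w.fst x) ∂(ENNReal.ofReal ρ • volume.restrict (offGamma Ω)) := by
    refine integral_congr_ae ?_
    filter_upwards [toH_fst_ae ρ v, toH_fst_ae ρ w] with x hv hw
    rw [hv, hw]
  refine h1.trans ?_
  rw [integral_smul_measure, ENNReal.toReal_ofReal hρ.le, Complex.real_smul]

theorem toH_surjective (hρ : 0 < ρ) (y : HSpace Ω ρ) : ∃ g : L2Pair Ω, toH Ω ρ g = y := by
  have h0 : ENNReal.ofReal ρ ≠ 0 := (ENNReal.ofReal_pos.2 hρ).ne'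
  have hm : MemLp y.fst 2 (volume.restrict (offGamma Ω)) := by
    have := (Lp.memLp y.fst).smul_measure (ENNReal.inv_ne_top.2 h0)
    rwa [smul_smul, ENNReal.inv_mul_cancel h0 ENNReal.ofReal_ne_top, one_smul] at this
  refine ⟨WithLp.toLp 2 (hm.toLp _, y.snd), WithLp.ofLp_injective 2 (Prod.ext ?_ rfl)⟩
  refine Lp.ext ((toH_fst_ae ρ (WithLp.toLp 2 (hm.toLp _, y.snd))).trans ?_)
  exact Measure.smul_absolutelyContinuous.ae_le hm.coeFn_toLp

/-- The weight `ρ` of `H` cancels the `ρ⁻¹` of `A⋆`, and the boundary terms of Green's formula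
cancel by polarity. The remaining expression is Hermitian and nonpositive on the diagonal: symmetry
and dissipativity at once. -/
theorem inner_pairFn_Astar (tr : Traces Ω) (hρ : 0 < ρ) {v w : DSpace Ω} (hv : v ∈ Dh κ Xh Yh)
    (hw : w ∈ Dh κ Xh Yh) :
    inner ℂ (toH Ω ρ (pairFn v)) (toH Ω ρ (Astar ρ κ w))
      = -(κ * inner ℂ (gradOf (toH1 v.1)) (gradOf (toH1 w.1))
        + inner ℂ (gradOf (toH1 v.2)) (gradOf (toH1 w.2))) := by
  obtain ⟨⟨η, h1, h2⟩, -⟩ := hv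
  obtain ⟨-, θ, h3, h4⟩ := hw
  rw [tr.isGammaD_iff] at h1
  rw [tr.isGammaN_iff] at h3
  have h := sum_eq_zero_of_mem h2 h4
  rw [h1, h3, tr.sum_gN_gD] at h
  change greenL ((κ : ℂ) • w.1) (toH1 v.1) + greenL w.2 (toH1 v.2) = 0 at h
  rw [greenL_ofReal_smul, greenL_apply, greenL_apply] at h
  rw [inner_toH hρ]
  change (ρ : ℂ) * inner ℂ (fnOf (toH1 v.1)) (((ρ⁻¹ * κ : ℝ) : ℂ) • lapOf w.1)
    + inner ℂ (fnOf (toH1 v.2)) (lapOf w.2) = _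
  have hρ' : (ρ : ℂ) ≠ 0 := Complex.ofReal_ne_zero.2 hρ.ne'
  rw [inner_smul_right, ← mul_assoc, Complex.ofReal_mul, Complex.ofReal_inv, ← mul_assoc,
    mul_inv_cancel₀ hρ', one_mul]
  linear_combination h

theorem exists_of_mem_domain (hρ : 0 < ρ) (x : (opA Ω ρ κ Xh Yh).domain) :
    ∃ w ∈ Dh κ Xh Yh, toH Ω ρ (pairFn w) = x ∧ toH Ω ρ (Astar ρ κ w) = opA Ω ρ κ Xh Yh x := by
  have h := (opA Ω ρ κ Xh Yh).mem_graph x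
  rw [opA_graph Ω hρ] at h
  obtain ⟨w, hw, h⟩ := h
  exact ⟨w, hw, congrArg Prod.fst h, congrArg Prod.snd h⟩

theorem inner_opA_symm (tr : Traces Ω) (hρ : 0 < ρ) (x y : (opA Ω ρ κ Xh Yh).domain) :
    inner ℂ (opA Ω ρ κ Xh Yh x) (y : HSpace Ω ρ) = inner ℂ (x : HSpace Ω ρ) (opA Ω ρ κ Xh Yh y) := by
  obtain ⟨v, hv, h1, h2⟩ := exists_of_mem_domain hρ x
  obtain ⟨w, hw, h3, h4⟩ := exists_of_mem_domain hρ y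
  rw [← h1, ← h2, ← h3, ← h4, inner_pairFn_Astar tr hρ hv hw, ← inner_conj_symm,
    inner_pairFn_Astar tr hρ hw hv]
  simp only [map_neg, map_add, map_mul, Complex.conj_ofReal, inner_conj_symm]

theorem isMaximalDissipative_opA (tr : Traces Ω) (hρ : 0 < ρ) (hκ : 0 < κ)
    (hX : IsClosed (Xh : Set (Hm12 Ω))) (hY : IsClosed (Yh : Set (H12 Ω))) :
    IsMaximalDissipative (opA Ω ρ κ Xh Yh) := by
  refine ⟨fun x => ?_, fun y => ?_⟩
  · obtain ⟨w, hw, h1, h2⟩ := exists_of_mem_domain hρ x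
    rw [← h1, ← h2, inner_pairFn_Astar tr hρ hw hw, inner_self_eq_norm_sq_to_K,
      inner_self_eq_norm_sq_to_K]
    have : (-((κ : ℂ) * ((‖gradOf (toH1 w.1)‖ : ℝ) : ℂ) ^ 2
        + ((‖gradOf (toH1 w.2)‖ : ℝ) : ℂ) ^ 2)).re
        = -(κ * ‖gradOf (toH1 w.1)‖ ^ 2 + ‖gradOf (toH1 w.2)‖ ^ 2) := by norm_cast
    refine this.le.trans (neg_nonpos.2 (by positivity))
  · obtain ⟨g, rfl⟩ := toH_surjective hρ y
    -- Surjectivity of `I - A` is the steady state problem with homogeneous transmission data.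
    obtain ⟨w, hw, hT⟩ := tr.exists_isSteadyState hρ hκ hX hY g 0 0
    simp only [TransmissionCond, sub_zero] at hT
    have hg : (toH Ω ρ (pairFn w), toH Ω ρ (Astar ρ κ w)) ∈ (opA Ω ρ κ Xh Yh).graph := by
      rw [opA_graph Ω hρ]
      exact ⟨w, hT, rfl⟩
    obtain ⟨x, h1, h2⟩ := (LinearPMap.mem_graph_iff _).1 hg
    refine ⟨x, ?_⟩
    change (x : HSpace Ω ρ) = toH Ω ρ (pairFn w) at h1
    change opA Ω ρ κ Xh Yh x = toH Ω ρ (Astar ρ κ w) at h2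
    rw [h1, h2, ← map_sub, hw, add_sub_cancel_left]

end OperatorA

end HeatTransmission

end

theorem mainTheorem7 (d : ℕ) (hd : d = 2 ∨ d = 3) (Ω : Set (E d)) (hΩ : IsBoundedLipschitz Ω)
    (ρ κ : ℝ) (hρ : 0 < ρ) (hκ : 0 < κ) :
    (∃ C : ℝ, ∀ (Xh : Submodule ℂ (Hm12 Ω)) (Yh : Submodule ℂ (H12 Ω)),
      IsClosed (Xh : Set (Hm12 Ω)) → IsClosed (Yh : Set (H12 Ω)) →
      ∀ (g : L2Pair Ω) (ξD : Fin 4 → H12 Ω) (ξN : Fin 4 → Hm12 Ω),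
        (∃! w : DSpace Ω, IsSteadyState ρ κ Xh Yh g ξD ξN w) ∧
        ∀ w : DSpace Ω, IsSteadyState ρ κ Xh Yh g ξD ξN w →
          ‖WithLp.toLp 2 (pairV w)‖ + ‖pairLap w‖ ≤
            C * (‖g‖ + ‖WithLp.toLp 2 ξD‖ + ‖WithLp.toLp 2 ξN‖)) ∧
    ∀ (Xh : Submodule ℂ (Hm12 Ω)) (Yh : Submodule ℂ (H12 Ω)),
      IsClosed (Xh : Set (Hm12 Ω)) → IsClosed (Yh : Set (H12 Ω)) →
        IsMaximalDissipative (opA Ω ρ κ Xh Yh) ∧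
        (Dense ((opA Ω ρ κ Xh Yh).domain : Set (HSpace Ω ρ)) ∧ IsSelfAdjoint (opA Ω ρ κ Xh Yh)) ∧
        ∃ (T : ℂ → HSpace Ω ρ →L[ℂ] HSpace Ω ρ) (δ : ℝ),
          IsContractiveAnalyticSemigroup T δ ∧ IsGenerator (opA Ω ρ κ Xh Yh) T := by
  have hd0 : 0 < d := by omega
  obtain ⟨tr⟩ := hΩ.nonempty_traces hd0
  refine ⟨tr.wellPosed hρ hκ, fun Xh Yh hX hY => ?_⟩
  have hA := isMaximalDissipative_opA tr hρ hκ hX hY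
  have hs := inner_opA_symm (κ := κ) (Xh := Xh) (Yh := Yh) tr hρ
  exact ⟨hA, ⟨hA.dense_domain, hA.isSelfAdjoint hs⟩, hA.exists_semigroup hs⟩
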